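/- Let $(M,\omega,\mathbb T)$ be a compact connected symplectic toric manifold of real dimension $4$: the torus $\mathbb T=(S^1)^2$, with Lie algebra $\mathfrak t$, acts smoothly and effectively on $(M,\omega)$ with invariant moment map $\mu:M\to\mathfrak t^*$, $d\mu^{\xi}=-\omega(\xi^\sharp,\cdot)$, where $\xi^\sharp$ is the vector field induced by $\xi\in\mathfrak t$. Let $\mathring M$ be the dense open set on which $\mathbb T$ acts freely (the preimage of the interior of the moment polytope) and let $\mathcal K$ be the distribution tangent to the orbits on $\mathring M$. Let $J\in DGK^{\mathbb T}_\omega(M)$, i.e. $J$ is a smooth $\mathbb T$-invariant almost complex structure on $M$ with $\omega(v,Jv)>0$ for $v\ne0$, such that $J$ and its symplectic adjoint $J^{*_\omega}$ (defined by $\omega(J\cdot,\cdot)=\omega(\cdot,J^{*_\omega}\cdot)$) are both integrable and $J^{*_\omega}\mathcal K=J\mathcal K$ on $\mathring M$. Put $g=\omega(\cdot,J\cdot)^{s}$ (symmetric part, a Riemannian metric), $p=-\tfrac14\mathrm{tr}(JJ^{*_\omega})$, $F=g(J\cdot,\cdot)$, and let $\theta$ be the Lee form of $(g,J)$, the unique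 $1$-form with $dF=\theta\wedge F$. Let $u_J=\frac{4\rho\wedge F}{F\wedge F}$ be the Hermitian scalar curvature of $(g,J)$, where $\rho$ is the Chern–Ricci form, that is, the real curvature form of the connection induced by the Chern connection on the anticanonical bundle, with the sign for which $\rho$ is the usual Ricci form in the Kähler case. Let $s_g$ be the Riemannian scalar curvature of $g$, and $\Delta=\delta d$ the nonnegative Laplacian of $g$. View $[J,J^{*_\omega}]$ as the $2$-form $g([J,J^{*_\omega}]\cdot,\cdot)$, and let $\langle\cdot,\cdot\rangle$ be the inner product of $2$-forms normalized so that fundamental forms have norm one, $\langle\varphi,\psi\rangle=\tfrac14\sum_{a,b}\varphi(e_a,e_b)\psi(e_a,e_b)$ in a $g$-orthonormal basis (so that $p$ is the inner product of the fundamental forms $g(J\cdot,\cdot)$ and $g(J^{*_\omega}\cdot,\cdot)$). For a basis $(\xi_1,\xi_2)$ of $\mathfrak t$, let $x^1,x^2$ be the corresponding coordinates on $\mathfrak t^*$, let $A=-2(J-J^{*_\omega})^{-1}$, and let $Q_{ij}=\omega(A\xi_i^\sharp,\xi_j^\sharp)$, a $\mathbb T$-invariant function, seen as a function of the momentum. The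 generalized Hermitian scalar curvature of $J$ is $u_{GK}(J)=\sum_{i,j}\frac{\partial^2Q_{ij}}{\partial x^i\partial x^j}$ (on $\mathring M$, and extended continuously to $M$). Then, on all of $M$, $$u_{GK}(J)=u_J-\frac{4-2p}{1-p}|\theta|^2+\frac{2\langle[J,J^{*_\omega}],d\theta\rangle}{1-p},$$ and, on $\mathring M$, $$u_{GK}(J)=s_g+\frac{2\Delta p}{1-p}-\frac{1}{1-p^2}\Bigl(\frac{4+2p}{1-p}-\frac12\Bigr)|dp|^2 .$$ If $p\equiv-1$ (the Kähler case), the second formula holds on all of $M$. At a point where $p=-1$, the last term of the second formula is read as $0$; on $\mathring M$ this happens only in the Kähler case. -/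

import Mathlib

open scoped Manifold ContDiff Topology

noncomputable section

namespace ToricGK

/-- The model space of a real 4-manifold. -/
abbrev E4 : Type := EuclideanSpace ℝ (Fin 4)

/-! ### Local tensor calculus on open subsets of `ℝ⁴`

A tensor field on an open set is a function on `E4`; only its germ at the point considered matters.
A bilinear form is written `E4 →L[ℝ] E4 →L[ℝ] ℝ`. A connection is given by its Christoffel symbol
`Γ`: `∇_u W = D_u W + Γ(u, W)`. -/

/-- The exterior derivative of a 1-form: `dθ(u, v) = (D_u θ)(v) - (D_v θ)(u)`. -/
def extDerivOne (θ : E4 → E4 →L[ℝ] ℝ) (y : E4) : E4 →L[ℝ] E4 →L[ℝ] ℝ :=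
  fderiv ℝ θ y - (fderiv ℝ θ y).flip

/-- The exterior derivative of a 2-form:
`dB(u, v, w) = (D_u B)(v, w) - (D_v B)(u, w) + (D_w B)(u, v)`. -/
def extDerivTwo (B : E4 → E4 →L[ℝ] E4 →L[ℝ] ℝ) (y u v w : E4) : ℝ :=
  fderiv ℝ B y u v w - fderiv ℝ B y v u w + fderiv ℝ B y w u v

/-- The vector dual to a covector: `G (sharp G α) = α` for a nondegenerate `G`. -/
def sharp (G : E4 →L[ℝ] E4 →L[ℝ] ℝ) (α : E4 →L[ℝ] ℝ) : E4 := G.inverse α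

/-- The squared norm `|α|²` of a covector. -/
def normSqOne (G : E4 →L[ℝ] E4 →L[ℝ] ℝ) (α : E4 →L[ℝ] ℝ) : ℝ := α (sharp G α)

/-- The metric trace `∑ g^{jk} b(e_j, e_k)` of a bilinear expression. -/
def metricTrace (G : E4 →L[ℝ] E4 →L[ℝ] ℝ) (b : E4 → E4 → ℝ) : ℝ :=
  ∑ k : Fin 4, b (sharp G (EuclideanSpace.proj k)) (EuclideanSpace.single k 1)

/-- The endomorphism `A` with `φ = G(A ·, ·)`. -/
def endOfForm (G φ : E4 →L[ℝ] E4 →L[ℝ] ℝ) : E4 →L[ℝ] E4 := G.inverse ∘L φ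

/-- The 2-form `G(A ·, ·)` of a `G`-antisymmetric endomorphism `A`. -/
def formOfEnd (G : E4 →L[ℝ] E4 →L[ℝ] ℝ) (A : E4 →L[ℝ] E4) : E4 →L[ℝ] E4 →L[ℝ] ℝ := G ∘L A

/-- The inner product of 2-forms
`⟨φ, ψ⟩ = (1/4) ∑_{a,b} φ(e_a, e_b) ψ(e_a, e_b)` (`G`-orthonormal basis), that is
`-(1/4) tr(A B)` for `φ = G(A ·, ·)` and `ψ = G(B ·, ·)`. It is normalized so that the fundamental
form of an almost Hermitian structure has norm one, and the angle function of two almost Hermitian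
structures is the inner product of their fundamental forms. -/
def innerTwo (G φ ψ : E4 →L[ℝ] E4 →L[ℝ] ℝ) : ℝ :=
  -(1 / 4) * LinearMap.trace ℝ E4 ((endOfForm G φ ∘L endOfForm G ψ : E4 →L[ℝ] E4) : E4 →ₗ[ℝ] E4)

/-- The value at `e₀, e₁, e₂, e₃` of the 4-form `α ∧ β`, for 2-forms `α`, `β`. -/
def wedgeTwoTwo (α β : E4 → E4 → ℝ) : ℝ :=
  let e : Fin 4 → E4 := fun i => EuclideanSpace.single i 1
  α (e 0) (e 1) * β (e 2) (e 3) - α (e 0) (e 2) * β (e 1) (e 3) + α (e 0) (e 3) * β (e 1) (e 2)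
    + α (e 1) (e 2) * β (e 0) (e 3) - α (e 1) (e 3) * β (e 0) (e 2) + α (e 2) (e 3) * β (e 0) (e 1)

/-- `Γ` is the value at `y` of the Christoffel symbol of the torsion-free metric connection. -/
def IsLeviCivitaAt (G : E4 → E4 →L[ℝ] E4 →L[ℝ] ℝ) (y : E4) (Γ : E4 →L[ℝ] E4 →L[ℝ] E4) : Prop :=
  (∀ u v, Γ u v = Γ v u) ∧
  ∀ u v w, fderiv ℝ G y u v w = G y (Γ u v) w + G y v (Γ u w)

/-- The Christoffel symbol of the Levi-Civita connection. -/
def leviCivita (G : E4 → E4 →L[ℝ] E4 →L[ℝ] ℝ) (y : E4) : E4 →L[ℝ] E4 →L[ℝ] E4 :=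
  Classical.epsilon (IsLeviCivitaAt G y)

/-- `Γ` is the value at `y` of the Christoffel symbol of the Chern connection of the almost
Hermitian structure `(G, J)`: `∇G = 0`, `∇J = 0`, and the torsion `T` has no `(1,1)`-part,
i.e. `T(Ju, Jv) = -T(u, v)`. -/
def IsChernAt (G : E4 → E4 →L[ℝ] E4 →L[ℝ] ℝ) (J : E4 → E4 →L[ℝ] E4) (y : E4)
    (Γ : E4 →L[ℝ] E4 →L[ℝ] E4) : Prop :=
  (∀ u v w, fderiv ℝ G y u v w = G y (Γ u v) w + G y v (Γ u w)) ∧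
  (∀ u v, fderiv ℝ J y u v + Γ u (J y v) - J y (Γ u v) = 0) ∧
  ∀ u v, Γ (J y u) (J y v) - Γ (J y v) (J y u) = -(Γ u v - Γ v u)

/-- The Christoffel symbol of the Chern connection. -/
def chern (G : E4 → E4 →L[ℝ] E4 →L[ℝ] ℝ) (J : E4 → E4 →L[ℝ] E4) (y : E4) :
    E4 →L[ℝ] E4 →L[ℝ] E4 :=
  Classical.epsilon (IsChernAt G J y)

/-- The curvature `R(u, v) = [∇_u, ∇_v] - ∇_{[u, v]}` of the connection with symbol `Γ`. -/
def curvature (Γ : E4 → E4 →L[ℝ] E4 →L[ℝ] E4) (y u v : E4) : E4 →L[ℝ] E4 :=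
  fderiv ℝ Γ y u v - fderiv ℝ Γ y v u + Γ y u ∘L Γ y v - Γ y v ∘L Γ y u

/-- The Ricci tensor `Ric(v, w) = tr(u ↦ R(u, v) w)` of a Riemannian metric. -/
def ricci (G : E4 → E4 →L[ℝ] E4 →L[ℝ] ℝ) (y v w : E4) : ℝ :=
  ∑ i : Fin 4, curvature (leviCivita G) y (EuclideanSpace.single i 1) v w i

/-- The Riemannian scalar curvature. -/
def scalarCurvature (G : E4 → E4 →L[ℝ] E4 →L[ℝ] ℝ) (y : E4) : ℝ :=
  metricTrace (G y) (ricci G y)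

/-- The (nonnegative) Laplacian `Δf = δdf = -tr_G ∇df`. -/
def laplacian (G : E4 → E4 →L[ℝ] E4 →L[ℝ] ℝ) (f : E4 → ℝ) (y : E4) : ℝ :=
  -metricTrace (G y) fun u v => fderiv ℝ (fderiv ℝ f) y u v - fderiv ℝ f y (leviCivita G y u v)

/-- The fundamental form `F = G(J ·, ·)`. -/
def fundForm (G : E4 → E4 →L[ℝ] E4 →L[ℝ] ℝ) (J : E4 → E4 →L[ℝ] E4) (y : E4) :
    E4 →L[ℝ] E4 →L[ℝ] ℝ := formOfEnd (G y) (J y)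

/-- The Lee form: the unique 1-form `θ` with `dF = θ ∧ F`. -/
def leeForm (G : E4 → E4 →L[ℝ] E4 →L[ℝ] ℝ) (J : E4 → E4 →L[ℝ] E4) (y : E4) : E4 →L[ℝ] ℝ :=
  Classical.epsilon fun θ => ∀ u v w, extDerivTwo (fundForm G J) y u v w =
    θ u * fundForm G J y v w - θ v * fundForm G J y u w + θ w * fundForm G J y u v

/-- The Chern-Ricci form. The connection induced by the Chern connection `∇` on the anticanonical
bundle `Λ²T^{1,0}` has curvature
`tr_ℂ R(u, v) = (tr R(u, v) - √-1 tr(J R(u, v))) / 2 = -√-1 ρ(u, v)` for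
`R(u, v) = [∇_u, ∇_v] - ∇_{[u, v]}`; for a Kähler structure `ρ` is the usual Ricci form. -/
def chernRicci (G : E4 → E4 →L[ℝ] E4 →L[ℝ] ℝ) (J : E4 → E4 →L[ℝ] E4) (y u v : E4) : ℝ :=
  (1 / 2) * LinearMap.trace ℝ E4
    ((J y ∘L curvature (chern G J) y u v : E4 →L[ℝ] E4) : E4 →ₗ[ℝ] E4)

/-- The Hermitian scalar curvature `4 (ρ ∧ F) / (F ∧ F)`. -/
def hermitianScalar (G : E4 → E4 →L[ℝ] E4 →L[ℝ] ℝ) (J : E4 → E4 →L[ℝ] E4) (y : E4) : ℝ :=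
  4 * wedgeTwoTwo (chernRicci G J y) (fun u v => fundForm G J y u v) /
    wedgeTwoTwo (fun u v => fundForm G J y u v) (fun u v => fundForm G J y u v)

/-! ### Tensor fields on a 4-manifold -/

section Manifold

variable {M : Type*} [TopologicalSpace M] [ChartedSpace E4 M]

/-- Fields of bilinear forms on the tangent spaces of `M`. -/
abbrev BilinField (M : Type*) [TopologicalSpace M] [ChartedSpace E4 M] :=
  ∀ x : M, TangentSpace (𝓡 4) x →L[ℝ] TangentSpace (𝓡 4) x →L[ℝ] ℝ

/-- Fields of endomorphisms of the tangent spaces of `M`. -/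
abbrev EndField (M : Type*) [TopologicalSpace M] [ChartedSpace E4 M] :=
  ∀ x : M, TangentSpace (𝓡 4) x →L[ℝ] TangentSpace (𝓡 4) x

/-- The expression of a field of bilinear forms in the preferred chart at `x`. -/
def chartBilin (B : BilinField M) (x : M) (y : E4) : E4 →L[ℝ] E4 →L[ℝ] ℝ :=
  let D : E4 →L[ℝ] E4 := mfderiv 𝓘(ℝ, E4) (𝓡 4) (extChartAt (𝓡 4) x).symm y
  let b : E4 →L[ℝ] E4 →L[ℝ] ℝ := B ((extChartAt (𝓡 4) x).symm y)
  b.bilinearComp D D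

/-- The expression of a field of endomorphisms in the preferred chart at `x`. -/
def chartEnd (A : EndField M) (x : M) (y : E4) : E4 →L[ℝ] E4 :=
  mfderiv (𝓡 4) 𝓘(ℝ, E4) (extChartAt (𝓡 4) x) ((extChartAt (𝓡 4) x).symm y) ∘L
    A ((extChartAt (𝓡 4) x).symm y) ∘L
    mfderiv 𝓘(ℝ, E4) (𝓡 4) (extChartAt (𝓡 4) x).symm y

/-- The expression of a function in the preferred chart at `x`. -/
def chartFun (f : M → ℝ) (x : M) (y : E4) : ℝ := f ((extChartAt (𝓡 4) x).symm y)

/-- `Ω` is a symplectic form. -/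
structure IsSymplecticForm [IsManifold (𝓡 4) ∞ M] (Ω : BilinField M) : Prop where
  smooth : ContMDiff (𝓡 4) ((𝓡 4).prod 𝓘(ℝ, E4 →L[ℝ] E4 →L[ℝ] ℝ)) ∞
    (fun x => Bundle.TotalSpace.mk' (E4 →L[ℝ] E4 →L[ℝ] ℝ)
      (E := fun x : M => TangentSpace (𝓡 4) x →L[ℝ] TangentSpace (𝓡 4) x →L[ℝ] ℝ) x (Ω x))
  alternating : ∀ x (v : TangentSpace (𝓡 4) x), Ω x v v = 0
  nondegenerate : ∀ x (v : TangentSpace (𝓡 4) x), (∀ w, Ω x v w = 0) → v = 0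
  closed : ∀ (x : M) (u v w : E4), extDerivTwo (chartBilin Ω x) (extChartAt (𝓡 4) x x) u v w = 0

/-- The symplectic adjoint `J^{*Ω}`, determined by `Ω(Ju, v) = Ω(u, J^{*Ω}v)`: as `Ω` is
antisymmetric, this says `Ω(J^{*Ω}v, ·) = Ω(v, J ·)`. -/
def sympAdjoint (Ω : BilinField M) (J : EndField M) : EndField M := fun x =>
  ContinuousLinearMap.inverse (Ω x) ∘L (J x).precomp ℝ ∘L Ω x

/-- The Riemannian metric `g = Ω(·, J ·)^s`. -/
def metric (Ω : BilinField M) (J : EndField M) : BilinField M := fun x =>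
  let w : E4 →L[ℝ] E4 →L[ℝ] ℝ := Ω x
  let j : E4 →L[ℝ] E4 := J x
  (1 / 2 : ℝ) • (w.bilinearComp (.id ℝ E4) j + (w.bilinearComp (.id ℝ E4) j).flip)

/-- The angle function `p = -(1/4) tr(J J^{*Ω})`. -/
def angle (Ω : BilinField M) (J : EndField M) (x : M) : ℝ :=
  -(1 / 4) * LinearMap.trace ℝ (TangentSpace (𝓡 4) x)
    ((J x ∘L sympAdjoint Ω J x : TangentSpace (𝓡 4) x →L[ℝ] TangentSpace (𝓡 4) x) :
      TangentSpace (𝓡 4) x →ₗ[ℝ] TangentSpace (𝓡 4) x)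

/-- The commutator `[J, J^{*Ω}]`. -/
def commutator (Ω : BilinField M) (J : EndField M) : EndField M := fun x =>
  J x ∘L sympAdjoint Ω J x - sympAdjoint Ω J x ∘L J x

/-- Integrability of an almost complex structure: vanishing of the Nijenhuis tensor
`[JX, JY] - J[JX, Y] - J[X, JY] - [X, Y]`. -/
def IsIntegrable [IsManifold (𝓡 4) ∞ M] (J : EndField M) : Prop :=
  ∀ (X Y : ∀ x : M, TangentSpace (𝓡 4) x) (x : M),
    MDifferentiableAt (𝓡 4) (𝓡 4).tangent (fun z => (⟨z, X z⟩ : TangentBundle (𝓡 4) M)) x →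
    MDifferentiableAt (𝓡 4) (𝓡 4).tangent (fun z => (⟨z, Y z⟩ : TangentBundle (𝓡 4) M)) x →
    VectorField.mlieBracket (𝓡 4) (fun z => J z (X z)) (fun z => J z (Y z)) x
      - J x (VectorField.mlieBracket (𝓡 4) (fun z => J z (X z)) Y x)
      - J x (VectorField.mlieBracket (𝓡 4) X (fun z => J z (Y z)) x)
      - VectorField.mlieBracket (𝓡 4) X Y x = 0

/-- The scalar curvature `s_g` of the metric `g`. -/
def sRiem (Ω : BilinField M) (J : EndField M) (x : M) : ℝ :=
  scalarCurvature (chartBilin (metric Ω J) x) (extChartAt (𝓡 4) x x)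

/-- The Hermitian scalar curvature `u_J` of `(g, J)`. -/
def uHerm (Ω : BilinField M) (J : EndField M) (x : M) : ℝ :=
  hermitianScalar (chartBilin (metric Ω J) x) (chartEnd J x) (extChartAt (𝓡 4) x x)

/-- `|θ|²`, for the Lee form `θ` of `(g, J)`. -/
def leeNormSq (Ω : BilinField M) (J : EndField M) (x : M) : ℝ :=
  normSqOne (chartBilin (metric Ω J) x (extChartAt (𝓡 4) x x))
    (leeForm (chartBilin (metric Ω J) x) (chartEnd J x) (extChartAt (𝓡 4) x x))

/-- `⟨[J, J^{*Ω}], dθ⟩`, where `[J, J^{*Ω}]` is seen as the 2-form `g([J, J^{*Ω}] ·, ·)`. -/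
def commutatorInnerLee (Ω : BilinField M) (J : EndField M) (x : M) : ℝ :=
  innerTwo (chartBilin (metric Ω J) x (extChartAt (𝓡 4) x x))
    (formOfEnd (chartBilin (metric Ω J) x (extChartAt (𝓡 4) x x))
      (chartEnd (commutator Ω J) x (extChartAt (𝓡 4) x x)))
    (extDerivOne (leeForm (chartBilin (metric Ω J) x) (chartEnd J x)) (extChartAt (𝓡 4) x x))

/-- `Δp`. -/
def laplacianAngle (Ω : BilinField M) (J : EndField M) (x : M) : ℝ :=
  laplacian (chartBilin (metric Ω J) x) (chartFun (angle Ω J) x) (extChartAt (𝓡 4) x x)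

/-- `|dp|²`. -/
def dAngleNormSq (Ω : BilinField M) (J : EndField M) (x : M) : ℝ :=
  normSqOne (chartBilin (metric Ω J) x (extChartAt (𝓡 4) x x))
    (fderiv ℝ (chartFun (angle Ω J) x) (extChartAt (𝓡 4) x x))

/-! ### Torus actions -/

/-- The 2-torus `𝕋`. -/
abbrev Torus : Type := Fin 2 → Circle

/-- The Lie algebra `𝔱` of the 2-torus. -/
abbrev LieT : Type := Fin 2 → ℝ

/-- The exponential map `𝔱 → 𝕋`. -/
def torusExp (ξ : LieT) : Torus := fun j => Circle.exp (ξ j)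

variable [MulAction Torus M]

/-- The vector field `ξ^♯` induced on `M` by `ξ ∈ 𝔱`: the velocity at `s = 0` of
`s ↦ exp(sξ) • x`. -/
def fundField (ξ : LieT) (x : M) : TangentSpace (𝓡 4) x :=
  mfderiv 𝓘(ℝ, ℝ) (𝓡 4) (fun s : ℝ => torusExp (s • ξ) • x) 0 (1 : ℝ)

/-- The torus acts smoothly, and in a Hamiltonian fashion with moment map `μ : M → 𝔱^*`:
`μ` is invariant and `dμ^ξ = -Ω(ξ^♯, ·)`. Smoothness of `𝕋 × M → M` is expressed through the
covering `exp : 𝔱 → 𝕋`, which is a local diffeomorphism. -/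
structure IsHamiltonianAction (Ω : BilinField M) (μ : M → (LieT →L[ℝ] ℝ)) : Prop where
  smooth_action : ContMDiff (𝓘(ℝ, LieT).prod (𝓡 4)) (𝓡 4) ∞
    (fun q : LieT × M => torusExp q.1 • q.2)
  smooth_moment : ContMDiff (𝓡 4) 𝓘(ℝ, LieT →L[ℝ] ℝ) ∞ μ
  invariant : ∀ (t : Torus) (x : M), μ (t • x) = μ x
  hamiltonian : ∀ (ξ : LieT) (x : M) (v : TangentSpace (𝓡 4) x),
    mvfderiv (𝓡 4) (fun z => μ z ξ) x v = -Ω x (fundField ξ x) v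

/-- The open dense set of points at which the action is free (for a compact symplectic toric
manifold, the preimage of the interior of the moment polytope). -/
def freeLocus (M : Type*) [MulAction Torus M] : Set M := {x | ∀ t : Torus, t • x = x → t = 1}

/-- The tangent space at `x` of the orbit of `x`. -/
def orbitDist (x : M) : Submodule ℝ (TangentSpace (𝓡 4) x) :=
  Submodule.span ℝ (Set.range fun ξ : LieT => fundField ξ x)

/-- `J` belongs to `DGK_Ω^𝕋(M)`: `J` is a smooth `Ω`-tamed `𝕋`-invariant almost complex structure,
`J` and `J^{*Ω}` are integrable, and `J^{*Ω}𝒦 = J𝒦` on the set where the action is free, for the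
distribution `𝒦` tangent to the orbits. -/
structure IsDGK [IsManifold (𝓡 4) ∞ M] (Ω : BilinField M) (J : EndField M) : Prop where
  smooth : ContMDiff (𝓡 4) ((𝓡 4).prod 𝓘(ℝ, E4 →L[ℝ] E4)) ∞
    (fun x => Bundle.TotalSpace.mk' (E4 →L[ℝ] E4)
      (E := fun x : M => TangentSpace (𝓡 4) x →L[ℝ] TangentSpace (𝓡 4) x) x (J x))
  sq : ∀ x (v : TangentSpace (𝓡 4) x), J x (J x v) = -v
  tamed : ∀ x (v : TangentSpace (𝓡 4) x), v ≠ 0 → 0 < Ω x v (J x v)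
  invariant : ∀ (t : Torus) (x : M) (v : TangentSpace (𝓡 4) x),
    mfderiv (𝓡 4) (𝓡 4) (fun z : M => t • z) x (J x v) =
      J (t • x) (mfderiv (𝓡 4) (𝓡 4) (fun z : M => t • z) x v)
  integrable : IsIntegrable J
  integrable_adjoint : IsIntegrable (sympAdjoint Ω J)
  antidiagonal : ∀ x ∈ freeLocus M,
    (orbitDist x).map (sympAdjoint Ω J x : TangentSpace (𝓡 4) x →ₗ[ℝ] TangentSpace (𝓡 4) x) =
      (orbitDist x).map (J x : TangentSpace (𝓡 4) x →ₗ[ℝ] TangentSpace (𝓡 4) x)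

/-! ### The generalized Hermitian scalar curvature -/

/-- The tangent part `A = -2 (J - J^{*Ω})⁻¹` of the generalized almost Kähler structure
corresponding to `J`; it is the real part of `K = A + √-1 B`. -/
def tangentPart (Ω : BilinField M) (J : EndField M) : EndField M := fun x =>
  (-2 : ℝ) • ContinuousLinearMap.inverse (J x - sympAdjoint Ω J x)

/-- The function `ℜ Q(ξ, η) = Ω(A ξ^♯, η^♯)`. -/
def reQ (Ω : BilinField M) (J : EndField M) (ξ η : LieT) (x : M) : ℝ :=
  Ω x (tangentPart Ω J x (fundField ξ x)) (fundField η x)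

/-- The partial derivative `∂f/∂x^i` of a `𝕋`-invariant function, seen as a function of the
momentum: `x^i` are the coordinates on `𝔱^*` dual to the basis `ξ` of `𝔱`, `μ^i = x^i ∘ μ`, and
`df = ∑ (∂f/∂x^i) dμ^i` (the coefficients are unique where the action is free). -/
def momentumPartial (ξ : Module.Basis (Fin 2) ℝ LieT) (μ : M → (LieT →L[ℝ] ℝ)) (f : M → ℝ)
    (i : Fin 2) (x : M) : ℝ :=
  Classical.epsilon (fun c : Fin 2 → ℝ => ∀ v : TangentSpace (𝓡 4) x,
    mvfderiv (𝓡 4) f x v = ∑ k, c k * mvfderiv (𝓡 4) (fun z => μ z (ξ k)) x v) i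

/-- The generalized Hermitian scalar curvature `u_GK = ∑ ∂²(ℜ Q_ij)/∂x^i∂x^j`. It is computed on
the dense open set where the action is free, on which the momenta are independent, and extended by
continuity to `M`. -/
def uGK (ξ : Module.Basis (Fin 2) ℝ LieT) (μ : M → (LieT →L[ℝ] ℝ)) (Ω : BilinField M)
    (J : EndField M) : M → ℝ :=
  extendFrom (freeLocus M) fun x => ∑ i, ∑ j,
    momentumPartial ξ μ (momentumPartial ξ μ (reQ Ω J (ξ i) (ξ j)) j) i x

end Manifold

end ToricGK

end

/-! Near a free point everything is encoded in one 2×2 matrix. Let `K i` be the fundamental fields,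
`Φ_il = σ(K_i, jK_l)` and `Ψ = Φ⁻¹`. Taming makes `Φ` invertible, and `J^*𝒦 = J𝒦` makes `J𝒦`
Lagrangian. Hence the fields `N_l` of `J𝒦` dual to the momenta form with the `K_i` a commuting
frame, in which derivatives along `N_l` are the derivatives `∂/∂x^l` (`commNN`, `coeff_iff`). In
this frame `j` sends `N_l` to the `K`'s through the columns of `Ψ`, and the symplectic adjoint does
so through minus the rows.

Integrability of `j` makes the derivatives of `Ψ` symmetric in the column index, and integrability
of the adjoint in the row index (`codazzi_right`, `codazzi_left`). So locally `Ψ` is the Hessian of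
a potential plus a constant skew matrix; only the jets of `Ψ` are used, never the potential itself.
Writing `Ψ^s` for the symmetric part, the metric is block diagonal with blocks `Ψ^s` and `Φ^s`, the
angle is `p = 1 - 2 det Ψ^s / det Ψ` (`locAngle_eq`), and `Q = -(Ψ^s)⁻¹` (`locQ_eq`). Thus `u_GK` is
an Abreu-type expression `-∑ ∂_i∂_j (Ψ^s)⁻¹_ij`.

Both formulas are pointwise and independent of the basis of the Lie algebra (`sum_locQ_mix`). A
Cholesky change of basis brings `Ψ` at the given point to `[[1, c], [-c, 1]]`
(`exists_isNormalToric`). Its jet is then given by `c` and nine numbers, the third and fourth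
derivatives of the potential. The scalar curvature and the Laplacian are computed from Christoffel
symbols in the commuting frame. The Hermitian scalar curvature comes from the logarithm of the Gram
determinant of the holomorphic frame, and the Lee form from a 2×2 linear system. Each formula
becomes a rational identity in ten variables (`IsNormalToric.hermitian_formula`,
`IsNormalToric.riemannian_formula`).

To reach all of `M`, the free locus must be dense. A point with nontrivial stabilizer is fixed by a
nontrivial element of finite order. There are countably many such elements, the fixed set of each
has empty interior, and Baire's theorem applies (`dense_freeLocus`). The right side of the first
formula is continuous because `p < 1` (`locAngle_lt_one`), so it is the continuous extension of
`u_GK`. In the Kähler case the second right side is the scalar curvature, again continuous. -/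

noncomputable section

set_option maxSynthPendingDepth 3

namespace ToricGK

/-! ### Calculus along vector fields -/

section Calculus

variable {F : Type*} [NormedAddCommGroup F] [NormedSpace ℝ F]

/-- The derivative of `f` along the vector field `X`. -/
def along (X : E4 → E4) (f : E4 → F) (y : E4) : F := fderiv ℝ f y (X y)

theorem contDiffAt_fderiv {f : E4 → F} {y : E4} (hf : ContDiffAt ℝ ∞ f y) :
    ContDiffAt ℝ ∞ (fderiv ℝ f) y :=
  hf.fderiv_right (by simp)

theorem contDiffAt_along {X : E4 → E4} {f : E4 → F} {y : E4} (hX : ContDiffAt ℝ ∞ X y)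
    (hf : ContDiffAt ℝ ∞ f y) : ContDiffAt ℝ ∞ (along X f) y :=
  (contDiffAt_fderiv hf).clm_apply hX

theorem differentiableAt_of_smooth {f : E4 → F} {y : E4} (hf : ContDiffAt ℝ ∞ f y) :
    DifferentiableAt ℝ f y := hf.differentiableAt (by simp)

theorem along_congr {X : E4 → E4} {f g : E4 → F} {y : E4} (h : f =ᶠ[𝓝 y] g) :
    along X f y = along X g y := by
  simp only [along, h.fderiv_eq]

theorem along_congr_on {X : E4 → E4} {f g : E4 → F} {U : Set E4} (hU : IsOpen U)
    (h : ∀ y ∈ U, f y = g y) {y : E4} (hy : y ∈ U) : along X f y = along X g y :=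
  along_congr (Filter.eventuallyEq_of_mem (hU.mem_nhds hy) h)

@[simp] theorem along_const (X : E4 → E4) (a : F) (y : E4) : along X (fun _ => a) y = 0 := by
  simp [along]

theorem along_add {X : E4 → E4} {f g : E4 → F} {y : E4} (hf : ContDiffAt ℝ ∞ f y)
    (hg : ContDiffAt ℝ ∞ g y) :
    along X (fun z => f z + g z) y = along X f y + along X g y := by
  simp only [along]
  rw [fderiv_fun_add (differentiableAt_of_smooth hf) (differentiableAt_of_smooth hg)]; rfl

theorem along_sub {X : E4 → E4} {f g : E4 → F} {y : E4} (hf : ContDiffAt ℝ ∞ f y)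
    (hg : ContDiffAt ℝ ∞ g y) :
    along X (fun z => f z - g z) y = along X f y - along X g y := by
  simp only [along]
  rw [fderiv_fun_sub (differentiableAt_of_smooth hf) (differentiableAt_of_smooth hg)]; rfl

theorem along_neg {X : E4 → E4} {f : E4 → F} {y : E4} :
    along X (fun z => -f z) y = -along X f y := by
  simp only [along]
  rw [fderiv_fun_neg]; rfl

theorem along_mul {X : E4 → E4} {f g : E4 → ℝ} {y : E4} (hf : ContDiffAt ℝ ∞ f y)
    (hg : ContDiffAt ℝ ∞ g y) :
    along X (fun z => f z * g z) y = along X f y * g y + f y * along X g y := by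
  simp only [along]
  rw [fderiv_fun_mul (differentiableAt_of_smooth hf) (differentiableAt_of_smooth hg)]
  simp; ring

theorem along_const_mul {X : E4 → E4} {f : E4 → ℝ} {y : E4} (a : ℝ) (hf : ContDiffAt ℝ ∞ f y) :
    along X (fun z => a * f z) y = a * along X f y := by
  rw [along_mul contDiffAt_const hf]; simp

theorem along_smul {X : E4 → E4} {f : E4 → ℝ} {g : E4 → F} {y : E4} (hf : ContDiffAt ℝ ∞ f y)
    (hg : ContDiffAt ℝ ∞ g y) :
    along X (fun z => f z • g z) y = along X f y • g y + f y • along X g y := by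
  simp only [along]
  rw [fderiv_fun_smul (differentiableAt_of_smooth hf) (differentiableAt_of_smooth hg)]
  simp [add_comm]

theorem along_sum {ι : Type*} {s : Finset ι} {X : E4 → E4} {f : ι → E4 → F} {y : E4}
    (hf : ∀ i ∈ s, ContDiffAt ℝ ∞ (f i) y) :
    along X (fun z => ∑ i ∈ s, f i z) y = ∑ i ∈ s, along X (f i) y := by
  simp only [along]
  rw [fderiv_fun_sum fun i hi => differentiableAt_of_smooth (hf i hi)]
  simp

theorem along_clm_apply {F' : Type*} [NormedAddCommGroup F'] [NormedSpace ℝ F'] {X : E4 → E4}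
    {A : E4 → F →L[ℝ] F'} {v : E4 → F} {y : E4} (hA : ContDiffAt ℝ ∞ A y)
    (hv : ContDiffAt ℝ ∞ v y) :
    along X (fun z => A z (v z)) y = along X A y (v y) + A y (along X v y) := by
  simp only [along]
  rw [fderiv_clm_apply (differentiableAt_of_smooth hA) (differentiableAt_of_smooth hv)]
  simp [add_comm]

theorem along_bilin {F' F'' : Type*} [NormedAddCommGroup F'] [NormedSpace ℝ F']
    [NormedAddCommGroup F''] [NormedSpace ℝ F''] {X : E4 → E4}
    {B : E4 → F →L[ℝ] F' →L[ℝ] F''} {v : E4 → F} {w : E4 → F'} {y : E4}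
    (hB : ContDiffAt ℝ ∞ B y) (hv : ContDiffAt ℝ ∞ v y) (hw : ContDiffAt ℝ ∞ w y) :
    along X (fun z => B z (v z) (w z)) y =
      along X B y (v y) (w y) + B y (along X v y) (w y) + B y (v y) (along X w y) := by
  rw [along_clm_apply (A := fun z => B z (v z)) (hB.clm_apply hv) hw, along_clm_apply hB hv]
  simp

/-- Second derivatives along two fields differ by the derivative along their bracket. -/
theorem along_along_sub {X Y : E4 → E4} {f : E4 → F} {y : E4} (hX : ContDiffAt ℝ ∞ X y)
    (hY : ContDiffAt ℝ ∞ Y y) (hf : ContDiffAt ℝ ∞ f y) :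
    along X (along Y f) y - along Y (along X f) y =
      fderiv ℝ f y (along X Y y - along Y X y) := by
  have h1 := along_clm_apply (X := X) (contDiffAt_fderiv hf) hY
  have h2 := along_clm_apply (X := Y) (contDiffAt_fderiv hf) hX
  have hs : IsSymmSndFDerivAt ℝ f y := hf.isSymmSndFDerivAt (by
    simp only [minSmoothness_of_isRCLikeNormedField]; exact ENat.LEInfty.out)
  change along X (fun z => fderiv ℝ f z (Y z)) y - along Y (fun z => fderiv ℝ f z (X z)) y = _
  rw [h1, h2, map_sub]
  have := hs.eq (X y) (Y y)
  simp only [along] at this ⊢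
  rw [this]; abel

theorem along_along_comm {X Y : E4 → E4} {f : E4 → F} {y : E4} (hX : ContDiffAt ℝ ∞ X y)
    (hY : ContDiffAt ℝ ∞ Y y) (hf : ContDiffAt ℝ ∞ f y) (h : along X Y y = along Y X y) :
    along X (along Y f) y = along Y (along X f) y := by
  have := along_along_sub hX hY hf
  rw [h, sub_self, map_zero] at this
  exact sub_eq_zero.mp this

/-- The covariant derivative `∇_X Y` for the connection with symbol `Γ`. -/
def cov (Γ : E4 → E4 →L[ℝ] E4 →L[ℝ] E4) (X Y : E4 → E4) (y : E4) : E4 :=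
  along X Y y + Γ y (X y) (Y y)

theorem contDiffAt_cov {Γ : E4 → E4 →L[ℝ] E4 →L[ℝ] E4} {X Y : E4 → E4} {y : E4}
    (hΓ : ContDiffAt ℝ ∞ Γ y) (hX : ContDiffAt ℝ ∞ X y) (hY : ContDiffAt ℝ ∞ Y y) :
    ContDiffAt ℝ ∞ (cov Γ X Y) y :=
  (contDiffAt_along hX hY).add ((hΓ.clm_apply hX).clm_apply hY)

/-- The curvature evaluated on commuting fields. -/
theorem curvature_apply_commuting {Γ : E4 → E4 →L[ℝ] E4 →L[ℝ] E4} {X Y Z : E4 → E4} {y : E4}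
    (hΓ : ContDiffAt ℝ ∞ Γ y) (hX : ContDiffAt ℝ ∞ X y) (hY : ContDiffAt ℝ ∞ Y y)
    (hZ : ContDiffAt ℝ ∞ Z y) (hXY : along X Y y = along Y X y) :
    curvature Γ y (X y) (Y y) (Z y) = cov Γ X (cov Γ Y Z) y - cov Γ Y (cov Γ X Z) y := by
  have e : ∀ {A B : E4 → E4}, ContDiffAt ℝ ∞ A y → ContDiffAt ℝ ∞ B y →
      cov Γ A (cov Γ B Z) y = along A (along B Z) y + (along A Γ y (B y) (Z y)
        + Γ y (along A B y) (Z y) + Γ y (B y) (along A Z y))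
        + Γ y (A y) (along B Z y + Γ y (B y) (Z y)) := by
    intro A B hA hB
    have : along A (cov Γ B Z) y = _ :=
      along_add (contDiffAt_along hB hZ) ((hΓ.clm_apply hB).clm_apply hZ)
    rw [cov, this, along_bilin hΓ hB hZ]; rfl
  -- Every term other than those of the curvature is symmetric in the two fields: second derivatives
  -- of `Z` along commuting fields commute, and the cross terms are exchanged.
  rw [e hX hY, e hY hX, along_along_comm hX hY hZ hXY, hXY]
  simp only [curvature, along, _root_.sub_apply, _root_.add_apply,
    ContinuousLinearMap.comp_apply, map_add]
  abel

end Calculus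

/-! ### Linear algebra of bilinear forms -/

/-- A nondegenerate bilinear form is an isomorphism onto the dual. -/
theorem isInvertible_of_nondegenerate {B : E4 →L[ℝ] E4 →L[ℝ] ℝ}
    (h : ∀ v, (∀ w, B v w = 0) → v = 0) : B.IsInvertible := by
  have hinj : Function.Injective (B : E4 →ₗ[ℝ] (E4 →L[ℝ] ℝ)) := by
    rw [← LinearMap.ker_eq_bot, LinearMap.ker_eq_bot']
    intro v hv
    exact h v fun w => by
      have : B v = 0 := hv
      rw [this]; rfl
  have hd : Module.finrank ℝ E4 = Module.finrank ℝ (E4 →L[ℝ] ℝ) := by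
    rw [← (LinearMap.toContinuousLinearMap (𝕜 := ℝ) (E := E4) (F' := ℝ)).finrank_eq]
    exact (Subspace.dual_finrank_eq).symm
  let e := LinearMap.linearEquivOfInjective (B : E4 →ₗ[ℝ] (E4 →L[ℝ] ℝ)) hinj hd
  exact ⟨e.toContinuousLinearEquiv, by ext v w; rfl⟩

theorem isInvertible_of_posDef {G : E4 →L[ℝ] E4 →L[ℝ] ℝ} (h : ∀ v, v ≠ 0 → 0 < G v v) :
    G.IsInvertible :=
  isInvertible_of_nondegenerate fun v hv => by
    by_contra h0
    exact (h v h0).ne' (hv v)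

theorem isInvertible_of_injective {A : E4 →L[ℝ] E4} (h : ∀ v, A v = 0 → v = 0) :
    A.IsInvertible := by
  have hinj : Function.Injective (A : E4 →ₗ[ℝ] E4) := by
    rw [← LinearMap.ker_eq_bot, LinearMap.ker_eq_bot']
    exact h
  exact ⟨(LinearEquiv.ofInjectiveEndo (A : E4 →ₗ[ℝ] E4) hinj).toContinuousLinearEquiv, by
    ext v : 1; rfl⟩

theorem contDiffAt_inverse {F F' : Type*} [NormedAddCommGroup F] [NormedSpace ℝ F]
    [CompleteSpace F] [NormedAddCommGroup F'] [NormedSpace ℝ F'] {A : E4 → F →L[ℝ] F'} {y : E4}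
    (hA : ContDiffAt ℝ ∞ A y) (hi : (A y).IsInvertible) :
    ContDiffAt ℝ ∞ (fun z => (A z).inverse) y :=
  hi.contDiffAt_map_inverse.comp y hA

/-- Finite dimensionality lets smoothness of an operator-valued map be tested one vector at a time;
tensors built from `inverse` and `flip` are handled this way. -/
theorem contDiffAt_clm_of_apply {F F' : Type*} [NormedAddCommGroup F] [NormedSpace ℝ F]
    [FiniteDimensional ℝ F] [NormedAddCommGroup F'] [NormedSpace ℝ F'] {A : E4 → F →L[ℝ] F'}
    {U : Set E4} (hU : IsOpen U) (h : ∀ v, ∀ x ∈ U, ContDiffAt ℝ ∞ (fun z => A z v) x) :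
    ∀ y ∈ U, ContDiffAt ℝ ∞ A y := fun _ hy =>
  (contDiffOn_clm_apply.mpr fun v z hz => (h v z hz).contDiffWithinAt).contDiffAt (hU.mem_nhds hy)

theorem apply_sharp {G : E4 →L[ℝ] E4 →L[ℝ] ℝ} (hG : G.IsInvertible) (α : E4 →L[ℝ] ℝ) (w : E4) :
    G (sharp G α) w = α w := by
  rw [sharp, hG.self_apply_inverse]

theorem sharp_eq_iff {G : E4 →L[ℝ] E4 →L[ℝ] ℝ} (hG : G.IsInvertible) {α : E4 →L[ℝ] ℝ} {v : E4} :
    sharp G α = v ↔ ∀ w, G v w = α w := by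
  constructor
  · rintro rfl w; exact apply_sharp hG α w
  · intro h
    have : α = G v := by ext w : 1; exact (h w).symm
    rw [this, sharp, hG.inverse_apply_self]

theorem apply_endOfForm {G φ : E4 →L[ℝ] E4 →L[ℝ] ℝ} (hG : G.IsInvertible) (v w : E4) :
    G (endOfForm G φ v) w = φ v w :=
  apply_sharp hG (φ v) w

theorem endOfForm_formOfEnd {G : E4 →L[ℝ] E4 →L[ℝ] ℝ} (hG : G.IsInvertible)
    (A : E4 →L[ℝ] E4) : endOfForm G (formOfEnd G A) = A := by
  ext v : 1
  exact hG.inverse_apply_self (A v)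

/-- `X` is a `G`-orthogonal frame with `G(X_a, X_a) = d_a ≠ 0`. -/
structure IsOrthFrame (G : E4 →L[ℝ] E4 →L[ℝ] ℝ) (X : Fin 4 → E4) (d : Fin 4 → ℝ) : Prop where
  apply : ∀ a b, G (X a) (X b) = if a = b then d a else 0
  ne_zero : ∀ a, d a ≠ 0

namespace IsOrthFrame

variable {G : E4 →L[ℝ] E4 →L[ℝ] ℝ} {X : Fin 4 → E4} {d : Fin 4 → ℝ}

theorem linearIndependent (h : IsOrthFrame G X d) : LinearIndependent ℝ X := by
  rw [Fintype.linearIndependent_iff]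
  intro c hc a
  have := congrArg (fun v => G (X a) v) hc
  simp only [map_sum, map_smul, h.apply, map_zero, smul_eq_mul, mul_ite, mul_zero,
    Finset.sum_ite_eq, Finset.mem_univ, if_true] at this
  exact (mul_eq_zero.mp this).resolve_right (h.ne_zero a)

/-- The basis given by an orthogonal frame. -/
def basis (h : IsOrthFrame G X d) : Module.Basis (Fin 4) ℝ E4 :=
  basisOfLinearIndependentOfCardEqFinrank h.linearIndependent (by simp)

theorem basis_apply (h : IsOrthFrame G X d) (a : Fin 4) : h.basis a = X a := by
  simp [basis]

theorem repr_eq (h : IsOrthFrame G X d) (v : E4) (a : Fin 4) :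
    h.basis.repr v a = G (X a) v / d a := by
  rw [eq_div_iff (h.ne_zero a)]
  conv_rhs => rw [← h.basis.sum_repr v]
  simp only [map_sum, map_smul, h.basis_apply, h.apply, smul_eq_mul, mul_ite, mul_zero,
    Finset.sum_ite_eq, Finset.mem_univ, if_true]

theorem sum_eq (h : IsOrthFrame G X d) (v : E4) : ∑ a, (G (X a) v / d a) • X a = v := by
  conv_rhs => rw [← h.basis.sum_repr v]
  simp only [h.repr_eq, h.basis_apply]

theorem trace_eq (h : IsOrthFrame G X d) (T : E4 →ₗ[ℝ] E4) :
    LinearMap.trace ℝ E4 T = ∑ a, G (X a) (T (X a)) / d a := by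
  rw [LinearMap.trace_eq_matrix_trace ℝ h.basis, Matrix.trace]
  simp only [Matrix.diag_apply, LinearMap.toMatrix_apply, h.repr_eq, h.basis_apply]

theorem apply_eq_sum (h : IsOrthFrame G X d) (v w : E4) :
    G v w = ∑ a, G v (X a) * G (X a) w / d a := by
  conv_lhs => rw [← h.sum_eq w]
  simp only [map_sum, map_smul, smul_eq_mul]
  exact Finset.sum_congr rfl fun a _ => by ring

theorem normSqOne_eq (h : IsOrthFrame G X d) (hG : G.IsInvertible) (α : E4 →L[ℝ] ℝ) :
    normSqOne G α = ∑ a, α (X a) ^ 2 / d a := by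
  have e : sharp G α = ∑ a, (α (X a) / d a) • X a := by
    rw [sharp_eq_iff hG]
    intro w
    conv_rhs => rw [← h.sum_eq w]
    simp only [map_sum, map_smul, smul_eq_mul, _root_.sum_apply, _root_.smul_apply]
    exact Finset.sum_congr rfl fun a _ => by ring
  rw [normSqOne, e]
  simp only [map_sum, map_smul, smul_eq_mul]
  exact Finset.sum_congr rfl fun a _ => by ring

/-- Expanding the raised coordinate covectors in the frame collapses the coordinate sum. The weights
`1 / d a` appear because the frame is orthogonal but not normalized. -/
theorem metricTrace_eq (h : IsOrthFrame G X d) (hG : G.IsInvertible)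
    (b : E4 →ₗ[ℝ] E4 →ₗ[ℝ] ℝ) :
    metricTrace G (fun u v => b u v) = ∑ a, b (X a) (X a) / d a := by
  have key : ∀ k : Fin 4, sharp G (EuclideanSpace.proj k) = ∑ a, (X a k / d a) • X a := by
    intro k
    rw [sharp_eq_iff hG]
    intro w
    conv_rhs => rw [← h.sum_eq w]
    simp only [map_sum, map_smul, smul_eq_mul, _root_.sum_apply, _root_.smul_apply]
    exact Finset.sum_congr rfl fun a _ => by
      change X a k / d a * G (X a) w = G (X a) w / d a * X a k
      ring
  have hX : ∀ a, ∑ k : Fin 4, X a k • (EuclideanSpace.single k 1 : E4) = X a := by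
    intro a
    ext i
    simp [Fin.sum_univ_four]
    fin_cases i <;> simp
  simp only [metricTrace, key, map_sum, LinearMap.sum_apply, map_smul, LinearMap.smul_apply,
    smul_eq_mul]
  rw [Finset.sum_comm]
  refine Finset.sum_congr rfl fun a _ => ?_
  have e : b (X a) (X a) = b (X a) (∑ k : Fin 4, X a k • (EuclideanSpace.single k 1 : E4)) := by
    rw [hX a]
  rw [e, map_sum, Finset.sum_div]
  exact Finset.sum_congr rfl fun k _ => by rw [map_smul, smul_eq_mul]; ring

/-- The inner product with the 2-form of a skew endomorphism. -/
theorem innerTwo_formOfEnd (h : IsOrthFrame G X d) (hG : G.IsInvertible)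
    (hs : ∀ u v, G u v = G v u) {A : E4 →L[ℝ] E4} (hA : ∀ u v, G (A u) v = -G u (A v))
    (φ : E4 →L[ℝ] E4 →L[ℝ] ℝ) :
    innerTwo G (formOfEnd G A) φ = (1 / 4) * ∑ a, φ (X a) (A (X a)) / d a := by
  rw [innerTwo, endOfForm_formOfEnd hG, h.trace_eq, neg_mul, ← mul_neg, ← Finset.sum_neg_distrib]
  congr 1
  refine Finset.sum_congr rfl fun a _ => ?_
  rw [← apply_endOfForm hG (X a) (A (X a)), hs (endOfForm G φ (X a)), hA, neg_div]
  simp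

end IsOrthFrame

/-- The value at `X₀, X₁, X₂, X₃` of the 4-form `α ∧ β`, for 2-forms `α`, `β`. -/
def wedgeFrame (α β : E4 → E4 → ℝ) (X : Fin 4 → E4) : ℝ :=
  α (X 0) (X 1) * β (X 2) (X 3) - α (X 0) (X 2) * β (X 1) (X 3) + α (X 0) (X 3) * β (X 1) (X 2)
    + α (X 1) (X 2) * β (X 0) (X 3) - α (X 1) (X 3) * β (X 0) (X 2) + α (X 2) (X 3) * β (X 0) (X 1)

theorem sum_single (v : E4) : v = ∑ k : Fin 4, v k • (EuclideanSpace.single k 1 : E4) := by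
  ext i
  simp [Fin.sum_univ_four]
  fin_cases i <;> simp

/-- Skewness reduces the double sum to the six 2×2 minors of the pair `u, v`, the form needed for
the Laplace expansion in `wedgeFrame_eq`. -/
theorem alternating_apply_eq {α : E4 →ₗ[ℝ] E4 →ₗ[ℝ] ℝ} (hα : ∀ v, α v v = 0) (u v : E4) :
    let e : Fin 4 → E4 := fun i => EuclideanSpace.single i 1
    α u v = (u 0 * v 1 - u 1 * v 0) * α (e 0) (e 1) + (u 0 * v 2 - u 2 * v 0) * α (e 0) (e 2)
      + (u 0 * v 3 - u 3 * v 0) * α (e 0) (e 3) + (u 1 * v 2 - u 2 * v 1) * α (e 1) (e 2)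
      + (u 1 * v 3 - u 3 * v 1) * α (e 1) (e 3) + (u 2 * v 3 - u 3 * v 2) * α (e 2) (e 3) := by
  intro e
  have hsk : ∀ a b, α a b = -α b a := by
    intro a b
    have := hα (a + b)
    simp only [map_add, LinearMap.add_apply, hα, zero_add, add_zero] at this
    linarith
  have : α u v = α (∑ k : Fin 4, u k • e k) (∑ k : Fin 4, v k • e k) := by
    rw [← sum_single u, ← sum_single v]
  rw [this]
  simp only [Fin.sum_univ_four, map_add, map_smul, LinearMap.add_apply, LinearMap.smul_apply,
    smul_eq_mul, hα]
  rw [hsk (e 1) (e 0), hsk (e 2) (e 0), hsk (e 3) (e 0), hsk (e 2) (e 1), hsk (e 3) (e 1),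
    hsk (e 3) (e 2)]
  ring

-- A 4-form on a 4-dimensional space scales by the determinant. With the determinant written in its
-- Laplace expansion along the first two rows, the claim is a polynomial identity in the minors.
set_option maxHeartbeats 1600000 in
theorem wedgeFrame_eq {α β : E4 →ₗ[ℝ] E4 →ₗ[ℝ] ℝ} (hα : ∀ v, α v v = 0) (hβ : ∀ v, β v v = 0)
    (X : Fin 4 → E4) :
    wedgeFrame (fun u v => α u v) (fun u v => β u v) X =
      (Matrix.of fun a i => X a i).det *
        wedgeTwoTwo (fun u v => α u v) (fun u v => β u v) := by
  have hd : (Matrix.of fun a i => X a i).det =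
      (X 0 0 * X 1 1 - X 0 1 * X 1 0) * (X 2 2 * X 3 3 - X 2 3 * X 3 2)
      - (X 0 0 * X 1 2 - X 0 2 * X 1 0) * (X 2 1 * X 3 3 - X 2 3 * X 3 1)
      + (X 0 0 * X 1 3 - X 0 3 * X 1 0) * (X 2 1 * X 3 2 - X 2 2 * X 3 1)
      + (X 0 1 * X 1 2 - X 0 2 * X 1 1) * (X 2 0 * X 3 3 - X 2 3 * X 3 0)
      - (X 0 1 * X 1 3 - X 0 3 * X 1 1) * (X 2 0 * X 3 2 - X 2 2 * X 3 0)
      + (X 0 2 * X 1 3 - X 0 3 * X 1 2) * (X 2 0 * X 3 1 - X 2 1 * X 3 0) := by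
    simp [Matrix.det_succ_row_zero, Fin.sum_univ_succ, Fin.succAbove]
    ring
  rw [hd]
  simp only [wedgeFrame, wedgeTwoTwo]
  rw [alternating_apply_eq hα (X 0) (X 1), alternating_apply_eq hα (X 0) (X 2),
    alternating_apply_eq hα (X 0) (X 3), alternating_apply_eq hα (X 1) (X 2),
    alternating_apply_eq hα (X 1) (X 3), alternating_apply_eq hα (X 2) (X 3),
    alternating_apply_eq hβ (X 0) (X 1), alternating_apply_eq hβ (X 0) (X 2),
    alternating_apply_eq hβ (X 0) (X 3), alternating_apply_eq hβ (X 1) (X 2),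
    alternating_apply_eq hβ (X 1) (X 3), alternating_apply_eq hβ (X 2) (X 3)]
  ring

/-! ### The Levi-Civita connection -/

/-- `G` is a smooth Riemannian metric on the open set `U`. -/
structure IsMetricOn (U : Set E4) (G : E4 → E4 →L[ℝ] E4 →L[ℝ] ℝ) : Prop where
  isOpen : IsOpen U
  smooth : ∀ y ∈ U, ContDiffAt ℝ ∞ G y
  symm : ∀ y ∈ U, ∀ u v, G y u v = G y v u
  posDef : ∀ y ∈ U, ∀ v, v ≠ 0 → 0 < G y v v

theorem IsMetricOn.isInvertible {U : Set E4} {G : E4 → E4 →L[ℝ] E4 →L[ℝ] ℝ}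
    (h : IsMetricOn U G) {y : E4} (hy : y ∈ U) : (G y).IsInvertible :=
  isInvertible_of_posDef (h.posDef y hy)

/-- The covectors `w ↦ 2 G(∇_u v, w)` of the Koszul formula. -/
def koszul (D : E4 →L[ℝ] E4 →L[ℝ] E4 →L[ℝ] ℝ) : E4 →L[ℝ] E4 →L[ℝ] E4 →L[ℝ] ℝ :=
  D + D.flip - ((ContinuousLinearMap.flipₗᵢ ℝ E4 E4 ℝ).toContinuousLinearEquiv :
    (E4 →L[ℝ] E4 →L[ℝ] ℝ) →L[ℝ] (E4 →L[ℝ] E4 →L[ℝ] ℝ)) ∘L D.flip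

theorem koszul_apply (D : E4 →L[ℝ] E4 →L[ℝ] E4 →L[ℝ] ℝ) (u v w : E4) :
    koszul D u v w = D u v w + D v u w - D w u v := rfl

/-- The Christoffel symbol given by the Koszul formula. -/
def lcSymbol (G : E4 → E4 →L[ℝ] E4 →L[ℝ] ℝ) (y : E4) : E4 →L[ℝ] E4 →L[ℝ] E4 :=
  (ContinuousLinearMap.compL ℝ E4 (E4 →L[ℝ] ℝ) E4 (G y).inverse) ∘L
    ((1 / 2 : ℝ) • koszul (fderiv ℝ G y))

theorem lcSymbol_apply (G : E4 → E4 →L[ℝ] E4 →L[ℝ] ℝ) (y u v : E4) :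
    lcSymbol G y u v = (G y).inverse ((1 / 2 : ℝ) • koszul (fderiv ℝ G y) u v) := rfl

theorem apply_lcSymbol {G : E4 → E4 →L[ℝ] E4 →L[ℝ] ℝ} {y : E4} (hi : (G y).IsInvertible)
    (u v w : E4) : G y (lcSymbol G y u v) w =
      (1 / 2) * (fderiv ℝ G y u v w + fderiv ℝ G y v u w - fderiv ℝ G y w u v) := by
  rw [lcSymbol_apply, hi.self_apply_inverse]
  rfl

theorem fderiv_apply_symm {U : Set E4} {G : E4 → E4 →L[ℝ] E4 →L[ℝ] ℝ} (hU : IsOpen U)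
    (hsm : ∀ y ∈ U, ContDiffAt ℝ ∞ G y) (h : ∀ y ∈ U, ∀ u v, G y u v = G y v u) {y : E4}
    (hy : y ∈ U) (u v w : E4) : fderiv ℝ G y u v w = fderiv ℝ G y u w v := by
  have e : ∀ v w, fderiv ℝ G y u v w = along (fun _ => u) (fun z => G z v w) y := by
    intro v w
    rw [along_bilin (hsm y hy) contDiffAt_const contDiffAt_const]
    simp [along]
  rw [e, e]
  exact along_congr_on hU (fun z hz => h z hz v w) hy

theorem IsMetricOn.isLeviCivitaAt {U : Set E4} {G : E4 → E4 →L[ℝ] E4 →L[ℝ] ℝ}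
    (h : IsMetricOn U G) {y : E4} (hy : y ∈ U) : IsLeviCivitaAt G y (lcSymbol G y) := by
  have hs := fun u v w => fderiv_apply_symm h.isOpen h.smooth h.symm hy u v w
  refine ⟨fun u v => ?_, fun u v w => ?_⟩
  · rw [lcSymbol_apply, lcSymbol_apply]
    congr 2
    ext w
    rw [koszul_apply, koszul_apply, hs w u v]; ring
  · rw [h.symm y hy v, apply_lcSymbol (h.isInvertible hy), apply_lcSymbol (h.isInvertible hy),
      hs u w v, hs v u w, hs w u v]
    ring

/-- Koszul's argument: in the signed sum of the three metric equations, torsion-freeness cancels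
everything except `Γ u v`. This is uniqueness of the connection. -/
theorem IsLeviCivitaAt.apply_eq {G : E4 → E4 →L[ℝ] E4 →L[ℝ] ℝ} {y : E4}
    (hs : ∀ u v, G y u v = G y v u) {Γ : E4 →L[ℝ] E4 →L[ℝ] E4} (h : IsLeviCivitaAt G y Γ)
    (u v w : E4) : G y (Γ u v) w =
      (1 / 2) * (fderiv ℝ G y u v w + fderiv ℝ G y v u w - fderiv ℝ G y w u v) := by
  rw [h.2 u v w, h.2 v u w, h.2 w u v, h.1 v u, h.1 w u, h.1 w v, hs v (Γ u w), hs u (Γ v w)]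
  ring

/-- A solution exists and Koszul's formula determines it, so the value chosen by `epsilon` is the
explicit symbol, whose smoothness is accessible. -/
theorem IsMetricOn.leviCivita_eq {U : Set E4} {G : E4 → E4 →L[ℝ] E4 →L[ℝ] ℝ}
    (h : IsMetricOn U G) {y : E4} (hy : y ∈ U) : leviCivita G y = lcSymbol G y := by
  have h0 : IsLeviCivitaAt G y (leviCivita G y) :=
    Classical.epsilon_spec (p := IsLeviCivitaAt G y) ⟨_, h.isLeviCivitaAt hy⟩
  ext1 u; ext1 v
  apply (h.isInvertible hy).injective
  ext1 w
  rw [h0.apply_eq (h.symm y hy), apply_lcSymbol (h.isInvertible hy)]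

theorem IsMetricOn.contDiffAt_lcSymbol {U : Set E4} {G : E4 → E4 →L[ℝ] E4 →L[ℝ] ℝ}
    (h : IsMetricOn U G) : ∀ y ∈ U, ContDiffAt ℝ ∞ (lcSymbol G) y := by
  have hd : ∀ a b c : E4, ∀ y ∈ U, ContDiffAt ℝ ∞ (fun z => fderiv ℝ G z a b c) y :=
    fun a b c y hy => (((contDiffAt_fderiv (h.smooth y hy)).clm_apply contDiffAt_const).clm_apply
      contDiffAt_const).clm_apply contDiffAt_const
  refine contDiffAt_clm_of_apply h.isOpen fun u => contDiffAt_clm_of_apply h.isOpen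
    fun v y hy => ?_
  refine (contDiffAt_inverse (h.smooth y hy) (h.isInvertible hy)).clm_apply ?_
  refine contDiffAt_clm_of_apply h.isOpen (fun w y hy => ?_) y hy
  exact (((hd u v w y hy).add (hd v u w y hy)).sub (hd w u v y hy)).const_smul (1 / 2 : ℝ)

theorem curvature_congr {Γ Γ' : E4 → E4 →L[ℝ] E4 →L[ℝ] E4} {y : E4} (h : Γ =ᶠ[𝓝 y] Γ')
    (u v : E4) : curvature Γ y u v = curvature Γ' y u v := by
  simp only [curvature, h.fderiv_eq, h.self_of_nhds]

theorem continuousAt_curvature {Γ : E4 → E4 →L[ℝ] E4 →L[ℝ] E4} {y : E4}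
    (h : ContDiffAt ℝ ∞ Γ y) (u v : E4) : ContinuousAt (fun z => curvature Γ z u v) y := by
  have hd := (contDiffAt_fderiv h).continuousAt
  have h0 := h.continuousAt
  unfold curvature
  fun_prop

/-- The Ricci tensor of a connection. -/
def ricciOf (Γ : E4 → E4 →L[ℝ] E4 →L[ℝ] E4) (y v w : E4) : ℝ :=
  ∑ i : Fin 4, curvature Γ y (EuclideanSpace.single i 1) v w i

theorem IsMetricOn.leviCivita_eventuallyEq {U : Set E4} {G : E4 → E4 →L[ℝ] E4 →L[ℝ] ℝ}
    (h : IsMetricOn U G) {y : E4} (hy : y ∈ U) : leviCivita G =ᶠ[𝓝 y] lcSymbol G :=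
  Filter.eventuallyEq_of_mem (h.isOpen.mem_nhds hy) fun _ hz => h.leviCivita_eq hz

theorem IsMetricOn.ricci_eq {U : Set E4} {G : E4 → E4 →L[ℝ] E4 →L[ℝ] ℝ}
    (h : IsMetricOn U G) {y : E4} (hy : y ∈ U) : ricci G y = ricciOf (lcSymbol G) y := by
  ext v w
  simp only [ricci, ricciOf, curvature_congr (h.leviCivita_eventuallyEq hy)]

/-- Serves to carry the second formula from the free locus to all points in the Kähler case. -/
theorem IsMetricOn.continuousAt_scalarCurvature {U : Set E4} {G : E4 → E4 →L[ℝ] E4 →L[ℝ] ℝ}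
    (h : IsMetricOn U G) {y : E4} (hy : y ∈ U) : ContinuousAt (scalarCurvature G) y := by
  have e : scalarCurvature G =ᶠ[𝓝 y] fun z => metricTrace (G z) (ricciOf (lcSymbol G) z) :=
    Filter.eventuallyEq_of_mem (h.isOpen.mem_nhds hy) fun z hz => by
      simp only [scalarCurvature, h.ricci_eq hz]
  rw [continuousAt_congr e]
  have hL := h.contDiffAt_lcSymbol y hy
  have hi := (contDiffAt_inverse (h.smooth y hy) (h.isInvertible hy)).continuousAt
  have hd := (contDiffAt_fderiv hL).continuousAt
  have h0 := hL.continuousAt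
  unfold metricTrace ricciOf curvature sharp
  fun_prop

theorem curvature_add_left (Γ : E4 → E4 →L[ℝ] E4 →L[ℝ] E4) (y u u' v : E4) :
    curvature Γ y (u + u') v = curvature Γ y u v + curvature Γ y u' v := by
  ext1 w
  simp only [curvature, map_add, _root_.sub_apply, _root_.add_apply, ContinuousLinearMap.comp_apply]
  abel

theorem curvature_smul_left (Γ : E4 → E4 →L[ℝ] E4 →L[ℝ] E4) (y : E4) (c : ℝ) (u v : E4) :
    curvature Γ y (c • u) v = c • curvature Γ y u v := by
  ext1 w
  simp only [curvature, map_smul, _root_.sub_apply, _root_.add_apply, _root_.smul_apply,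
    ContinuousLinearMap.comp_apply, smul_sub, smul_add]

theorem curvature_swap (Γ : E4 → E4 →L[ℝ] E4 →L[ℝ] E4) (y u v : E4) :
    curvature Γ y v u = -curvature Γ y u v := by
  ext1 w
  simp only [curvature, _root_.sub_apply, _root_.add_apply, _root_.neg_apply,
    ContinuousLinearMap.comp_apply]
  abel

theorem curvature_add_right (Γ : E4 → E4 →L[ℝ] E4 →L[ℝ] E4) (y u v v' : E4) :
    curvature Γ y u (v + v') = curvature Γ y u v + curvature Γ y u v' := by
  rw [curvature_swap, curvature_add_left, curvature_swap Γ y u v, curvature_swap Γ y u v']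
  abel

theorem curvature_smul_right (Γ : E4 → E4 →L[ℝ] E4 →L[ℝ] E4) (y : E4) (c : ℝ) (u v : E4) :
    curvature Γ y u (c • v) = c • curvature Γ y u v := by
  rw [curvature_swap, curvature_smul_left, curvature_swap Γ y u v, smul_neg, neg_neg]

/-- The curvature as a trilinear map. -/
theorem ricciOf_eq_trace (Γ : E4 → E4 →L[ℝ] E4 →L[ℝ] E4) (y v w : E4) :
    ricciOf Γ y v w = LinearMap.trace ℝ E4
      { toFun := fun u => curvature Γ y u v w
        map_add' := fun u u' => by rw [curvature_add_left]; rfl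
        map_smul' := fun c u => by rw [curvature_smul_left]; rfl } := by
  rw [LinearMap.trace_eq_matrix_trace ℝ (EuclideanSpace.basisFun (Fin 4) ℝ).toBasis, Matrix.trace]
  simp only [Matrix.diag_apply, LinearMap.toMatrix_apply]
  simp [ricciOf]

theorem IsOrthFrame.scalarCurvature_eq {U : Set E4} {G : E4 → E4 →L[ℝ] E4 →L[ℝ] ℝ}
    (h : IsMetricOn U G) {y : E4} (hy : y ∈ U) {X : Fin 4 → E4} {d : Fin 4 → ℝ}
    (hX : IsOrthFrame (G y) X d) :
    scalarCurvature G y =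
      ∑ b, ∑ a, G y (X a) (curvature (lcSymbol G) y (X a) (X b) (X b)) / d a / d b := by
  let B : E4 →ₗ[ℝ] E4 →ₗ[ℝ] ℝ := LinearMap.mk₂ ℝ (ricciOf (lcSymbol G) y)
    (fun v v' w => by
      simp only [ricciOf, curvature_add_right, ← Finset.sum_add_distrib]; rfl)
    (fun c v w => by
      simp only [ricciOf, curvature_smul_right, smul_eq_mul, Finset.mul_sum]; rfl)
    (fun v w w' => by
      simp only [ricciOf, map_add, ← Finset.sum_add_distrib]; rfl)
    (fun c v w => by
      simp only [ricciOf, map_smul, smul_eq_mul, Finset.mul_sum]; rfl)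
  have := hX.metricTrace_eq (h.isInvertible hy) B
  rw [scalarCurvature, h.ricci_eq hy]
  refine this.trans (Finset.sum_congr rfl fun b _ => ?_)
  change ricciOf (lcSymbol G) y (X b) (X b) / d b = _
  rw [ricciOf_eq_trace, hX.trace_eq, Finset.sum_div]
  rfl

/-! ### Curvature in a commuting frame -/

/-- Four smooth commuting vector fields on an open set. -/
structure IsCommutingFrame (U : Set E4) (X : Fin 4 → E4 → E4) : Prop where
  smooth : ∀ a, ∀ y ∈ U, ContDiffAt ℝ ∞ (X a) y
  comm : ∀ a b, ∀ y ∈ U, along (X a) (X b) y = along (X b) (X a) y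

/-- The components of a bilinear form in a frame. -/
def comp (G : E4 → E4 →L[ℝ] E4 →L[ℝ] ℝ) (X : Fin 4 → E4 → E4) (a b : Fin 4) (z : E4) : ℝ :=
  G z (X a z) (X b z)

/-- The Christoffel symbols of the first kind of a metric in a commuting frame. -/
def christoffel (G : E4 → E4 →L[ℝ] E4 →L[ℝ] ℝ) (X : Fin 4 → E4 → E4) (a b e : Fin 4) (z : E4) :
    ℝ :=
  (1 / 2) * (along (X a) (comp G X b e) z + along (X b) (comp G X a e) z
    - along (X e) (comp G X a b) z)

/-- Differentiation of a bilinear form which is parallel for the connection `Γ`. -/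
theorem along_parallel {G : E4 → E4 →L[ℝ] E4 →L[ℝ] ℝ} {Γ : E4 → E4 →L[ℝ] E4 →L[ℝ] E4} {y : E4}
    (hG : ContDiffAt ℝ ∞ G y)
    (h : ∀ u v w, fderiv ℝ G y u v w = G y (Γ y u v) w + G y v (Γ y u w))
    {Z V W : E4 → E4} (hV : ContDiffAt ℝ ∞ V y) (hW : ContDiffAt ℝ ∞ W y) :
    along Z (fun z => G z (V z) (W z)) y = G y (cov Γ Z V y) (W y) + G y (V y) (cov Γ Z W y) := by
  rw [along_bilin hG hV hW]
  simp only [cov, map_add, _root_.add_apply]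
  have := h (Z y) (V y) (W y)
  simp only [along] at this ⊢
  rw [this]; ring

section

variable {U : Set E4} {G : E4 → E4 →L[ℝ] E4 →L[ℝ] ℝ} {X : Fin 4 → E4 → E4}

theorem cov_comm (hG : IsMetricOn U G) (hX : IsCommutingFrame U X) (a b : Fin 4) {y : E4}
    (hy : y ∈ U) : cov (lcSymbol G) (X a) (X b) y = cov (lcSymbol G) (X b) (X a) y := by
  rw [cov, cov, hX.comm a b y hy, (hG.isLeviCivitaAt hy).1]

/-- Koszul's formula for vector fields; the bracket terms vanish because the frame commutes. -/
theorem apply_cov_eq_christoffel (hG : IsMetricOn U G) (hX : IsCommutingFrame U X) (a b e : Fin 4)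
    {y : E4} (hy : y ∈ U) :
    G y (cov (lcSymbol G) (X a) (X b) y) (X e y) = christoffel G X a b e y := by
  have k := fun a b e => along_parallel (Z := X a) (hG.smooth y hy) (hG.isLeviCivitaAt hy).2
    (hX.smooth b y hy) (hX.smooth e y hy)
  have k1 := k a b e
  have k2 := k b a e
  have k3 := k e a b
  rw [hG.symm y hy (X b y)] at k1
  rw [hG.symm y hy (X a y), cov_comm hG hX b a hy] at k2
  rw [hG.symm y hy (X a y), cov_comm hG hX e a hy, cov_comm hG hX e b hy] at k3
  simp only [christoffel]
  change _ = (1 / 2) * (along (X a) (fun z => G z (X b z) (X e z)) y +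
    along (X b) (fun z => G z (X a z) (X e z)) y - along (X e) (fun z => G z (X a z) (X b z)) y)
  rw [k1, k2, k3]; ring

/-- Metric compatibility moves the outer covariant derivative off the pairing. What remains is
derivatives of Christoffel symbols, taken near `y`, and products of covariant derivatives at `y`.
Only the latter are expanded in the frame, so orthogonality at the single point `y` is enough. -/
theorem apply_curvature_eq (hG : IsMetricOn U G) (hX : IsCommutingFrame U X) {y : E4}
    (hy : y ∈ U) {d : Fin 4 → ℝ} (hd : IsOrthFrame (G y) (fun a => X a y) d) (a b : Fin 4) :
    G y (X a y) (curvature (lcSymbol G) y (X a y) (X b y) (X b y)) =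
      along (X a) (christoffel G X b b a) y - along (X b) (christoffel G X a b a) y
        + ∑ e, (christoffel G X a b e y ^ 2 - christoffel G X a a e y * christoffel G X b b e y)
          / d e := by
  have hL := hG.contDiffAt_lcSymbol
  have hs := hX.smooth
  rw [curvature_apply_commuting (hL y hy) (hs a y hy) (hs b y hy) (hs b y hy) (hX.comm a b y hy),
    map_sub]
  have k : ∀ (Z : Fin 4) (V : E4 → E4), ContDiffAt ℝ ∞ V y →
      G y (X a y) (cov (lcSymbol G) (X Z) V y) =
        along (X Z) (fun z => G z (V z) (X a z)) y
          - G y (cov (lcSymbol G) (X Z) (X a) y) (V y) := by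
    intro Z V hV
    rw [along_parallel (hG.smooth y hy) (hG.isLeviCivitaAt hy).2 hV (hs a y hy),
      hG.symm y hy (V y), hG.symm y hy (X a y)]
    ring
  rw [k a _ (contDiffAt_cov (hL y hy) (hs b y hy) (hs b y hy)),
    k b _ (contDiffAt_cov (hL y hy) (hs a y hy) (hs b y hy)),
    along_congr_on hG.isOpen (fun z hz => apply_cov_eq_christoffel hG hX b b a hz) hy,
    along_congr_on hG.isOpen (fun z hz => apply_cov_eq_christoffel hG hX a b a hz) hy,
    cov_comm hG hX b a hy, hd.apply_eq_sum (cov _ (X a) (X a) y),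
    hd.apply_eq_sum (cov _ (X a) (X b) y) (cov _ (X a) (X b) y)]
  have e1 : ∀ a b e, G y (X e y) (cov (lcSymbol G) (X a) (X b) y) = christoffel G X a b e y :=
    fun a b e => by rw [hG.symm y hy, apply_cov_eq_christoffel hG hX a b e hy]
  simp only [e1, apply_cov_eq_christoffel hG hX _ _ _ hy, sub_div, Finset.sum_sub_distrib, sq]
  ring

theorem scalarCurvature_frame (hG : IsMetricOn U G) (hX : IsCommutingFrame U X) {y : E4}
    (hy : y ∈ U) {d : Fin 4 → ℝ} (hd : IsOrthFrame (G y) (fun a => X a y) d) :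
    scalarCurvature G y = ∑ b, ∑ a,
      (along (X a) (christoffel G X b b a) y - along (X b) (christoffel G X a b a) y
        + ∑ e, (christoffel G X a b e y ^ 2 - christoffel G X a a e y * christoffel G X b b e y)
          / d e) / d a / d b := by
  rw [hd.scalarCurvature_eq hG hy]
  simp only [apply_curvature_eq hG hX hy hd]

/-- The Hessian on `(X_a, X_a)` is `X_a X_a f` minus the derivative of `f` along `∇_{X_a} X_a`, and
that field is expanded in the orthogonal frame. -/
theorem laplacian_frame (hG : IsMetricOn U G) (hX : IsCommutingFrame U X) {y : E4}
    (hy : y ∈ U) {d : Fin 4 → ℝ} (hd : IsOrthFrame (G y) (fun a => X a y) d) {f : E4 → ℝ}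
    (hf : ContDiffAt ℝ ∞ f y) :
    laplacian G f y = -∑ a, (along (X a) (along (X a) f) y
      - ∑ e, christoffel G X a a e y * along (X e) f y / d e) / d a := by
  let B : E4 →ₗ[ℝ] E4 →ₗ[ℝ] ℝ := LinearMap.mk₂ ℝ
    (fun u v => fderiv ℝ (fderiv ℝ f) y u v - fderiv ℝ f y (lcSymbol G y u v))
    (fun u u' v => by simp only [map_add, _root_.add_apply]; ring)
    (fun c u v => by simp only [map_smul, _root_.smul_apply, smul_eq_mul]; ring)
    (fun u v v' => by simp only [map_add]; ring)
    (fun c u v => by simp only [map_smul, smul_eq_mul]; ring)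
  have h1 := hd.metricTrace_eq (hG.isInvertible hy) B
  rw [laplacian, hG.leviCivita_eq hy]
  refine congrArg Neg.neg (h1.trans (Finset.sum_congr rfl fun a _ => ?_))
  congr 1
  change fderiv ℝ (fderiv ℝ f) y (X a y) (X a y) - fderiv ℝ f y (lcSymbol G y (X a y) (X a y)) = _
  have h2 : along (X a) (along (X a) f) y = _ :=
    along_clm_apply (contDiffAt_fderiv hf) (hX.smooth a y hy)
  have h3 : fderiv ℝ f y (cov (lcSymbol G) (X a) (X a) y) =
      ∑ e, christoffel G X a a e y * along (X e) f y / d e := by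
    conv_lhs => rw [← hd.sum_eq (cov (lcSymbol G) (X a) (X a) y)]
    rw [map_sum]
    refine Finset.sum_congr rfl fun e _ => ?_
    rw [map_smul, hG.symm y hy, apply_cov_eq_christoffel hG hX a a e hy, smul_eq_mul, along]
    ring
  rw [h2, ← h3, cov, map_add]
  simp only [along]
  ring

end

/-! ### The Chern connection -/

/-- The Nijenhuis tensor of `J` vanishes at `y`. -/
def NijenhuisZeroAt (J : E4 → E4 →L[ℝ] E4) (y : E4) : Prop :=
  ∀ u v, fderiv ℝ J y (J y u) v - fderiv ℝ J y (J y v) u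
    + J y (fderiv ℝ J y v u) - J y (fderiv ℝ J y u v) = 0

/-- `(G, J)` is a smooth Hermitian structure on the open set `U`. -/
structure IsHermitianOn (U : Set E4) (G : E4 → E4 →L[ℝ] E4 →L[ℝ] ℝ) (J : E4 → E4 →L[ℝ] E4) :
    Prop extends IsMetricOn U G where
  smoothJ : ∀ y ∈ U, ContDiffAt ℝ ∞ J y
  sq : ∀ y ∈ U, ∀ v, J y (J y v) = -v
  orth : ∀ y ∈ U, ∀ u v, G y (J y u) (J y v) = G y u v
  nijenhuis : ∀ y ∈ U, NijenhuisZeroAt J y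

/-- The exterior derivative of a 2-form with derivative `D`, as a trilinear map. -/
def altDeriv (D : E4 →L[ℝ] E4 →L[ℝ] E4 →L[ℝ] ℝ) : E4 →L[ℝ] E4 →L[ℝ] E4 →L[ℝ] ℝ :=
  D - D.flip + ((ContinuousLinearMap.flipₗᵢ ℝ E4 E4 ℝ).toContinuousLinearEquiv :
    (E4 →L[ℝ] E4 →L[ℝ] ℝ) →L[ℝ] (E4 →L[ℝ] E4 →L[ℝ] ℝ)) ∘L D.flip

theorem altDeriv_apply (B : E4 → E4 →L[ℝ] E4 →L[ℝ] ℝ) (y u v w : E4) :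
    altDeriv (fderiv ℝ B y) u v w = extDerivTwo B y u v w := rfl

/-- The Christoffel symbol `G(Γ(u, v), w) = G(Γ^{LC}(u, v), w) - dF(Ju, v, w) / 2`. -/
def chSymbol (G : E4 → E4 →L[ℝ] E4 →L[ℝ] ℝ) (J : E4 → E4 →L[ℝ] E4) (y : E4) :
    E4 →L[ℝ] E4 →L[ℝ] E4 :=
  (ContinuousLinearMap.compL ℝ E4 (E4 →L[ℝ] ℝ) E4 (G y).inverse) ∘L
    ((1 / 2 : ℝ) • (koszul (fderiv ℝ G y) - altDeriv (fderiv ℝ (fundForm G J) y) ∘L J y))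

theorem chSymbol_apply (G : E4 → E4 →L[ℝ] E4 →L[ℝ] ℝ) (J : E4 → E4 →L[ℝ] E4) (y u v : E4) :
    chSymbol G J y u v = (G y).inverse ((1 / 2 : ℝ) • (koszul (fderiv ℝ G y) u v -
      altDeriv (fderiv ℝ (fundForm G J) y) (J y u) v)) := rfl

theorem apply_chSymbol {G : E4 → E4 →L[ℝ] E4 →L[ℝ] ℝ} {J : E4 → E4 →L[ℝ] E4} {y : E4}
    (hi : (G y).IsInvertible) (u v w : E4) : G y (chSymbol G J y u v) w =
      (1 / 2) * (fderiv ℝ G y u v w + fderiv ℝ G y v u w - fderiv ℝ G y w u v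
        - extDerivTwo (fundForm G J) y (J y u) v w) := by
  rw [chSymbol_apply, hi.self_apply_inverse]
  rfl

namespace IsHermitianOn

variable {U : Set E4} {G : E4 → E4 →L[ℝ] E4 →L[ℝ] ℝ} {J : E4 → E4 →L[ℝ] E4}

theorem apply_left (h : IsHermitianOn U G J) {y : E4} (hy : y ∈ U) (u v : E4) :
    G y (J y u) v = -G y u (J y v) := by
  have := h.orth y hy u (J y v)
  rw [h.sq y hy, map_neg] at this
  linarith

theorem contDiffAt_fundForm (h : IsHermitianOn U G J) {y : E4} (hy : y ∈ U) :
    ContDiffAt ℝ ∞ (fundForm G J) y :=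
  (h.smooth y hy).clm_comp (h.smoothJ y hy)

theorem fderiv_fundForm (h : IsHermitianOn U G J) {y : E4} (hy : y ∈ U) (u v w : E4) :
    fderiv ℝ (fundForm G J) y u v w = fderiv ℝ G y u (J y v) w + G y (fderiv ℝ J y u v) w := by
  have e1 : fderiv ℝ (fundForm G J) y u v w =
      along (fun _ => u) (fun z => fundForm G J z v w) y := by
    rw [along_bilin (h.contDiffAt_fundForm hy) contDiffAt_const contDiffAt_const]
    simp [along]
  have e2 : along (fun _ => u) (fun z => G z (J z v) w) y = _ :=
    along_bilin (v := fun z => J z v) (h.smooth y hy) ((h.smoothJ y hy).clm_apply contDiffAt_const)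
      (contDiffAt_const (c := w))
  have e3 := along_clm_apply (X := fun _ => u) (h.smoothJ y hy) (contDiffAt_const (c := v))
  rw [e1]
  change along (fun _ => u) (fun z => G z (J z v) w) y = _
  rw [e2, e3]
  simp [along]

theorem fderiv_apply_J (h : IsHermitianOn U G J) {y : E4} (hy : y ∈ U) (u v : E4) :
    fderiv ℝ J y u (J y v) = -J y (fderiv ℝ J y u v) := by
  have e : along (fun _ => u) (fun z => J z (J z v)) y = 0 := by
    rw [along_congr_on h.isOpen (fun z hz => h.sq z hz v) hy, along_const]
  rw [along_clm_apply (v := fun z => J z v) (h.smoothJ y hy)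
    ((h.smoothJ y hy).clm_apply contDiffAt_const),
    along_clm_apply (h.smoothJ y hy) contDiffAt_const] at e
  simp only [along_const, map_zero, add_zero] at e
  exact eq_neg_of_add_eq_zero_left e

theorem fderiv_orth (h : IsHermitianOn U G J) {y : E4} (hy : y ∈ U) (a v w : E4) :
    fderiv ℝ G y a (J y v) (J y w) + G y (fderiv ℝ J y a v) (J y w)
      + G y (J y v) (fderiv ℝ J y a w) = fderiv ℝ G y a v w := by
  have hJ := fun v : E4 => (h.smoothJ y hy).clm_apply (contDiffAt_const (c := v))
  have e : along (fun _ => a) (fun z => G z (J z v) (J z w)) y =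
      along (fun _ => a) (fun z => G z v w) y :=
    along_congr_on h.isOpen (fun z hz => h.orth z hz v w) hy
  rw [along_bilin (v := fun z => J z v) (w := fun z => J z w) (h.smooth y hy) (hJ v) (hJ w),
    along_bilin (h.smooth y hy) contDiffAt_const contDiffAt_const,
    along_clm_apply (h.smoothJ y hy) contDiffAt_const,
    along_clm_apply (h.smoothJ y hy) contDiffAt_const] at e
  simpa [along] using e

theorem fundForm_antisymm (h : IsHermitianOn U G J) {y : E4} (hy : y ∈ U) (u v : E4) :
    fundForm G J y u v = -fundForm G J y v u := by
  change G y (J y u) v = -G y (J y v) u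
  rw [h.apply_left hy, h.symm y hy]

theorem fderiv_fundForm_antisymm (h : IsHermitianOn U G J) {y : E4} (hy : y ∈ U) (u v w : E4) :
    fderiv ℝ (fundForm G J) y u v w = -fderiv ℝ (fundForm G J) y u w v := by
  have e : ∀ b c, fderiv ℝ (fundForm G J) y u b c =
      along (fun _ => u) (fun z => fundForm G J z b c) y := by
    intro b c
    rw [along_bilin (h.contDiffAt_fundForm hy) contDiffAt_const contDiffAt_const]
    simp [along]
  rw [e, e, ← along_neg]
  exact along_congr_on h.isOpen (fun z hz => h.fundForm_antisymm hz v w) hy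

theorem extDerivTwo_fundForm_antisymm (h : IsHermitianOn U G J) {y : E4} (hy : y ∈ U)
    (u v w : E4) : extDerivTwo (fundForm G J) y u v w = -extDerivTwo (fundForm G J) y u w v := by
  simp only [extDerivTwo]
  rw [h.fderiv_fundForm_antisymm hy u v w]; ring

theorem extDerivTwo_fundForm_antisymm_left (h : IsHermitianOn U G J) {y : E4} (hy : y ∈ U)
    (u v w : E4) : extDerivTwo (fundForm G J) y u v w = -extDerivTwo (fundForm G J) y v u w := by
  simp only [extDerivTwo]
  rw [h.fderiv_fundForm_antisymm hy w u v]; ring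

/-- The correction `-dF(J·, ·, ·)/2` to the Levi-Civita symbol is skew in its last two slots, so `G`
stays parallel. Skewness of `dF` in its first two slots gives the torsion condition. Parallelism of
`J` is where the vanishing of the Nijenhuis tensor enters. -/
theorem isChernAt (h : IsHermitianOn U G J) {y : E4} (hy : y ∈ U) :
    IsChernAt G J y (chSymbol G J y) := by
  have hi := h.toIsMetricOn.isInvertible hy
  have hs := fun u v w => fderiv_apply_symm h.isOpen h.smooth h.symm hy u v w
  have hc := apply_chSymbol (J := J) hi
  refine ⟨fun u v w => ?_, fun u v => ?_, fun u v => ?_⟩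
  · rw [h.symm y hy v, hc, hc, h.extDerivTwo_fundForm_antisymm hy (J y u) w v, hs u w v, hs v u w,
      hs w u v]
    ring
  · apply hi.injective
    ext1 w
    have hA := h.fderiv_apply_J hy
    -- The covariant derivative of `J` paired with `w` is a linear combination of two Nijenhuis
    -- identities composed with `J` and two differentiated orthogonality relations.
    have hN1 := congrArg (fun x => G y (J y x) w) (h.nijenhuis y hy u v)
    have hN2 := congrArg (fun x => G y (J y x) v) (h.nijenhuis y hy u w)
    have ho1 := h.fderiv_orth hy u v (J y w)
    have ho2 := h.fderiv_orth hy (J y u) v w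
    have hl := h.apply_left hy
    simp only [map_sub, map_add, _root_.sub_apply, _root_.add_apply, map_zero, _root_.zero_apply,
      h.sq y hy, map_neg, _root_.neg_apply, hc, hl, extDerivTwo, h.fderiv_fundForm hy, hA,
      h.symm y hy v] at *
    linarith
  · apply hi.injective
    ext1 w
    have hn : ∀ a b, extDerivTwo (fundForm G J) y (-a) b w = -extDerivTwo (fundForm G J) y a b w :=
      fun a b => by simp only [← altDeriv_apply, map_neg, _root_.neg_apply]
    simp only [map_sub, map_neg, _root_.sub_apply, _root_.neg_apply, hc, h.sq y hy, hn]
    rw [hs w (J y v) (J y u), hs w v u, h.extDerivTwo_fundForm_antisymm_left hy u (J y v),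
      h.extDerivTwo_fundForm_antisymm_left hy v (J y u)]
    ring

/-- The difference `A` of two solutions has values that are `G`-skew and commute with `J`. The
torsion condition forces `A` to be complex linear in its direction as well, and a
skew-Hermitian-valued form with that property is zero. -/
theorem eq_of_isChernAt (h : IsHermitianOn U G J) {y : E4} (hy : y ∈ U)
    {Γ Γ' : E4 →L[ℝ] E4 →L[ℝ] E4} (hΓ : IsChernAt G J y Γ) (hΓ' : IsChernAt G J y Γ') :
    Γ = Γ' := by
  have hi := h.toIsMetricOn.isInvertible hy
  obtain ⟨A, hA⟩ : ∃ A : E4 → E4 → E4, ∀ u v, A u v = Γ u v - Γ' u v := ⟨_, fun _ _ => rfl⟩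
  have hneg : ∀ u v, A u (-v) = -A u v := fun u v => by simp only [hA, map_neg]; abel
  have hneg' : ∀ u v, A (-u) v = -A u v := fun u v => by
    simp only [hA, map_neg, _root_.neg_apply]; abel
  have skew : ∀ u v w, G y (A u v) w = -G y (A u w) v := by
    intro u v w
    have h1 := hΓ.1 u v w
    have h2 := hΓ'.1 u v w
    rw [h.symm y hy v] at h1 h2
    simp only [hA, map_sub, _root_.sub_apply]
    linarith
  have hJ : ∀ u v, A u (J y v) = J y (A u v) := by
    intro u v
    have h1 := hΓ.2.1 u v
    have h2 := hΓ'.2.1 u v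
    rw [hA, hA, map_sub]
    linear_combination (norm := module) h1 - h2
  have hT : ∀ u v, J y (A (J y u) v - A (J y v) u) = -(A u v - A v u) := by
    intro u v
    rw [map_sub, ← hJ, ← hJ]
    have h1 := hΓ.2.2 u v
    have h2 := hΓ'.2.2 u v
    simp only [hA]
    linear_combination (norm := module) h1 - h2
  -- The expression is symmetric in `u, v`, complex linear in `v` and antilinear in `u`; such an
  -- expression vanishes.
  have hB : ∀ u v, A u v + J y (A (J y u) v) = 0 := by
    intro u v
    have s1 : ∀ u v, A u v + J y (A (J y u) v) = A v u + J y (A (J y v) u) := by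
      intro u v
      have := hT u v
      rw [map_sub] at this
      linear_combination (norm := module) this
    have s2 := s1 u (J y v)
    rw [h.sq y hy, hneg', map_neg, hJ, hJ] at s2
    have s3 := congrArg (J y) (s1 u v)
    simp only [map_add, h.sq y hy] at s2 s3
    have s4 : J y (A u v + J y (A (J y u) v)) = 0 := by
      rw [map_add, h.sq y hy]
      have : (2 : ℝ) • (J y (A u v) + -A (J y u) v) = 0 := by
        rw [two_smul]
        linear_combination (norm := module) s2 + s3
      exact (smul_eq_zero.mp this).resolve_left two_ne_zero
    have := congrArg (J y) s4
    rw [h.sq y hy, map_zero, neg_eq_zero] at this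
    exact this
  ext1 u; ext1 v
  rw [← sub_eq_zero, ← hA]
  apply hi.injective
  ext1 w
  rw [map_zero, _root_.zero_apply]
  -- `A (J u)` is skew by compatibility with `G`, but it equals `J` composed with `A u`, which is
  -- symmetric since `A u` is skew and commutes with `J`.
  have k : ∀ u v w, G y (A (J y u) v) w = 0 := by
    intro u v w
    have e : ∀ v, A (J y u) v = J y (A u v) := by
      intro v
      have := congrArg (J y) (hB u v)
      rw [map_add, h.sq y hy, map_zero] at this
      linear_combination (norm := module) -this
    have k1 := skew (J y u) v w
    rw [e v, e w, h.apply_left hy, h.apply_left hy (A u w), skew u w, hJ, h.apply_left hy] at k1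
    rw [e v, h.apply_left hy]
    linarith
  have := k (J y u) v w
  rw [h.sq y hy, hneg', map_neg, _root_.neg_apply] at this
  linarith

theorem chern_eq (h : IsHermitianOn U G J) {y : E4} (hy : y ∈ U) :
    chern G J y = chSymbol G J y :=
  h.eq_of_isChernAt hy
    (Classical.epsilon_spec (p := IsChernAt G J y) ⟨_, h.isChernAt hy⟩) (h.isChernAt hy)

theorem contDiffAt_extDerivTwo (h : IsHermitianOn U G J) (u v w : E4) :
    ∀ y ∈ U, ContDiffAt ℝ ∞ (fun z => extDerivTwo (fundForm G J) z u v w) y := by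
  intro y hy
  have hd := fun a b c : E4 => (((contDiffAt_fderiv (h.contDiffAt_fundForm hy)).clm_apply
    (contDiffAt_const (c := a))).clm_apply (contDiffAt_const (c := b))).clm_apply
      (contDiffAt_const (c := c))
  exact ((hd u v w).sub (hd v u w)).add (hd w u v)

theorem contDiffAt_chSymbol (h : IsHermitianOn U G J) :
    ∀ y ∈ U, ContDiffAt ℝ ∞ (chSymbol G J) y := by
  have hd : ∀ a b c : E4, ∀ y ∈ U, ContDiffAt ℝ ∞ (fun z => fderiv ℝ G z a b c) y :=
    fun a b c y hy => (((contDiffAt_fderiv (h.smooth y hy)).clm_apply contDiffAt_const).clm_apply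
      contDiffAt_const).clm_apply contDiffAt_const
  refine contDiffAt_clm_of_apply h.isOpen fun u => contDiffAt_clm_of_apply h.isOpen
    fun v y hy => ?_
  refine (contDiffAt_inverse (h.smooth y hy) (h.toIsMetricOn.isInvertible hy)).clm_apply ?_
  refine contDiffAt_clm_of_apply h.isOpen (fun w y hy => ?_) y hy
  have hF : ContDiffAt ℝ ∞ (fun z => altDeriv (fderiv ℝ (fundForm G J) z) (J z u) v w) y := by
    have hA : ContDiffAt ℝ ∞ (fun z => altDeriv (fderiv ℝ (fundForm G J) z)) y := by
      refine contDiffAt_clm_of_apply h.isOpen (fun a => contDiffAt_clm_of_apply h.isOpen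
        fun b => contDiffAt_clm_of_apply h.isOpen fun c => ?_) y hy
      exact h.contDiffAt_extDerivTwo a b c
    exact ((hA.clm_apply ((h.smoothJ y hy).clm_apply contDiffAt_const)).clm_apply
      contDiffAt_const).clm_apply contDiffAt_const
  exact ((((hd u v w y hy).add (hd v u w y hy)).sub (hd w u v y hy)).sub hF).const_smul (1 / 2 : ℝ)

theorem chern_eventuallyEq (h : IsHermitianOn U G J) {y : E4} (hy : y ∈ U) :
    chern G J =ᶠ[𝓝 y] chSymbol G J :=
  Filter.eventuallyEq_of_mem (h.isOpen.mem_nhds hy) fun _ hz => h.chern_eq hz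

theorem chernRicci_eq (h : IsHermitianOn U G J) {y : E4} (hy : y ∈ U) (u v : E4) :
    chernRicci G J y u v = (1 / 2) * LinearMap.trace ℝ E4
      ((J y ∘L curvature (chSymbol G J) y u v : E4 →L[ℝ] E4) : E4 →ₗ[ℝ] E4) := by
  rw [chernRicci, curvature_congr (h.chern_eventuallyEq hy)]

end IsHermitianOn

/-! ### The Chern-Ricci form in a holomorphic frame -/

theorem contDiffAt_comp₂ {B : E4 → E4 →L[ℝ] E4 →L[ℝ] ℝ} {V W : E4 → E4} {y : E4}
    (hB : ContDiffAt ℝ ∞ B y) (hV : ContDiffAt ℝ ∞ V y) (hW : ContDiffAt ℝ ∞ W y) :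
    ContDiffAt ℝ ∞ (fun z => B z (V z) (W z)) y :=
  (hB.clm_apply hV).clm_apply hW

/-- Commuting fields `K_i`, `e_i = J K_i` spanning the tangent spaces, with `K` and `e` mutually
orthogonal. -/
structure IsHoloFrame (U : Set E4) (G : E4 → E4 →L[ℝ] E4 →L[ℝ] ℝ) (J : E4 → E4 →L[ℝ] E4)
    (K e : Fin 2 → E4 → E4) : Prop where
  smoothK : ∀ i, ∀ y ∈ U, ContDiffAt ℝ ∞ (K i) y
  smoothE : ∀ i, ∀ y ∈ U, ContDiffAt ℝ ∞ (e i) y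
  commKK : ∀ i j, ∀ y ∈ U, along (K i) (K j) y = along (K j) (K i) y
  commKE : ∀ i j, ∀ y ∈ U, along (K i) (e j) y = along (e j) (K i) y
  commEE : ∀ i j, ∀ y ∈ U, along (e i) (e j) y = along (e j) (e i) y
  J_K : ∀ i, ∀ y ∈ U, J y (K i y) = e i y
  orth : ∀ i j, ∀ y ∈ U, G y (K i y) (e j y) = 0
  gram : ∀ y ∈ U, G y (K 0 y) (K 0 y) * G y (K 1 y) (K 1 y) - G y (K 0 y) (K 1 y) ^ 2 ≠ 0
  span : ∀ y ∈ U, ∀ v, (∀ i, G y v (K i y) = 0) → (∀ i, G y v (e i y) = 0) → v = 0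

/-- The Gram determinant of `K`. -/
def gramDet (G : E4 → E4 →L[ℝ] E4 →L[ℝ] ℝ) (K : Fin 2 → E4 → E4) (z : E4) : ℝ :=
  G z (K 0 z) (K 0 z) * G z (K 1 z) (K 1 z) - G z (K 0 z) (K 1 z) ^ 2

/-- The inverse of the Gram matrix of `K`. -/
def gramInv (G : E4 → E4 →L[ℝ] E4 →L[ℝ] ℝ) (K : Fin 2 → E4 → E4) (z : E4) :
    Matrix (Fin 2) (Fin 2) ℝ :=
  !![G z (K 1 z) (K 1 z) / gramDet G K z, -G z (K 0 z) (K 1 z) / gramDet G K z;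
    -G z (K 0 z) (K 1 z) / gramDet G K z, G z (K 0 z) (K 0 z) / gramDet G K z]

/-- The coefficient of `v` along the `k`-th member of the frame `X`, where `X` has the same Gram
matrix as `K`. -/
def coef (G : E4 → E4 →L[ℝ] E4 →L[ℝ] ℝ) (K X : Fin 2 → E4 → E4) (k : Fin 2) (z v : E4) : ℝ :=
  ∑ j, gramInv G K z k j * G z v (X j z)

theorem coef_add (G : E4 → E4 →L[ℝ] E4 →L[ℝ] ℝ) (K X : Fin 2 → E4 → E4) (k : Fin 2) (z v w : E4) :
    coef G K X k z (v + w) = coef G K X k z v + coef G K X k z w := by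
  simp only [coef, map_add, _root_.add_apply, mul_add, Finset.sum_add_distrib]

theorem coef_smul (G : E4 → E4 →L[ℝ] E4 →L[ℝ] ℝ) (K X : Fin 2 → E4 → E4) (k : Fin 2) (c : ℝ)
    (z v : E4) : coef G K X k z (c • v) = c * coef G K X k z v := by
  simp only [coef, map_smul, _root_.smul_apply, smul_eq_mul, Finset.mul_sum]
  exact Finset.sum_congr rfl fun _ _ => by ring

theorem coef_neg (G : E4 → E4 →L[ℝ] E4 →L[ℝ] ℝ) (K X : Fin 2 → E4 → E4) (k : Fin 2) (z v : E4) :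
    coef G K X k z (-v) = -coef G K X k z v := by
  rw [← neg_one_smul ℝ v, coef_smul]; ring

theorem coef_sub (G : E4 → E4 →L[ℝ] E4 →L[ℝ] ℝ) (K X : Fin 2 → E4 → E4) (k : Fin 2) (z v w : E4) :
    coef G K X k z (v - w) = coef G K X k z v - coef G K X k z w := by
  rw [sub_eq_add_neg, coef_add, coef_neg]; ring

theorem cov_add {Γ : E4 → E4 →L[ℝ] E4 →L[ℝ] E4} {X V W : E4 → E4} {y : E4}
    (hV : ContDiffAt ℝ ∞ V y) (hW : ContDiffAt ℝ ∞ W y) :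
    cov Γ X (fun z => V z + W z) y = cov Γ X V y + cov Γ X W y := by
  simp only [cov, along_add hV hW, map_add]; abel

theorem cov_smul {Γ : E4 → E4 →L[ℝ] E4 →L[ℝ] E4} {X V : E4 → E4} {f : E4 → ℝ} {y : E4}
    (hf : ContDiffAt ℝ ∞ f y) (hV : ContDiffAt ℝ ∞ V y) :
    cov Γ X (fun z => f z • V z) y = along X f y • V y + f y • cov Γ X V y := by
  simp only [cov, along_smul hf hV, map_smul, smul_add]; abel

theorem cov_congr_on {Γ : E4 → E4 →L[ℝ] E4 →L[ℝ] E4} {X V W : E4 → E4} {U : Set E4}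
    (hU : IsOpen U) (h : ∀ y ∈ U, V y = W y) {y : E4} (hy : y ∈ U) :
    cov Γ X V y = cov Γ X W y := by
  rw [cov, cov, along_congr_on hU h hy, h y hy]

theorem IsHermitianOn.cov_J {U : Set E4} {G : E4 → E4 →L[ℝ] E4 →L[ℝ] ℝ} {J : E4 → E4 →L[ℝ] E4}
    (h : IsHermitianOn U G J) {X V : E4 → E4} {y : E4} (hy : y ∈ U) (hV : ContDiffAt ℝ ∞ V y) :
    cov (chSymbol G J) X (fun z => J z (V z)) y = J y (cov (chSymbol G J) X V y) := by
  have := (h.isChernAt hy).2.1 (X y) (V y)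
  rw [cov, cov, along_clm_apply (h.smoothJ y hy) hV, map_add]
  simp only [along] at this ⊢
  linear_combination (norm := module) this

namespace IsHoloFrame

variable {U : Set E4} {G : E4 → E4 →L[ℝ] E4 →L[ℝ] ℝ} {J : E4 → E4 →L[ℝ] E4}
  {K e : Fin 2 → E4 → E4}

theorem J_e (h : IsHoloFrame U G J K e) (hH : IsHermitianOn U G J) (i : Fin 2) {y : E4}
    (hy : y ∈ U) : J y (e i y) = -K i y := by
  rw [← h.J_K i y hy, hH.sq y hy]

theorem apply_e_e (h : IsHoloFrame U G J K e) (hH : IsHermitianOn U G J) (i j : Fin 2) {y : E4}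
    (hy : y ∈ U) : G y (e i y) (e j y) = G y (K i y) (K j y) := by
  rw [← h.J_K i y hy, ← h.J_K j y hy, hH.orth y hy]

theorem coef_K_K (h : IsHoloFrame U G J K e) (hH : IsHermitianOn U G J) (k l : Fin 2) {y : E4}
    (hy : y ∈ U) : coef G K K k y (K l y) = if k = l then 1 else 0 := by
  have hq : gramDet G K y ≠ 0 := h.gram y hy
  have hs := hH.symm y hy (K 1 y) (K 0 y)
  fin_cases k <;> fin_cases l <;>
    simp [coef, gramInv, Fin.sum_univ_two, hs] <;> field_simp <;>
    (try simp only [gramDet]) <;> ring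

theorem coef_e_e (h : IsHoloFrame U G J K e) (hH : IsHermitianOn U G J) (k l : Fin 2) {y : E4}
    (hy : y ∈ U) : coef G K e k y (e l y) = if k = l then 1 else 0 := by
  rw [← h.coef_K_K hH k l hy]
  simp only [coef, h.apply_e_e hH _ _ hy]

theorem coef_e_K (h : IsHoloFrame U G J K e) (k l : Fin 2) {y : E4}
    (hy : y ∈ U) : coef G K e k y (K l y) = 0 := by
  simp only [coef, h.orth _ _ y hy, mul_zero, Finset.sum_const_zero]

theorem coef_K_e (h : IsHoloFrame U G J K e) (hH : IsHermitianOn U G J) (k l : Fin 2) {y : E4}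
    (hy : y ∈ U) : coef G K K k y (e l y) = 0 := by
  simp only [coef, hH.symm y hy (e l y), h.orth _ _ y hy, mul_zero, Finset.sum_const_zero]

theorem gramInv_mul (h : IsHoloFrame U G J K e) (hH : IsHermitianOn U G J) {y : E4} (hy : y ∈ U)
    (f : Fin 2 → ℝ) (j : Fin 2) :
    ∑ k, (∑ l, gramInv G K y k l * f l) * G y (K k y) (K j y) = f j := by
  have hq : gramDet G K y ≠ 0 := h.gram y hy
  have hs := hH.symm y hy (K 1 y) (K 0 y)
  fin_cases j <;>
    simp [gramInv, Fin.sum_univ_two, hs] <;> field_simp <;> simp only [gramDet] <;> ring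

theorem sum_coef (h : IsHoloFrame U G J K e) (hH : IsHermitianOn U G J) {y : E4} (hy : y ∈ U)
    (v : E4) : v = ∑ k, coef G K K k y v • K k y + ∑ k, coef G K e k y v • e k y := by
  rw [← sub_eq_zero]
  refine h.span y hy _ (fun j => ?_) (fun j => ?_)
  · simp only [map_sub, map_add, map_sum, map_smul, _root_.sub_apply, _root_.add_apply,
      _root_.sum_apply, _root_.smul_apply, smul_eq_mul, hH.symm y hy (e _ y) (K _ y),
      h.orth _ _ y hy, mul_zero, Finset.sum_const_zero, add_zero]
    simp only [coef]
    rw [h.gramInv_mul hH hy (fun l => G y v (K l y)) j, sub_self]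
  · simp only [map_sub, map_add, map_sum, map_smul, _root_.sub_apply, _root_.add_apply,
      _root_.sum_apply, _root_.smul_apply, smul_eq_mul,
      h.orth _ _ y hy, mul_zero, Finset.sum_const_zero, zero_add, h.apply_e_e hH _ _ hy]
    simp only [coef]
    rw [h.gramInv_mul hH hy (fun l => G y v (e l y)) j, sub_self]

/-- The basis given by the frame. -/
def basis (h : IsHoloFrame U G J K e) (hH : IsHermitianOn U G J) {y : E4} (hy : y ∈ U) :
    Module.Basis (Fin 2 ⊕ Fin 2) ℝ E4 :=
  Module.Basis.ofEquivFun
    { toFun := fun v => Sum.elim (fun k => coef G K K k y v) (fun k => coef G K e k y v)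
      map_add' := fun v w => by
        ext (k | k) <;> simp [coef_add]
      map_smul' := fun c v => by
        ext (k | k) <;> simp [coef_smul]
      invFun := fun c => ∑ k, c (.inl k) • K k y + ∑ k, c (.inr k) • e k y
      left_inv := fun v => (h.sum_coef hH hy v).symm
      right_inv := fun c => by
        ext (k | k)
        · simp [Fin.sum_univ_two, coef_add, coef_smul, h.coef_K_K hH _ _ hy, h.coef_K_e hH _ _ hy]
          fin_cases k <;> simp
        · simp [Fin.sum_univ_two, coef_add, coef_smul, h.coef_e_e hH _ _ hy, h.coef_e_K _ _ hy]
          fin_cases k <;> simp }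

theorem trace_eq (h : IsHoloFrame U G J K e) (hH : IsHermitianOn U G J) {y : E4} (hy : y ∈ U)
    (T : E4 →ₗ[ℝ] E4) : LinearMap.trace ℝ E4 T =
      ∑ k, coef G K K k y (T (K k y)) + ∑ k, coef G K e k y (T (e k y)) := by
  have hr : ∀ v i, (h.basis hH hy).repr v i =
      Sum.elim (fun k => coef G K K k y v) (fun k => coef G K e k y v) i := fun v i => rfl
  have hl : ∀ k, h.basis hH hy (.inl k) = K k y := by
    intro k
    apply (h.basis hH hy).repr.injective
    rw [Module.Basis.repr_self]
    ext (i | i)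
    · rw [hr]; simp [h.coef_K_K hH _ _ hy, Finsupp.single_apply, eq_comm]
    · rw [hr]; simp [h.coef_e_K _ _ hy]
  have he : ∀ k, h.basis hH hy (.inr k) = e k y := by
    intro k
    apply (h.basis hH hy).repr.injective
    rw [Module.Basis.repr_self]
    ext (i | i)
    · rw [hr]; simp [h.coef_K_e hH _ _ hy]
    · rw [hr]; simp [h.coef_e_e hH _ _ hy, Finsupp.single_apply, eq_comm]
  rw [LinearMap.trace_eq_matrix_trace ℝ (h.basis hH hy), Matrix.trace]
  simp only [Matrix.diag_apply, LinearMap.toMatrix_apply, Fintype.sum_sum_type, hr, hl, he,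
    Sum.elim_inl, Sum.elim_inr]

theorem coef_K_J (h : IsHoloFrame U G J K e) (hH : IsHermitianOn U G J) (k : Fin 2) {y : E4}
    (hy : y ∈ U) (v : E4) : coef G K K k y (J y v) = -coef G K e k y v := by
  simp only [coef, hH.apply_left hy, h.J_K _ y hy, ← Finset.sum_neg_distrib, mul_neg]

theorem coef_e_J (h : IsHoloFrame U G J K e) (hH : IsHermitianOn U G J) (k : Fin 2) {y : E4}
    (hy : y ∈ U) (v : E4) : coef G K e k y (J y v) = coef G K K k y v := by
  simp only [coef, hH.apply_left hy, h.J_e hH _ hy, map_neg, neg_neg]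

theorem contDiffAt_gramDet (h : IsHoloFrame U G J K e) (hH : IsHermitianOn U G J) {y : E4}
    (hy : y ∈ U) : ContDiffAt ℝ ∞ (gramDet G K) y := by
  have hW := fun i j => contDiffAt_comp₂ (hH.smooth y hy) (h.smoothK i y hy) (h.smoothK j y hy)
  exact ((hW 0 0).mul (hW 1 1)).sub ((hW 0 1).pow 2)

theorem contDiffAt_coef (h : IsHoloFrame U G J K e) (hH : IsHermitianOn U G J)
    {X : Fin 2 → E4 → E4} {V : E4 → E4} {y : E4} (hy : y ∈ U)
    (hX : ∀ i, ContDiffAt ℝ ∞ (X i) y) (hV : ContDiffAt ℝ ∞ V y) (k : Fin 2) :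
    ContDiffAt ℝ ∞ (fun z => coef G K X k z (V z)) y := by
  have hW := fun i j => contDiffAt_comp₂ (hH.smooth y hy) (h.smoothK i y hy) (h.smoothK j y hy)
  have hq := h.contDiffAt_gramDet hH hy
  have hq0 : gramDet G K y ≠ 0 := h.gram y hy
  refine ContDiffAt.sum fun j _ => ContDiffAt.mul ?_
    (contDiffAt_comp₂ (hH.smooth y hy) hV (hX j))
  fin_cases k <;> fin_cases j
  · exact (hW 1 1).div hq hq0
  · exact (hW 0 1).neg.div hq hq0
  · exact (hW 0 1).neg.div hq hq0
  · exact (hW 0 0).div hq hq0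

/-- The Chern connection is complex linear in its direction on a holomorphic frame. -/
theorem cov_e_K (h : IsHoloFrame U G J K e) (hH : IsHermitianOn U G J) (i j : Fin 2) {y : E4}
    (hy : y ∈ U) : cov (chSymbol G J) (e i) (K j) y = J y (cov (chSymbol G J) (K i) (K j) y) := by
  have hC := hH.isChernAt hy
  have t1 := hC.2.2 (K i y) (K j y)
  have t2 := hC.2.2 (K i y) (e j y)
  rw [h.J_K i y hy, h.J_K j y hy] at t1
  rw [h.J_K i y hy, h.J_e hH j hy, map_neg, map_neg, _root_.neg_apply] at t2
  have c : ∀ i j, cov (chSymbol G J) (K i) (e j) y = J y (cov (chSymbol G J) (K i) (K j) y) :=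
    fun i j => by
      rw [← hH.cov_J hy (h.smoothK j y hy)]
      exact cov_congr_on hH.isOpen (fun z hz => (h.J_K j z hz).symm) hy
  have c' : ∀ i j, cov (chSymbol G J) (e i) (e j) y = J y (cov (chSymbol G J) (e i) (K j) y) :=
    fun i j => by
      rw [← hH.cov_J hy (h.smoothK j y hy)]
      exact cov_congr_on hH.isOpen (fun z hz => (h.J_K j z hz).symm) hy
  -- `s1` and `s2` are the torsion condition on `(K_i, K_j)` and on `(K_i, e_j)`, where the brackets
  -- vanish. Subtracting `J` applied to the first from the second eliminates `∇_{e_j} K_i` and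
  -- leaves twice the claim.
  have s1 : J y (cov (chSymbol G J) (e i) (K j) y) - J y (cov (chSymbol G J) (e j) (K i) y) =
      -(cov (chSymbol G J) (K i) (K j) y - cov (chSymbol G J) (K j) (K i) y) := by
    rw [← c', ← c']
    simp only [cov, h.commEE i j y hy, h.commKK i j y hy]
    linear_combination (norm := module) t1
  have s2 : cov (chSymbol G J) (e i) (K j) y - J y (cov (chSymbol G J) (K j) (K i) y) =
      J y (cov (chSymbol G J) (K i) (K j) y) - cov (chSymbol G J) (e j) (K i) y := by
    rw [← c, ← c]
    simp only [cov, h.commKE i j y hy, h.commKE j i y hy]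
    linear_combination (norm := module) -t2
  have s3 := congrArg (J y) s1
  simp only [map_sub, map_neg, hH.sq y hy] at s3
  have : (2 : ℝ) • (cov (chSymbol G J) (e i) (K j) y - J y (cov (chSymbol G J) (K i) (K j) y))
      = 0 := by
    linear_combination (norm := module) s2 - s3
  exact sub_eq_zero.mp ((smul_eq_zero.mp this).resolve_left two_ne_zero)

/-- Jacobi's formula: since the metric is parallel, the trace of the connection matrix on the `K`'s
is half the logarithmic derivative of their Gram determinant. -/
theorem sum_coef_cov (h : IsHoloFrame U G J K e) (hH : IsHermitianOn U G J) (X : E4 → E4) {y : E4}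
    (hy : y ∈ U) : ∑ i, coef G K K i y (cov (chSymbol G J) X (K i) y) =
      along X (gramDet G K) y / (2 * gramDet G K y) := by
  have hq0 : gramDet G K y ≠ 0 := h.gram y hy
  have hW := fun i j => contDiffAt_comp₂ (hH.smooth y hy) (h.smoothK i y hy) (h.smoothK j y hy)
  have hp := fun i j => along_parallel (Z := X) (hH.smooth y hy) (hH.isChernAt hy).1
    (h.smoothK i y hy) (h.smoothK j y hy)
  have e1 : along X (gramDet G K) y = _ :=
    along_sub (f := fun z => G z (K 0 z) (K 0 z) * G z (K 1 z) (K 1 z))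
      (g := fun z => G z (K 0 z) (K 1 z) ^ 2) ((hW 0 0).mul (hW 1 1)) ((hW 0 1).pow 2)
  simp only [pow_two] at e1
  rw [along_mul (hW 0 0) (hW 1 1), along_mul (hW 0 1) (hW 0 1), hp, hp, hp] at e1
  rw [e1]
  simp only [coef, gramInv, Fin.sum_univ_two, hH.symm y hy (K _ y) (cov _ _ _ _)]
  simp
  field_simp
  ring

/-- The trace of `J R(X, V)`, for commuting fields `X`, `V`. -/
theorem trace_J_curvature (h : IsHoloFrame U G J K e) (hH : IsHermitianOn U G J) {X V : E4 → E4}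
    (hX : ∀ y ∈ U, ContDiffAt ℝ ∞ X y) (hV : ∀ y ∈ U, ContDiffAt ℝ ∞ V y) {y : E4} (hy : y ∈ U)
    (hXV : along X V y = along V X y) :
    LinearMap.trace ℝ E4 ((J y ∘L curvature (chSymbol G J) y (X y) (V y) : E4 →L[ℝ] E4) :
      E4 →ₗ[ℝ] E4) =
      -2 * (along X (fun z => ∑ i, coef G K e i z (cov (chSymbol G J) V (K i) z)) y
        - along V (fun z => ∑ i, coef G K e i z (cov (chSymbol G J) X (K i) z)) y) := by
  have hΓ := hH.contDiffAt_chSymbol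
  have hcov : ∀ {Z : E4 → E4}, (∀ y ∈ U, ContDiffAt ℝ ∞ Z y) → ∀ i, ∀ z ∈ U,
      ContDiffAt ℝ ∞ (cov (chSymbol G J) Z (K i)) z :=
    fun hZ i z hz => contDiffAt_cov (hΓ z hz) (hZ z hz) (h.smoothK i z hz)
  have hc : ∀ {Z : E4 → E4}, (∀ y ∈ U, ContDiffAt ℝ ∞ Z y) → ∀ k i,
      ContDiffAt ℝ ∞ (fun z => coef G K K k z (cov (chSymbol G J) Z (K i) z)) y :=
    fun hZ k i => h.contDiffAt_coef hH hy (fun i => h.smoothK i y hy) (hcov hZ i y hy) k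
  have hc' : ∀ {Z : E4 → E4}, (∀ y ∈ U, ContDiffAt ℝ ∞ Z y) → ∀ k i,
      ContDiffAt ℝ ∞ (fun z => coef G K e k z (cov (chSymbol G J) Z (K i) z)) y :=
    fun hZ k i => h.contDiffAt_coef hH hy (fun i => h.smoothE i y hy) (hcov hZ i y hy) k
  have cKe : ∀ (Z : E4 → E4) (i : Fin 2), ∀ z ∈ U,
      cov (chSymbol G J) Z (e i) z = J z (cov (chSymbol G J) Z (K i) z) := fun Z i z hz => by
    rw [← hH.cov_J hz (h.smoothK i z hz)]
    exact cov_congr_on hH.isOpen (fun z hz => (h.J_K i z hz).symm) hz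
  have RK : ∀ i, curvature (chSymbol G J) y (X y) (V y) (K i y) =
      cov (chSymbol G J) X (cov (chSymbol G J) V (K i)) y
        - cov (chSymbol G J) V (cov (chSymbol G J) X (K i)) y := fun i =>
    curvature_apply_commuting (hΓ y hy) (hX y hy) (hV y hy) (h.smoothK i y hy) hXV
  -- `J` is parallel, so the curvature commutes with it. The `e`-half of the trace therefore repeats
  -- the `K`-half, whence the factor 2 in the result.
  have RE : ∀ i, curvature (chSymbol G J) y (X y) (V y) (e i y) =
      J y (curvature (chSymbol G J) y (X y) (V y) (K i y)) := fun i => by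
    rw [curvature_apply_commuting (hΓ y hy) (hX y hy) (hV y hy) (h.smoothE i y hy) hXV, RK,
      cov_congr_on hH.isOpen (cKe V i) hy, cov_congr_on hH.isOpen (cKe X i) hy,
      hH.cov_J hy (hcov hV i y hy), hH.cov_J hy (hcov hX i y hy), map_sub]
  have key : ∀ {Z Z' : E4 → E4}, (∀ y ∈ U, ContDiffAt ℝ ∞ Z y) → (∀ y ∈ U, ContDiffAt ℝ ∞ Z' y) →
      ∀ i, coef G K e i y (cov (chSymbol G J) Z (cov (chSymbol G J) Z' (K i)) y) =
        along Z (fun z => coef G K e i z (cov (chSymbol G J) Z' (K i) z)) y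
        + ∑ k, (coef G K K k y (cov (chSymbol G J) Z' (K i) y) *
            coef G K e i y (cov (chSymbol G J) Z (K k) y)
          + coef G K e k y (cov (chSymbol G J) Z' (K i) y) *
            coef G K K i y (cov (chSymbol G J) Z (K k) y)) := by
    intro Z Z' hZ hZ' i
    rw [cov_congr_on hH.isOpen (fun z hz => h.sum_coef hH hz (cov (chSymbol G J) Z' (K i) z)) hy]
    simp only [Fin.sum_univ_two]
    have sK : ∀ k, ContDiffAt ℝ ∞
        (fun z => coef G K K k z (cov (chSymbol G J) Z' (K i) z) • K k z) y :=
      fun k => (hc hZ' k i).smul (h.smoothK k y hy)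
    have sE : ∀ k, ContDiffAt ℝ ∞
        (fun z => coef G K e k z (cov (chSymbol G J) Z' (K i) z) • e k z) y :=
      fun k => (hc' hZ' k i).smul (h.smoothE k y hy)
    rw [cov_add (V := fun z => coef G K K 0 z (cov (chSymbol G J) Z' (K i) z) • K 0 z
        + coef G K K 1 z (cov (chSymbol G J) Z' (K i) z) • K 1 z)
        (W := fun z => coef G K e 0 z (cov (chSymbol G J) Z' (K i) z) • e 0 z
        + coef G K e 1 z (cov (chSymbol G J) Z' (K i) z) • e 1 z)
        ((sK 0).add (sK 1)) ((sE 0).add (sE 1)), cov_add (sK 0) (sK 1),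
      cov_add (sE 0) (sE 1), cov_smul (hc hZ' 0 i) (h.smoothK 0 y hy),
      cov_smul (hc hZ' 1 i) (h.smoothK 1 y hy), cov_smul (hc' hZ' 0 i) (h.smoothE 0 y hy),
      cov_smul (hc' hZ' 1 i) (h.smoothE 1 y hy), cKe Z 0 y hy, cKe Z 1 y hy]
    simp only [coef_add, coef_smul, h.coef_e_K _ _ hy, h.coef_e_e hH _ _ hy, h.coef_e_J hH _ hy]
    fin_cases i <;> simp <;> ring
  rw [h.trace_eq hH hy]
  simp only [ContinuousLinearMap.coe_coe, ContinuousLinearMap.comp_apply, RE, h.coef_K_J hH _ hy,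
    h.coef_e_J hH _ hy]
  rw [along_sum fun i _ => hc' hV i i, along_sum fun i _ => hc' hX i i]
  -- The products of connection coefficients coming from the two orders are the trace of a
  -- commutator and cancel, leaving the exterior derivative of the trace of the connection form.
  simp only [RK, coef_sub, key hX hV, key hV hX, Fin.sum_univ_two]
  ring

end IsHoloFrame

/-! ### The Hermitian scalar curvature -/

theorem trace_eq_sum (T : E4 →ₗ[ℝ] E4) :
    LinearMap.trace ℝ E4 T = ∑ i : Fin 4, T (EuclideanSpace.single i 1) i := by
  rw [LinearMap.trace_eq_matrix_trace ℝ (EuclideanSpace.basisFun (Fin 4) ℝ).toBasis, Matrix.trace]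
  simp only [Matrix.diag_apply, LinearMap.toMatrix_apply]
  simp

/-- A continuous bilinear form as a bilinear map. -/
def toBilin (B : E4 →L[ℝ] E4 →L[ℝ] ℝ) : E4 →ₗ[ℝ] E4 →ₗ[ℝ] ℝ :=
  LinearMap.mk₂ ℝ (fun u v => B u v) (by simp) (by simp) (by simp) (by simp)

theorem toBilin_apply (B : E4 →L[ℝ] E4 →L[ℝ] ℝ) (u v : E4) : toBilin B u v = B u v := rfl

/-- The Pfaffian of a nondegenerate 2-form is nonzero. -/
theorem wedgeTwoTwo_self_ne_zero {B : E4 →L[ℝ] E4 →L[ℝ] ℝ} (ha : ∀ v, B v v = 0)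
    (hn : ∀ v, (∀ w, B v w = 0) → v = 0) :
    wedgeTwoTwo (fun u v => B u v) (fun u v => B u v) ≠ 0 := by
  intro h0
  let e : Fin 4 → E4 := fun i => EuclideanSpace.single i 1
  have hal := fun u v => alternating_apply_eq (α := toBilin B) ha u v
  simp only [toBilin_apply] at hal
  change B (e 0) (e 1) * B (e 2) (e 3) - B (e 0) (e 2) * B (e 1) (e 3)
    + B (e 0) (e 3) * B (e 1) (e 2) + B (e 1) (e 2) * B (e 0) (e 3)
    - B (e 1) (e 3) * B (e 0) (e 2) + B (e 2) (e 3) * B (e 0) (e 1) = 0 at h0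
  have hk : ∀ a b c d : ℝ, (∀ w : E4,
      (a * w 1 - b * w 0) * B (e 0) (e 1) + (a * w 2 - c * w 0) * B (e 0) (e 2)
      + (a * w 3 - d * w 0) * B (e 0) (e 3) + (b * w 2 - c * w 1) * B (e 1) (e 2)
      + (b * w 3 - d * w 1) * B (e 1) (e 3) + (c * w 3 - d * w 2) * B (e 2) (e 3) = 0) →
      a = 0 ∧ b = 0 ∧ c = 0 ∧ d = 0 := by
    intro a b c d h
    have := hn (!₂[a, b, c, d]) fun w => by
      rw [hal]
      simpa using h w
    exact ⟨congrArg (fun v : E4 => v 0) this, congrArg (fun v : E4 => v 1) this,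
      congrArg (fun v : E4 => v 2) this, congrArg (fun v : E4 => v 3) this⟩
  -- The vectors tested are those of the Pfaffian adjoint of the matrix of `B`. Their contraction
  -- with `B` is a multiple of the Pfaffian, hence zero, and their vanishing kills every entry of
  -- `B`.
  obtain ⟨-, h23, h13, h12⟩ := hk 0 (B (e 2) (e 3)) (-B (e 1) (e 3)) (B (e 1) (e 2)) fun w => by
    linear_combination (-(w 0) / 2) * h0
  obtain ⟨-, -, h03, h02⟩ := hk (-B (e 2) (e 3)) 0 (B (e 0) (e 3)) (-B (e 0) (e 2)) fun w => by
    linear_combination (-(w 1) / 2) * h0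
  obtain ⟨-, -, -, h01⟩ := hk (B (e 1) (e 3)) (-B (e 0) (e 3)) 0 (B (e 0) (e 1)) fun w => by
    linear_combination (-(w 2) / 2) * h0
  have := hn (e 0) fun w => by
    rw [hal]
    change _ * B (e 0) (e 1) + _ * B (e 0) (e 2) + _ * B (e 0) (e 3) + _ * B (e 1) (e 2)
      + _ * B (e 1) (e 3) + _ * B (e 2) (e 3) = 0
    rw [h01, h03, h12, h23, neg_eq_zero.mp h13, neg_eq_zero.mp h02]
    ring
  have := congrArg (fun v : E4 => v 0) this
  simp [e] at this

namespace IsHermitianOn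

variable {U : Set E4} {G : E4 → E4 →L[ℝ] E4 →L[ℝ] ℝ} {J : E4 → E4 →L[ℝ] E4}

theorem fundForm_self (h : IsHermitianOn U G J) {y : E4} (hy : y ∈ U) (v : E4) :
    fundForm G J y v v = 0 := by
  have := h.fundForm_antisymm hy v v
  linarith

theorem fundForm_nondegenerate (h : IsHermitianOn U G J) {y : E4} (hy : y ∈ U) (v : E4)
    (hv : ∀ w, fundForm G J y v w = 0) : v = 0 := by
  by_contra h0
  have h1 : J y v ≠ 0 := fun h1 => h0 (by
    have := h.sq y hy v
    rw [h1, map_zero] at this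
    exact neg_eq_zero.mp this.symm)
  exact (h.posDef y hy _ h1).ne' (hv (J y v))

theorem wedge_fundForm_ne_zero (h : IsHermitianOn U G J) {y : E4} (hy : y ∈ U) :
    wedgeTwoTwo (fun u v => fundForm G J y u v) (fun u v => fundForm G J y u v) ≠ 0 :=
  wedgeTwoTwo_self_ne_zero (h.fundForm_self hy) (h.fundForm_nondegenerate hy)

theorem continuousAt_hermitianScalar (h : IsHermitianOn U G J) {y : E4} (hy : y ∈ U) :
    ContinuousAt (hermitianScalar G J) y := by
  have hr : ∀ u v, ContinuousAt (fun z => chernRicci G J z u v) y := by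
    intro u v
    have e : (fun z => chernRicci G J z u v) =ᶠ[𝓝 y] fun z => (1 / 2) * ∑ i : Fin 4,
        J z (curvature (chSymbol G J) z u v (EuclideanSpace.single i 1)) i :=
      Filter.eventuallyEq_of_mem (h.isOpen.mem_nhds hy) fun z hz => by
        simp only [h.chernRicci_eq hz, trace_eq_sum]; rfl
    rw [continuousAt_congr e]
    have h1 := continuousAt_curvature (h.contDiffAt_chSymbol y hy) u v
    have h2 := (h.smoothJ y hy).continuousAt
    fun_prop
  have hF := (h.contDiffAt_fundForm hy).continuousAt
  have hw := h.wedge_fundForm_ne_zero hy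
  unfold hermitianScalar
  refine ContinuousAt.div ?_ ?_ hw
  · unfold wedgeTwoTwo
    fun_prop
  · unfold wedgeTwoTwo
    fun_prop

/-- Numerator and denominator scale by the same determinant, so the quotient may be computed in any
frame on which `F ∧ F` does not vanish. -/
theorem hermitianScalar_eq_frame (h : IsHermitianOn U G J) {y : E4} (hy : y ∈ U) (X : Fin 4 → E4)
    (hX : wedgeFrame (fun u v => fundForm G J y u v) (fun u v => fundForm G J y u v) X ≠ 0) :
    hermitianScalar G J y = 4 * wedgeFrame (chernRicci G J y) (fun u v => fundForm G J y u v) X /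
      wedgeFrame (fun u v => fundForm G J y u v) (fun u v => fundForm G J y u v) X := by
  let R : E4 →ₗ[ℝ] E4 →ₗ[ℝ] ℝ := LinearMap.mk₂ ℝ (chernRicci G J y)
    (fun u u' v => by
      simp only [chernRicci, curvature_add_left, trace_eq_sum, ← mul_add, ← Finset.sum_add_distrib]
      simp)
    (fun c u v => by
      simp only [chernRicci, curvature_smul_left, trace_eq_sum, smul_eq_mul]
      simp [Finset.mul_sum]
      exact Finset.sum_congr rfl fun i _ => by ring)
    (fun u v v' => by
      simp only [chernRicci, curvature_add_right, trace_eq_sum, ← mul_add, ← Finset.sum_add_distrib]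
      simp)
    (fun c u v => by
      simp only [chernRicci, curvature_smul_right, trace_eq_sum, smul_eq_mul]
      simp [Finset.mul_sum]
      exact Finset.sum_congr rfl fun i _ => by ring)
  have hR : ∀ v, R v v = 0 := by
    intro v
    have e : curvature (chern G J) y v v = 0 := by
      simp [curvature]
    change chernRicci G J y v v = 0
    simp [chernRicci, e]
  have h1 := wedgeFrame_eq (β := toBilin (fundForm G J y)) hR (h.fundForm_self hy) X
  have h2 := wedgeFrame_eq (α := toBilin (fundForm G J y)) (β := toBilin (fundForm G J y))
    (h.fundForm_self hy) (h.fundForm_self hy) X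
  change wedgeFrame (chernRicci G J y) (fun u v => fundForm G J y u v) X = _ *
    wedgeTwoTwo (chernRicci G J y) (fun u v => fundForm G J y u v) at h1
  change wedgeFrame (fun u v => fundForm G J y u v) (fun u v => fundForm G J y u v) X = _ *
    wedgeTwoTwo (fun u v => fundForm G J y u v) (fun u v => fundForm G J y u v) at h2
  rw [h2] at hX
  rw [h1, h2, hermitianScalar, mul_left_comm, mul_div_mul_left _ _ (left_ne_zero_of_mul hX)]

end IsHermitianOn

namespace IsHoloFrame

variable {U : Set E4} {G : E4 → E4 →L[ℝ] E4 →L[ℝ] ℝ} {J : E4 → E4 →L[ℝ] E4}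
  {K e : Fin 2 → E4 → E4}

/-- The derivative of `log gramDet` along `e_i`. -/
def dlog (G : E4 → E4 →L[ℝ] E4 →L[ℝ] ℝ) (K e : Fin 2 → E4 → E4) (i : Fin 2) (z : E4) : ℝ :=
  along (e i) (gramDet G K) z / gramDet G K z

theorem contDiffAt_dlog (h : IsHoloFrame U G J K e) (hH : IsHermitianOn U G J) (i : Fin 2) {y : E4}
    (hy : y ∈ U) : ContDiffAt ℝ ∞ (dlog G K e i) y :=
  (contDiffAt_along (h.smoothE i y hy) (h.contDiffAt_gramDet hH hy)).div
    (h.contDiffAt_gramDet hH hy) (h.gram y hy)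

/-- Complex linearity in the direction exchanges the `e`-part of the trace along `K_j` with minus
the `K`-part along `e_j`, which Jacobi's formula evaluates. -/
theorem sum_coef_cov_K (h : IsHoloFrame U G J K e) (hH : IsHermitianOn U G J) (j : Fin 2) {y : E4}
    (hy : y ∈ U) : ∑ i, coef G K e i y (cov (chSymbol G J) (K j) (K i) y) =
      -(1 / 2) * dlog G K e j y := by
  have e1 := h.sum_coef_cov hH (e j) hy
  simp only [h.cov_e_K hH _ _ hy, h.coef_K_J hH _ hy, Finset.sum_neg_distrib] at e1
  have hq0 : gramDet G K y ≠ 0 := h.gram y hy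
  rw [← neg_eq_iff_eq_neg.mpr e1.symm, dlog]
  field_simp

theorem sum_coef_cov_e (h : IsHoloFrame U G J K e) (hH : IsHermitianOn U G J)
    (hK : ∀ i, ∀ z ∈ U, along (K i) (gramDet G K) z = 0) (j : Fin 2) {y : E4}
    (hy : y ∈ U) : ∑ i, coef G K e i y (cov (chSymbol G J) (e j) (K i) y) = 0 := by
  simp only [h.cov_e_K hH _ _ hy, h.coef_e_J hH _ hy]
  rw [h.sum_coef_cov hH (K j) hy, hK j y hy, zero_div]

/-- The frame of type `(1,0)` built from the `K_i` is holomorphic, so the Chern-Ricci form is a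
multiple of `dd^c log gramDet`. Invariance along the `K_i` leaves only these mixed components. -/
theorem chernRicci_e_K (h : IsHoloFrame U G J K e) (hH : IsHermitianOn U G J)
    (hK : ∀ i, ∀ z ∈ U, along (K i) (gramDet G K) z = 0) (i j : Fin 2) {y : E4} (hy : y ∈ U) :
    chernRicci G J y (e i y) (K j y) = (1 / 2) * along (e i) (dlog G K e j) y := by
  rw [hH.chernRicci_eq hy, h.trace_J_curvature hH (h.smoothE i) (h.smoothK j) hy
    (h.commKE j i y hy).symm,
    along_congr_on hH.isOpen (fun z hz => h.sum_coef_cov_K hH j hz) hy,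
    along_congr_on hH.isOpen (fun z hz => h.sum_coef_cov_e hH hK i hz) hy, along_const,
    along_const_mul _ (h.contDiffAt_dlog hH j hy)]
  ring

theorem chernRicci_K_K (h : IsHoloFrame U G J K e) (hH : IsHermitianOn U G J)
    (hK : ∀ i, ∀ z ∈ U, along (K i) (gramDet G K) z = 0) (i j : Fin 2) {y : E4} (hy : y ∈ U) :
    chernRicci G J y (K i y) (K j y) = 0 := by
  have k : ∀ i j, along (K i) (dlog G K e j) y = 0 := by
    intro i j
    have hq := fun z (hz : z ∈ U) => h.contDiffAt_gramDet hH hz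
    have h1 : along (K i) (fun z => dlog G K e j z * gramDet G K z) y =
        along (K i) (along (e j) (gramDet G K)) y :=
      along_congr_on hH.isOpen (fun z hz => div_mul_cancel₀ _ (h.gram z hz)) hy
    rw [along_mul (h.contDiffAt_dlog hH j hy) (hq y hy), hK i y hy, mul_zero, add_zero,
      along_along_comm (h.smoothK i y hy) (h.smoothE j y hy) (hq y hy) (h.commKE i j y hy),
      along_congr_on hH.isOpen (hK i) hy, along_const] at h1
    exact (mul_eq_zero.mp h1).resolve_right (h.gram y hy)
  rw [hH.chernRicci_eq hy, h.trace_J_curvature hH (h.smoothK i) (h.smoothK j) hy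
    (h.commKK i j y hy),
    along_congr_on hH.isOpen (fun z hz => h.sum_coef_cov_K hH j hz) hy,
    along_congr_on hH.isOpen (fun z hz => h.sum_coef_cov_K hH i hz) hy,
    along_const_mul _ (h.contDiffAt_dlog hH j hy), along_const_mul _ (h.contDiffAt_dlog hH i hy),
    k, k]
  ring

theorem chernRicci_e_e (h : IsHoloFrame U G J K e) (hH : IsHermitianOn U G J)
    (hK : ∀ i, ∀ z ∈ U, along (K i) (gramDet G K) z = 0) (i j : Fin 2) {y : E4} (hy : y ∈ U) :
    chernRicci G J y (e i y) (e j y) = 0 := by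
  rw [hH.chernRicci_eq hy, h.trace_J_curvature hH (h.smoothE i) (h.smoothE j) hy
    (h.commEE i j y hy),
    along_congr_on hH.isOpen (fun z hz => h.sum_coef_cov_e hH hK j hz) hy,
    along_congr_on hH.isOpen (fun z hz => h.sum_coef_cov_e hH hK i hz) hy, along_const, along_const]
  ring

/-- The Hermitian scalar curvature in a holomorphic frame of symmetries. -/
theorem hermitianScalar_eq (h : IsHoloFrame U G J K e) (hH : IsHermitianOn U G J)
    (hK : ∀ i, ∀ z ∈ U, along (K i) (gramDet G K) z = 0) {y : E4} (hy : y ∈ U) :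
    hermitianScalar G J y = -(G y (K 1 y) (K 1 y) * along (e 0) (dlog G K e 0) y
      - G y (K 0 y) (K 1 y) * (along (e 1) (dlog G K e 0) y + along (e 0) (dlog G K e 1) y)
      + G y (K 0 y) (K 0 y) * along (e 1) (dlog G K e 1) y) / gramDet G K y := by
  have hq : gramDet G K y ≠ 0 := h.gram y hy
  have hs := hH.symm y hy (K 1 y) (K 0 y)
  have F1 : ∀ i j, fundForm G J y (K i y) (K j y) = 0 := fun i j => by
    change G y (J y (K i y)) (K j y) = 0
    rw [h.J_K i y hy, hH.symm y hy, h.orth j i y hy]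
  have F2 : ∀ i j, fundForm G J y (K i y) (e j y) = G y (K i y) (K j y) := fun i j => by
    change G y (J y (K i y)) (e j y) = _
    rw [h.J_K i y hy, h.apply_e_e hH i j hy]
  have F3 : ∀ i j, fundForm G J y (e i y) (e j y) = 0 := fun i j => by
    change G y (J y (e i y)) (e j y) = 0
    rw [h.J_e hH i hy, map_neg, _root_.neg_apply, h.orth i j y hy, neg_zero]
  have R2 : ∀ i j, chernRicci G J y (K i y) (e j y) = -((1 / 2) * along (e j) (dlog G K e i) y) :=
    fun i j => by
      rw [← h.chernRicci_e_K hH hK j i hy, chernRicci, curvature_swap]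
      simp [chernRicci]
  let X : Fin 4 → E4 := ![K 0 y, K 1 y, e 0 y, e 1 y]
  have hw : wedgeFrame (fun u v => fundForm G J y u v) (fun u v => fundForm G J y u v) X =
      -2 * gramDet G K y := by
    simp only [wedgeFrame, X, Matrix.cons_val, F1, F2, F3, hs, gramDet]
    ring
  rw [hH.hermitianScalar_eq_frame hy X (by rw [hw]; exact mul_ne_zero (by norm_num) hq), hw]
  simp only [wedgeFrame, X, Matrix.cons_val, F1, F2, F3, hs, R2, h.chernRicci_K_K hH hK _ _ hy,
    h.chernRicci_e_e hH hK _ _ hy]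
  field_simp
  ring

end IsHoloFrame

/-! ### The Lee form -/

theorem alternating_three_apply_eq {D : E4 →L[ℝ] E4 →L[ℝ] E4 →L[ℝ] ℝ}
    (h1 : ∀ u v w, D u v w = -D v u w) (h2 : ∀ u v w, D u v w = -D u w v) (u v w : E4) :
    let e : Fin 4 → E4 := fun i => EuclideanSpace.single i 1
    let d : Fin 4 → Fin 4 → Fin 4 → ℝ := fun i j k =>
      u i * (v j * w k - v k * w j) - u j * (v i * w k - v k * w i) + u k * (v i * w j - v j * w i)
    D u v w = d 0 1 2 * D (e 0) (e 1) (e 2) + d 0 1 3 * D (e 0) (e 1) (e 3)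
      + d 0 2 3 * D (e 0) (e 2) (e 3) + d 1 2 3 * D (e 1) (e 2) (e 3) := by
  intro e d
  have hz : ∀ u v, D u v v = 0 := fun u v => by have := h2 u v v; linarith
  have hz' : ∀ u v, D u u v = 0 := fun u v => by have := h1 u u v; linarith
  have hz'' : ∀ u v, D u v u = 0 := fun u v => by rw [h2, hz', neg_zero]
  have hu : ∀ j k, D u (e j) (e k) = u 0 * D (e 0) (e j) (e k) + u 1 * D (e 1) (e j) (e k)
      + u 2 * D (e 2) (e j) (e k) + u 3 * D (e 3) (e j) (e k) := by
    intro j k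
    have : D u (e j) (e k) = D (∑ i : Fin 4, u i • e i) (e j) (e k) := by rw [← sum_single u]
    rw [this]
    simp only [Fin.sum_univ_four, map_add, map_smul, _root_.add_apply, _root_.smul_apply,
      smul_eq_mul]
  have ha := alternating_apply_eq (α := toBilin (D u)) (hz u) v w
  simp only [toBilin_apply] at ha
  rw [ha]
  change _ * D u (e 0) (e 1) + _ * D u (e 0) (e 2) + _ * D u (e 0) (e 3) + _ * D u (e 1) (e 2)
      + _ * D u (e 1) (e 3) + _ * D u (e 2) (e 3) = _
  simp only [hu, hz', hz'']
  rw [h1 (e 2) (e 0) (e 1), h2 (e 0) (e 2) (e 1), h1 (e 3) (e 0) (e 1), h2 (e 0) (e 3) (e 1),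
    h1 (e 1) (e 0) (e 2), h1 (e 3) (e 0) (e 2), h2 (e 0) (e 3) (e 2), h1 (e 1) (e 0) (e 3),
    h1 (e 2) (e 0) (e 3), h1 (e 3) (e 1) (e 2), h2 (e 1) (e 3) (e 2), h1 (e 2) (e 1) (e 3)]
  simp only [d]
  ring

/-- The solution `θ` of `β = θ ∧ F` for a 3-form `β` and a nondegenerate 2-form `F` on `ℝ⁴`. -/
def leeSol (F : E4 →L[ℝ] E4 →L[ℝ] ℝ) (β : E4 → E4 → E4 → ℝ) : Fin 4 → ℝ :=
  let e : Fin 4 → E4 := fun i => EuclideanSpace.single i 1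
  let P := wedgeTwoTwo (fun u v => F u v) (fun u v => F u v) / 2
  ![(F (e 0) (e 1) * β (e 0) (e 2) (e 3) - F (e 0) (e 2) * β (e 0) (e 1) (e 3)
      + F (e 0) (e 3) * β (e 0) (e 1) (e 2)) / P,
    (F (e 0) (e 1) * β (e 1) (e 2) (e 3) - F (e 1) (e 2) * β (e 0) (e 1) (e 3)
      + F (e 1) (e 3) * β (e 0) (e 1) (e 2)) / P,
    (F (e 0) (e 2) * β (e 1) (e 2) (e 3) - F (e 1) (e 2) * β (e 0) (e 2) (e 3)
      + F (e 2) (e 3) * β (e 0) (e 1) (e 2)) / P,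
    (F (e 0) (e 3) * β (e 1) (e 2) (e 3) - F (e 1) (e 3) * β (e 0) (e 2) (e 3)
      + F (e 2) (e 3) * β (e 0) (e 1) (e 3)) / P]

/-- The covector with prescribed coordinates. -/
def covector (c : Fin 4 → ℝ) : E4 →L[ℝ] ℝ := ∑ i, c i • (EuclideanSpace.proj i : E4 →L[ℝ] ℝ)

theorem covector_apply (c : Fin 4 → ℝ) (v : E4) : covector c v = ∑ i, c i * v i := by
  simp [covector]

theorem eq_covector (θ : E4 →L[ℝ] ℝ) : θ = covector fun i => θ (EuclideanSpace.single i 1) := by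
  ext1 v
  conv_lhs => rw [sum_single v]
  simp only [covector_apply, map_sum, map_smul, smul_eq_mul]
  exact Finset.sum_congr rfl fun i _ => mul_comm _ _

/-- Contracting `θ ∧ F` with entries of `F` as in `leeSol` isolates the Pfaffian of `F` times one
coordinate of `θ`; all other terms cancel in pairs. -/
theorem eq_leeSol {F : E4 →L[ℝ] E4 →L[ℝ] ℝ} {β : E4 → E4 → E4 → ℝ} {θ : E4 →L[ℝ] ℝ}
    (hF : wedgeTwoTwo (fun u v => F u v) (fun u v => F u v) ≠ 0)
    (h : ∀ u v w, β u v w = θ u * F v w - θ v * F u w + θ w * F u v) :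
    θ = covector (leeSol F β) := by
  let e : Fin 4 → E4 := fun i => EuclideanSpace.single i 1
  have hP : wedgeTwoTwo (fun u v => F u v) (fun u v => F u v) / 2 ≠ 0 :=
    div_ne_zero hF two_ne_zero
  rw [eq_covector θ]
  congr 1
  ext i
  have hp : wedgeTwoTwo (fun u v => F u v) (fun u v => F u v) / 2 = F (e 0) (e 1) * F (e 2) (e 3)
      - F (e 0) (e 2) * F (e 1) (e 3) + F (e 0) (e 3) * F (e 1) (e 2) := by
    simp only [wedgeTwoTwo, e]; ring
  fin_cases i <;> simp only [leeSol, Matrix.cons_val, Fin.zero_eta, Fin.mk_one, Fin.reduceFinMk,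
    eq_div_iff hP, h] <;> rw [hp] <;> simp only [e] <;> ring

/-- In dimension four, wedging with a nondegenerate 2-form is an isomorphism from 1-forms to
3-forms. Once the Pfaffian is cleared, the claim is a polynomial identity in components. -/
theorem leeSol_spec {F : E4 →L[ℝ] E4 →L[ℝ] ℝ} {D : E4 →L[ℝ] E4 →L[ℝ] E4 →L[ℝ] ℝ}
    (ha : ∀ v, F v v = 0) (hF : wedgeTwoTwo (fun u v => F u v) (fun u v => F u v) ≠ 0)
    (h1 : ∀ u v w, D u v w = -D v u w) (h2 : ∀ u v w, D u v w = -D u w v) (u v w : E4) :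
    D u v w = covector (leeSol F fun u v w => D u v w) u * F v w
      - covector (leeSol F fun u v w => D u v w) v * F u w
      + covector (leeSol F fun u v w => D u v w) w * F u v := by
  let e : Fin 4 → E4 := fun i => EuclideanSpace.single i 1
  have hP : wedgeTwoTwo (fun u v => F u v) (fun u v => F u v) / 2 ≠ 0 :=
    div_ne_zero hF two_ne_zero
  have hp : wedgeTwoTwo (fun u v => F u v) (fun u v => F u v) / 2 = F (e 0) (e 1) * F (e 2) (e 3)
      - F (e 0) (e 2) * F (e 1) (e 3) + F (e 0) (e 3) * F (e 1) (e 2) := by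
    simp only [wedgeTwoTwo, e]; ring
  have hc : ∀ v, covector (leeSol F fun u v w => D u v w) v * (F (e 0) (e 1) * F (e 2) (e 3)
      - F (e 0) (e 2) * F (e 1) (e 3) + F (e 0) (e 3) * F (e 1) (e 2)) =
      v 0 * (F (e 0) (e 1) * D (e 0) (e 2) (e 3) - F (e 0) (e 2) * D (e 0) (e 1) (e 3)
        + F (e 0) (e 3) * D (e 0) (e 1) (e 2))
      + v 1 * (F (e 0) (e 1) * D (e 1) (e 2) (e 3) - F (e 1) (e 2) * D (e 0) (e 1) (e 3)
        + F (e 1) (e 3) * D (e 0) (e 1) (e 2))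
      + v 2 * (F (e 0) (e 2) * D (e 1) (e 2) (e 3) - F (e 1) (e 2) * D (e 0) (e 2) (e 3)
        + F (e 2) (e 3) * D (e 0) (e 1) (e 2))
      + v 3 * (F (e 0) (e 3) * D (e 1) (e 2) (e 3) - F (e 1) (e 3) * D (e 0) (e 2) (e 3)
        + F (e 2) (e 3) * D (e 0) (e 1) (e 3)) := by
    intro v
    rw [← hp, covector_apply]
    simp only [Fin.sum_univ_four, leeSol, Matrix.cons_val, add_mul]
    simp only [div_mul_eq_mul_div]
    simp only [mul_div_assoc, div_self hP, e]
    ring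
  rw [hp] at hP
  refine mul_right_cancel₀ hP ?_
  rw [add_mul, sub_mul, mul_right_comm _ (F v w), mul_right_comm _ (F u w),
    mul_right_comm _ (F u v), hc, hc, hc]
  have hal := fun u v => alternating_apply_eq (α := toBilin F) ha u v
  simp only [toBilin_apply] at hal
  rw [alternating_three_apply_eq h1 h2 u v w, hal v w, hal u w, hal u v]
  change (_ * D (e 0) (e 1) (e 2) + _ * D (e 0) (e 1) (e 3) + _ * D (e 0) (e 2) (e 3)
    + _ * D (e 1) (e 2) (e 3)) * _ = _
  simp only [e]
  ring

namespace IsHermitianOn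

variable {U : Set E4} {G : E4 → E4 →L[ℝ] E4 →L[ℝ] ℝ} {J : E4 → E4 →L[ℝ] E4}

theorem leeForm_spec (h : IsHermitianOn U G J) {y : E4} (hy : y ∈ U) (u v w : E4) :
    extDerivTwo (fundForm G J) y u v w = leeForm G J y u * fundForm G J y v w
      - leeForm G J y v * fundForm G J y u w + leeForm G J y w * fundForm G J y u v := by
  refine Classical.epsilon_spec (p := fun θ : E4 →L[ℝ] ℝ => ∀ u v w,
    extDerivTwo (fundForm G J) y u v w = θ u * fundForm G J y v w - θ v * fundForm G J y u w
      + θ w * fundForm G J y u v) ⟨covector (leeSol (fundForm G J y) (extDerivTwo (fundForm G J) y)),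
      fun u v w => ?_⟩ u v w
  exact leeSol_spec (D := altDeriv (fderiv ℝ (fundForm G J) y)) (h.fundForm_self hy)
    (h.wedge_fundForm_ne_zero hy) (h.extDerivTwo_fundForm_antisymm_left hy)
    (h.extDerivTwo_fundForm_antisymm hy) u v w

theorem leeForm_eq (h : IsHermitianOn U G J) {y : E4} (hy : y ∈ U) :
    leeForm G J y = covector (leeSol (fundForm G J y) (extDerivTwo (fundForm G J) y)) :=
  eq_leeSol (h.wedge_fundForm_ne_zero hy) (h.leeForm_spec hy)

/-- The explicit solution is rational in the entries of `F` and `dF`, with the Pfaffian as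
denominator. This makes the `epsilon`-defined form differentiable, as `dθ` requires. -/
theorem contDiffAt_leeForm (h : IsHermitianOn U G J) {y : E4} (hy : y ∈ U) :
    ContDiffAt ℝ ∞ (leeForm G J) y := by
  have e : leeForm G J =ᶠ[𝓝 y]
      fun z => covector (leeSol (fundForm G J z) (extDerivTwo (fundForm G J) z)) :=
    Filter.eventuallyEq_of_mem (h.isOpen.mem_nhds hy) fun z hz => h.leeForm_eq hz
  refine ContDiffAt.congr_of_eventuallyEq ?_ e
  have hF : ∀ a b : E4, ContDiffAt ℝ ∞ (fun z => fundForm G J z a b) y := fun a b =>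
    ((h.contDiffAt_fundForm hy).clm_apply contDiffAt_const).clm_apply contDiffAt_const
  have hd := fun a b c => h.contDiffAt_extDerivTwo a b c y hy
  have hw : ContDiffAt ℝ ∞ (fun z => wedgeTwoTwo (fun u v => fundForm G J z u v)
      (fun u v => fundForm G J z u v) / 2) y := by
    unfold wedgeTwoTwo
    fun_prop
  have hw0 := div_ne_zero (h.wedge_fundForm_ne_zero hy) two_ne_zero
  have hc : ∀ i, ContDiffAt ℝ ∞
      (fun z => leeSol (fundForm G J z) (extDerivTwo (fundForm G J) z) i) y := by
    intro i
    fin_cases i <;> refine ContDiffAt.div ?_ hw hw0 <;> fun_prop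
  unfold covector
  exact ContDiffAt.sum fun i _ => (hc i).smul contDiffAt_const

end IsHermitianOn

/-! ### Generalized Kähler structures of symplectic type on open sets of `ℝ⁴` -/

/-- The symplectic adjoint of `j`. -/
def locAdj (σ : E4 → E4 →L[ℝ] E4 →L[ℝ] ℝ) (j : E4 → E4 →L[ℝ] E4) (y : E4) : E4 →L[ℝ] E4 :=
  (σ y).inverse ∘L (j y).precomp ℝ ∘L σ y

/-- The metric `σ(·, j ·)^s`. -/
def locMetric (σ : E4 → E4 →L[ℝ] E4 →L[ℝ] ℝ) (j : E4 → E4 →L[ℝ] E4) (y : E4) :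
    E4 →L[ℝ] E4 →L[ℝ] ℝ :=
  (1 / 2 : ℝ) • ((σ y).bilinearComp (.id ℝ E4) (j y)
    + ((σ y).bilinearComp (.id ℝ E4) (j y)).flip)

theorem locMetric_apply (σ : E4 → E4 →L[ℝ] E4 →L[ℝ] ℝ) (j : E4 → E4 →L[ℝ] E4) (y u v : E4) :
    locMetric σ j y u v = (1 / 2) * (σ y u (j y v) + σ y v (j y u)) := rfl

/-- The angle function. -/
def locAngle (σ : E4 → E4 →L[ℝ] E4 →L[ℝ] ℝ) (j : E4 → E4 →L[ℝ] E4) (y : E4) : ℝ :=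
  -(1 / 4) * LinearMap.trace ℝ E4 ((j y ∘L locAdj σ j y : E4 →L[ℝ] E4) : E4 →ₗ[ℝ] E4)

/-- The bracket form of the vanishing of the Nijenhuis tensor. -/
theorem NijenhuisZeroAt.bracket {J : E4 → E4 →L[ℝ] E4} {y : E4} (h : NijenhuisZeroAt J y)
    (hJ : ContDiffAt ℝ ∞ J y) (hsq : ∀ v, J y (J y v) = -v) {X Y X' Y' : E4 → E4}
    (hX : ContDiffAt ℝ ∞ X y) (hY : ContDiffAt ℝ ∞ Y y)
    (hX' : X' =ᶠ[𝓝 y] fun z => J z (X z)) (hY' : Y' =ᶠ[𝓝 y] fun z => J z (Y z)) :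
    (along X' Y' y - along Y' X' y) - J y (along X' Y y - along Y X' y)
      - J y (along X Y' y - along Y' X y) - (along X Y y - along Y X y) = 0 := by
  have hn := h (X y) (Y y)
  have e1 : ∀ Z, along Z X' y = along Z J y (X y) + J y (along Z X y) := fun Z => by
    rw [along_congr hX', along_clm_apply hJ hX]
  have e2 : ∀ Z, along Z Y' y = along Z J y (Y y) + J y (along Z Y y) := fun Z => by
    rw [along_congr hY', along_clm_apply hJ hY]
  simp only [e1, e2, map_sub, map_add, hsq]
  simp only [along, hX'.self_of_nhds, hY'.self_of_nhds]
  linear_combination (norm := module) hn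

/-- A symplectic form `σ` with a tamed complex structure `j` whose symplectic adjoint is
integrable. -/
structure IsLocalGK (U : Set E4) (σ : E4 → E4 →L[ℝ] E4 →L[ℝ] ℝ) (j : E4 → E4 →L[ℝ] E4) : Prop where
  isOpen : IsOpen U
  smooth_form : ∀ y ∈ U, ContDiffAt ℝ ∞ σ y
  smooth_str : ∀ y ∈ U, ContDiffAt ℝ ∞ j y
  alternating : ∀ y ∈ U, ∀ v, σ y v v = 0
  closed : ∀ y ∈ U, ∀ u v w, extDerivTwo σ y u v w = 0
  sq : ∀ y ∈ U, ∀ v, j y (j y v) = -v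
  tamed : ∀ y ∈ U, ∀ v, v ≠ 0 → 0 < σ y v (j y v)
  nijenhuis : ∀ y ∈ U, NijenhuisZeroAt j y
  nijenhuis_adj : ∀ y ∈ U, NijenhuisZeroAt (locAdj σ j) y

namespace IsLocalGK

variable {U : Set E4} {σ : E4 → E4 →L[ℝ] E4 →L[ℝ] ℝ} {j : E4 → E4 →L[ℝ] E4}

theorem skew (h : IsLocalGK U σ j) {y : E4} (hy : y ∈ U) (u v : E4) : σ y u v = -σ y v u := by
  have := h.alternating y hy (u + v)
  simp only [map_add, _root_.add_apply, h.alternating y hy, zero_add, add_zero] at this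
  linarith

theorem nondegenerate (h : IsLocalGK U σ j) {y : E4} (hy : y ∈ U) (v : E4)
    (hv : ∀ w, σ y v w = 0) : v = 0 := by
  by_contra h0
  exact (h.tamed y hy v h0).ne' (hv _)

theorem isInvertible (h : IsLocalGK U σ j) {y : E4} (hy : y ∈ U) : (σ y).IsInvertible :=
  isInvertible_of_nondegenerate (h.nondegenerate hy)

theorem apply_locAdj (h : IsLocalGK U σ j) {y : E4} (hy : y ∈ U) (v w : E4) :
    σ y (locAdj σ j y v) w = σ y v (j y w) := by
  change σ y ((σ y).inverse ((σ y v) ∘L (j y))) w = _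
  rw [(h.isInvertible hy).self_apply_inverse]; rfl

theorem locAdj_eq_iff (h : IsLocalGK U σ j) {y : E4} (hy : y ∈ U) (v u : E4) :
    locAdj σ j y v = u ↔ ∀ w, σ y u w = σ y v (j y w) := by
  constructor
  · rintro rfl w; exact h.apply_locAdj hy v w
  · intro hu
    apply (h.isInvertible hy).injective
    ext1 w
    rw [h.apply_locAdj hy, hu]

theorem locAdj_sq (h : IsLocalGK U σ j) {y : E4} (hy : y ∈ U) (v : E4) :
    locAdj σ j y (locAdj σ j y v) = -v := by
  rw [h.locAdj_eq_iff hy]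
  intro w
  rw [h.apply_locAdj hy, h.sq y hy, map_neg, map_neg, _root_.neg_apply]

theorem contDiffAt_locAdj (h : IsLocalGK U σ j) {y : E4} (hy : y ∈ U) :
    ContDiffAt ℝ ∞ (locAdj σ j) y := by
  refine contDiffAt_clm_of_apply h.isOpen (fun v y hy => ?_) y hy
  refine (contDiffAt_inverse (h.smooth_form y hy) (h.isInvertible hy)).clm_apply ?_
  exact ((h.smooth_form y hy).clm_apply contDiffAt_const).clm_comp (h.smooth_str y hy)

theorem contDiffAt_locMetric (h : IsLocalGK U σ j) {y : E4} (hy : y ∈ U) :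
    ContDiffAt ℝ ∞ (locMetric σ j) y := by
  refine contDiffAt_clm_of_apply h.isOpen (fun u => contDiffAt_clm_of_apply h.isOpen
    fun v y hy => ?_) y hy
  have k : ∀ u v : E4, ContDiffAt ℝ ∞ (fun z => σ z u (j z v)) y := fun u v =>
    contDiffAt_comp₂ (h.smooth_form y hy) contDiffAt_const
      ((h.smooth_str y hy).clm_apply contDiffAt_const)
  exact contDiffAt_const.mul ((k u v).add (k v u))

theorem isHermitianOn (h : IsLocalGK U σ j) : IsHermitianOn U (locMetric σ j) j where
  isOpen := h.isOpen
  smooth y hy := h.contDiffAt_locMetric hy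
  symm y hy u v := by rw [locMetric_apply, locMetric_apply, add_comm]
  posDef y hy v hv := by
    rw [locMetric_apply]
    have := h.tamed y hy v hv
    linarith
  smoothJ := h.smooth_str
  sq := h.sq
  orth y hy u v := by
    rw [locMetric_apply, locMetric_apply, h.sq y hy, h.sq y hy, map_neg, map_neg,
      h.skew hy (j y u), h.skew hy (j y v)]
    ring
  nijenhuis := h.nijenhuis

/-- The adjoint is `G`-skew. -/
theorem locMetric_locAdj (h : IsLocalGK U σ j) {y : E4} (hy : y ∈ U) (u v : E4) :
    locMetric σ j y (locAdj σ j y u) v = -locMetric σ j y u (locAdj σ j y v) := by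
  have e : ∀ u v, σ y v (j y (locAdj σ j y u)) = σ y (locAdj σ j y v) (locAdj σ j y u) :=
    fun u v => by rw [h.apply_locAdj hy]
  rw [locMetric_apply, locMetric_apply, e, e, h.apply_locAdj hy u, h.sq y hy, map_neg,
    h.apply_locAdj hy v (j y u), h.sq y hy, map_neg, h.skew hy v u,
    h.skew hy (locAdj σ j y v)]
  ring

theorem contDiffAt_locAngle (h : IsLocalGK U σ j) {y : E4} (hy : y ∈ U) :
    ContDiffAt ℝ ∞ (locAngle σ j) y := by
  have e : locAngle σ j = fun z => -(1 / 4) * ∑ i : Fin 4, (EuclideanSpace.proj i : E4 →L[ℝ] ℝ)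
      (j z (locAdj σ j z (EuclideanSpace.single i 1))) := by
    ext z
    rw [locAngle, trace_eq_sum]; rfl
  rw [e]
  refine contDiffAt_const.mul (ContDiffAt.sum fun i _ => ?_)
  exact (EuclideanSpace.proj i : E4 →L[ℝ] ℝ).contDiff.contDiffAt.comp y
    ((h.smooth_str y hy).clm_apply ((h.contDiffAt_locAdj hy).clm_apply contDiffAt_const))

end IsLocalGK

/-! ### Toric structures on open sets of `ℝ⁴` -/

/-- A local anti-diagonal toric generalized Kähler structure: `K_i` are independent commuting
symmetries, with momenta `m_i`, and `jK` is contained in `j^*K`. -/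
structure IsLocalToric (U : Set E4) (σ : E4 → E4 →L[ℝ] E4 →L[ℝ] ℝ) (j : E4 → E4 →L[ℝ] E4)
    (K : Fin 2 → E4 → E4) (m : Fin 2 → E4 → ℝ) : Prop extends IsLocalGK U σ j where
  smoothK : ∀ i, ∀ y ∈ U, ContDiffAt ℝ ∞ (K i) y
  smoothM : ∀ i, ∀ y ∈ U, ContDiffAt ℝ ∞ (m i) y
  hamiltonian : ∀ i, ∀ y ∈ U, ∀ v, fderiv ℝ (m i) y v = -σ y (K i y) v
  invariant : ∀ i l, ∀ y ∈ U, fderiv ℝ (m i) y (K l y) = 0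
  commKK : ∀ i l, ∀ y ∈ U, along (K i) (K l) y = along (K l) (K i) y
  invJ : ∀ i, ∀ y ∈ U, ∀ v,
    fderiv ℝ (K i) y (j y v) = fderiv ℝ j y (K i y) v + j y (fderiv ℝ (K i) y v)
  indep : ∀ y ∈ U, ∀ a b : ℝ, a • K 0 y + b • K 1 y = 0 → a = 0 ∧ b = 0
  anti : ∀ i, ∀ y ∈ U, ∃ a b : ℝ, j y (K i y) = locAdj σ j y (a • K 0 y + b • K 1 y)

/-- The fields `e_i = jK_i`. -/
def eField (j : E4 → E4 →L[ℝ] E4) (K : Fin 2 → E4 → E4) (i : Fin 2) (y : E4) : E4 := j y (K i y)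

/-- The matrix `Φ_il = σ(K_i, jK_l)`. -/
def phi (σ : E4 → E4 →L[ℝ] E4 →L[ℝ] ℝ) (j : E4 → E4 →L[ℝ] E4) (K : Fin 2 → E4 → E4)
    (i l : Fin 2) (y : E4) : ℝ := σ y (K i y) (eField j K l y)

/-- The determinant of `Φ`. -/
def phiDet (σ : E4 → E4 →L[ℝ] E4 →L[ℝ] ℝ) (j : E4 → E4 →L[ℝ] E4) (K : Fin 2 → E4 → E4)
    (y : E4) : ℝ := phi σ j K 0 0 y * phi σ j K 1 1 y - phi σ j K 0 1 y * phi σ j K 1 0 y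

/-- The entries of the inverse `Ψ` of `Φ`. -/
def psi (σ : E4 → E4 →L[ℝ] E4 →L[ℝ] ℝ) (j : E4 → E4 →L[ℝ] E4) (K : Fin 2 → E4 → E4)
    (i l : Fin 2) (y : E4) : ℝ :=
  (!![phi σ j K 1 1 y, -phi σ j K 0 1 y; -phi σ j K 1 0 y, phi σ j K 0 0 y] i l) / phiDet σ j K y

/-- The fields dual to the momenta and tangent to `jK`. -/
def nField (σ : E4 → E4 →L[ℝ] E4 →L[ℝ] ℝ) (j : E4 → E4 →L[ℝ] E4) (K : Fin 2 → E4 → E4)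
    (l : Fin 2) (y : E4) : E4 :=
  (-psi σ j K 0 l y) • eField j K 0 y + (-psi σ j K 1 l y) • eField j K 1 y

namespace IsLocalToric

variable {U : Set E4} {σ : E4 → E4 →L[ℝ] E4 →L[ℝ] ℝ} {j : E4 → E4 →L[ℝ] E4}
  {K : Fin 2 → E4 → E4} {m : Fin 2 → E4 → ℝ}

theorem form_K_K (h : IsLocalToric U σ j K m) (i l : Fin 2) {y : E4} (hy : y ∈ U) :
    σ y (K i y) (K l y) = 0 := by
  have := h.hamiltonian i y hy (K l y)
  rw [h.invariant i l y hy] at this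
  linarith

/-- The geometric input of the anti-diagonal condition: writing `jK_i` as the adjoint of an orbit
vector moves both copies of `j` onto `K_l`, and the orbits are isotropic. So `j𝒦` is isotropic too.
-/
theorem form_e_e (h : IsLocalToric U σ j K m) (i l : Fin 2) {y : E4} (hy : y ∈ U) :
    σ y (eField j K i y) (eField j K l y) = 0 := by
  obtain ⟨a, b, hab⟩ := h.anti i y hy
  change σ y (j y (K i y)) (j y (K l y)) = 0
  rw [hab, h.apply_locAdj hy, h.sq y hy]
  simp [h.form_K_K _ l hy]

theorem phiDet_ne_zero (h : IsLocalToric U σ j K m) {y : E4} (hy : y ∈ U) :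
    phiDet σ j K y ≠ 0 := by
  intro h0
  have q : ∀ a b : ℝ, a • K 0 y + b • K 1 y ≠ 0 →
      0 < a * a * phi σ j K 0 0 y + a * b * (phi σ j K 0 1 y + phi σ j K 1 0 y)
        + b * b * phi σ j K 1 1 y := by
    intro a b hab
    have := h.tamed y hy _ hab
    simp only [map_add, map_smul, _root_.add_apply, _root_.smul_apply, smul_eq_mul] at this
    simp only [phi, eField]
    linarith
  have h00 : phi σ j K 0 0 y ≠ 0 := by
    have := q 1 0 fun hh => one_ne_zero (h.indep y hy 1 0 hh).1
    intro hz
    rw [hz] at this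
    simp at this
  -- On this vector the quadratic form of `Φ` equals `Φ₀₀ det Φ`. `Φ` need not be symmetric, so
  -- positivity of the quadratic form is used rather than a criterion for symmetric matrices.
  have := q (-phi σ j K 0 1 y) (phi σ j K 0 0 y) fun hh => h00 (h.indep y hy _ _ hh).2
  rw [phiDet] at h0
  have e : phi σ j K 0 0 y * (phi σ j K 0 0 y * phi σ j K 1 1 y
    - phi σ j K 0 1 y * phi σ j K 1 0 y) = 0 := by rw [h0, mul_zero]
  nlinarith

theorem smoothE (h : IsLocalToric U σ j K m) (i : Fin 2) {y : E4} (hy : y ∈ U) :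
    ContDiffAt ℝ ∞ (eField j K i) y := (h.smooth_str y hy).clm_apply (h.smoothK i y hy)

theorem smooth_phi (h : IsLocalToric U σ j K m) (i l : Fin 2) {y : E4} (hy : y ∈ U) :
    ContDiffAt ℝ ∞ (phi σ j K i l) y :=
  contDiffAt_comp₂ (h.smooth_form y hy) (h.smoothK i y hy) (h.smoothE l hy)

theorem smooth_phiDet (h : IsLocalToric U σ j K m) {y : E4} (hy : y ∈ U) :
    ContDiffAt ℝ ∞ (phiDet σ j K) y :=
  ((h.smooth_phi 0 0 hy).mul (h.smooth_phi 1 1 hy)).sub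
    ((h.smooth_phi 0 1 hy).mul (h.smooth_phi 1 0 hy))

theorem smooth_psi (h : IsLocalToric U σ j K m) (i l : Fin 2) {y : E4} (hy : y ∈ U) :
    ContDiffAt ℝ ∞ (psi σ j K i l) y := by
  refine ContDiffAt.div ?_ (h.smooth_phiDet hy) (h.phiDet_ne_zero hy)
  fin_cases i <;> fin_cases l
  · exact h.smooth_phi 1 1 hy
  · exact (h.smooth_phi 0 1 hy).neg
  · exact (h.smooth_phi 1 0 hy).neg
  · exact h.smooth_phi 0 0 hy

theorem smoothN (h : IsLocalToric U σ j K m) (l : Fin 2) {y : E4} (hy : y ∈ U) :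
    ContDiffAt ℝ ∞ (nField σ j K l) y :=
  ((h.smooth_psi 0 l hy).neg.smul (h.smoothE 0 hy)).add
    ((h.smooth_psi 1 l hy).neg.smul (h.smoothE 1 hy))

theorem phi_mul_psi (h : IsLocalToric U σ j K m) (i l : Fin 2) {y : E4} (hy : y ∈ U) :
    phi σ j K i 0 y * psi σ j K 0 l y + phi σ j K i 1 y * psi σ j K 1 l y =
      if i = l then 1 else 0 := by
  have h0 := h.phiDet_ne_zero hy
  fin_cases i <;> fin_cases l <;> simp [psi] <;> field_simp <;> (try simp only [phiDet]) <;> ring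

theorem psi_mul_phi (h : IsLocalToric U σ j K m) (i l : Fin 2) {y : E4} (hy : y ∈ U) :
    psi σ j K i 0 y * phi σ j K 0 l y + psi σ j K i 1 y * phi σ j K 1 l y =
      if i = l then 1 else 0 := by
  have h0 := h.phiDet_ne_zero hy
  fin_cases i <;> fin_cases l <;> simp [psi] <;> field_simp <;> (try simp only [phiDet]) <;> ring

theorem form_K_N (h : IsLocalToric U σ j K m) (i l : Fin 2) {y : E4} (hy : y ∈ U) :
    σ y (K i y) (nField σ j K l y) = if i = l then -1 else 0 := by
  have := h.phi_mul_psi i l hy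
  simp only [nField, map_add, map_smul, smul_eq_mul]
  change -psi σ j K 0 l y * phi σ j K i 0 y + -psi σ j K 1 l y * phi σ j K i 1 y = _
  rw [show (if i = l then (-1 : ℝ) else 0) = -(if i = l then 1 else 0) by split_ifs <;> simp,
    ← this]
  ring

theorem fderiv_moment_N (h : IsLocalToric U σ j K m) (i l : Fin 2) {y : E4} (hy : y ∈ U) :
    fderiv ℝ (m i) y (nField σ j K l y) = if i = l then 1 else 0 := by
  rw [h.hamiltonian i y hy, h.form_K_N i l hy]
  split_ifs <;> simp

theorem form_N_N (h : IsLocalToric U σ j K m) (i l : Fin 2) {y : E4} (hy : y ∈ U) :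
    σ y (nField σ j K i y) (nField σ j K l y) = 0 := by
  simp [nField, h.form_e_e _ _ hy]

theorem j_e (h : IsLocalToric U σ j K m) (i : Fin 2) {y : E4} (hy : y ∈ U) :
    j y (eField j K i y) = -K i y := h.sq y hy _

theorem j_N (h : IsLocalToric U σ j K m) (l : Fin 2) {y : E4} (hy : y ∈ U) :
    j y (nField σ j K l y) = psi σ j K 0 l y • K 0 y + psi σ j K 1 l y • K 1 y := by
  simp only [nField, map_add, map_smul, h.j_e _ hy]
  module

theorem e_eq (h : IsLocalToric U σ j K m) (l : Fin 2) {y : E4} (hy : y ∈ U) :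
    eField j K l y = (-phi σ j K 0 l y) • nField σ j K 0 y
      + (-phi σ j K 1 l y) • nField σ j K 1 y := by
  have h0 := h.psi_mul_phi 0 l hy
  have h1 := h.psi_mul_phi 1 l hy
  have e : (-phi σ j K 0 l y) • nField σ j K 0 y + (-phi σ j K 1 l y) • nField σ j K 1 y =
      (psi σ j K 0 0 y * phi σ j K 0 l y + psi σ j K 0 1 y * phi σ j K 1 l y) • eField j K 0 y
      + (psi σ j K 1 0 y * phi σ j K 0 l y + psi σ j K 1 1 y * phi σ j K 1 l y) • eField j K 1 y := by
    simp only [nField]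
    module
  rw [e, h0, h1]
  fin_cases l <;> simp

/-- Every vector is a combination of the `K_i` and the `N_i`. -/
theorem exists_combination (h : IsLocalToric U σ j K m) {y : E4} (hy : y ∈ U) (v : E4) :
    ∃ a b c d : ℝ, v = a • K 0 y + b • K 1 y + (c • nField σ j K 0 y + d • nField σ j K 1 y) := by
  let X : Fin 4 → E4 := ![K 0 y, K 1 y, nField σ j K 0 y, nField σ j K 1 y]
  have hX : LinearIndependent ℝ X := by
    rw [Fintype.linearIndependent_iff]
    intro g hg
    simp only [Fin.sum_univ_four, X, Matrix.cons_val] at hg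
    have k := fun i => congrArg (σ y (K i y)) hg
    simp only [map_add, map_smul, h.form_K_K _ _ hy, h.form_K_N _ _ hy, map_zero, smul_eq_mul] at k
    have k0 : g 2 = 0 := by simpa using k 0
    have k1 : g 3 = 0 := by simpa using k 1
    rw [k0, k1, zero_smul, zero_smul, add_zero, add_zero] at hg
    obtain ⟨h0, h1⟩ := h.indep y hy _ _ hg
    intro i
    fin_cases i <;> assumption
  let b := basisOfLinearIndependentOfCardEqFinrank hX (by simp)
  refine ⟨b.repr v 0, b.repr v 1, b.repr v 2, b.repr v 3, ?_⟩
  conv_lhs => rw [← b.sum_repr v]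
  simp [b, Fin.sum_univ_four, X, add_assoc]

theorem form_N_K (h : IsLocalToric U σ j K m) (l i : Fin 2) {y : E4} (hy : y ∈ U) :
    σ y (nField σ j K l y) (K i y) = if i = l then 1 else 0 := by
  rw [h.skew hy, h.form_K_N i l hy]
  split_ifs <;> simp

/-- Compared with `j_N`, the matrix is transposed and negated: `j` sees the columns of `Ψ`, its
adjoint the rows. Integrability of the adjoint will thus control the other index of `Ψ`. -/
theorem adj_N (h : IsLocalToric U σ j K m) (l : Fin 2) {y : E4} (hy : y ∈ U) :
    locAdj σ j y (nField σ j K l y) =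
      (-psi σ j K l 0 y) • K 0 y + (-psi σ j K l 1 y) • K 1 y := by
  rw [h.locAdj_eq_iff hy]
  intro w
  obtain ⟨a, b, c, d, rfl⟩ := h.exists_combination hy w
  have jK : ∀ i, j y (K i y) = (-phi σ j K 0 i y) • nField σ j K 0 y
      + (-phi σ j K 1 i y) • nField σ j K 1 y := fun i => h.e_eq i hy
  simp only [map_add, map_smul, _root_.add_apply, _root_.smul_apply, smul_eq_mul,
    h.form_K_K _ _ hy, h.form_K_N _ _ hy, h.j_N _ hy, h.form_N_K _ _ hy, jK, h.form_N_N _ _ hy]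
  fin_cases l <;> simp

theorem adj_K (h : IsLocalToric U σ j K m) (i : Fin 2) {y : E4} (hy : y ∈ U) :
    locAdj σ j y (K i y) = phi σ j K i 0 y • nField σ j K 0 y
      + phi σ j K i 1 y • nField σ j K 1 y := by
  rw [h.locAdj_eq_iff hy]
  intro w
  obtain ⟨a, b, c, d, rfl⟩ := h.exists_combination hy w
  have jK : ∀ i, j y (K i y) = (-phi σ j K 0 i y) • nField σ j K 0 y
      + (-phi σ j K 1 i y) • nField σ j K 1 y := fun i => h.e_eq i hy
  simp only [map_add, map_smul, _root_.add_apply, _root_.smul_apply, smul_eq_mul,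
    h.form_K_K _ _ hy, h.form_K_N _ _ hy, h.j_N _ hy, h.form_N_K _ _ hy, jK, h.form_N_N _ _ hy]
  fin_cases i <;> simp

/-! #### Commutation relations -/

theorem commKE (h : IsLocalToric U σ j K m) (i l : Fin 2) {y : E4} (hy : y ∈ U) :
    along (K i) (eField j K l) y = along (eField j K l) (K i) y := by
  have h1 : along (K i) (eField j K l) y = _ :=
    along_clm_apply (h.smooth_str y hy) (h.smoothK l y hy)
  rw [h1, h.commKK i l y hy]
  exact (h.invJ i y hy (K l y)).symm

/-- All brackets except `[jK_i, jK_l]` drop out of the Nijenhuis tensor, because the `K`'s commute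
with one another and with the invariant fields `jK_l`. -/
theorem commEE (h : IsLocalToric U σ j K m) (i l : Fin 2) {y : E4} (hy : y ∈ U) :
    along (eField j K i) (eField j K l) y = along (eField j K l) (eField j K i) y := by
  have := (h.nijenhuis y hy).bracket (h.smooth_str y hy) (h.sq y hy) (h.smoothK i y hy)
    (h.smoothK l y hy) (X' := eField j K i) (Y' := eField j K l) (.of_forall fun _ => rfl)
    (.of_forall fun _ => rfl)
  rw [h.commKE i l hy, h.commKE l i hy, h.commKK i l y hy] at this
  simp only [sub_self, map_zero, sub_zero] at this
  exact sub_eq_zero.mp this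

/-- The form is invariant along `K`. -/
theorem along_form (h : IsLocalToric U σ j K m) (i : Fin 2) {V W : E4 → E4} {y : E4} (hy : y ∈ U)
    (hV : ContDiffAt ℝ ∞ V y) (hW : ContDiffAt ℝ ∞ W y)
    (cV : along (K i) V y = along V (K i) y) (cW : along (K i) W y = along W (K i) y) :
    along (K i) (fun z => σ z (V z) (W z)) y = 0 := by
  rw [along_bilin (h.smooth_form y hy) hV hW, cV, cW]
  -- The contraction of `σ` with `K_i` is minus the differential of the momentum, so its derivative
  -- is minus a Hessian. Symmetry of the Hessian and closedness of `σ` give Cartan's `L_K σ = 0`.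
  have e : ∀ u v, fderiv ℝ σ y u (K i y) v + σ y (fderiv ℝ (K i) y u) v =
      -fderiv ℝ (fderiv ℝ (m i)) y u v := by
    intro u v
    have e1 : along (fun _ => u) (fun z => σ z (K i z) v) y =
        along (fun _ => u) (fun z => -fderiv ℝ (m i) z v) y :=
      along_congr_on h.isOpen (fun z hz => by rw [h.hamiltonian i z hz, neg_neg]) hy
    rw [along_bilin (h.smooth_form y hy) (h.smoothK i y hy) contDiffAt_const, along_neg,
      along_clm_apply (contDiffAt_fderiv (h.smoothM i y hy)) contDiffAt_const] at e1
    simpa [along] using e1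
  have hs : IsSymmSndFDerivAt ℝ (m i) y := (h.smoothM i y hy).isSymmSndFDerivAt (by
    simp only [minSmoothness_of_isRCLikeNormedField]; exact ENat.LEInfty.out)
  have h1 := e (V y) (W y)
  have h2 := e (W y) (V y)
  have h3 := hs.eq (V y) (W y)
  have h4 := h.closed y hy (K i y) (V y) (W y)
  simp only [extDerivTwo] at h4
  rw [h.skew hy (V y) (along W (K i) y)]
  simp only [along]
  linarith

theorem along_K_phi (h : IsLocalToric U σ j K m) (k i l : Fin 2) {y : E4} (hy : y ∈ U) :
    along (K k) (phi σ j K i l) y = 0 :=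
  h.along_form k hy (h.smoothK i y hy) (h.smoothE l hy) (h.commKK k i y hy) (h.commKE k l hy)

theorem along_K_psi (h : IsLocalToric U σ j K m) (k i l : Fin 2) {y : E4} (hy : y ∈ U) :
    along (K k) (psi σ j K i l) y = 0 := by
  have hd : along (K k) (phiDet σ j K) y = 0 := by
    have e : along (K k) (phiDet σ j K) y = _ :=
      along_sub (f := fun z => phi σ j K 0 0 z * phi σ j K 1 1 z)
        (g := fun z => phi σ j K 0 1 z * phi σ j K 1 0 z)
        ((h.smooth_phi 0 0 hy).mul (h.smooth_phi 1 1 hy))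
        ((h.smooth_phi 0 1 hy).mul (h.smooth_phi 1 0 hy))
    rw [e, along_mul (h.smooth_phi 0 0 hy) (h.smooth_phi 1 1 hy),
      along_mul (h.smooth_phi 0 1 hy) (h.smooth_phi 1 0 hy)]
    simp [h.along_K_phi _ _ _ hy]
  have hn : along (K k) (fun z => psi σ j K i l z * phiDet σ j K z) y = 0 := by
    have e : ∀ z ∈ U, psi σ j K i l z * phiDet σ j K z =
        !![phi σ j K 1 1 z, -phi σ j K 0 1 z; -phi σ j K 1 0 z, phi σ j K 0 0 z] i l :=
      fun z hz => div_mul_cancel₀ _ (h.phiDet_ne_zero hz)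
    rw [along_congr_on h.isOpen e hy]
    fin_cases i <;> fin_cases l <;> simp [along_neg, h.along_K_phi _ _ _ hy]
  rw [along_mul (h.smooth_psi i l hy) (h.smooth_phiDet hy), hd, mul_zero, add_zero] at hn
  exact (mul_eq_zero.mp hn).resolve_right (h.phiDet_ne_zero hy)

theorem along_N (h : IsLocalToric U σ j K m) (X : E4 → E4) (l : Fin 2) {y : E4} (hy : y ∈ U) :
    along X (nField σ j K l) y =
      (-along X (psi σ j K 0 l) y) • eField j K 0 y + (-along X (psi σ j K 1 l) y) • eField j K 1 y
      + ((-psi σ j K 0 l y) • along X (eField j K 0) y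
        + (-psi σ j K 1 l y) • along X (eField j K 1) y) := by
  have e : along X (nField σ j K l) y = _ :=
    along_add (f := fun z => (-psi σ j K 0 l z) • eField j K 0 z)
      (g := fun z => (-psi σ j K 1 l z) • eField j K 1 z)
      ((h.smooth_psi 0 l hy).neg.smul (h.smoothE 0 hy))
      ((h.smooth_psi 1 l hy).neg.smul (h.smoothE 1 hy))
  rw [e, along_smul (f := fun z => -psi σ j K 0 l z) (h.smooth_psi 0 l hy).neg (h.smoothE 0 hy),
    along_smul (f := fun z => -psi σ j K 1 l z) (h.smooth_psi 1 l hy).neg (h.smoothE 1 hy),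
    along_neg, along_neg]
  abel

theorem along_N_field (X : E4 → E4) (l : Fin 2) (y : E4) :
    along (nField σ j K l) X y = (-psi σ j K 0 l y) • along (eField j K 0) X y
      + (-psi σ j K 1 l y) • along (eField j K 1) X y := by
  simp only [along, nField, map_add, map_smul]

theorem commKN (h : IsLocalToric U σ j K m) (i l : Fin 2) {y : E4} (hy : y ∈ U) :
    along (K i) (nField σ j K l) y = along (nField σ j K l) (K i) y := by
  rw [h.along_N _ _ hy, along_N_field, h.along_K_psi _ _ _ hy, h.along_K_psi _ _ _ hy,
    h.commKE _ _ hy, h.commKE _ _ hy]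
  simp

/-- The bracket is killed by every `dm_k`, since `dm_k(N_l)` is constant. It also lies in the span
of the `jK_i`, because these commute. The `N_l` span the same plane and are dual to the `dm_k`, so
the bracket vanishes. -/
theorem commNN (h : IsLocalToric U σ j K m) (i l : Fin 2) {y : E4} (hy : y ∈ U) :
    along (nField σ j K i) (nField σ j K l) y = along (nField σ j K l) (nField σ j K i) y := by
  have hd : ∀ k, fderiv ℝ (m k) y (along (nField σ j K i) (nField σ j K l) y
      - along (nField σ j K l) (nField σ j K i) y) = 0 := by
    intro k
    rw [← along_along_sub (h.smoothN i hy) (h.smoothN l hy) (h.smoothM k y hy),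
      along_congr_on (f := along (nField σ j K l) (m k)) h.isOpen
        (fun z hz => h.fderiv_moment_N k l hz) hy,
      along_congr_on (f := along (nField σ j K i) (m k)) h.isOpen
        (fun z hz => h.fderiv_moment_N k i hz) hy, along_const, along_const,
      sub_zero]
  obtain ⟨a, b, hab⟩ : ∃ a b : ℝ, along (nField σ j K i) (nField σ j K l) y
      - along (nField σ j K l) (nField σ j K i) y =
        a • eField j K 0 y + b • eField j K 1 y := by
    refine ⟨-along (nField σ j K i) (psi σ j K 0 l) y + along (nField σ j K l) (psi σ j K 0 i) y,
      -along (nField σ j K i) (psi σ j K 1 l) y + along (nField σ j K l) (psi σ j K 1 i) y, ?_⟩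
    rw [h.along_N _ _ hy, h.along_N _ _ hy]
    simp only [along_N_field (eField j K _)]
    rw [h.commEE 1 0 hy]
    module
  obtain ⟨c, d, hcd⟩ : ∃ c d : ℝ, along (nField σ j K i) (nField σ j K l) y
      - along (nField σ j K l) (nField σ j K i) y =
        c • nField σ j K 0 y + d • nField σ j K 1 y := by
    refine ⟨a * -phi σ j K 0 0 y + b * -phi σ j K 0 1 y,
      a * -phi σ j K 1 0 y + b * -phi σ j K 1 1 y, hab.trans ?_⟩
    rw [h.e_eq 0 hy, h.e_eq 1 hy]
    module
  have h0 := hd 0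
  have h1 := hd 1
  rw [hcd] at h0 h1
  simp [h.fderiv_moment_N _ _ hy] at h0 h1
  rw [h0, h1] at hcd
  simp only [zero_smul, add_zero] at hcd
  exact sub_eq_zero.mp hcd

/-- Symmetry of the derivatives of the matrix of an integrable complex structure mapping the
`N_l` to combinations of the `K_i`. -/
theorem codazzi (h : IsLocalToric U σ j K m) {A : E4 → E4 →L[ℝ] E4} {y : E4} (hy : y ∈ U)
    (hn : NijenhuisZeroAt A y) (hA : ContDiffAt ℝ ∞ A y) (hsq : ∀ v, A y (A y v) = -v)
    {C : Fin 2 → Fin 2 → E4 → ℝ} (hC : ∀ i l, ContDiffAt ℝ ∞ (C i l) y)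
    (hKC : ∀ k i l, along (K k) (C i l) y = 0)
    (hN : ∀ l, ∀ z ∈ U, A z (nField σ j K l z) = C 0 l z • K 0 z + C 1 l z • K 1 z) (i : Fin 2) :
    along (nField σ j K 0) (C i 1) y = along (nField σ j K 1) (C i 0) y := by
  let P : Fin 2 → E4 → E4 := fun l z => C 0 l z • K 0 z + C 1 l z • K 1 z
  have hP : ∀ X l, along X (P l) y = along X (C 0 l) y • K 0 y + C 0 l y • along X (K 0) y
      + (along X (C 1 l) y • K 1 y + C 1 l y • along X (K 1) y) := by
    intro X l
    have e : along X (P l) y = _ :=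
      along_add (f := fun z => C 0 l z • K 0 z) (g := fun z => C 1 l z • K 1 z)
        ((hC 0 l).smul (h.smoothK 0 y hy)) ((hC 1 l).smul (h.smoothK 1 y hy))
    rw [e, along_smul (hC 0 l) (h.smoothK 0 y hy), along_smul (hC 1 l) (h.smoothK 1 y hy)]
  have hPf : ∀ {F : Type} [NormedAddCommGroup F] [NormedSpace ℝ F] (f : E4 → F) l,
      along (P l) f y = C 0 l y • along (K 0) f y + C 1 l y • along (K 1) f y := by
    intro F _ _ f l
    simp only [along, P, map_add, map_smul]
  have hb := hn.bracket hA hsq (h.smoothN 0 hy) (h.smoothN 1 hy) (X' := P 0) (Y' := P 1)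
    (Filter.eventuallyEq_of_mem (h.isOpen.mem_nhds hy) fun z hz => (hN 0 z hz).symm)
    (Filter.eventuallyEq_of_mem (h.isOpen.mem_nhds hy) fun z hz => (hN 1 z hz).symm)
  have e1 : along (P 0) (P 1) y - along (P 1) (P 0) y = 0 := by
    simp only [hP, hPf, hKC]
    rw [h.commKK 1 0 y hy]
    module
  have e2 : along (P 0) (nField σ j K 1) y - along (nField σ j K 1) (P 0) y =
      -(along (nField σ j K 1) (C 0 0) y • K 0 y + along (nField σ j K 1) (C 1 0) y • K 1 y) := by
    rw [hP, hPf, h.commKN _ _ hy, h.commKN _ _ hy]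
    module
  have e3 : along (nField σ j K 0) (P 1) y - along (P 1) (nField σ j K 0) y =
      along (nField σ j K 0) (C 0 1) y • K 0 y + along (nField σ j K 0) (C 1 1) y • K 1 y := by
    rw [hP, hPf, h.commKN _ _ hy, h.commKN _ _ hy]
    module
  rw [e1, e2, e3, h.commNN 0 1 hy, sub_self, zero_sub, sub_zero] at hb
  -- The surviving part of the Nijenhuis tensor is `A` applied to a combination of the `K_i`. As `A²
  -- = -1` and the `K_i` are independent, the coefficients vanish.
  have hb2 : A y ((along (nField σ j K 0) (C 0 1) y - along (nField σ j K 1) (C 0 0) y) • K 0 y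
      + (along (nField σ j K 0) (C 1 1) y - along (nField σ j K 1) (C 1 0) y) • K 1 y) = 0 := by
    rw [← neg_eq_zero, ← hb]
    simp only [map_add, map_neg, map_smul]
    module
  have hb3 := congrArg (A y) hb2
  rw [hsq, map_zero, neg_eq_zero] at hb3
  obtain ⟨k0, k1⟩ := h.indep y hy _ _ hb3
  fin_cases i
  · exact sub_eq_zero.mp k0
  · exact sub_eq_zero.mp k1

theorem codazzi_right (h : IsLocalToric U σ j K m) (i : Fin 2) {y : E4} (hy : y ∈ U) :
    along (nField σ j K 0) (psi σ j K i 1) y = along (nField σ j K 1) (psi σ j K i 0) y :=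
  h.codazzi hy (h.nijenhuis y hy) (h.smooth_str y hy) (h.sq y hy) (C := psi σ j K)
    (fun i l => h.smooth_psi i l hy) (fun k i l => h.along_K_psi k i l hy)
    (fun l _ hz => h.j_N l hz) i

/-- Integrability of the adjoint gives the condition in the row index. With `codazzi_right` the
first derivatives of `Ψ` become totally symmetric, so its skew part has zero derivatives along the
`N_l`. -/
theorem codazzi_left (h : IsLocalToric U σ j K m) (i : Fin 2) {y : E4} (hy : y ∈ U) :
    along (nField σ j K 0) (psi σ j K 1 i) y = along (nField σ j K 1) (psi σ j K 0 i) y := by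
  have := h.codazzi hy (h.nijenhuis_adj y hy) (h.contDiffAt_locAdj hy) (h.locAdj_sq hy)
    (C := fun i l z => -psi σ j K l i z)
    (fun i l => (h.smooth_psi l i hy).neg)
    (fun k i l => by rw [along_neg, h.along_K_psi k l i hy, neg_zero])
    (fun l z hz => h.adj_N l hz) i
  rw [along_neg, along_neg] at this
  exact neg_injective this

end IsLocalToric

/-! ### Second order jets in a frame -/

/-- The first derivatives in a frame of a function invariant along its two last fields. -/
def jetOne (p q : ℝ) : Fin 4 → ℝ := ![p, q, 0, 0]

/-- The second derivatives in a commuting frame of a function invariant along its two last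
fields. -/
def jetTwo (r s t : ℝ) : Fin 4 → Fin 4 → ℝ := ![![r, s, 0, 0], ![s, t, 0, 0], 0, 0]

/-- The function `f` has at `y` the value `v`, first derivatives `p`, `q` and second derivatives
`r`, `s`, `t` along the fields `X 0`, `X 1`, and its derivatives along `X 2` and `X 3` vanish. -/
structure IsJet (X : Fin 4 → E4 → E4) (f : E4 → ℝ) (y : E4) (v p q r s t : ℝ) : Prop where
  smooth : ContDiffAt ℝ ∞ f y
  val : f y = v
  first : ∀ i, along (X i) f y = jetOne p q i
  second : ∀ i l, along (X i) (along (X l) f) y = jetTwo r s t i l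

/-- Smoothness of infinite order at a point need not persist on a neighbourhood, but order one does,
and that suffices for the product rule near `y`. -/
theorem eventually_smooth {F : Type*} [NormedAddCommGroup F] [NormedSpace ℝ F] {f : E4 → F} {y : E4}
    (hf : ContDiffAt ℝ ∞ f y) : ∀ᶠ z in 𝓝 y, ContDiffAt ℝ 1 f z :=
  (hf.of_le (m := 1) ENat.LEInfty.out).eventually (by simp)

theorem along_along_mul {X Y : E4 → E4} {f g : E4 → ℝ} {y : E4} (hY : ContDiffAt ℝ ∞ Y y)
    (hf : ContDiffAt ℝ ∞ f y) (hg : ContDiffAt ℝ ∞ g y) :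
    along X (along Y fun z => f z * g z) y = along X (along Y f) y * g y + along Y f y * along X g y
      + (along X f y * along Y g y + f y * along X (along Y g) y) := by
  have e : along Y (fun z => f z * g z) =ᶠ[𝓝 y]
      fun z => along Y f z * g z + f z * along Y g z := by
    filter_upwards [eventually_smooth hf, eventually_smooth hg] with z h1 h2
    simp only [along]
    rw [fderiv_fun_mul (h1.differentiableAt (by simp)) (h2.differentiableAt (by simp))]
    simp [mul_comm]
    ring
  have a := contDiffAt_along hY hf
  have b := contDiffAt_along hY hg
  rw [along_congr e, along_add (a.mul hg) (hf.mul b), along_mul a hg, along_mul hf b]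

theorem along_along_sub_fun {X Y : E4 → E4} {f g : E4 → ℝ} {y : E4} (hY : ContDiffAt ℝ ∞ Y y)
    (hf : ContDiffAt ℝ ∞ f y) (hg : ContDiffAt ℝ ∞ g y) :
    along X (along Y fun z => f z - g z) y = along X (along Y f) y - along X (along Y g) y := by
  have e : along Y (fun z => f z - g z) =ᶠ[𝓝 y] fun z => along Y f z - along Y g z := by
    filter_upwards [eventually_smooth hf, eventually_smooth hg] with z h1 h2
    simp only [along]
    rw [fderiv_fun_sub (h1.differentiableAt (by simp)) (h2.differentiableAt (by simp))]
    simp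
  rw [along_congr e, along_sub (contDiffAt_along hY hf) (contDiffAt_along hY hg)]

namespace IsJet

variable {X : Fin 4 → E4 → E4} {f g : E4 → ℝ} {y : E4} {v p q r s t v' p' q' r' s' t' : ℝ}

theorem of_eq (h : IsJet X f y v p q r s t) (hv : v = v') (hp : p = p') (hq : q = q')
    (hr : r = r') (hs : s = s') (ht : t = t') : IsJet X f y v' p' q' r' s' t' := by
  subst hv hp hq hr hs ht
  exact h

theorem congr {U : Set E4} (hU : IsOpen U) (hy : y ∈ U) (h : IsJet X f y v p q r s t)
    (hfg : ∀ z ∈ U, g z = f z) : IsJet X g y v p q r s t where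
  smooth := h.smooth.congr_of_eventuallyEq (Filter.eventuallyEq_of_mem (hU.mem_nhds hy) hfg)
  val := (hfg y hy).trans h.val
  first i := (along_congr_on hU hfg hy).trans (h.first i)
  second i l := (along_congr_on hU (fun _ hz => along_congr_on hU hfg hz) hy).trans (h.second i l)

theorem const (X : Fin 4 → E4 → E4) (c : ℝ) (y : E4) : IsJet X (fun _ => c) y c 0 0 0 0 0 where
  smooth := contDiffAt_const
  val := rfl
  first i := by rw [along_const]; fin_cases i <;> rfl
  second i l := by
    have : along (X l) (fun _ => c) = fun _ => (0 : ℝ) := funext fun z => along_const _ _ _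
    rw [this, along_const]
    fin_cases i <;> fin_cases l <;> rfl

theorem mul (hX : ∀ i, ContDiffAt ℝ ∞ (X i) y) (hf : IsJet X f y v p q r s t)
    (hg : IsJet X g y v' p' q' r' s' t') :
    IsJet X (fun z => f z * g z) y (v * v') (p * v' + v * p') (q * v' + v * q')
      (r * v' + 2 * (p * p') + v * r') (s * v' + (p * q' + q * p') + v * s')
      (t * v' + 2 * (q * q') + v * t') where
  smooth := hf.smooth.mul hg.smooth
  val := by rw [hf.val, hg.val]
  first i := by
    rw [along_mul hf.smooth hg.smooth, hf.first, hg.first, hf.val, hg.val]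
    fin_cases i <;> simp [jetOne]
  second i l := by
    rw [along_along_mul (hX l) hf.smooth hg.smooth, hf.second, hg.second, hf.first, hf.first,
      hg.first, hg.first, hf.val, hg.val]
    fin_cases i <;> fin_cases l <;> simp [jetOne, jetTwo] <;> ring

theorem sub (hX : ∀ i, ContDiffAt ℝ ∞ (X i) y) (hf : IsJet X f y v p q r s t)
    (hg : IsJet X g y v' p' q' r' s' t') :
    IsJet X (fun z => f z - g z) y (v - v') (p - p') (q - q') (r - r') (s - s') (t - t') where
  smooth := hf.smooth.sub hg.smooth
  val := by rw [hf.val, hg.val]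
  first i := by
    rw [along_sub hf.smooth hg.smooth, hf.first, hg.first]
    fin_cases i <;> simp [jetOne]
  second i l := by
    rw [along_along_sub_fun (hX l) hf.smooth hg.smooth, hf.second, hg.second]
    fin_cases i <;> fin_cases l <;> simp [jetTwo]

theorem const_mul (hX : ∀ i, ContDiffAt ℝ ∞ (X i) y) (c : ℝ) (hf : IsJet X f y v p q r s t) :
    IsJet X (fun z => c * f z) y (c * v) (c * p) (c * q) (c * r) (c * s) (c * t) :=
  ((const X c y).mul hX hf).of_eq rfl (by ring) (by ring) (by ring) (by ring) (by ring)

theorem add (hX : ∀ i, ContDiffAt ℝ ∞ (X i) y) (hf : IsJet X f y v p q r s t)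
    (hg : IsJet X g y v' p' q' r' s' t') :
    IsJet X (fun z => f z + g z) y (v + v') (p + p') (q + q') (r + r') (s + s') (t + t') := by
  have := hf.sub hX (hg.const_mul hX (-1))
  simp only [neg_one_mul, sub_neg_eq_add] at this
  exact this

/-- The jet of a quotient. -/
theorem div (hX : ∀ i, ContDiffAt ℝ ∞ (X i) y) (hf : IsJet X f y v p q r s t)
    (hg : IsJet X g y v' p' q' r' s' t') (h0 : v' ≠ 0) :
    IsJet X (fun z => f z / g z) y (v / v') ((p - v / v' * p') / v') ((q - v / v' * q') / v')
      ((r - 2 * ((p - v / v' * p') / v' * p') - v / v' * r') / v')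
      ((s - ((p - v / v' * p') / v' * q' + (q - v / v' * q') / v' * p') - v / v' * s') / v')
      ((t - 2 * ((q - v / v' * q') / v' * q') - v / v' * t') / v') := by
  have hg0 : g y ≠ 0 := by rw [hg.val]; exact h0
  have hs : ContDiffAt ℝ ∞ (fun z => f z / g z) y := hf.smooth.div hg.smooth hg0
  -- The derivatives of the quotient are solved for from the product rule applied to `f = (f / g)
  -- g`.
  have ev : f =ᶠ[𝓝 y] fun z => f z / g z * g z := by
    filter_upwards [hg.smooth.continuousAt.eventually_ne hg0] with z hz
    field_simp
  have hv : f y / g y = v / v' := by rw [hf.val, hg.val]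
  have h1 : ∀ i, along (X i) (fun z => f z / g z) y
      = (jetOne p q i - v / v' * jetOne p' q' i) / v' := fun i => by
    have := along_congr (X := X i) ev
    rw [along_mul hs hg.smooth, hf.first, hg.first, hg.val, hf.val] at this
    rw [eq_div_iff h0]
    linear_combination -this
  refine ⟨hs, hv, fun i => (h1 i).trans ?_, fun i l => ?_⟩
  · fin_cases i <;> simp [jetOne]
  · have := along_congr (X := X i) ((ev.fderiv (𝕜 := ℝ)).mono fun z hz =>
      show along (X l) f z = along (X l) (fun z => f z / g z * g z) z by simp only [along, hz])
    rw [along_along_mul (hX l) hs hg.smooth, hf.second, hg.second, hg.first, hg.first, hg.val, h1,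
      h1, hf.val] at this
    have e : along (X i) (along (X l) fun z => f z / g z) y = (jetTwo r s t i l
      - ((jetOne p q l - v / v' * jetOne p' q' l) / v' * jetOne p' q' i
        + (jetOne p q i - v / v' * jetOne p' q' i) / v' * jetOne p' q' l
        + v / v' * jetTwo r' s' t' i l)) / v' := by
      rw [eq_div_iff h0]
      linear_combination -this
    rw [e]
    fin_cases i <;> fin_cases l <;> simp [jetOne, jetTwo] <;> ring

end IsJet

/-! ### The metric of a local toric structure -/

/-- The commuting frame `N₀, N₁, K₀, K₁`. -/
def tFrame (σ : E4 → E4 →L[ℝ] E4 →L[ℝ] ℝ) (j : E4 → E4 →L[ℝ] E4) (K : Fin 2 → E4 → E4) :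
    Fin 4 → E4 → E4 := ![nField σ j K 0, nField σ j K 1, K 0, K 1]

/-- The determinant of `Ψ`. -/
def psiDet (σ : E4 → E4 →L[ℝ] E4 →L[ℝ] ℝ) (j : E4 → E4 →L[ℝ] E4) (K : Fin 2 → E4 → E4)
    (y : E4) : ℝ := psi σ j K 0 0 y * psi σ j K 1 1 y - psi σ j K 0 1 y * psi σ j K 1 0 y

namespace IsLocalToric

variable {U : Set E4} {σ : E4 → E4 →L[ℝ] E4 →L[ℝ] ℝ} {j : E4 → E4 →L[ℝ] E4}
  {K : Fin 2 → E4 → E4} {m : Fin 2 → E4 → ℝ} {y : E4}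

theorem isCommutingFrame (h : IsLocalToric U σ j K m) : IsCommutingFrame U (tFrame σ j K) where
  smooth a y hy := by
    fin_cases a
    exacts [h.smoothN 0 hy, h.smoothN 1 hy, h.smoothK 0 y hy, h.smoothK 1 y hy]
  comm a b y hy := by
    fin_cases a <;> fin_cases b
    exacts [rfl, h.commNN 0 1 hy, (h.commKN 0 0 hy).symm, (h.commKN 1 0 hy).symm,
      h.commNN 1 0 hy, rfl, (h.commKN 0 1 hy).symm, (h.commKN 1 1 hy).symm,
      h.commKN 0 0 hy, h.commKN 0 1 hy, rfl, h.commKK 0 1 y hy,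
      h.commKN 1 0 hy, h.commKN 1 1 hy, h.commKK 1 0 y hy, rfl]

theorem psiDet_mul_phiDet (h : IsLocalToric U σ j K m) (hy : y ∈ U) :
    psiDet σ j K y * phiDet σ j K y = 1 := by
  have h0 := h.phiDet_ne_zero hy
  simp only [psiDet, psi, Matrix.of_apply, Matrix.cons_val]
  field_simp
  simp only [phiDet]
  ring

theorem psiDet_ne_zero (h : IsLocalToric U σ j K m) (hy : y ∈ U) : psiDet σ j K y ≠ 0 :=
  left_ne_zero_of_mul_eq_one (h.psiDet_mul_phiDet hy)

theorem phi_eq (h : IsLocalToric U σ j K m) (hy : y ∈ U) (i l : Fin 2) :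
    phi σ j K i l y =
      !![psi σ j K 1 1 y, -psi σ j K 0 1 y; -psi σ j K 1 0 y, psi σ j K 0 0 y] i l
        / psiDet σ j K y := by
  have h0 := h.phiDet_ne_zero hy
  rw [eq_div_iff (h.psiDet_ne_zero hy), eq_div_of_mul_eq h0 (h.psiDet_mul_phiDet hy)]
  fin_cases i <;> fin_cases l <;> simp [psi] <;> field_simp

theorem metric_N_N (h : IsLocalToric U σ j K m) (hy : y ∈ U) (i l : Fin 2) :
    locMetric σ j y (nField σ j K i y) (nField σ j K l y) =
      (1 / 2) * (psi σ j K i l y + psi σ j K l i y) := by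
  rw [locMetric_apply, h.j_N _ hy, h.j_N _ hy]
  simp only [map_add, map_smul, h.form_N_K _ _ hy, smul_eq_mul]
  fin_cases i <;> fin_cases l <;> simp

theorem metric_K_K (i l : Fin 2) :
    locMetric σ j y (K i y) (K l y) = (1 / 2) * (phi σ j K i l y + phi σ j K l i y) :=
  locMetric_apply σ j y _ _

theorem metric_N_K (h : IsLocalToric U σ j K m) (hy : y ∈ U) (i l : Fin 2) :
    locMetric σ j y (nField σ j K i y) (K l y) = 0 := by
  rw [locMetric_apply, h.j_N _ hy]
  have e : σ y (nField σ j K i y) (j y (K l y)) = 0 := by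
    change σ y _ (eField j K l y) = 0
    simp [nField, h.form_e_e _ _ hy]
  simp [e, h.form_K_K _ _ hy]

theorem metric_K_N (h : IsLocalToric U σ j K m) (hy : y ∈ U) (i l : Fin 2) :
    locMetric σ j y (K l y) (nField σ j K i y) = 0 := by
  rw [h.isHermitianOn.symm y hy, h.metric_N_K hy]

theorem fund_N_K (h : IsLocalToric U σ j K m) (hy : y ∈ U) (i l : Fin 2) :
    fundForm (locMetric σ j) j y (nField σ j K i y) (K l y) =
      psi σ j K 0 i y * locMetric σ j y (K 0 y) (K l y)
        + psi σ j K 1 i y * locMetric σ j y (K 1 y) (K l y) := by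
  change locMetric σ j y (j y (nField σ j K i y)) (K l y) = _
  rw [h.j_N _ hy]
  simp

theorem fund_K_N (h : IsLocalToric U σ j K m) (hy : y ∈ U) (i l : Fin 2) :
    fundForm (locMetric σ j) j y (K l y) (nField σ j K i y) =
      -fundForm (locMetric σ j) j y (nField σ j K i y) (K l y) :=
  h.isHermitianOn.fundForm_antisymm hy _ _

theorem fund_N_N (h : IsLocalToric U σ j K m) (hy : y ∈ U) (i l : Fin 2) :
    fundForm (locMetric σ j) j y (nField σ j K i y) (nField σ j K l y) = 0 := by
  change locMetric σ j y (j y (nField σ j K i y)) (nField σ j K l y) = _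
  rw [h.j_N _ hy]
  simp [h.metric_K_N hy]

theorem fund_K_K (h : IsLocalToric U σ j K m) (hy : y ∈ U) (i l : Fin 2) :
    fundForm (locMetric σ j) j y (K i y) (K l y) = 0 := by
  change locMetric σ j y (eField j K i y) (K l y) = _
  rw [h.e_eq _ hy]
  simp [h.metric_N_K hy]

theorem isHoloFrame (h : IsLocalToric U σ j K m) :
    IsHoloFrame U (locMetric σ j) j K (eField j K) where
  smoothK := h.smoothK
  smoothE i _ hy := h.smoothE i hy
  commKK := h.commKK
  commKE i l _ hy := h.commKE i l hy
  commEE i l _ hy := h.commEE i l hy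
  J_K _ _ _ := rfl
  orth i l y hy := by
    rw [h.e_eq _ hy]
    simp [h.metric_K_N hy]
  gram y hy := by
    have hp := h.isHermitianOn.posDef y hy
    have h0 : 0 < locMetric σ j y (K 0 y) (K 0 y) := hp _ fun h0 =>
      one_ne_zero (h.indep y hy 1 0 (by simp [h0])).1
    -- The unnormalized Gram-Schmidt vector: its square norm is `G(K₀, K₀)` times the Gram
    -- determinant.
    have h1 := hp ((-locMetric σ j y (K 0 y) (K 1 y)) • K 0 y
      + locMetric σ j y (K 0 y) (K 0 y) • K 1 y) fun h1 => h0.ne' (h.indep y hy _ _ h1).2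
    simp only [map_add, map_smul, _root_.add_apply, _root_.smul_apply, smul_eq_mul,
      h.isHermitianOn.symm y hy (K 1 y) (K 0 y)] at h1
    refine (pos_of_mul_pos_right (lt_of_lt_of_eq h1 ?_) h0.le).ne'
    ring
  span y hy v hv he := by
    by_contra hne
    have hN : ∀ l, locMetric σ j y v (nField σ j K l y) = 0 := fun l => by
      simp [nField, he]
    obtain ⟨a, b, c, d, e⟩ := h.exists_combination hy v
    have hp := h.isHermitianOn.posDef y hy v hne
    have : locMetric σ j y v v = locMetric σ j y v (a • K 0 y + b • K 1 y
      + (c • nField σ j K 0 y + d • nField σ j K 1 y)) := congrArg _ e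
    simp [hv, hN] at this
    exact hp.ne' this

/-- The first and second derivatives of an invariant function. -/
theorem isJet (h : IsLocalToric U σ j K m) (hy : y ∈ U) {f : E4 → ℝ}
    (hf : ∀ z ∈ U, ContDiffAt ℝ ∞ f z) (hK : ∀ i, ∀ z ∈ U, along (K i) f z = 0) :
    IsJet (tFrame σ j K) f y (f y) (along (nField σ j K 0) f y) (along (nField σ j K 1) f y)
      (along (nField σ j K 0) (along (nField σ j K 0) f) y)
      (along (nField σ j K 0) (along (nField σ j K 1) f) y)
      (along (nField σ j K 1) (along (nField σ j K 1) f) y) where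
  smooth := hf y hy
  val := rfl
  first i := by
    fin_cases i
    exacts [rfl, rfl, hK 0 y hy, hK 1 y hy]
  second i l := by
    have e : ∀ (X : E4 → E4) i, along X (along (K i) f) y = 0 := fun X i => by
      rw [along_congr_on h.isOpen (hK i) hy, along_const]
    have e' : ∀ i l, along (K i) (along (nField σ j K l) f) y = 0 := fun i l => by
      rw [along_along_comm (h.smoothK i y hy) (h.smoothN l hy) (hf y hy) (h.commKN i l hy), e]
    fin_cases i <;> fin_cases l
    exacts [rfl, rfl, e _ 0, e _ 1,
      along_along_comm (h.smoothN 1 hy) (h.smoothN 0 hy) (hf y hy) (h.commNN 1 0 hy), rfl, e _ 0,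
      e _ 1, e' 0 0, e' 0 1, e _ 0, e _ 1, e' 1 0, e' 1 1, e _ 0, e _ 1]

/-- The jets of the entries of `Ψ`. -/
theorem exists_jet_psi (h : IsLocalToric U σ j K m) (hy : y ∈ U) :
    ∃ A B C E P Q R S T : ℝ,
      IsJet (tFrame σ j K) (psi σ j K 0 0) y (psi σ j K 0 0 y) A B P Q R ∧
      IsJet (tFrame σ j K) (psi σ j K 0 1) y (psi σ j K 0 1 y) B C Q R S ∧
      IsJet (tFrame σ j K) (psi σ j K 1 0) y (psi σ j K 1 0 y) B C Q R S ∧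
      IsJet (tFrame σ j K) (psi σ j K 1 1) y (psi σ j K 1 1 y) C E R S T := by
  have k := fun i l => h.isJet hy (f := psi σ j K i l) (fun z hz => h.smooth_psi i l hz)
    (fun k z hz => h.along_K_psi k i l hz)
  have r0 := fun z (hz : z ∈ U) => h.codazzi_right 0 hz
  have r1 := fun z (hz : z ∈ U) => h.codazzi_right 1 hz
  have l0 := fun z (hz : z ∈ U) => h.codazzi_left 0 hz
  have l1 := fun z (hz : z ∈ U) => h.codazzi_left 1 hz
  have c : ∀ i l, along (nField σ j K 0) (along (nField σ j K 1) (psi σ j K i l)) y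
      = along (nField σ j K 1) (along (nField σ j K 0) (psi σ j K i l)) y := fun i l =>
    along_along_comm (h.smoothN 0 hy) (h.smoothN 1 hy) (h.smooth_psi i l hy) (h.commNN 0 1 hy)
  have g : ∀ (X f g), (∀ z ∈ U, f z = g z) → along X f y = (along X g y : ℝ) :=
    fun X f g hfg => along_congr_on h.isOpen hfg hy
  have e01 := l1
  have e10 : ∀ z ∈ U, along (nField σ j K 1) (psi σ j K 1 0) z
      = along (nField σ j K 1) (psi σ j K 0 1) z := fun z hz => (r1 z hz).symm.trans (l1 z hz)
  -- The nine numbers are the third and fourth derivatives of a potential for the symmetric part.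
  -- The identifications of second derivatives come from differentiating the Codazzi relations,
  -- valid on all of `U`, and commuting `N₀` with `N₁`.
  refine ⟨_, _, along (nField σ j K 1) (psi σ j K 0 1) y, _, _, _, _,
    along (nField σ j K 1) (along (nField σ j K 1) (psi σ j K 0 1)) y, _, k 0 0,
    (k 0 1).of_eq rfl (r0 y hy) rfl (g _ _ _ r0) ((c 0 1).trans (g _ _ _ r0)) rfl,
    (k 1 0).of_eq rfl (l0 y hy) (e10 y hy) (g _ _ _ l0) ((c 1 0).trans (g _ _ _ l0)) (g _ _ _ e10),
    (k 1 1).of_eq rfl (l1 y hy) rfl ((g _ _ _ l1).trans ((c 0 1).trans (g _ _ _ r0)))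
      ((c 1 1).trans (g _ _ _ l1)) rfl⟩

end IsLocalToric

/-! ### Curvature in a block diagonal invariant frame -/

/-- The frame `X` is commuting on `U`, the metric `G` is block diagonal in it, with components of
given jets, invariant along `X 2`, `X 3`, and `X` is orthogonal at `y`. -/
structure IsBlockJet (U : Set E4) (G : E4 → E4 →L[ℝ] E4 →L[ℝ] ℝ) (X : Fin 4 → E4 → E4) (y : E4)
    (A B C E P Q R S T w p₀ q₀ r₀ s₀ t₀ p₁ q₁ r₁ s₁ t₁ p₂ q₂ r₂ s₂ t₂ : ℝ) : Prop where
  metric : IsMetricOn U G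
  frame : IsCommutingFrame U X
  mem : y ∈ U
  ne_zero : w ≠ 0
  jet00 : IsJet X (comp G X 0 0) y 1 A B P Q R
  jet01 : IsJet X (comp G X 0 1) y 0 B C Q R S
  jet11 : IsJet X (comp G X 1 1) y 1 C E R S T
  jet22 : IsJet X (comp G X 2 2) y w p₀ q₀ r₀ s₀ t₀
  jet23 : IsJet X (comp G X 2 3) y 0 p₁ q₁ r₁ s₁ t₁
  jet33 : IsJet X (comp G X 3 3) y w p₂ q₂ r₂ s₂ t₂
  comp02 : ∀ z ∈ U, comp G X 0 2 z = 0
  comp03 : ∀ z ∈ U, comp G X 0 3 z = 0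
  comp12 : ∀ z ∈ U, comp G X 1 2 z = 0
  comp13 : ∀ z ∈ U, comp G X 1 3 z = 0

namespace IsBlockJet

variable {U : Set E4} {G : E4 → E4 →L[ℝ] E4 →L[ℝ] ℝ} {X : Fin 4 → E4 → E4} {y : E4}
  {A B C E P Q R S T w p₀ q₀ r₀ s₀ t₀ p₁ q₁ r₁ s₁ t₁ p₂ q₂ r₂ s₂ t₂ : ℝ}

theorem comp_symm (h : IsBlockJet U G X y A B C E P Q R S T w p₀ q₀ r₀ s₀ t₀ p₁ q₁ r₁ s₁ t₁
    p₂ q₂ r₂ s₂ t₂) (a b : Fin 4) : ∀ z ∈ U, comp G X a b z = comp G X b a z :=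
  fun z hz => h.metric.symm z hz _ _

theorem jet (h : IsBlockJet U G X y A B C E P Q R S T w p₀ q₀ r₀ s₀ t₀ p₁ q₁ r₁ s₁ t₁
    p₂ q₂ r₂ s₂ t₂) (a b : Fin 4) : IsJet X (comp G X a b) y
      (!![1, 0, 0, 0; 0, 1, 0, 0; 0, 0, w, 0; 0, 0, 0, w] a b)
      (!![A, B, 0, 0; B, C, 0, 0; 0, 0, p₀, p₁; 0, 0, p₁, p₂] a b)
      (!![B, C, 0, 0; C, E, 0, 0; 0, 0, q₀, q₁; 0, 0, q₁, q₂] a b)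
      (!![P, Q, 0, 0; Q, R, 0, 0; 0, 0, r₀, r₁; 0, 0, r₁, r₂] a b)
      (!![Q, R, 0, 0; R, S, 0, 0; 0, 0, s₀, s₁; 0, 0, s₁, s₂] a b)
      (!![R, S, 0, 0; S, T, 0, 0; 0, 0, t₀, t₁; 0, 0, t₁, t₂] a b) := by
  have z := IsJet.const X 0 y
  have k := fun {a b} (hab : ∀ z ∈ U, comp G X a b z = 0) => z.congr h.metric.isOpen h.mem hab
  have k' := fun {a b} (hab : ∀ z ∈ U, comp G X b a z = 0) =>
    z.congr h.metric.isOpen h.mem fun z hz => (h.comp_symm a b z hz).trans (hab z hz)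
  fin_cases a <;> fin_cases b
  exacts [h.jet00, h.jet01, k h.comp02, k h.comp03,
    h.jet01.congr h.metric.isOpen h.mem (h.comp_symm 1 0), h.jet11, k h.comp12, k h.comp13,
    k' h.comp02, k' h.comp12, h.jet22, h.jet23, k' h.comp03, k' h.comp13,
    h.jet23.congr h.metric.isOpen h.mem (h.comp_symm 3 2), h.jet33]

theorem isOrthFrame (h : IsBlockJet U G X y A B C E P Q R S T w p₀ q₀ r₀ s₀ t₀ p₁ q₁ r₁ s₁ t₁
    p₂ q₂ r₂ s₂ t₂) : IsOrthFrame (G y) (fun a => X a y) ![1, 1, w, w] where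
  apply a b := ((h.jet a b).val).trans (by fin_cases a <;> fin_cases b <;> simp)
  ne_zero a := by
    fin_cases a
    exacts [one_ne_zero, one_ne_zero, h.ne_zero, h.ne_zero]

theorem christoffel_eq (a b e : Fin 4) : christoffel G X a b e y =
    (1 / 2) * (along (X a) (comp G X b e) y + along (X b) (comp G X a e) y
      - along (X e) (comp G X a b) y) := rfl

theorem along_christoffel (h : IsBlockJet U G X y A B C E P Q R S T w p₀ q₀ r₀ s₀ t₀
    p₁ q₁ r₁ s₁ t₁ p₂ q₂ r₂ s₂ t₂) (f a b e : Fin 4) : along (X f) (christoffel G X a b e) y =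
      (1 / 2) * (along (X f) (along (X a) (comp G X b e)) y
        + along (X f) (along (X b) (comp G X a e)) y
        - along (X f) (along (X e) (comp G X a b)) y) := by
  have s := fun a b e => contDiffAt_along (h.frame.smooth a y h.mem) (h.jet b e).smooth
  have : along (X f) (christoffel G X a b e) y = _ :=
    along_const_mul (1 / 2) (((s a b e).add (s b a e)).sub (s e a b))
  rw [this, along_sub ((s a b e).add (s b a e)) (s e a b), along_add (s a b e) (s b a e)]

/-- The fourth derivatives `P, …, T` of the potential cancel. In the base block they enter through
`2 ∂₀∂₁g₀₁ - ∂₁∂₁g₀₀ - ∂₀∂₀g₁₁`, which for a Hessian is `2R - R - R`. -/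
theorem scalarCurvature_eq (h : IsBlockJet U G X y A B C E P Q R S T w p₀ q₀ r₀ s₀ t₀
    p₁ q₁ r₁ s₁ t₁ p₂ q₂ r₂ s₂ t₂) : scalarCurvature G y =
      (1 / 2) * (C ^ 2 - A * C + B ^ 2 - B * E + (A + C) * (p₀ + p₂) / w
        + (B + E) * (q₀ + q₂) / w
        + (p₀ ^ 2 - p₀ * p₂ + 3 * p₁ ^ 2 + p₂ ^ 2 + q₀ ^ 2 - q₀ * q₂ + 3 * q₁ ^ 2 + q₂ ^ 2) / w ^ 2)
        - (r₀ + r₂ + t₀ + t₂) / w := by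
  have hw := h.ne_zero
  rw [scalarCurvature_frame h.metric h.frame h.mem h.isOrthFrame]
  simp only [h.along_christoffel, christoffel_eq, (h.jet _ _).first, (h.jet _ _).second,
    Fin.sum_univ_four, jetOne, jetTwo, Matrix.of_apply, Matrix.cons_val, Pi.zero_apply]
  field_simp
  ring

theorem laplacian_eq (h : IsBlockJet U G X y A B C E P Q R S T w p₀ q₀ r₀ s₀ t₀
    p₁ q₁ r₁ s₁ t₁ p₂ q₂ r₂ s₂ t₂) {f : E4 → ℝ} {f₀ f₁ f₂ f₃ f₄ f₅ : ℝ}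
    (hf : IsJet X f y f₀ f₁ f₂ f₃ f₄ f₅) : laplacian G f y =
      (1 / 2) * ((A + C) * f₁ + (B + E) * f₂ - ((p₀ + p₂) * f₁ + (q₀ + q₂) * f₂) / w)
        - f₃ - f₅ := by
  have hw := h.ne_zero
  rw [laplacian_frame h.metric h.frame h.mem h.isOrthFrame hf.smooth]
  simp only [christoffel_eq, (h.jet _ _).first, hf.first, hf.second,
    Fin.sum_univ_four, jetOne, jetTwo, Matrix.of_apply, Matrix.cons_val, Pi.zero_apply]
  field_simp
  ring

theorem normSqOne_fderiv_eq (h : IsBlockJet U G X y A B C E P Q R S T w p₀ q₀ r₀ s₀ t₀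
    p₁ q₁ r₁ s₁ t₁ p₂ q₂ r₂ s₂ t₂) {f : E4 → ℝ} {f₀ f₁ f₂ f₃ f₄ f₅ : ℝ}
    (hf : IsJet X f y f₀ f₁ f₂ f₃ f₄ f₅) : normSqOne (G y) (fderiv ℝ f y) = f₁ ^ 2 + f₂ ^ 2 := by
  rw [h.isOrthFrame.normSqOne_eq (h.metric.isInvertible h.mem)]
  have e : ∀ a, fderiv ℝ f y (X a y) = jetOne f₁ f₂ a := hf.first
  simp [e, Fin.sum_univ_four, jetOne]

end IsBlockJet

/-- The function `σ(A K_i, K_l)`, for `A = -2 (j - j^*)⁻¹`. -/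
def locQ (σ : E4 → E4 →L[ℝ] E4 →L[ℝ] ℝ) (j : E4 → E4 →L[ℝ] E4) (K : Fin 2 → E4 → E4) (i l : Fin 2)
    (y : E4) : ℝ :=
  σ y (((-2 : ℝ) • ContinuousLinearMap.inverse (j y - locAdj σ j y)) (K i y)) (K l y)

/-- The symmetric part of `Ψ`. -/
def psiSym (σ : E4 → E4 →L[ℝ] E4 →L[ℝ] ℝ) (j : E4 → E4 →L[ℝ] E4) (K : Fin 2 → E4 → E4) (i l : Fin 2)
    (y : E4) : ℝ := (1 / 2) * (psi σ j K i l y + psi σ j K l i y)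

/-- The determinant of the symmetric part of `Ψ`. -/
def symDet (σ : E4 → E4 →L[ℝ] E4 →L[ℝ] ℝ) (j : E4 → E4 →L[ℝ] E4) (K : Fin 2 → E4 → E4) (y : E4) : ℝ :=
  psi σ j K 0 0 y * psi σ j K 1 1 y - psiSym σ j K 0 1 y * psiSym σ j K 0 1 y

/-- Pairing `(j - j^*)v` with `v` under `σ` gives `-2 σ(v, jv)`, which is negative by taming. -/
theorem IsLocalGK.isInvertible_sub {U : Set E4} {σ : E4 → E4 →L[ℝ] E4 →L[ℝ] ℝ}
    {j : E4 → E4 →L[ℝ] E4} (h : IsLocalGK U σ j) {y : E4} (hy : y ∈ U) :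
    (j y - locAdj σ j y).IsInvertible := by
  refine isInvertible_of_injective fun v hv => ?_
  by_contra h0
  have e : σ y ((j y - locAdj σ j y) v) v = 0 := by rw [hv]; simp
  rw [_root_.sub_apply, map_sub, _root_.sub_apply, h.apply_locAdj hy, h.skew hy (j y v) v] at e
  have := h.tamed y hy v h0
  linarith

namespace IsLocalToric

variable {U : Set E4} {σ : E4 → E4 →L[ℝ] E4 →L[ℝ] ℝ} {j : E4 → E4 →L[ℝ] E4}
  {K : Fin 2 → E4 → E4} {m : Fin 2 → E4 → ℝ} {y : E4}

/-- For 2×2 matrices the symmetric part of `Ψ⁻¹` is the adjugate of the symmetric part of `Ψ`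
divided by `det Ψ`, and the adjugate preserves the determinant. -/
theorem gramDet_eq (h : IsLocalToric U σ j K m) (hy : y ∈ U) :
    gramDet (locMetric σ j) K y = symDet σ j K y / (psiDet σ j K y * psiDet σ j K y) := by
  have h0 := h.psiDet_ne_zero hy
  simp only [gramDet, metric_K_K, h.phi_eq hy, symDet, psiSym, Matrix.of_apply, Matrix.cons_val]
  field_simp
  ring

theorem symDet_ne_zero (h : IsLocalToric U σ j K m) (hy : y ∈ U) : symDet σ j K y ≠ 0 := by
  have := h.isHoloFrame.gram y hy
  change gramDet _ _ _ ≠ 0 at this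
  rw [h.gramDet_eq hy] at this
  exact (div_ne_zero_iff.1 this).1

/-- The anticommutator of `j` and its adjoint is a scalar, as seen on each `N_l` and `K_l`. Its
trace is `2 tr(j j^*) = -8p`. -/
theorem locAngle_eq (h : IsLocalToric U σ j K m) (hy : y ∈ U) :
    locAngle σ j y = (psiDet σ j K y - 2 * symDet σ j K y) / psiDet σ j K y := by
  have h0 := h.psiDet_ne_zero hy
  set q := (psiDet σ j K y - 2 * symDet σ j K y) / psiDet σ j K y with hq
  have key : j y ∘L locAdj σ j y + locAdj σ j y ∘L j y = (-2 * q) • ContinuousLinearMap.id ℝ E4 := by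
    have eN : ∀ l, (j y ∘L locAdj σ j y + locAdj σ j y ∘L j y) (nField σ j K l y) =
        (-2 * q) • nField σ j K l y := by
      intro l
      simp only [_root_.add_apply, ContinuousLinearMap.comp_apply, h.adj_N _ hy, h.j_N _ hy, map_add,
        map_smul, h.adj_K _ hy, show ∀ i, j y (K i y) = eField j K i y from fun _ => rfl,
        h.e_eq _ hy]
      rw [hq]
      simp only [h.phi_eq hy, Matrix.of_apply, Matrix.cons_val]
      simp only [smul_add, smul_smul, symDet, psiSym]
      fin_cases l <;> simp only [Fin.zero_eta, Fin.mk_one, Fin.isValue] <;> match_scalars <;>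
        field_simp <;> simp only [psiDet] <;> ring
    have eK : ∀ l, (j y ∘L locAdj σ j y + locAdj σ j y ∘L j y) (K l y) = (-2 * q) • K l y := by
      intro l
      simp only [_root_.add_apply, ContinuousLinearMap.comp_apply, h.adj_K _ hy, map_add,
        map_smul, show ∀ i, j y (K i y) = eField j K i y from fun _ => rfl,
        h.e_eq _ hy, h.adj_N _ hy, h.j_N _ hy]
      rw [hq]
      simp only [h.phi_eq hy, smul_add, smul_smul, symDet, psiSym]
      fin_cases l <;>
        simp only [Fin.zero_eta, Fin.mk_one, Fin.isValue, Matrix.of_apply, Matrix.cons_val] <;>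
        match_scalars <;> field_simp <;> simp only [psiDet] <;> ring
    ext1 v
    obtain ⟨a, b, c, d, rfl⟩ := h.exists_combination hy v
    rw [map_add, map_add, map_add, map_smul, map_smul, map_smul, map_smul, eN, eN, eK, eK]
    simp only [_root_.smul_apply, ContinuousLinearMap.id_apply]
    module
  have ht := congrArg (fun T : E4 →L[ℝ] E4 => LinearMap.trace ℝ E4 (T : E4 →ₗ[ℝ] E4)) key
  simp only [ContinuousLinearMap.toLinearMap_add, map_add, ContinuousLinearMap.toLinearMap_comp,
    ContinuousLinearMap.toLinearMap_smul, map_smul, ContinuousLinearMap.coe_id,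
    LinearMap.trace_id] at ht
  rw [LinearMap.trace_comp_comm' (j y : E4 →ₗ[ℝ] E4)] at ht
  rw [locAngle, ContinuousLinearMap.toLinearMap_comp]
  simp at ht
  linarith

/-- By `j_N` and `adj_N`, the difference `j - j^*` sends `N_l` to `2 ∑ Ψ^s_kl K_k`. Inverting and
pairing with `K_l` shows that the matrix is `-(Ψ^s)⁻¹`. -/
theorem locQ_eq (h : IsLocalToric U σ j K m) (hy : y ∈ U) (i l : Fin 2) : locQ σ j K i l y =
    !![-psi σ j K 1 1 y, psiSym σ j K 0 1 y; psiSym σ j K 0 1 y, -psi σ j K 0 0 y] i l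
      / symDet σ j K y := by
  have h0 := h.symDet_ne_zero hy
  have hi := h.isInvertible_sub hy
  have e : ∀ i, (j y - locAdj σ j y).inverse (K i y) =
      (!![psi σ j K 1 1 y, -psiSym σ j K 0 1 y; -psiSym σ j K 0 1 y, psi σ j K 0 0 y] i 0
        / (2 * symDet σ j K y)) • nField σ j K 0 y
      + (!![psi σ j K 1 1 y, -psiSym σ j K 0 1 y; -psiSym σ j K 0 1 y, psi σ j K 0 0 y] i 1
        / (2 * symDet σ j K y)) • nField σ j K 1 y := by
    intro i
    have : K i y = (j y - locAdj σ j y) ((!![psi σ j K 1 1 y, -psiSym σ j K 0 1 y;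
        -psiSym σ j K 0 1 y, psi σ j K 0 0 y] i 0 / (2 * symDet σ j K y)) • nField σ j K 0 y
      + (!![psi σ j K 1 1 y, -psiSym σ j K 0 1 y; -psiSym σ j K 0 1 y, psi σ j K 0 0 y] i 1
        / (2 * symDet σ j K y)) • nField σ j K 1 y) := by
      simp only [map_add, map_smul, _root_.sub_apply, h.j_N _ hy, h.adj_N _ hy, smul_add, smul_sub,
        smul_smul]
      fin_cases i <;>
        simp only [Fin.zero_eta, Fin.mk_one, Fin.isValue, Matrix.of_apply, Matrix.cons_val] <;>
        match_scalars <;> field_simp <;> simp only [symDet, psiSym] <;> ring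
    conv_lhs => rw [this]
    exact hi.inverse_apply_eq.2 rfl
  rw [locQ, _root_.smul_apply, e]
  simp only [map_add, map_smul, _root_.add_apply, _root_.smul_apply, h.form_N_K _ _ hy,
    smul_eq_mul]
  fin_cases i <;> fin_cases l <;> simp <;> field_simp

/-- The exterior derivative of the fundamental form on commuting fields. -/
theorem extDerivTwo_fund (h : IsLocalToric U σ j K m) (hy : y ∈ U) (a b e : Fin 4) :
    extDerivTwo (fundForm (locMetric σ j) j) y (tFrame σ j K a y) (tFrame σ j K b y)
        (tFrame σ j K e y) =
      along (tFrame σ j K a) (comp (fundForm (locMetric σ j) j) (tFrame σ j K) b e) y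
      - along (tFrame σ j K b) (comp (fundForm (locMetric σ j) j) (tFrame σ j K) a e) y
      + along (tFrame σ j K e) (comp (fundForm (locMetric σ j) j) (tFrame σ j K) a b) y := by
  have hX := h.isCommutingFrame
  have k : ∀ a b e, along (tFrame σ j K a)
      (comp (fundForm (locMetric σ j) j) (tFrame σ j K) b e) y = _ :=
    fun a b e => along_bilin (h.isHermitianOn.contDiffAt_fundForm hy) (hX.smooth b y hy)
      (hX.smooth e y hy)
  rw [k, k, k, extDerivTwo, hX.comm b a y hy, hX.comm e a y hy, hX.comm e b y hy,
    h.isHermitianOn.fundForm_antisymm hy (along (tFrame σ j K a) (tFrame σ j K e) y)]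
  simp only [along]
  ring

end IsLocalToric

/-! ### The curvature functions at a point where the frame is orthogonal -/

/-- A local toric structure whose matrix `Ψ` has at `y` the symmetric part `1`, with the jets of its
entries. -/
structure IsNormalToric (U : Set E4) (σ : E4 → E4 →L[ℝ] E4 →L[ℝ] ℝ) (j : E4 → E4 →L[ℝ] E4)
    (K : Fin 2 → E4 → E4) (m : Fin 2 → E4 → ℝ) (y : E4) (c A B C E P Q R S T : ℝ) : Prop where
  toric : IsLocalToric U σ j K m
  mem : y ∈ U
  jet00 : IsJet (tFrame σ j K) (psi σ j K 0 0) y 1 A B P Q R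
  jet01 : IsJet (tFrame σ j K) (psi σ j K 0 1) y c B C Q R S
  jet10 : IsJet (tFrame σ j K) (psi σ j K 1 0) y (-c) B C Q R S
  jet11 : IsJet (tFrame σ j K) (psi σ j K 1 1) y 1 C E R S T

namespace IsNormalToric

variable {U : Set E4} {σ : E4 → E4 →L[ℝ] E4 →L[ℝ] ℝ} {j : E4 → E4 →L[ℝ] E4}
  {K : Fin 2 → E4 → E4} {m : Fin 2 → E4 → ℝ} {y : E4} {c A B C E P Q R S T : ℝ}

theorem smooth_frame (h : IsNormalToric U σ j K m y c A B C E P Q R S T) (i : Fin 4) :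
    ContDiffAt ℝ ∞ (tFrame σ j K i) y := h.toric.isCommutingFrame.smooth i y h.mem

theorem one_add_sq_ne_zero (_ : IsNormalToric U σ j K m y c A B C E P Q R S T) : 1 + c ^ 2 ≠ 0 := by
  positivity

theorem jet_psiSym (h : IsNormalToric U σ j K m y c A B C E P Q R S T) :
    IsJet (tFrame σ j K) (psiSym σ j K 0 1) y 0 B C Q R S :=
  ((h.jet01.add h.smooth_frame h.jet10).const_mul h.smooth_frame (1 / 2)).of_eq
    (by ring) (by ring) (by ring) (by ring) (by ring) (by ring)

theorem jet_psiDet (h : IsNormalToric U σ j K m y c A B C E P Q R S T) :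
    IsJet (tFrame σ j K) (psiDet σ j K) y (1 + c ^ 2) (A + C) (B + E)
      (P + R + 2 * A * C - 2 * B ^ 2) (Q + S + A * E - B * C) (R + T + 2 * B * E - 2 * C ^ 2) :=
  ((h.jet00.mul h.smooth_frame h.jet11).sub h.smooth_frame
    (h.jet01.mul h.smooth_frame h.jet10)).of_eq
    (by ring) (by ring) (by ring) (by ring) (by ring) (by ring)

/-- The derivatives agree with those of `det Ψ`: the two determinants differ by the square of the
skew entry, which is constant to the order considered. -/
theorem jet_symDet (h : IsNormalToric U σ j K m y c A B C E P Q R S T) :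
    IsJet (tFrame σ j K) (symDet σ j K) y 1 (A + C) (B + E)
      (P + R + 2 * A * C - 2 * B ^ 2) (Q + S + A * E - B * C) (R + T + 2 * B * E - 2 * C ^ 2) :=
  ((h.jet00.mul h.smooth_frame h.jet11).sub h.smooth_frame
    (h.jet_psiSym.mul h.smooth_frame h.jet_psiSym)).of_eq
    (by ring) (by ring) (by ring) (by ring) (by ring) (by ring)

theorem jet_locAngle (h : IsNormalToric U σ j K m y c A B C E P Q R S T) :
    IsJet (tFrame σ j K) (locAngle σ j) y ((c ^ 2 - 1) / (1 + c ^ 2))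
      (-2 * c ^ 2 * (A + C) / (1 + c ^ 2) ^ 2)
      (-2 * c ^ 2 * (B + E) / (1 + c ^ 2) ^ 2)
      (-2 * c ^ 2 * ((P + R + 2 * A * C - 2 * B ^ 2) / (1 + c ^ 2) ^ 2
        - 2 * (A + C) ^ 2 / (1 + c ^ 2) ^ 3))
      (-2 * c ^ 2 * ((Q + S + A * E - B * C) / (1 + c ^ 2) ^ 2
        - 2 * (A + C) * (B + E) / (1 + c ^ 2) ^ 3))
      (-2 * c ^ 2 * ((R + T + 2 * B * E - 2 * C ^ 2) / (1 + c ^ 2) ^ 2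
        - 2 * (B + E) ^ 2 / (1 + c ^ 2) ^ 3)) := by
  have hk := h.one_add_sq_ne_zero
  refine (((h.jet_psiDet.sub h.smooth_frame (h.jet_symDet.const_mul h.smooth_frame 2)).div
    h.smooth_frame h.jet_psiDet hk).congr h.toric.isOpen h.mem
      fun z hz => h.toric.locAngle_eq hz).of_eq ?_ ?_ ?_ ?_ ?_ ?_ <;> field_simp <;> ring

/-- The jet of a quotient by the determinant of `Ψ`. -/
theorem jet_div_psiDet (h : IsNormalToric U σ j K m y c A B C E P Q R S T) {f : E4 → ℝ}
    {v p q r s t : ℝ} (hf : IsJet (tFrame σ j K) f y v p q r s t) :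
    IsJet (tFrame σ j K) (fun z => f z / psiDet σ j K z) y (v / (1 + c ^ 2))
      (p / (1 + c ^ 2) - v * (A + C) / (1 + c ^ 2) ^ 2)
      (q / (1 + c ^ 2) - v * (B + E) / (1 + c ^ 2) ^ 2)
      (r / (1 + c ^ 2) - (2 * p * (A + C) + v * (P + R + 2 * A * C - 2 * B ^ 2)) / (1 + c ^ 2) ^ 2
        + 2 * v * (A + C) ^ 2 / (1 + c ^ 2) ^ 3)
      (s / (1 + c ^ 2) - (p * (B + E) + q * (A + C) + v * (Q + S + A * E - B * C)) / (1 + c ^ 2) ^ 2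
        + 2 * v * (A + C) * (B + E) / (1 + c ^ 2) ^ 3)
      (t / (1 + c ^ 2) - (2 * q * (B + E) + v * (R + T + 2 * B * E - 2 * C ^ 2)) / (1 + c ^ 2) ^ 2
        + 2 * v * (B + E) ^ 2 / (1 + c ^ 2) ^ 3) := by
  have hk := h.one_add_sq_ne_zero
  refine (hf.div h.smooth_frame h.jet_psiDet hk).of_eq ?_ ?_ ?_ ?_ ?_ ?_ <;> field_simp <;> ring

/-- The factors `1 *` keep the shape of `jet_div_psiDet` at `v = 1`, so the jet transfers without
rewriting. -/
theorem jet_phi00 (h : IsNormalToric U σ j K m y c A B C E P Q R S T) :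
    IsJet (tFrame σ j K) (phi σ j K 0 0) y (1 / (1 + c ^ 2))
      (C / (1 + c ^ 2) - 1 * (A + C) / (1 + c ^ 2) ^ 2)
      (E / (1 + c ^ 2) - 1 * (B + E) / (1 + c ^ 2) ^ 2)
      (R / (1 + c ^ 2) - (2 * C * (A + C) + 1 * (P + R + 2 * A * C - 2 * B ^ 2)) / (1 + c ^ 2) ^ 2
        + 2 * 1 * (A + C) ^ 2 / (1 + c ^ 2) ^ 3)
      (S / (1 + c ^ 2) - (C * (B + E) + E * (A + C) + 1 * (Q + S + A * E - B * C)) / (1 + c ^ 2) ^ 2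
        + 2 * 1 * (A + C) * (B + E) / (1 + c ^ 2) ^ 3)
      (T / (1 + c ^ 2) - (2 * E * (B + E) + 1 * (R + T + 2 * B * E - 2 * C ^ 2)) / (1 + c ^ 2) ^ 2
        + 2 * 1 * (B + E) ^ 2 / (1 + c ^ 2) ^ 3) :=
  (h.jet_div_psiDet h.jet11).congr h.toric.isOpen h.mem fun _ hz => h.toric.phi_eq hz 0 0

theorem jet_phi11 (h : IsNormalToric U σ j K m y c A B C E P Q R S T) :
    IsJet (tFrame σ j K) (phi σ j K 1 1) y (1 / (1 + c ^ 2))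
      (A / (1 + c ^ 2) - 1 * (A + C) / (1 + c ^ 2) ^ 2)
      (B / (1 + c ^ 2) - 1 * (B + E) / (1 + c ^ 2) ^ 2)
      (P / (1 + c ^ 2) - (2 * A * (A + C) + 1 * (P + R + 2 * A * C - 2 * B ^ 2)) / (1 + c ^ 2) ^ 2
        + 2 * 1 * (A + C) ^ 2 / (1 + c ^ 2) ^ 3)
      (Q / (1 + c ^ 2) - (A * (B + E) + B * (A + C) + 1 * (Q + S + A * E - B * C)) / (1 + c ^ 2) ^ 2
        + 2 * 1 * (A + C) * (B + E) / (1 + c ^ 2) ^ 3)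
      (R / (1 + c ^ 2) - (2 * B * (B + E) + 1 * (R + T + 2 * B * E - 2 * C ^ 2)) / (1 + c ^ 2) ^ 2
        + 2 * 1 * (B + E) ^ 2 / (1 + c ^ 2) ^ 3) :=
  (h.jet_div_psiDet h.jet00).congr h.toric.isOpen h.mem fun _ hz => h.toric.phi_eq hz 1 1

theorem jet_phi01 (h : IsNormalToric U σ j K m y c A B C E P Q R S T) :
    IsJet (tFrame σ j K) (phi σ j K 0 1) y ((-c) / (1 + c ^ 2))
      ((-B) / (1 + c ^ 2) - (-c) * (A + C) / (1 + c ^ 2) ^ 2)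
      ((-C) / (1 + c ^ 2) - (-c) * (B + E) / (1 + c ^ 2) ^ 2)
      ((-Q) / (1 + c ^ 2) - (2 * (-B) * (A + C) + (-c) * (P + R + 2 * A * C - 2 * B ^ 2)) / (1 + c ^ 2) ^ 2
        + 2 * (-c) * (A + C) ^ 2 / (1 + c ^ 2) ^ 3)
      ((-R) / (1 + c ^ 2) - ((-B) * (B + E) + (-C) * (A + C) + (-c) * (Q + S + A * E - B * C)) / (1 + c ^ 2) ^ 2
        + 2 * (-c) * (A + C) * (B + E) / (1 + c ^ 2) ^ 3)
      ((-S) / (1 + c ^ 2) - (2 * (-C) * (B + E) + (-c) * (R + T + 2 * B * E - 2 * C ^ 2)) / (1 + c ^ 2) ^ 2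
        + 2 * (-c) * (B + E) ^ 2 / (1 + c ^ 2) ^ 3) :=
  ((h.jet_div_psiDet (h.jet01.const_mul h.smooth_frame (-1))).congr h.toric.isOpen h.mem
    fun z hz => (h.toric.phi_eq hz 0 1).trans (by simp)).of_eq
    (by ring) (by ring) (by ring) (by ring) (by ring) (by ring)

theorem jet_phi10 (h : IsNormalToric U σ j K m y c A B C E P Q R S T) :
    IsJet (tFrame σ j K) (phi σ j K 1 0) y (c / (1 + c ^ 2))
      ((-B) / (1 + c ^ 2) - c * (A + C) / (1 + c ^ 2) ^ 2)
      ((-C) / (1 + c ^ 2) - c * (B + E) / (1 + c ^ 2) ^ 2)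
      ((-Q) / (1 + c ^ 2) - (2 * (-B) * (A + C) + c * (P + R + 2 * A * C - 2 * B ^ 2)) / (1 + c ^ 2) ^ 2
        + 2 * c * (A + C) ^ 2 / (1 + c ^ 2) ^ 3)
      ((-R) / (1 + c ^ 2) - ((-B) * (B + E) + (-C) * (A + C) + c * (Q + S + A * E - B * C)) / (1 + c ^ 2) ^ 2
        + 2 * c * (A + C) * (B + E) / (1 + c ^ 2) ^ 3)
      ((-S) / (1 + c ^ 2) - (2 * (-C) * (B + E) + c * (R + T + 2 * B * E - 2 * C ^ 2)) / (1 + c ^ 2) ^ 2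
        + 2 * c * (B + E) ^ 2 / (1 + c ^ 2) ^ 3) :=
  ((h.jet_div_psiDet (h.jet10.const_mul h.smooth_frame (-1))).congr h.toric.isOpen h.mem
    fun z hz => (h.toric.phi_eq hz 1 0).trans (by simp)).of_eq
    (by ring) (by ring) (by ring) (by ring) (by ring) (by ring)

theorem jet_metric00 (h : IsNormalToric U σ j K m y c A B C E P Q R S T) :
    IsJet (tFrame σ j K) (fun z => locMetric σ j z (K 0 z) (K 0 z)) y (1 / (1 + c ^ 2))
      (C / (1 + c ^ 2) - 1 * (A + C) / (1 + c ^ 2) ^ 2)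
      (E / (1 + c ^ 2) - 1 * (B + E) / (1 + c ^ 2) ^ 2)
      (R / (1 + c ^ 2) - (2 * C * (A + C) + 1 * (P + R + 2 * A * C - 2 * B ^ 2)) / (1 + c ^ 2) ^ 2
        + 2 * 1 * (A + C) ^ 2 / (1 + c ^ 2) ^ 3)
      (S / (1 + c ^ 2) - (C * (B + E) + E * (A + C) + 1 * (Q + S + A * E - B * C)) / (1 + c ^ 2) ^ 2
        + 2 * 1 * (A + C) * (B + E) / (1 + c ^ 2) ^ 3)
      (T / (1 + c ^ 2) - (2 * E * (B + E) + 1 * (R + T + 2 * B * E - 2 * C ^ 2)) / (1 + c ^ 2) ^ 2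
        + 2 * 1 * (B + E) ^ 2 / (1 + c ^ 2) ^ 3) :=
  h.jet_phi00.congr h.toric.isOpen h.mem fun z _ =>
    (IsLocalToric.metric_K_K 0 0).trans (by ring)

theorem jet_metric11 (h : IsNormalToric U σ j K m y c A B C E P Q R S T) :
    IsJet (tFrame σ j K) (fun z => locMetric σ j z (K 1 z) (K 1 z)) y (1 / (1 + c ^ 2))
      (A / (1 + c ^ 2) - 1 * (A + C) / (1 + c ^ 2) ^ 2)
      (B / (1 + c ^ 2) - 1 * (B + E) / (1 + c ^ 2) ^ 2)
      (P / (1 + c ^ 2) - (2 * A * (A + C) + 1 * (P + R + 2 * A * C - 2 * B ^ 2)) / (1 + c ^ 2) ^ 2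
        + 2 * 1 * (A + C) ^ 2 / (1 + c ^ 2) ^ 3)
      (Q / (1 + c ^ 2) - (A * (B + E) + B * (A + C) + 1 * (Q + S + A * E - B * C)) / (1 + c ^ 2) ^ 2
        + 2 * 1 * (A + C) * (B + E) / (1 + c ^ 2) ^ 3)
      (R / (1 + c ^ 2) - (2 * B * (B + E) + 1 * (R + T + 2 * B * E - 2 * C ^ 2)) / (1 + c ^ 2) ^ 2
        + 2 * 1 * (B + E) ^ 2 / (1 + c ^ 2) ^ 3) :=
  h.jet_phi11.congr h.toric.isOpen h.mem fun z _ =>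
    (IsLocalToric.metric_K_K 1 1).trans (by ring)

theorem jet_metric01 (h : IsNormalToric U σ j K m y c A B C E P Q R S T) :
    IsJet (tFrame σ j K) (fun z => locMetric σ j z (K 0 z) (K 1 z)) y 0 (-B / (1 + c ^ 2))
      (-C / (1 + c ^ 2)) (-Q / (1 + c ^ 2) + 2 * B * (A + C) / (1 + c ^ 2) ^ 2)
      (-R / (1 + c ^ 2) + (B * (B + E) + C * (A + C)) / (1 + c ^ 2) ^ 2)
      (-S / (1 + c ^ 2) + 2 * C * (B + E) / (1 + c ^ 2) ^ 2) := by
  have hk := h.one_add_sq_ne_zero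
  refine (((h.jet_phi01.add h.smooth_frame h.jet_phi10).const_mul h.smooth_frame (1 / 2)).congr
    h.toric.isOpen h.mem fun z _ => IsLocalToric.metric_K_K 0 1).of_eq ?_ ?_ ?_ ?_ ?_ ?_ <;>
  field_simp <;> ring

theorem jet_gramDet (h : IsNormalToric U σ j K m y c A B C E P Q R S T) :
    IsJet (tFrame σ j K) (gramDet (locMetric σ j) K) y (1 / (1 + c ^ 2) ^ 2)
      ((A + C) / (1 + c ^ 2) ^ 2 - 2 * (A + C) / (1 + c ^ 2) ^ 3)
      ((B + E) / (1 + c ^ 2) ^ 2 - 2 * (B + E) / (1 + c ^ 2) ^ 3)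
      ((P + R + 2 * A * C - 2 * B ^ 2) / (1 + c ^ 2) ^ 2 - (4 * (A + C) ^ 2 + 2 * (P + R + 2 * A * C - 2 * B ^ 2)) / (1 + c ^ 2) ^ 3
        + 6 * (A + C) ^ 2 / (1 + c ^ 2) ^ 4)
      ((Q + S + A * E - B * C) / (1 + c ^ 2) ^ 2 - (4 * (A + C) * (B + E) + 2 * (Q + S + A * E - B * C)) / (1 + c ^ 2) ^ 3
        + 6 * (A + C) * (B + E) / (1 + c ^ 2) ^ 4)
      ((R + T + 2 * B * E - 2 * C ^ 2) / (1 + c ^ 2) ^ 2 - (4 * (B + E) ^ 2 + 2 * (R + T + 2 * B * E - 2 * C ^ 2)) / (1 + c ^ 2) ^ 3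
        + 6 * (B + E) ^ 2 / (1 + c ^ 2) ^ 4) := by
  have hk := h.one_add_sq_ne_zero
  refine ((h.jet_symDet.div h.smooth_frame (h.jet_psiDet.mul h.smooth_frame h.jet_psiDet)
    (mul_ne_zero h.one_add_sq_ne_zero h.one_add_sq_ne_zero)).congr
    h.toric.isOpen h.mem fun z hz => h.toric.gramDet_eq hz).of_eq ?_ ?_ ?_ ?_ ?_ ?_ <;>
  field_simp <;> ring

theorem isBlockJet (h : IsNormalToric U σ j K m y c A B C E P Q R S T) :
    IsBlockJet U (locMetric σ j) (tFrame σ j K) y A B C E P Q R S T (1 / (1 + c ^ 2))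
      (C / (1 + c ^ 2) - 1 * (A + C) / (1 + c ^ 2) ^ 2)
      (E / (1 + c ^ 2) - 1 * (B + E) / (1 + c ^ 2) ^ 2)
      (R / (1 + c ^ 2) - (2 * C * (A + C) + 1 * (P + R + 2 * A * C - 2 * B ^ 2)) / (1 + c ^ 2) ^ 2
        + 2 * 1 * (A + C) ^ 2 / (1 + c ^ 2) ^ 3)
      (S / (1 + c ^ 2) - (C * (B + E) + E * (A + C) + 1 * (Q + S + A * E - B * C)) / (1 + c ^ 2) ^ 2
        + 2 * 1 * (A + C) * (B + E) / (1 + c ^ 2) ^ 3)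
      (T / (1 + c ^ 2) - (2 * E * (B + E) + 1 * (R + T + 2 * B * E - 2 * C ^ 2)) / (1 + c ^ 2) ^ 2
        + 2 * 1 * (B + E) ^ 2 / (1 + c ^ 2) ^ 3)
      (-B / (1 + c ^ 2))
      (-C / (1 + c ^ 2))
      (-Q / (1 + c ^ 2) + 2 * B * (A + C) / (1 + c ^ 2) ^ 2)
      (-R / (1 + c ^ 2) + (B * (B + E) + C * (A + C)) / (1 + c ^ 2) ^ 2)
      (-S / (1 + c ^ 2) + 2 * C * (B + E) / (1 + c ^ 2) ^ 2)
      (A / (1 + c ^ 2) - 1 * (A + C) / (1 + c ^ 2) ^ 2)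
      (B / (1 + c ^ 2) - 1 * (B + E) / (1 + c ^ 2) ^ 2)
      (P / (1 + c ^ 2) - (2 * A * (A + C) + 1 * (P + R + 2 * A * C - 2 * B ^ 2)) / (1 + c ^ 2) ^ 2
        + 2 * 1 * (A + C) ^ 2 / (1 + c ^ 2) ^ 3)
      (Q / (1 + c ^ 2) - (A * (B + E) + B * (A + C) + 1 * (Q + S + A * E - B * C)) / (1 + c ^ 2) ^ 2
        + 2 * 1 * (A + C) * (B + E) / (1 + c ^ 2) ^ 3)
      (R / (1 + c ^ 2) - (2 * B * (B + E) + 1 * (R + T + 2 * B * E - 2 * C ^ 2)) / (1 + c ^ 2) ^ 2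
        + 2 * 1 * (B + E) ^ 2 / (1 + c ^ 2) ^ 3) where
  metric := h.toric.isHermitianOn.toIsMetricOn
  frame := h.toric.isCommutingFrame
  mem := h.mem
  ne_zero := one_div_ne_zero h.one_add_sq_ne_zero
  jet00 := h.jet00.congr h.toric.isOpen h.mem fun z hz =>
    (h.toric.metric_N_N hz 0 0).trans (by ring)
  jet01 := h.jet_psiSym.congr h.toric.isOpen h.mem fun z hz => h.toric.metric_N_N hz 0 1
  jet11 := h.jet11.congr h.toric.isOpen h.mem fun z hz =>
    (h.toric.metric_N_N hz 1 1).trans (by ring)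
  jet22 := h.jet_metric00
  jet23 := h.jet_metric01
  jet33 := h.jet_metric11
  comp02 := fun z hz => h.toric.metric_N_K hz 0 0
  comp03 := fun z hz => h.toric.metric_N_K hz 0 1
  comp12 := fun z hz => h.toric.metric_N_K hz 1 0
  comp13 := fun z hz => h.toric.metric_N_K hz 1 1

/-- The sum `∑ N_i N_l Q_il`. -/
theorem sum_locQ (h : IsNormalToric U σ j K m y c A B C E P Q R S T) :
    ∑ i, ∑ l, along (nField σ j K i) (along (nField σ j K l) (locQ σ j K i l)) y =
      P + 2 * R + T + 2 * A * C - 2 * B ^ 2 + 2 * B * E - 2 * C ^ 2 - 2 * (A + C) ^ 2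
        - 2 * (B + E) ^ 2 := by
  have q : ∀ i l {f : E4 → ℝ} {v p q r s t : ℝ}, IsJet (tFrame σ j K) f y v p q r s t →
      (∀ z, !![-psi σ j K 1 1 z, psiSym σ j K 0 1 z; psiSym σ j K 0 1 z, -psi σ j K 0 0 z] i l
        = f z) → _ := fun i l {f v p q r s t} hf e =>
    (hf.div h.smooth_frame h.jet_symDet one_ne_zero).congr (g := locQ σ j K i l) h.toric.isOpen
      h.mem fun z hz => (h.toric.locQ_eq hz i l).trans (by rw [e z])
  have q00 := (q 0 0 (h.jet11.const_mul h.smooth_frame (-1)) fun z => by simp).second 0 0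
  have q01 := (q 0 1 h.jet_psiSym fun z => by simp).second 0 1
  have q10 := (q 1 0 h.jet_psiSym fun z => by simp).second 1 0
  have q11 := (q 1 1 (h.jet00.const_mul h.smooth_frame (-1)) fun z => by simp).second 1 1
  simp only [tFrame, jetTwo, Matrix.cons_val] at q00 q01 q10 q11
  simp only [Fin.sum_univ_two, q00, q01, q10, q11]
  ring

/-- The second formula. -/
theorem riemannian_formula (h : IsNormalToric U σ j K m y c A B C E P Q R S T) :
    scalarCurvature (locMetric σ j) y
      + 2 * laplacian (locMetric σ j) (locAngle σ j) y / (1 - locAngle σ j y)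
      - 1 / (1 - locAngle σ j y ^ 2) * ((4 + 2 * locAngle σ j y) / (1 - locAngle σ j y) - 1 / 2)
        * normSqOne (locMetric σ j y) (fderiv ℝ (locAngle σ j) y) =
    ∑ i, ∑ l, along (nField σ j K i) (along (nField σ j K l) (locQ σ j K i l)) y := by
  have hk := h.one_add_sq_ne_zero
  rw [h.isBlockJet.scalarCurvature_eq, h.isBlockJet.laplacian_eq h.jet_locAngle,
    h.isBlockJet.normSqOne_fderiv_eq h.jet_locAngle, h.jet_locAngle.val, h.sum_locQ]
  have e1 : 1 - (c ^ 2 - 1) / (1 + c ^ 2) = 2 / (1 + c ^ 2) := by field_simp; ring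
  have e2 : 1 - ((c ^ 2 - 1) / (1 + c ^ 2)) ^ 2 = 4 * c ^ 2 / (1 + c ^ 2) ^ 2 := by
    field_simp; ring
  rw [e1, e2]
  -- `c = 0` is the case `p = -1` at `y`. There `1 - p²` vanishes and division by zero makes the
  -- last term `0`, as the convention requires. Otherwise `|dp|²` carries `c⁴`, which absorbs the
  -- `c²` in the denominator.
  rcases eq_or_ne c 0 with rfl | hc
  · norm_num
    ring
  · field_simp
    ring

end IsNormalToric

/-! ### The Lee form and the commutator in the toric frame. -/

namespace IsLocalToric

variable {U : Set E4} {σ : E4 → E4 →L[ℝ] E4 →L[ℝ] ℝ} {j : E4 → E4 →L[ℝ] E4}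
  {K : Fin 2 → E4 → E4} {m : Fin 2 → E4 → ℝ} {y : E4}

/-- The values `θ(N_i)` of the Lee form. -/
def leeN (σ : E4 → E4 →L[ℝ] E4 →L[ℝ] ℝ) (j : E4 → E4 →L[ℝ] E4) (K : Fin 2 → E4 → E4) (i : Fin 2)
    (z : E4) : ℝ := leeForm (locMetric σ j) j z (nField σ j K i z)

/-- The values `F(N_i, K_l)` of the fundamental form. -/
def fundNK (σ : E4 → E4 →L[ℝ] E4 →L[ℝ] ℝ) (j : E4 → E4 →L[ℝ] E4) (K : Fin 2 → E4 → E4)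
    (i l : Fin 2) (z : E4) : ℝ :=
  fundForm (locMetric σ j) j z (nField σ j K i z) (K l z)

theorem along_e (h : IsLocalToric U σ j K m) (hy : y ∈ U) (l : Fin 2) (f : E4 → ℝ) :
    along (eField j K l) f y = -phi σ j K 0 l y * along (nField σ j K 0) f y
      - phi σ j K 1 l y * along (nField σ j K 1) f y := by
  simp only [along, h.e_eq l hy, map_add, map_smul, smul_eq_mul]
  ring

theorem along_K_metric (h : IsLocalToric U σ j K m) (hy : y ∈ U) (k i l : Fin 2) :
    along (K k) (fun z => locMetric σ j z (K i z) (K l z)) y = 0 := by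
  have e : along (K k) (fun z => locMetric σ j z (K i z) (K l z)) y = _ :=
    (along_const_mul (f := fun z => phi σ j K i l z + phi σ j K l i z) (1 / 2)
      ((h.smooth_phi i l hy).add (h.smooth_phi l i hy)))
  rw [e, along_add (h.smooth_phi i l hy) (h.smooth_phi l i hy), h.along_K_phi k i l hy,
    h.along_K_phi k l i hy]
  ring

theorem smooth_metric_K (h : IsLocalToric U σ j K m) (hy : y ∈ U) (i l : Fin 2) :
    ContDiffAt ℝ ∞ (fun z => locMetric σ j z (K i z) (K l z)) y :=
  contDiffAt_comp₂ (h.contDiffAt_locMetric hy) (h.smoothK i y hy) (h.smoothK l y hy)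

theorem along_K_gramDet (h : IsLocalToric U σ j K m) (hy : y ∈ U) (k : Fin 2) :
    along (K k) (gramDet (locMetric σ j) K) y = 0 := by
  have s := fun i l => h.smooth_metric_K hy i l
  have e : along (K k) (gramDet (locMetric σ j) K) y = _ :=
    along_sub ((s 0 0).mul (s 1 1)) ((s 0 1).pow 2)
  simp only [sq] at e
  rw [e, along_mul (s 0 0) (s 1 1), along_mul (s 0 1) (s 0 1)]
  simp [h.along_K_metric hy]

theorem smooth_fundNK (h : IsLocalToric U σ j K m) (hy : y ∈ U) (i l : Fin 2) :
    ContDiffAt ℝ ∞ (fundNK σ j K i l) y :=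
  contDiffAt_comp₂ (h.isHermitianOn.contDiffAt_fundForm hy) (h.smoothN i hy) (h.smoothK l y hy)

theorem smooth_leeN (h : IsLocalToric U σ j K m) (hy : y ∈ U) (i : Fin 2) :
    ContDiffAt ℝ ∞ (leeN σ j K i) y :=
  (h.isHermitianOn.contDiffAt_leeForm hy).clm_apply (h.smoothN i hy)

theorem along_K_fundNK (h : IsLocalToric U σ j K m) (hy : y ∈ U) (k i l : Fin 2) :
    along (K k) (fundNK σ j K i l) y = 0 := by
  have s := fun i => h.smooth_metric_K hy i l
  rw [along_congr_on (f := fundNK σ j K i l) h.isOpen (fun z hz => h.fund_N_K hz i l) hy,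
    along_add ((h.smooth_psi 0 i hy).mul (s 0)) ((h.smooth_psi 1 i hy).mul (s 1)),
    along_mul (h.smooth_psi 0 i hy) (s 0), along_mul (h.smooth_psi 1 i hy) (s 1)]
  simp [h.along_K_metric hy, h.along_K_psi _ _ _ hy]

/-- The matrix `F(N_i, K_l)` is the transpose of `Ψ` times the Gram matrix of the `K`'s. Its
invertibility is what makes the equations for the Lee form solvable. -/
theorem fundNK_det (h : IsLocalToric U σ j K m) (hy : y ∈ U) :
    fundNK σ j K 0 0 y * fundNK σ j K 1 1 y - fundNK σ j K 0 1 y * fundNK σ j K 1 0 y ≠ 0 := by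
  have e : fundNK σ j K 0 0 y * fundNK σ j K 1 1 y - fundNK σ j K 0 1 y * fundNK σ j K 1 0 y
      = psiDet σ j K y * gramDet (locMetric σ j) K y := by
    simp only [fundNK, h.fund_N_K hy, psiDet, gramDet, h.isHermitianOn.symm y hy (K 1 y) (K 0 y)]
    ring
  rw [e]
  exact mul_ne_zero (h.psiDet_ne_zero hy) (h.isHoloFrame.gram y hy)

/-- On `(K₀, K₁, N_i)` the form `dF` vanishes, since the components of `F` are `K`-invariant and
`F(K₀, K₁) = 0`. Then `dF = θ ∧ F` is a homogeneous linear system for the `θ(K_l)` with invertible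
matrix. -/
theorem leeForm_K (h : IsLocalToric U σ j K m) (hy : y ∈ U) (l : Fin 2) :
    leeForm (locMetric σ j) j y (K l y) = 0 := by
  have k : ∀ a (i : Fin 2), tFrame σ j K a = nField σ j K i →
      leeForm (locMetric σ j) j y (K 0 y) * fundNK σ j K i 1 y
        = leeForm (locMetric σ j) j y (K 1 y) * fundNK σ j K i 0 y := by
    intro a i ha
    have h1 := h.isHermitianOn.leeForm_spec hy (tFrame σ j K 2 y) (tFrame σ j K 3 y)
      (tFrame σ j K a y)
    rw [h.extDerivTwo_fund hy, ha] at h1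
    have e : ∀ b (l : Fin 2), tFrame σ j K b = K l → ∀ z ∈ U,
        comp (fundForm (locMetric σ j) j) (tFrame σ j K) b a z = -fundNK σ j K i l z := by
      intro b l hb z hz
      rw [comp, ha, hb]
      exact h.fund_K_N hz i l
    rw [along_congr_on h.isOpen (e 3 1 rfl) hy, along_congr_on h.isOpen (e 2 0 rfl) hy,
      along_congr_on (f := comp (fundForm (locMetric σ j) j) (tFrame σ j K) 2 3)
        (g := fun _ => 0) h.isOpen (fun z hz => h.fund_K_K hz 0 1) hy, along_neg,
      along_neg] at h1
    change -along (K 0) _ y - -along (K 1) _ y + _ =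
      leeForm (locMetric σ j) j y (K 0 y) * fundForm _ _ y (K 1 y) _ -
      leeForm (locMetric σ j) j y (K 1 y) * fundForm _ _ y (K 0 y) _ +
      _ * fundForm _ _ y (K 0 y) (K 1 y) at h1
    rw [h.along_K_fundNK hy, h.along_K_fundNK hy, along_const, h.fund_K_K hy, h.fund_K_N hy,
      h.fund_K_N hy] at h1
    simp only [fundNK]
    linarith
  have k0 := k 0 0 rfl
  have k1 := k 1 1 rfl
  have hd := h.fundNK_det hy
  fin_cases l
  · change leeForm (locMetric σ j) j y (K 0 y) = 0
    refine mul_right_cancel₀ hd ?_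
    linear_combination fundNK σ j K 0 0 y * k1 - fundNK σ j K 1 0 y * k0
  · change leeForm (locMetric σ j) j y (K 1 y) = 0
    refine mul_right_cancel₀ hd ?_
    linear_combination fundNK σ j K 0 1 y * k1 - fundNK σ j K 1 1 y * k0

/-- Evaluation of `dF = θ ∧ F` on `(N₀, N₁, K_l)`. For `l = 0, 1` this is a 2×2 linear system for
the two remaining components of `θ`. -/
theorem leeN_spec (h : IsLocalToric U σ j K m) (hy : y ∈ U) (l : Fin 2) :
    leeN σ j K 0 y * fundNK σ j K 1 l y - leeN σ j K 1 y * fundNK σ j K 0 l y =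
      along (nField σ j K 0) (fundNK σ j K 1 l) y - along (nField σ j K 1) (fundNK σ j K 0 l) y := by
  have k : ∀ a, tFrame σ j K a = K l → leeN σ j K 0 y * fundNK σ j K 1 l y
      - leeN σ j K 1 y * fundNK σ j K 0 l y =
      along (nField σ j K 0) (fundNK σ j K 1 l) y
        - along (nField σ j K 1) (fundNK σ j K 0 l) y := by
    intro a ha
    have h1 := h.isHermitianOn.leeForm_spec hy (tFrame σ j K 0 y) (tFrame σ j K 1 y)
      (tFrame σ j K a y)
    rw [h.extDerivTwo_fund hy,
      along_congr_on (f := comp (fundForm (locMetric σ j) j) (tFrame σ j K) 0 1)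
        (g := fun _ => 0) h.isOpen (fun z hz => h.fund_N_N hz 0 1) hy, along_const,
      along_congr_on (f := comp (fundForm (locMetric σ j) j) (tFrame σ j K) 1 a)
        (g := fundNK σ j K 1 l) h.isOpen (fun z _ => by rw [comp, ha]; rfl) hy,
      along_congr_on (f := comp (fundForm (locMetric σ j) j) (tFrame σ j K) 0 a)
        (g := fundNK σ j K 0 l) h.isOpen (fun z _ => by rw [comp, ha]; rfl) hy, ha,
      h.leeForm_K hy] at h1
    rw [zero_mul, add_zero, add_zero] at h1
    exact h1.symm
  fin_cases l
  exacts [k 2 rfl, k 3 rfl]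

theorem normSqOne_lee (h : IsLocalToric U σ j K m) (hy : y ∈ U) {w : ℝ}
    (hX : IsOrthFrame (locMetric σ j y) (fun a => tFrame σ j K a y) ![1, 1, w, w]) :
    normSqOne (locMetric σ j y) (leeForm (locMetric σ j) j y)
      = leeN σ j K 0 y ^ 2 + leeN σ j K 1 y ^ 2 := by
  rw [hX.normSqOne_eq (h.isHermitianOn.isInvertible hy)]
  simp [Fin.sum_univ_four, tFrame, h.leeForm_K hy, leeN]

/-- The commutator `[j, j^*]`. -/
theorem commutator_skew (h : IsLocalToric U σ j K m) (hy : y ∈ U) (u v : E4) :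
    locMetric σ j y ((j y ∘L locAdj σ j y - locAdj σ j y ∘L j y) u) v =
      -locMetric σ j y u ((j y ∘L locAdj σ j y - locAdj σ j y ∘L j y) v) := by
  have hj : ∀ u v, locMetric σ j y (j y u) v = -locMetric σ j y u (j y v) :=
    h.isHermitianOn.apply_left hy
  simp only [_root_.sub_apply, ContinuousLinearMap.comp_apply, map_sub, hj,
    h.locMetric_locAdj hy]
  ring

theorem extDerivOne_lee (h : IsLocalToric U σ j K m) (hy : y ∈ U) :
    extDerivOne (leeForm (locMetric σ j) j) y (nField σ j K 0 y) (nField σ j K 1 y) =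
      along (nField σ j K 0) (leeN σ j K 1) y - along (nField σ j K 1) (leeN σ j K 0) y := by
  have k : ∀ i l, along (nField σ j K i) (leeN σ j K l) y = _ := fun i l =>
    along_clm_apply (h.isHermitianOn.contDiffAt_leeForm hy) (h.smoothN l hy)
  rw [k, k, h.commNN 1 0 hy]
  simp only [extDerivOne, along, _root_.sub_apply, ContinuousLinearMap.flip_apply]
  ring

theorem extDerivOne_lee_K (h : IsLocalToric U σ j K m) (hy : y ∈ U) :
    extDerivOne (leeForm (locMetric σ j) j) y (K 0 y) (K 1 y) = 0 := by
  have k : ∀ i l, along (K i) (fun z => leeForm (locMetric σ j) j z (K l z)) y = _ := fun i l =>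
    along_clm_apply (h.isHermitianOn.contDiffAt_leeForm hy) (h.smoothK l y hy)
  have k0 := fun i l => (k i l).symm.trans
    ((along_congr_on h.isOpen (fun z hz => h.leeForm_K hz l) hy).trans (along_const _ _ _))
  have k1 := k0 0 1
  have k2 := k0 1 0
  rw [h.commKK 0 1 y hy] at k1
  simp only [along] at k1 k2
  simp only [extDerivOne, _root_.sub_apply, ContinuousLinearMap.flip_apply]
  linarith

end IsLocalToric

namespace IsLocalToric

variable {U : Set E4} {σ : E4 → E4 →L[ℝ] E4 →L[ℝ] ℝ} {j : E4 → E4 →L[ℝ] E4}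
  {K : Fin 2 → E4 → E4} {m : Fin 2 → E4 → ℝ} {y : E4}

/-- The derivatives of `dlog`. -/
theorem along_N_dlog (h : IsLocalToric U σ j K m) (hy : y ∈ U) (i l : Fin 2) :
    along (nField σ j K l) (IsHoloFrame.dlog (locMetric σ j) K (eField j K) i) y
        * gramDet (locMetric σ j) K y
      + IsHoloFrame.dlog (locMetric σ j) K (eField j K) i y
        * along (nField σ j K l) (gramDet (locMetric σ j) K) y =
      -(along (nField σ j K l) (phi σ j K 0 i) y
          * along (nField σ j K 0) (gramDet (locMetric σ j) K) y
        + phi σ j K 0 i y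
          * along (nField σ j K l) (along (nField σ j K 0) (gramDet (locMetric σ j) K)) y)
      - (along (nField σ j K l) (phi σ j K 1 i) y
          * along (nField σ j K 1) (gramDet (locMetric σ j) K) y
        + phi σ j K 1 i y
          * along (nField σ j K l) (along (nField σ j K 1) (gramDet (locMetric σ j) K)) y) := by
  have hW := h.isHoloFrame.contDiffAt_gramDet h.isHermitianOn hy
  have hL := h.isHoloFrame.contDiffAt_dlog h.isHermitianOn i hy
  have hp := fun k => h.smooth_phi k i hy
  have hN := fun k => contDiffAt_along (h.smoothN k hy) hW
  -- The relation `dlog · gramDet = e_i gramDet`, with `e_i` expanded in the `N`'s, is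
  -- differentiated as a product, which avoids the derivative of a quotient.
  have e : along (nField σ j K l) (fun z => IsHoloFrame.dlog (locMetric σ j) K (eField j K) i z
      * gramDet (locMetric σ j) K z) y = along (nField σ j K l) (fun z =>
        -(phi σ j K 0 i z * along (nField σ j K 0) (gramDet (locMetric σ j) K) z)
        - phi σ j K 1 i z * along (nField σ j K 1) (gramDet (locMetric σ j) K) z) y := by
    refine along_congr_on h.isOpen (fun z hz => ?_) hy
    have hg : gramDet (locMetric σ j) K z ≠ 0 := h.isHoloFrame.gram z hz
    rw [IsHoloFrame.dlog, div_mul_cancel₀ _ hg, h.along_e hz]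
    ring
  rw [along_mul hL hW, along_sub ((hp 0).mul (hN 0)).neg ((hp 1).mul (hN 1)), along_neg,
    along_mul (hp 0) (hN 0), along_mul (hp 1) (hN 1)] at e
  exact e

/-- The derivatives of the equations satisfied by the Lee form. -/
theorem along_leeN_spec (h : IsLocalToric U σ j K m) (hy : y ∈ U) (i l : Fin 2) :
    along (nField σ j K i) (leeN σ j K 0) y * fundNK σ j K 1 l y
        + leeN σ j K 0 y * along (nField σ j K i) (fundNK σ j K 1 l) y
      - (along (nField σ j K i) (leeN σ j K 1) y * fundNK σ j K 0 l y
        + leeN σ j K 1 y * along (nField σ j K i) (fundNK σ j K 0 l) y) =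
      along (nField σ j K i) (along (nField σ j K 0) (fundNK σ j K 1 l)) y
        - along (nField σ j K i) (along (nField σ j K 1) (fundNK σ j K 0 l)) y := by
  have hθ := h.smooth_leeN hy
  have hF := h.smooth_fundNK hy
  have hN := fun k i => contDiffAt_along (h.smoothN k hy) (hF i l)
  rw [← along_mul (hθ 0) (hF 1 l), ← along_mul (hθ 1) (hF 0 l),
    ← along_sub ((hθ 0).mul (hF 1 l)) ((hθ 1).mul (hF 0 l)), ← along_sub (hN 0 1) (hN 1 0)]
  exact along_congr_on h.isOpen (fun z hz => h.leeN_spec hz l) hy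

end IsLocalToric

/-! ### The Hermitian side at a normalized point. -/

namespace IsNormalToric

variable {U : Set E4} {σ : E4 → E4 →L[ℝ] E4 →L[ℝ] ℝ} {j : E4 → E4 →L[ℝ] E4}
  {K : Fin 2 → E4 → E4} {m : Fin 2 → E4 → ℝ} {y : E4} {c A B C E P Q R S T : ℝ}

theorem along_N_zero {f : E4 → ℝ} {v p q r s t : ℝ} (hf : IsJet (tFrame σ j K) f y v p q r s t) :
    along (nField σ j K 0) f y = p := hf.first 0

theorem along_N_one {f : E4 → ℝ} {v p q r s t : ℝ} (hf : IsJet (tFrame σ j K) f y v p q r s t) :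
    along (nField σ j K 1) f y = q := hf.first 1

theorem along_N_zero_zero {f : E4 → ℝ} {v p q r s t : ℝ}
    (hf : IsJet (tFrame σ j K) f y v p q r s t) :
    along (nField σ j K 0) (along (nField σ j K 0) f) y = r := hf.second 0 0

theorem along_N_zero_one {f : E4 → ℝ} {v p q r s t : ℝ}
    (hf : IsJet (tFrame σ j K) f y v p q r s t) :
    along (nField σ j K 0) (along (nField σ j K 1) f) y = s := hf.second 0 1

theorem along_N_one_zero {f : E4 → ℝ} {v p q r s t : ℝ}
    (hf : IsJet (tFrame σ j K) f y v p q r s t) :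
    along (nField σ j K 1) (along (nField σ j K 0) f) y = s := hf.second 1 0

theorem along_N_one_one {f : E4 → ℝ} {v p q r s t : ℝ}
    (hf : IsJet (tFrame σ j K) f y v p q r s t) :
    along (nField σ j K 1) (along (nField σ j K 1) f) y = t := hf.second 1 1

/-- The two derivatives of `log gramDet` along the `jK_i` are converted into derivatives along the
`N_l` by the matrix `-Φ`, all of whose jets are known. -/
theorem hermitianScalar_eq (h : IsNormalToric U σ j K m y c A B C E P Q R S T) :
    hermitianScalar (locMetric σ j) j y =
      -(P + 2 * R + T + 2 * A * C - 2 * B ^ 2 + 2 * B * E - 2 * C ^ 2) * (1 - 2 / (1 + c ^ 2))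
        + ((A + C) ^ 2 + (B + E) ^ 2) * (1 + 1 / (1 + c ^ 2) - 4 / (1 + c ^ 2) ^ 2) := by
  have hk := h.one_add_sq_ne_zero
  have hW := h.jet_gramDet
  have d := fun i l => h.toric.along_N_dlog h.mem i l
  have d0 : ∀ i, IsHoloFrame.dlog (locMetric σ j) K (eField j K) i y = _ := fun i => by
    rw [IsHoloFrame.dlog, h.toric.along_e h.mem]
  have d00 := d 0 0
  have d01 := d 0 1
  have d10 := d 1 0
  have d11 := d 1 1
  simp only [d0, hW.val, along_N_zero hW, along_N_one hW, along_N_zero_zero hW, along_N_zero_one hW,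
    along_N_one_zero hW, along_N_one_one hW, h.jet_phi00.val, h.jet_phi01.val, h.jet_phi10.val,
    h.jet_phi11.val, along_N_zero h.jet_phi00, along_N_zero h.jet_phi01, along_N_zero h.jet_phi10,
    along_N_zero h.jet_phi11, along_N_one h.jet_phi00, along_N_one h.jet_phi01,
    along_N_one h.jet_phi10, along_N_one h.jet_phi11] at d00 d01 d10 d11
  rw [h.toric.isHoloFrame.hermitianScalar_eq h.toric.isHermitianOn
    (fun i z hz => h.toric.along_K_gramDet hz i) h.mem, h.jet_metric00.val, h.jet_metric11.val,
    h.jet_metric01.val, hW.val]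
  simp only [h.toric.along_e h.mem, h.jet_phi00.val, h.jet_phi01.val, h.jet_phi10.val,
    h.jet_phi11.val]
  -- Solves the relations of `along_N_dlog` for the derivatives of `dlog`; at `y` the Gram
  -- determinant is `1 / (1 + c²)²`.
  have s : ∀ {a b e : ℝ}, a * (1 / (1 + c ^ 2) ^ 2) + b = e → a = (e - b) * (1 + c ^ 2) ^ 2 := by
    intro a b e hab
    rw [← hab]
    field_simp
    ring
  rw [s d00, s d01, s d10, s d11]
  field_simp
  ring

/-- The Lee form and its exterior derivative. -/
theorem lee_eq (h : IsNormalToric U σ j K m y c A B C E P Q R S T) :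
    IsLocalToric.leeN σ j K 0 y = -c * (B + E) / (1 + c ^ 2) ∧
    IsLocalToric.leeN σ j K 1 y = c * (A + C) / (1 + c ^ 2) ∧
    along (nField σ j K 0) (IsLocalToric.leeN σ j K 1) y
        - along (nField σ j K 1) (IsLocalToric.leeN σ j K 0) y =
      c * (P + 2 * R + T + 2 * A * C - 2 * B ^ 2 + 2 * B * E - 2 * C ^ 2) / (1 + c ^ 2)
        - c * ((A + C) ^ 2 + (B + E) ^ 2) * (2 + c ^ 2) / (1 + c ^ 2) ^ 2 := by
  have hk := h.one_add_sq_ne_zero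
  have hX := h.smooth_frame
  -- The `n`'s are the numerators of the entries `F(N_i, K_l)` over the common denominator `det Ψ`.
  have n00 := ((h.jet00.mul hX h.jet11).sub hX (h.jet10.mul hX h.jet_psiSym)).of_eq
    (v' := 1) (p' := A + C + c * B) (q' := B + E + c * C)
    (r' := P + R + 2 * A * C - 2 * B ^ 2 + c * Q) (s' := Q + S + A * E - B * C + c * R)
    (t' := R + T + 2 * B * E - 2 * C ^ 2 + c * S)
    (by ring) (by ring) (by ring) (by ring) (by ring) (by ring)
  have n01 := (h.jet00.mul hX (h.jet10.sub hX h.jet_psiSym)).of_eq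
    (v' := -c) (p' := -c * A) (q' := -c * B) (r' := -c * P) (s' := -c * Q) (t' := -c * R)
    (by ring) (by ring) (by ring) (by ring) (by ring) (by ring)
  have n10 := (h.jet11.mul hX (h.jet01.sub hX h.jet_psiSym)).of_eq
    (v' := c) (p' := c * C) (q' := c * E) (r' := c * R) (s' := c * S) (t' := c * T)
    (by ring) (by ring) (by ring) (by ring) (by ring) (by ring)
  have n11 := ((h.jet00.mul hX h.jet11).sub hX (h.jet01.mul hX h.jet_psiSym)).of_eq
    (v' := 1) (p' := A + C - c * B) (q' := B + E - c * C)
    (r' := P + R + 2 * A * C - 2 * B ^ 2 - c * Q) (s' := Q + S + A * E - B * C - c * R)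
    (t' := R + T + 2 * B * E - 2 * C ^ 2 - c * S)
    (by ring) (by ring) (by ring) (by ring) (by ring) (by ring)
  have k : ∀ (i l : Fin 2) {n : E4 → ℝ} {v p q r s t : ℝ},
      IsJet (tFrame σ j K) n y v p q r s t →
      (∀ z ∈ U, IsLocalToric.fundNK σ j K i l z = n z / psiDet σ j K z) → _ :=
    fun i l {n v p q r s t} hn e => (h.jet_div_psiDet hn).congr
      (g := IsLocalToric.fundNK σ j K i l) h.toric.isOpen h.mem e
  have f00 := k 0 0 n00 fun z hz => by
    have h0 := h.toric.psiDet_ne_zero hz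
    simp only [IsLocalToric.fundNK, h.toric.fund_N_K hz, IsLocalToric.metric_K_K,
      h.toric.phi_eq hz, psiSym, Matrix.of_apply, Matrix.cons_val]
    field_simp
    ring
  have f01 := k 0 1 n01 fun z hz => by
    have h0 := h.toric.psiDet_ne_zero hz
    simp only [IsLocalToric.fundNK, h.toric.fund_N_K hz, IsLocalToric.metric_K_K,
      h.toric.phi_eq hz, psiSym, Matrix.of_apply, Matrix.cons_val]
    field_simp
    ring
  have f10 := k 1 0 n10 fun z hz => by
    have h0 := h.toric.psiDet_ne_zero hz
    simp only [IsLocalToric.fundNK, h.toric.fund_N_K hz, IsLocalToric.metric_K_K,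
      h.toric.phi_eq hz, psiSym, Matrix.of_apply, Matrix.cons_val]
    field_simp
    ring
  have f11 := k 1 1 n11 fun z hz => by
    have h0 := h.toric.psiDet_ne_zero hz
    simp only [IsLocalToric.fundNK, h.toric.fund_N_K hz, IsLocalToric.metric_K_K,
      h.toric.phi_eq hz, psiSym, Matrix.of_apply, Matrix.cons_val]
    field_simp
    ring
  -- At `y` the matrix `F(N_i, K_l)` is `[[1, -c], [c, 1]] / (1 + c²)`. The same inversion gives the
  -- Lee form and, from the differentiated equations, its derivatives.
  have solve : ∀ {u v s t : ℝ}, u * (c / (1 + c ^ 2)) - v * (1 / (1 + c ^ 2)) = s →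
      u * (1 / (1 + c ^ 2)) - v * (-c / (1 + c ^ 2)) = t → u = c * s + t ∧ v = c * t - s := by
    intro u v s t hs ht
    rw [← hs, ← ht]
    constructor <;> field_simp <;> ring
  have l0 := h.toric.leeN_spec h.mem 0
  have l1 := h.toric.leeN_spec h.mem 1
  have a := fun i l => h.toric.along_leeN_spec h.mem i l
  have a00 := a 0 0
  have a01 := a 0 1
  have a10 := a 1 0
  have a11 := a 1 1
  simp only [f00.val, f01.val, f10.val, f11.val, along_N_zero f10, along_N_zero f11,
    along_N_one f00, along_N_one f01] at l0 l1
  obtain ⟨t0, t1⟩ := solve l0 l1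
  have t0' : IsLocalToric.leeN σ j K 0 y = -c * (B + E) / (1 + c ^ 2) := by
    rw [t0]; field_simp; ring
  have t1' : IsLocalToric.leeN σ j K 1 y = c * (A + C) / (1 + c ^ 2) := by
    rw [t1]; field_simp; ring
  refine ⟨t0', t1', ?_⟩
  simp only [t0', t1', f00.val, f01.val, f10.val, f11.val, along_N_zero f00, along_N_zero f01,
    along_N_zero f10, along_N_zero f11, along_N_one f00, along_N_one f01, along_N_one f10,
    along_N_one f11, along_N_zero_zero f10, along_N_zero_zero f11,
    along_N_zero_one f00, along_N_zero_one f01, along_N_one_zero f10, along_N_one_zero f11,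
    along_N_one_one f00, along_N_one_one f01] at a00 a01 a10 a11
  have mv : ∀ {u v p q s : ℝ}, u + p - (v + q) = s → u - v = s - p + q := by
    intro u v p q s hs
    linarith
  rw [(solve (mv a00) (mv a01)).2, (solve (mv a10) (mv a11)).1]
  field_simp
  ring

/-- `j` and its adjoint exchange the planes of the `N`'s and of the `K`'s, so the commutator
preserves each. Only `dθ(N₀, N₁)` and `dθ(K₀, K₁)` can enter, and the latter vanishes. -/
theorem commutatorInner_eq (h : IsNormalToric U σ j K m y c A B C E P Q R S T) :
    innerTwo (locMetric σ j y) (formOfEnd (locMetric σ j y)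
        (j y ∘L locAdj σ j y - locAdj σ j y ∘L j y)) (extDerivOne (leeForm (locMetric σ j) j) y) =
      2 * c / (1 + c ^ 2) * (along (nField σ j K 0) (IsLocalToric.leeN σ j K 1) y
        - along (nField σ j K 1) (IsLocalToric.leeN σ j K 0) y) := by
  have hk := h.one_add_sq_ne_zero
  have hy := h.mem
  rw [h.isBlockJet.isOrthFrame.innerTwo_formOfEnd (h.toric.isHermitianOn.isInvertible hy)
    (h.toric.isHermitianOn.symm y hy) (h.toric.commutator_skew hy),
    ← h.toric.extDerivOne_lee hy]
  have sk : ∀ u v, extDerivOne (leeForm (locMetric σ j) j) y u v =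
      -extDerivOne (leeForm (locMetric σ j) j) y v u := by
    intro u v
    simp only [extDerivOne, _root_.sub_apply, ContinuousLinearMap.flip_apply]
    ring
  have s0 : ∀ u, extDerivOne (leeForm (locMetric σ j) j) y u u = 0 := fun u => by
    have := sk u u
    linarith
  simp only [Fin.sum_univ_four, tFrame, Matrix.cons_val, _root_.sub_apply,
    ContinuousLinearMap.comp_apply, map_sub, h.toric.adj_N _ hy, h.toric.adj_K _ hy,
    h.toric.j_N _ hy, map_add, map_smul,
    show ∀ i, j y (K i y) = eField j K i y from fun _ => rfl, h.toric.e_eq _ hy, s0,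
    sk (nField σ j K 1 y) (nField σ j K 0 y), sk (K 1 y) (K 0 y), h.toric.extDerivOne_lee_K hy,
    smul_eq_mul, h.jet00.val, h.jet01.val, h.jet10.val, h.jet11.val, h.jet_phi00.val,
    h.jet_phi01.val, h.jet_phi10.val, h.jet_phi11.val]
  field_simp
  ring

/-- The first formula. -/
theorem hermitian_formula (h : IsNormalToric U σ j K m y c A B C E P Q R S T) :
    hermitianScalar (locMetric σ j) j y
      - (4 - 2 * locAngle σ j y) / (1 - locAngle σ j y)
        * normSqOne (locMetric σ j y) (leeForm (locMetric σ j) j y)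
      + 2 * innerTwo (locMetric σ j y) (formOfEnd (locMetric σ j y)
        (j y ∘L locAdj σ j y - locAdj σ j y ∘L j y)) (extDerivOne (leeForm (locMetric σ j) j) y)
        / (1 - locAngle σ j y) =
    ∑ i, ∑ l, along (nField σ j K i) (along (nField σ j K l) (locQ σ j K i l)) y := by
  have hk := h.one_add_sq_ne_zero
  obtain ⟨t0, t1, t2⟩ := h.lee_eq
  rw [h.sum_locQ, h.commutatorInner_eq, h.hermitianScalar_eq,
    h.toric.normSqOne_lee h.mem h.isBlockJet.isOrthFrame, t0, t1, t2, h.jet_locAngle.val]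
  have e1 : 1 - (c ^ 2 - 1) / (1 + c ^ 2) = 2 / (1 + c ^ 2) := by field_simp; ring
  rw [e1]
  field_simp
  ring

end IsNormalToric

/-! ### Change of basis and the local formulas -/

/-- A constant change of basis of the symmetries, or of their momenta. -/
def mixFun {F : Type*} [AddCommGroup F] [Module ℝ F] (B : Matrix (Fin 2) (Fin 2) ℝ)
    (K : Fin 2 → E4 → F) (i : Fin 2) (z : E4) : F := B i 0 • K 0 z + B i 1 • K 1 z

theorem fderiv_mixFun {F : Type*} [NormedAddCommGroup F] [NormedSpace ℝ F]
    (B : Matrix (Fin 2) (Fin 2) ℝ) {K : Fin 2 → E4 → F} {y : E4}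
    (hK : ∀ i, ContDiffAt ℝ ∞ (K i) y) (i : Fin 2) (v : E4) :
    fderiv ℝ (mixFun B K i) y v = B i 0 • fderiv ℝ (K 0) y v + B i 1 • fderiv ℝ (K 1) y v := by
  have h := fun i => differentiableAt_of_smooth (hK i)
  have e : HasFDerivAt (mixFun B K i) (B i 0 • fderiv ℝ (K 0) y + B i 1 • fderiv ℝ (K 1) y) y :=
    ((h 0).hasFDerivAt.const_smul (B i 0)).add ((h 1).hasFDerivAt.const_smul (B i 1))
  rw [e.fderiv]
  rfl

namespace IsLocalToric

variable {U : Set E4} {σ : E4 → E4 →L[ℝ] E4 →L[ℝ] ℝ} {j : E4 → E4 →L[ℝ] E4}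
  {K : Fin 2 → E4 → E4} {m : Fin 2 → E4 → ℝ} {y : E4}

theorem mix (h : IsLocalToric U σ j K m) {B : Matrix (Fin 2) (Fin 2) ℝ} (hB : B.det ≠ 0) :
    IsLocalToric U σ j (mixFun B K) (mixFun B m) where
  toIsLocalGK := h.toIsLocalGK
  smoothK i y hy := ((h.smoothK 0 y hy).const_smul _).add ((h.smoothK 1 y hy).const_smul _)
  smoothM i y hy := ((h.smoothM 0 y hy).const_smul _).add ((h.smoothM 1 y hy).const_smul _)
  hamiltonian i y hy v := by
    rw [fderiv_mixFun B (fun i => h.smoothM i y hy), h.hamiltonian _ y hy, h.hamiltonian _ y hy]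
    simp [mixFun]
    ring
  invariant i l y hy := by
    rw [fderiv_mixFun B (fun i => h.smoothM i y hy)]
    simp [mixFun, h.invariant _ _ y hy]
  commKK i l y hy := by
    have e : ∀ i l, along (mixFun B K i) (mixFun B K l) y = _ := fun i l =>
      fderiv_mixFun B (fun i => h.smoothK i y hy) l _
    have c : fderiv ℝ (K 0) y (K 1 y) = fderiv ℝ (K 1) y (K 0 y) := h.commKK 1 0 y hy
    rw [e, e]
    simp only [mixFun, map_add, map_smul, c]
    module
  invJ i y hy v := by
    rw [fderiv_mixFun B (fun i => h.smoothK i y hy), fderiv_mixFun B (fun i => h.smoothK i y hy),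
      h.invJ _ y hy, h.invJ _ y hy]
    simp only [mixFun, map_add, map_smul, _root_.add_apply, _root_.smul_apply]
    module
  indep y hy a b hab := by
    rw [Matrix.det_fin_two] at hB
    obtain ⟨h0, h1⟩ := h.indep y hy (a * B 0 0 + b * B 1 0) (a * B 0 1 + b * B 1 1)
      (by simp only [mixFun] at hab; rw [← hab]; module)
    exact ⟨mul_right_cancel₀ hB (by linear_combination B 1 1 * h0 - B 1 0 * h1),
      mul_right_cancel₀ hB (by linear_combination B 0 0 * h1 - B 0 1 * h0)⟩
  anti i y hy := by
    rw [Matrix.det_fin_two] at hB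
    obtain ⟨a, b, h0⟩ := h.anti 0 y hy
    obtain ⟨c, d, h1⟩ := h.anti 1 y hy
    obtain ⟨Δ, hΔ⟩ : ∃ Δ, Δ = B 0 0 * B 1 1 - B 0 1 * B 1 0 := ⟨_, rfl⟩
    rw [← hΔ] at hB
    -- The coordinates of the orbit vector in the old basis, multiplied by the inverse of `B`.
    refine ⟨((B i 0 * a + B i 1 * c) * B 1 1 - (B i 0 * b + B i 1 * d) * B 1 0) / Δ,
      ((B i 0 * b + B i 1 * d) * B 0 0 - (B i 0 * a + B i 1 * c) * B 0 1) / Δ, ?_⟩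
    simp only [mixFun]
    rw [map_add, map_smul, map_smul, h0, h1, ← map_smul, ← map_smul, ← map_add]
    congr 1
    simp only [smul_add, smul_smul]
    match_scalars <;> field_simp <;> rw [hΔ] <;> ring

/-- A vector is determined by its pairings with the `K_i` and the `N_i`. -/
theorem eq_of_form (h : IsLocalToric U σ j K m) (hy : y ∈ U) {v w : E4}
    (hK : ∀ i, σ y (K i y) v = σ y (K i y) w)
    (hN : ∀ i, σ y (nField σ j K i y) v = σ y (nField σ j K i y) w) : v = w := by
  rw [← sub_eq_zero]
  by_contra h0
  have ht := h.tamed y hy _ h0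
  rw [h.skew hy] at ht
  obtain ⟨a, b, c, d, e⟩ := h.exists_combination hy (j y (v - w))
  rw [e] at ht
  simp [hK, hN] at ht

/-- The `N_l` are dual to the momenta, so they transform by the inverse transpose of `B`. The proof
compares pairings with the `K_i` and with the `N_i`, which determine a vector. -/
theorem nField_mix (h : IsLocalToric U σ j K m) {B : Matrix (Fin 2) (Fin 2) ℝ} (hB : B.det ≠ 0)
    (hy : y ∈ U) (l : Fin 2) : nField σ j (mixFun B K) l y =
      mixFun (B.det⁻¹ • !![B 1 1, -B 1 0; -B 0 1, B 0 0]) (nField σ j K) l y := by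
  have h' := h.mix hB
  have hd := hB
  rw [Matrix.det_fin_two] at hd
  have eE : ∀ i, eField j (mixFun B K) i y = B i 0 • eField j K 0 y + B i 1 • eField j K 1 y := by
    intro i
    simp only [eField, mixFun, map_add, map_smul]
  refine h.eq_of_form hy (fun i => ?_) fun i => ?_
  · have k0 := h'.form_K_N 0 l hy
    have k1 := h'.form_K_N 1 l hy
    rw [show mixFun B K 0 y = B 0 0 • K 0 y + B 0 1 • K 1 y from rfl] at k0
    rw [show mixFun B K 1 y = B 1 0 • K 0 y + B 1 1 • K 1 y from rfl] at k1
    simp only [map_add, map_smul, _root_.add_apply, _root_.smul_apply, smul_eq_mul] at k0 k1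
    simp only [mixFun, map_add, map_smul, h.form_K_N _ _ hy, smul_eq_mul, Matrix.smul_apply,
      Matrix.det_fin_two, Matrix.of_apply]
    generalize nField σ j (mixFun B K) l y = n at *
    fin_cases i <;> fin_cases l <;> simp at k0 k1 ⊢ <;> field_simp <;>
      first
      | linear_combination B 1 1 * k0 - B 0 1 * k1
      | linear_combination B 0 0 * k1 - B 1 0 * k0
  · simp only [mixFun, map_add, map_smul, h.form_N_N _ _ hy]
    have eN : nField σ j (mixFun B K) l y =
        (-psi σ j (mixFun B K) 0 l y) • (B 0 0 • eField j K 0 y + B 0 1 • eField j K 1 y)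
        + (-psi σ j (mixFun B K) 1 l y) • (B 1 0 • eField j K 0 y + B 1 1 • eField j K 1 y) := by
      rw [← eE, ← eE]; rfl
    rw [eN]
    simp [nField, h.form_e_e _ _ hy]

theorem smooth_locQ (h : IsLocalToric U σ j K m) (hy : y ∈ U) (i l : Fin 2) :
    ContDiffAt ℝ ∞ (locQ σ j K i l) y :=
  contDiffAt_comp₂ (h.smooth_form y hy)
    (((contDiffAt_inverse ((h.smooth_str y hy).sub (h.contDiffAt_locAdj hy))
      (h.isInvertible_sub hy)).const_smul _).clm_apply (h.smoothK i y hy)) (h.smoothK l y hy)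

theorem locQ_mix (B : Matrix (Fin 2) (Fin 2) ℝ) (i l : Fin 2) : locQ σ j (mixFun B K) i l y =
    B i 0 * (B l 0 * locQ σ j K 0 0 y + B l 1 * locQ σ j K 0 1 y)
      + B i 1 * (B l 0 * locQ σ j K 1 0 y + B l 1 * locQ σ j K 1 1 y) := by
  simp only [locQ, mixFun, map_add, map_smul, _root_.add_apply, _root_.smul_apply, smul_eq_mul]
  ring

/-- `Q` transforms by `B` in both indices and the derivatives by its inverse transpose, so the
double contraction is invariant. -/
theorem sum_locQ_mix (h : IsLocalToric U σ j K m) {B : Matrix (Fin 2) (Fin 2) ℝ} (hB : B.det ≠ 0)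
    (hy : y ∈ U) :
    ∑ i, ∑ l, along (nField σ j (mixFun B K) i) (along (nField σ j (mixFun B K) l)
      (locQ σ j (mixFun B K) i l)) y =
    ∑ i, ∑ l, along (nField σ j K i) (along (nField σ j K l) (locQ σ j K i l)) y := by
  have hd := hB
  set C : Matrix (Fin 2) (Fin 2) ℝ := B.det⁻¹ • !![B 1 1, -B 1 0; -B 0 1, B 0 0] with hC
  have hN : ∀ l (f : E4 → ℝ), ∀ z ∈ U, along (nField σ j (mixFun B K) l) f z =
      C l 0 * along (nField σ j K 0) f z + C l 1 * along (nField σ j K 1) f z := by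
    intro l f z hz
    simp only [along, h.nField_mix hB hz l, mixFun, map_add, map_smul, smul_eq_mul, ← hC]
  have s := fun k i l (z) (hz : z ∈ U) => contDiffAt_along (h.smoothN k hz) (h.smooth_locQ hz i l)
  have hQ : ∀ i l a, ∀ z ∈ U, along (nField σ j K a) (locQ σ j (mixFun B K) i l) z =
      B i 0 * (B l 0 * along (nField σ j K a) (locQ σ j K 0 0) z
        + B l 1 * along (nField σ j K a) (locQ σ j K 0 1) z)
      + B i 1 * (B l 0 * along (nField σ j K a) (locQ σ j K 1 0) z
        + B l 1 * along (nField σ j K a) (locQ σ j K 1 1) z) := by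
    intro i l a z hz
    have q := fun i l => h.smooth_locQ hz i l
    have c : ∀ i l (x : ℝ), ContDiffAt ℝ ∞ (fun z => x * locQ σ j K i l z) z := fun i l x =>
      contDiffAt_const.mul (q i l)
    rw [along_congr_on h.isOpen (fun z _ => locQ_mix B i l) hz,
      along_add (contDiffAt_const.mul ((c 0 0 _).add (c 0 1 _)))
        (contDiffAt_const.mul ((c 1 0 _).add (c 1 1 _))),
      along_const_mul _ ((c 0 0 _).add (c 0 1 _)), along_const_mul _ ((c 1 0 _).add (c 1 1 _)),
      along_add (c 0 0 _) (c 0 1 _), along_add (c 1 0 _) (c 1 1 _), along_const_mul _ (q 0 0),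
      along_const_mul _ (q 0 1), along_const_mul _ (q 1 0), along_const_mul _ (q 1 1)]
  have hNQ : ∀ i l a b, along (nField σ j K a)
      (along (nField σ j K b) (locQ σ j (mixFun B K) i l)) y =
      B i 0 * (B l 0 * along (nField σ j K a) (along (nField σ j K b) (locQ σ j K 0 0)) y
        + B l 1 * along (nField σ j K a) (along (nField σ j K b) (locQ σ j K 0 1)) y)
      + B i 1 * (B l 0 * along (nField σ j K a) (along (nField σ j K b) (locQ σ j K 1 0)) y
        + B l 1 * along (nField σ j K a) (along (nField σ j K b) (locQ σ j K 1 1)) y) := by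
    intro i l a b
    have q := fun i l => s b i l y hy
    have c : ∀ i l (x : ℝ), ContDiffAt ℝ ∞ (fun z => x * along (nField σ j K b)
      (locQ σ j K i l) z) y := fun i l x => contDiffAt_const.mul (q i l)
    rw [along_congr_on h.isOpen (hQ i l b) hy,
      along_add (contDiffAt_const.mul ((c 0 0 _).add (c 0 1 _)))
        (contDiffAt_const.mul ((c 1 0 _).add (c 1 1 _))),
      along_const_mul _ ((c 0 0 _).add (c 0 1 _)), along_const_mul _ ((c 1 0 _).add (c 1 1 _)),
      along_add (c 0 0 _) (c 0 1 _), along_add (c 1 0 _) (c 1 1 _), along_const_mul _ (q 0 0),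
      along_const_mul _ (q 0 1), along_const_mul _ (q 1 0), along_const_mul _ (q 1 1)]
  have hNN : ∀ i l, along (nField σ j (mixFun B K) i) (along (nField σ j (mixFun B K) l)
      (locQ σ j (mixFun B K) i l)) y =
      C i 0 * (C l 0 * along (nField σ j K 0) (along (nField σ j K 0) (locQ σ j (mixFun B K) i l)) y
        + C l 1 * along (nField σ j K 0) (along (nField σ j K 1) (locQ σ j (mixFun B K) i l)) y)
      + C i 1 * (C l 0 * along (nField σ j K 1) (along (nField σ j K 0)
          (locQ σ j (mixFun B K) i l)) y
        + C l 1 * along (nField σ j K 1) (along (nField σ j K 1)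
          (locQ σ j (mixFun B K) i l)) y) := by
    intro i l
    have q := fun k => contDiffAt_along (h.smoothN k hy) ((h.mix hB).smooth_locQ hy i l)
    have c : ∀ k (x : ℝ), ContDiffAt ℝ ∞ (fun z => x * along (nField σ j K k)
      (locQ σ j (mixFun B K) i l) z) y := fun k x => contDiffAt_const.mul (q k)
    rw [hN i _ y hy, along_congr_on h.isOpen (hN l _) hy, along_congr_on h.isOpen (hN l _) hy,
      along_add (c 0 _) (c 1 _), along_add (c 0 _) (c 1 _), along_const_mul _ (q 0),
      along_const_mul _ (q 1), along_const_mul _ (q 0), along_const_mul _ (q 1)]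
  simp only [Fin.sum_univ_two, hNN, hNQ]
  simp only [hC, Matrix.smul_apply, Matrix.of_apply, Matrix.cons_val, smul_eq_mul]
  obtain ⟨Δ, hΔ⟩ : ∃ Δ, Δ = B.det := ⟨_, rfl⟩
  rw [← hΔ] at hd ⊢
  rw [Matrix.det_fin_two] at hΔ
  field_simp
  rw [hΔ]
  ring

/-- After a change of basis, the symmetric part of `Ψ` at a given point is the identity. -/
theorem exists_isNormalToric (h : IsLocalToric U σ j K m) (hy : y ∈ U) :
    ∃ B : Matrix (Fin 2) (Fin 2) ℝ, B.det ≠ 0 ∧ ∃ c A B' C E P Q R S T : ℝ,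
      IsNormalToric U σ j (mixFun B K) (mixFun B m) y c A B' C E P Q R S T := by
  have hp := h.isHermitianOn.posDef y hy
  set a := locMetric σ j y (nField σ j K 0 y) (nField σ j K 0 y) with ha
  set b := locMetric σ j y (nField σ j K 0 y) (nField σ j K 1 y) with hb
  set d := locMetric σ j y (nField σ j K 1 y) (nField σ j K 1 y) with hd
  have hs : locMetric σ j y (nField σ j K 1 y) (nField σ j K 0 y) = b :=
    h.isHermitianOn.symm y hy _ _
  have hN : ∀ x z : ℝ, x • nField σ j K 0 y + z • nField σ j K 1 y = 0 → x = 0 ∧ z = 0 := by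
    intro x z hxz
    have e : ∀ i, σ y (K i y) (x • nField σ j K 0 y + z • nField σ j K 1 y) = 0 := fun i => by
      rw [hxz, map_zero]
    have e0 := e 0
    have e1 := e 1
    simp only [map_add, map_smul, h.form_K_N _ _ hy] at e0 e1
    simpa using And.intro e0 e1
  have a0 : 0 < a := hp _ fun h0 => one_ne_zero (hN 1 0 (by simp [h0])).1
  have a1 : 0 < d - b ^ 2 / a := by
    have := hp ((-b / a) • nField σ j K 0 y + (1 : ℝ) • nField σ j K 1 y) fun h0 =>
      one_ne_zero (hN _ _ h0).2
    simp only [map_add, map_smul, _root_.add_apply, _root_.smul_apply, smul_eq_mul, hs, ← ha, ← hb,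
      ← hd] at this
    refine lt_of_lt_of_eq this ?_
    field_simp
    ring
  obtain ⟨r, r0, hr⟩ : ∃ r : ℝ, 0 < r ∧ r ^ 2 = a := ⟨√a, Real.sqrt_pos.2 a0, Real.sq_sqrt a0.le⟩
  obtain ⟨s, s0, hs'⟩ : ∃ s : ℝ, 0 < s ∧ s ^ 2 = d - b ^ 2 / a :=
    ⟨√(d - b ^ 2 / a), Real.sqrt_pos.2 a1, Real.sq_sqrt a1.le⟩
  -- A Cholesky factor: the Gram matrix of the `N`'s equals `BᵀB` for `B = !![r, b / r; 0, s]`, and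
  -- the new `N`'s, obtained by `B⁻ᵀ`, are orthonormal at `y`.
  have hdet : (!![r, b / r; 0, s] : Matrix (Fin 2) (Fin 2) ℝ).det = r * s := by
    simp [Matrix.det_fin_two]
  have hB : (!![r, b / r; 0, s] : Matrix (Fin 2) (Fin 2) ℝ).det ≠ 0 := by
    rw [hdet]; positivity
  have h' := h.mix hB
  have m' := fun i l => h'.metric_N_N hy i l
  have n0 := h.nField_mix hB hy 0
  have n1 := h.nField_mix hB hy 1
  simp only [mixFun, hdet, Matrix.smul_apply, Matrix.of_apply, Matrix.cons_val, smul_eq_mul,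
    mul_zero, neg_zero, zero_smul, add_zero] at n0 n1
  have e00 := m' 0 0
  have e01 := m' 0 1
  have e11 := m' 1 1
  change locMetric σ j y (nField σ j (mixFun _ K) 0 y) (nField σ j (mixFun _ K) 0 y) = _ at e00
  rw [n0] at e00 e01
  rw [n1] at e01 e11
  simp only [map_add, map_smul, _root_.add_apply, _root_.smul_apply, smul_eq_mul, hs, ← ha, ← hb,
      ← hd] at e00 e01 e11
  obtain ⟨A, B', C, E, P, Q, R, S, T, j00, j01, j10, j11⟩ := h'.exists_jet_psi hy
  have v00 : psi σ j (mixFun !![r, b / r; 0, s] K) 0 0 y = 1 := by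
    have : psi σ j (mixFun !![r, b / r; 0, s] K) 0 0 y = a / r ^ 2 := by
      field_simp at e00 ⊢
      linarith
    rw [this, hr, div_self a0.ne']
  have v11 : psi σ j (mixFun !![r, b / r; 0, s] K) 1 1 y = 1 := by
    have : psi σ j (mixFun !![r, b / r; 0, s] K) 1 1 y = (d - b ^ 2 / a) / s ^ 2 := by
      rw [← hr] at e11 ⊢
      field_simp at e11 ⊢
      linarith
    rw [this, hs', div_self a1.ne']
  have v10 : psi σ j (mixFun !![r, b / r; 0, s] K) 1 0 y
      = -psi σ j (mixFun !![r, b / r; 0, s] K) 0 1 y := by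
    rw [← hr] at e01
    field_simp at e01
    have := (mul_eq_zero.1 (e01.symm.trans (by ring))).resolve_left (mul_pos r0 s0).ne'
    linarith
  refine ⟨_, hB, _, A, B', C, E, P, Q, R, S, T, h', hy, ?_, j01, ?_, ?_⟩
  · rwa [v00] at j00
  · rwa [v10] at j10
  · rwa [v11] at j11

/-- The first formula for a local toric structure. -/
theorem hermitian_formula (h : IsLocalToric U σ j K m) (hy : y ∈ U) :
    ∑ i, ∑ l, along (nField σ j K i) (along (nField σ j K l) (locQ σ j K i l)) y =
    hermitianScalar (locMetric σ j) j y
      - (4 - 2 * locAngle σ j y) / (1 - locAngle σ j y)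
        * normSqOne (locMetric σ j y) (leeForm (locMetric σ j) j y)
      + 2 * innerTwo (locMetric σ j y) (formOfEnd (locMetric σ j y)
        (j y ∘L locAdj σ j y - locAdj σ j y ∘L j y)) (extDerivOne (leeForm (locMetric σ j) j) y)
        / (1 - locAngle σ j y) := by
  obtain ⟨B, hB, c, A, B', C, E, P, Q, R, S, T, h'⟩ := h.exists_isNormalToric hy
  rw [← h.sum_locQ_mix hB hy, h'.hermitian_formula]

/-- The second formula for a local toric structure. -/
theorem riemannian_formula (h : IsLocalToric U σ j K m) (hy : y ∈ U) :
    ∑ i, ∑ l, along (nField σ j K i) (along (nField σ j K l) (locQ σ j K i l)) y =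
    scalarCurvature (locMetric σ j) y
      + 2 * laplacian (locMetric σ j) (locAngle σ j) y / (1 - locAngle σ j y)
      - 1 / (1 - locAngle σ j y ^ 2) * ((4 + 2 * locAngle σ j y) / (1 - locAngle σ j y) - 1 / 2)
        * normSqOne (locMetric σ j y) (fderiv ℝ (locAngle σ j) y) := by
  obtain ⟨B, hB, c, A, B', C, E, P, Q, R, S, T, h'⟩ := h.exists_isNormalToric hy
  rw [← h.sum_locQ_mix hB hy, h'.riemannian_formula]

end IsLocalToric

/-! ### Germs and continuity -/

section Germ

variable {G G' : E4 → E4 →L[ℝ] E4 →L[ℝ] ℝ} {J J' : E4 → E4 →L[ℝ] E4} {y : E4}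

/-- The defining predicates depend only on the germ of the metric and are equal as predicates, so
the two `epsilon` choices coincide without any uniqueness argument. -/
theorem leviCivita_congr (h : G =ᶠ[𝓝 y] G') : leviCivita G y = leviCivita G' y := by
  have : IsLeviCivitaAt G y = IsLeviCivitaAt G' y := by
    funext Γ
    simp only [IsLeviCivitaAt]
    rw [h.fderiv_eq, h.eq_of_nhds]
  rw [leviCivita, leviCivita, this]

theorem chern_congr (h : G =ᶠ[𝓝 y] G') (hJ : J =ᶠ[𝓝 y] J') : chern G J y = chern G' J' y := by
  have : IsChernAt G J y = IsChernAt G' J' y := by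
    funext Γ
    simp only [IsChernAt]
    rw [h.fderiv_eq, h.eq_of_nhds, hJ.fderiv_eq, hJ.eq_of_nhds]
  rw [chern, chern, this]

theorem fundForm_congr (h : G =ᶠ[𝓝 y] G') (hJ : J =ᶠ[𝓝 y] J') :
    fundForm G J =ᶠ[𝓝 y] fundForm G' J' := by
  filter_upwards [h, hJ] with z h1 h2
  simp only [fundForm, h1, h2]

theorem leeForm_congr (h : G =ᶠ[𝓝 y] G') (hJ : J =ᶠ[𝓝 y] J') : leeForm G J y = leeForm G' J' y := by
  have e := fundForm_congr h hJ
  simp only [leeForm, extDerivTwo]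
  rw [e.fderiv_eq, e.eq_of_nhds]

theorem leeForm_eventuallyEq (h : G =ᶠ[𝓝 y] G') (hJ : J =ᶠ[𝓝 y] J') :
    leeForm G J =ᶠ[𝓝 y] leeForm G' J' := by
  filter_upwards [h.eventuallyEq_nhds, hJ.eventuallyEq_nhds] with z h1 h2
  exact leeForm_congr h1 h2

theorem scalarCurvature_congr (h : G =ᶠ[𝓝 y] G') : scalarCurvature G y = scalarCurvature G' y := by
  have e : leviCivita G =ᶠ[𝓝 y] leviCivita G' :=
    h.eventuallyEq_nhds.mono fun z hz => leviCivita_congr hz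
  have : ricci G y = ricci G' y := by
    funext v w
    simp only [ricci, curvature_congr e]
  rw [scalarCurvature, scalarCurvature, this, h.eq_of_nhds]

theorem laplacian_congr (h : G =ᶠ[𝓝 y] G') {f f' : E4 → ℝ} (hf : f =ᶠ[𝓝 y] f') :
    laplacian G f y = laplacian G' f' y := by
  simp only [laplacian]
  rw [leviCivita_congr h, h.eq_of_nhds, hf.fderiv_eq, (hf.fderiv (𝕜 := ℝ)).fderiv_eq]

theorem hermitianScalar_congr (h : G =ᶠ[𝓝 y] G') (hJ : J =ᶠ[𝓝 y] J') :
    hermitianScalar G J y = hermitianScalar G' J' y := by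
  have e : chern G J =ᶠ[𝓝 y] chern G' J' := by
    filter_upwards [h.eventuallyEq_nhds, hJ.eventuallyEq_nhds] with z h1 h2
    exact chern_congr h1 h2
  have : chernRicci G J y = chernRicci G' J' y := by
    funext u v
    simp only [chernRicci, curvature_congr e, hJ.eq_of_nhds]
  rw [hermitianScalar, hermitianScalar, this, (fundForm_congr h hJ).eq_of_nhds]

end Germ

theorem continuousAt_trace {T : E4 → E4 →L[ℝ] E4} {y : E4} (hT : ContinuousAt T y) :
    ContinuousAt (fun z => LinearMap.trace ℝ E4 (T z : E4 →ₗ[ℝ] E4)) y := by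
  simp only [trace_eq_sum]
  refine tendsto_finsetSum _ fun i _ => ?_
  exact (EuclideanSpace.proj (𝕜 := ℝ) i).continuous.continuousAt.comp
    (hT.clm_apply continuousAt_const)

/-- A positive definite form has an orthogonal frame. -/
theorem exists_isOrthFrame {G : E4 →L[ℝ] E4 →L[ℝ] ℝ} (hs : ∀ u v, G u v = G v u)
    (hp : ∀ v, v ≠ 0 → 0 < G v v) : ∃ X d, IsOrthFrame G X d ∧ ∀ a, 0 < d a := by
  let B : LinearMap.BilinForm ℝ E4 := toBilin G
  have hB : LinearMap.IsSymm B := ⟨fun u v => hs u v⟩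
  obtain ⟨v, hv⟩ := LinearMap.BilinForm.exists_orthogonal_basis hB
  let w := v.reindex (finCongr (by simp : Module.finrank ℝ E4 = 4))
  have hpos : ∀ a, 0 < G (w a) (w a) := fun a => hp _ (w.ne_zero a)
  refine ⟨w, fun a => G (w a) (w a), ⟨fun a b => ?_, fun a => (hpos a).ne'⟩, hpos⟩
  split_ifs with hab
  · rw [hab]
  · have : (finCongr (by simp : Module.finrank ℝ E4 = 4)).symm a ≠ (finCongr (by simp)).symm b :=
      fun h0 => hab (Equiv.injective _ h0)
    have h0 : B _ _ = 0 := hv this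
    simpa [w, B, toBilin_apply] using h0

namespace IsLocalGK

variable {U : Set E4} {σ : E4 → E4 →L[ℝ] E4 →L[ℝ] ℝ} {j : E4 → E4 →L[ℝ] E4} {y : E4}

/-- The endomorphism `A = j - j^*` is skew for the metric and injective, so `tr A² < 0`, while `tr
A² = 8p - 8`. -/
theorem locAngle_lt_one (h : IsLocalGK U σ j) (hy : y ∈ U) : locAngle σ j y < 1 := by
  obtain ⟨X, d, hX, hd⟩ := exists_isOrthFrame (h.isHermitianOn.symm y hy)
    (h.isHermitianOn.posDef y hy)
  set A := j y - locAdj σ j y with hA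
  have hsk : ∀ u v, locMetric σ j y (A u) v = -locMetric σ j y u (A v) := by
    intro u v
    rw [hA, _root_.sub_apply, _root_.sub_apply, map_sub, map_sub, _root_.sub_apply,
      h.locMetric_locAdj hy, h.isHermitianOn.apply_left hy]
    ring
  have hinj : ∀ a, A (X a) ≠ 0 := by
    intro a ha
    have hz : X a = 0 := by
      have := congrArg (ContinuousLinearMap.inverse A) ha
      rw [map_zero] at this
      rw [← this]
      exact ((h.isInvertible_sub hy).inverse_apply_eq.2 rfl).symm
    have := hX.apply a a
    rw [hz] at this
    simp at this
    exact hX.ne_zero a this.symm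
  have h1 := hX.trace_eq (A ∘L A : E4 →L[ℝ] E4)
  have h2 : ∀ a, locMetric σ j y (X a) ((A ∘L A) (X a)) / d a < 0 := by
    intro a
    have e : locMetric σ j y (X a) (A (A (X a))) = -locMetric σ j y (A (X a)) (A (X a)) := by
      rw [hsk, neg_neg]
    change locMetric σ j y (X a) (A (A (X a))) / d a < 0
    rw [e]
    exact div_neg_of_neg_of_pos (neg_neg_of_pos (h.isHermitianOn.posDef y hy _ (hinj a))) (hd a)
  have h3 : LinearMap.trace ℝ E4 ((A ∘L A : E4 →L[ℝ] E4) : E4 →ₗ[ℝ] E4) < 0 := by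
    rw [h1]
    exact Finset.sum_neg (fun a _ => h2 a) ⟨0, Finset.mem_univ _⟩
  have h4 : A ∘L A = (-2 : ℝ) • ContinuousLinearMap.id ℝ E4
      - (j y ∘L locAdj σ j y + locAdj σ j y ∘L j y) := by
    ext1 v
    simp only [hA, ContinuousLinearMap.comp_apply, _root_.sub_apply, map_sub, h.sq y hy,
      h.locAdj_sq hy, _root_.smul_apply, _root_.add_apply, ContinuousLinearMap.id_apply]
    module
  rw [h4] at h3
  simp only [ContinuousLinearMap.toLinearMap_add, map_add, ContinuousLinearMap.toLinearMap_comp,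
    ContinuousLinearMap.toLinearMap_smul, map_smul, ContinuousLinearMap.coe_id,
    ContinuousLinearMap.toLinearMap_sub, map_sub, LinearMap.trace_id] at h3
  rw [LinearMap.trace_comp_comm' (j y : E4 →ₗ[ℝ] E4)] at h3
  rw [locAngle, ContinuousLinearMap.toLinearMap_comp]
  simp at h3
  linarith

end IsLocalGK

/-- The right hand side of the first formula. -/
def hermitianSide (σ : E4 → E4 →L[ℝ] E4 →L[ℝ] ℝ) (j : E4 → E4 →L[ℝ] E4) (y : E4) : ℝ :=
  hermitianScalar (locMetric σ j) j y
    - (4 - 2 * locAngle σ j y) / (1 - locAngle σ j y)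
      * normSqOne (locMetric σ j y) (leeForm (locMetric σ j) j y)
    + 2 * innerTwo (locMetric σ j y) (formOfEnd (locMetric σ j y)
      (j y ∘L locAdj σ j y - locAdj σ j y ∘L j y)) (extDerivOne (leeForm (locMetric σ j) j) y)
      / (1 - locAngle σ j y)

/-- The only angle denominator is `1 - p`, positive everywhere, so this side makes sense and is
continuous across the nonfree points. The second formula involves `1 - p²` and has no such
continuity in general. -/
theorem IsLocalGK.continuousAt_hermitianSide {U : Set E4} {σ : E4 → E4 →L[ℝ] E4 →L[ℝ] ℝ}
    {j : E4 → E4 →L[ℝ] E4} (h : IsLocalGK U σ j) {y : E4} (hy : y ∈ U) :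
    ContinuousAt (hermitianSide σ j) y := by
  have hp : ContinuousAt (locAngle σ j) y := (h.contDiffAt_locAngle hy).continuousAt
  have h1 : 1 - locAngle σ j y ≠ 0 := (sub_pos.2 (h.locAngle_lt_one hy)).ne'
  have hH := h.isHermitianOn
  have hG := hH.smooth y hy
  have hGi : ContinuousAt (fun z => (locMetric σ j z).inverse) y :=
    (contDiffAt_inverse hG (hH.isInvertible hy)).continuousAt
  have hθ := hH.contDiffAt_leeForm hy
  have hdθ : ContinuousAt (extDerivOne (leeForm (locMetric σ j) j)) y := by
    have := (contDiffAt_fderiv hθ).continuousAt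
    exact this.sub ((ContinuousLinearMap.flipₗᵢ ℝ E4 E4 ℝ).continuous.continuousAt.comp this)
  have hj := (h.smooth_str y hy).continuousAt
  have hj' := (h.contDiffAt_locAdj hy).continuousAt
  refine ((hH.continuousAt_hermitianScalar hy).sub (((continuousAt_const.sub
    (continuousAt_const.mul hp)).div (continuousAt_const.sub hp) h1).mul ?_)).add
    ((continuousAt_const.mul ?_).div (continuousAt_const.sub hp) h1)
  · exact hθ.continuousAt.clm_apply (hGi.clm_apply hθ.continuousAt)
  · refine continuousAt_const.mul (continuousAt_trace ?_)
    exact (hGi.clm_comp (hG.continuousAt.clm_comp ((hj.clm_comp hj').sub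
      (hj'.clm_comp hj)))).clm_comp (hGi.clm_comp hdθ)

/-! ### Tensor fields in a chart -/

section Chart

variable {M : Type*} [TopologicalSpace M] [ChartedSpace E4 M]

/-- The derivative of the inverse of the preferred chart at `x`. -/
def chartD (x : M) (y : E4) : E4 →L[ℝ] E4 :=
  mfderiv 𝓘(ℝ, E4) (𝓡 4) (extChartAt (𝓡 4) x).symm y

/-- The derivative of the preferred chart at `x`, as a function of the coordinates. -/
def chartI (x : M) (y : E4) : E4 →L[ℝ] E4 :=
  mfderiv (𝓡 4) 𝓘(ℝ, E4) (extChartAt (𝓡 4) x) ((extChartAt (𝓡 4) x).symm y)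

/-- The value of a field of bilinear forms, on the model space. -/
def bilinAt (B : BilinField M) (z : M) : E4 →L[ℝ] E4 →L[ℝ] ℝ := B z

/-- The value of a field of endomorphisms, on the model space. -/
def endAt (A : EndField M) (z : M) : E4 →L[ℝ] E4 := A z

theorem chartBilin_apply (B : BilinField M) (x : M) (y u v : E4) :
    chartBilin B x y u v = bilinAt B ((extChartAt (𝓡 4) x).symm y) (chartD x y u) (chartD x y v) :=
  rfl

theorem chartEnd_apply (A : EndField M) (x : M) (y u : E4) :
    chartEnd A x y u = chartI x y (endAt A ((extChartAt (𝓡 4) x).symm y) (chartD x y u)) := rfl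

theorem mem_chart_source {x : M} {y : E4} (hy : y ∈ (extChartAt (𝓡 4) x).target) :
    (extChartAt (𝓡 4) x).symm y ∈ (chartAt E4 x).source := by
  rw [← extChartAt_source (𝓡 4)]
  exact (extChartAt (𝓡 4) x).map_target hy

theorem chart_target_mem_nhds {x : M} {y : E4} (hy : y ∈ (extChartAt (𝓡 4) x).target) :
    (extChartAt (𝓡 4) x).target ∈ 𝓝 y := (isOpen_extChartAt_target x).mem_nhds hy

variable [IsManifold (𝓡 4) ∞ M]

instance isManifold_two : IsManifold (𝓡 4) 2 M := .of_le (n := ∞) ENat.LEInfty.out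
instance isManifold_one : IsManifold (𝓡 4) 1 M := .of_le (n := ∞) ENat.LEInfty.out

theorem chartI_chartD (x : M) {y : E4} (hy : y ∈ (extChartAt (𝓡 4) x).target) (u : E4) :
    chartI x y (chartD x y u) = u := by
  have := mfderiv_extChartAt_comp_mfderivWithin_extChartAt_symm (I := 𝓡 4) hy
  rw [ModelWithCorners.range_eq_univ, mfderivWithin_univ] at this
  exact congrArg (fun T : E4 →L[ℝ] E4 => T u) this

theorem chartD_chartI (x : M) {y : E4} (hy : y ∈ (extChartAt (𝓡 4) x).target) (u : E4) :
    chartD x y (chartI x y u) = u := by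
  have := mfderivWithin_extChartAt_symm_comp_mfderiv_extChartAt (I := 𝓡 4) hy
  rw [ModelWithCorners.range_eq_univ, mfderivWithin_univ] at this
  exact congrArg (fun T : E4 →L[ℝ] E4 => T u) this

theorem contMDiffAt_chart_symm (x : M) {y : E4} (hy : y ∈ (extChartAt (𝓡 4) x).target) :
    ContMDiffAt 𝓘(ℝ, E4) (𝓡 4) ∞ (extChartAt (𝓡 4) x).symm y :=
  (contMDiffOn_extChartAt_symm x).contMDiffAt ((isOpen_extChartAt_target x).mem_nhds hy)

theorem contDiffAt_chartFun {f : M → ℝ} (hf : ContMDiff (𝓡 4) 𝓘(ℝ, ℝ) ∞ f) (x : M) {y : E4}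
    (hy : y ∈ (extChartAt (𝓡 4) x).target) : ContDiffAt ℝ ∞ (chartFun f x) y :=
  (hf.contMDiffAt.comp y (contMDiffAt_chart_symm x hy)).contDiffAt

/-- The trivialization of the tangent bundle over the preferred chart is the derivative of that
chart. This converts bundle smoothness into smoothness of coordinate expressions. -/
theorem trivialization_snd {x : M} {y : E4} (hy : y ∈ (extChartAt (𝓡 4) x).target)
    (v : TangentSpace (𝓡 4) ((extChartAt (𝓡 4) x).symm y)) :
    (trivializationAt E4 (TangentSpace (𝓡 4)) x
      (⟨(extChartAt (𝓡 4) x).symm y, v⟩ : TangentBundle (𝓡 4) M)).2 = chartI x y v := by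
  have h := TangentBundle.continuousLinearMapAt_trivializationAt (I := 𝓡 4) (mem_chart_source hy)
  have h2 := congrArg (fun T : E4 →L[ℝ] E4 => T v) h
  refine Eq.trans ?_ h2
  exact (Bundle.Trivialization.continuousLinearMapAt_apply_of_mem (R := ℝ)
    (trivializationAt E4 (TangentSpace (𝓡 4)) x) (by simpa using mem_chart_source hy) v).symm

/-- A field along the inverse chart is smooth if and only if its coordinate expression is. -/
theorem contMDiffAt_field_iff {x : M} {y : E4} (hy : y ∈ (extChartAt (𝓡 4) x).target)
    {V : ∀ z, TangentSpace (𝓡 4) ((extChartAt (𝓡 4) x).symm z)} :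
    ContMDiffAt 𝓘(ℝ, E4) ((𝓡 4).prod 𝓘(ℝ, E4)) ∞
      (fun z => (⟨(extChartAt (𝓡 4) x).symm z, V z⟩ : TangentBundle (𝓡 4) M)) y ↔
    ContDiffAt ℝ ∞ (fun z => chartI x z (V z)) y := by
  rw [Bundle.Trivialization.contMDiffAt_iff (e := trivializationAt E4 (TangentSpace (𝓡 4)) x)
    (by rw [Bundle.Trivialization.mem_source]; simpa using mem_chart_source hy), ← contMDiffAt_iff_contDiffAt]
  have e : (fun z => (trivializationAt E4 (TangentSpace (𝓡 4)) x
      (⟨(extChartAt (𝓡 4) x).symm z, V z⟩ : TangentBundle (𝓡 4) M)).2) =ᶠ[𝓝 y]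
      fun z => chartI x z (V z) :=
    Filter.eventuallyEq_of_mem ((isOpen_extChartAt_target x).mem_nhds hy) fun z hz =>
      trivialization_snd hz _
  exact ⟨fun h => h.2.congr_of_eventuallyEq e.symm,
    fun h => ⟨contMDiffAt_chart_symm x hy, h.congr_of_eventuallyEq e⟩⟩

theorem contMDiffAt_chartD {x : M} {y : E4} (hy : y ∈ (extChartAt (𝓡 4) x).target) {V : E4 → E4}
    (hV : ContDiffAt ℝ ∞ V y) :
    ContMDiffAt 𝓘(ℝ, E4) ((𝓡 4).prod 𝓘(ℝ, E4)) ∞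
      (fun z => (⟨(extChartAt (𝓡 4) x).symm z, chartD x z (V z)⟩ : TangentBundle (𝓡 4) M)) y := by
  refine (contMDiffAt_field_iff hy).2 (hV.congr_of_eventuallyEq ?_)
  exact Filter.eventuallyEq_of_mem ((isOpen_extChartAt_target x).mem_nhds hy) fun z hz =>
    chartI_chartD x hz _

theorem contDiffAt_chartBilin {B : BilinField M}
    (hB : ContMDiff (𝓡 4) ((𝓡 4).prod 𝓘(ℝ, E4 →L[ℝ] E4 →L[ℝ] ℝ)) ∞
      (fun x => Bundle.TotalSpace.mk' (E4 →L[ℝ] E4 →L[ℝ] ℝ)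
        (E := fun x : M => TangentSpace (𝓡 4) x →L[ℝ] TangentSpace (𝓡 4) x →L[ℝ] ℝ) x (B x)))
    (x : M) {y : E4} (hy : y ∈ (extChartAt (𝓡 4) x).target) :
    ContDiffAt ℝ ∞ (chartBilin B x) y := by
  refine contDiffAt_clm_of_apply (isOpen_extChartAt_target x) (fun u => contDiffAt_clm_of_apply
    (isOpen_extChartAt_target x) fun v z hz => ?_) y hy
  have h1 := contMDiffAt_chartD hz (contDiffAt_const (c := u))
  have h2 := contMDiffAt_chartD hz (contDiffAt_const (c := v))
  have : ContMDiffAt 𝓘(ℝ, E4) ((𝓡 4).prod 𝓘(ℝ)) ∞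
      (fun z => Bundle.TotalSpace.mk' ℝ (E := Bundle.Trivial M ℝ) ((extChartAt (𝓡 4) x).symm z)
        (B ((extChartAt (𝓡 4) x).symm z) (chartD x z u) (chartD x z v))) z := by
    apply ContMDiffAt.clm_bundle_apply₂ (F₁ := E4) (F₂ := E4)
    · exact ContMDiffAt.comp z hB.contMDiffAt (contMDiffAt_chart_symm x hz)
    · exact h1
    · exact h2
  simp only [Bundle.contMDiffAt_totalSpace] at this
  exact this.2.contDiffAt

theorem contDiffAt_chartEnd {A : EndField M}
    (hA : ContMDiff (𝓡 4) ((𝓡 4).prod 𝓘(ℝ, E4 →L[ℝ] E4)) ∞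
      (fun x => Bundle.TotalSpace.mk' (E4 →L[ℝ] E4)
        (E := fun x : M => TangentSpace (𝓡 4) x →L[ℝ] TangentSpace (𝓡 4) x) x (A x)))
    (x : M) {y : E4} (hy : y ∈ (extChartAt (𝓡 4) x).target) :
    ContDiffAt ℝ ∞ (chartEnd A x) y := by
  refine contDiffAt_clm_of_apply (isOpen_extChartAt_target x) (fun u z hz => ?_) y hy
  have h1 := contMDiffAt_chartD hz (contDiffAt_const (c := u))
  refine (contMDiffAt_field_iff hz).1 ?_
  apply ContMDiffAt.clm_bundle_apply (F₁ := E4) (F₂ := E4)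
  · exact ContMDiffAt.comp z hA.contMDiffAt (contMDiffAt_chart_symm x hz)
  · exact h1

end Chart

/-! ### The local structure in a chart -/

section ChartGK

variable {M : Type*} [TopologicalSpace M] [ChartedSpace E4 M] [IsManifold (𝓡 4) ∞ M]

theorem contMDiffAt_chart {x z : M} (hz : z ∈ (chartAt E4 x).source) :
    ContMDiffAt (𝓡 4) 𝓘(ℝ, E4) ∞ (extChartAt (𝓡 4) x) z := contMDiffAt_extChartAt' hz

/-- A vector field on `M` is differentiable where its coordinate expression is smooth. -/
theorem mdifferentiableAt_of_chart {x : M} {y : E4} (hy : y ∈ (extChartAt (𝓡 4) x).target)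
    {V : ∀ z : M, TangentSpace (𝓡 4) z}
    (h : ContDiffAt ℝ ∞ (fun z => chartI x z (V ((extChartAt (𝓡 4) x).symm z))) y) :
    MDifferentiableAt (𝓡 4) (𝓡 4).tangent (fun z => (⟨z, V z⟩ : TangentBundle (𝓡 4) M))
      ((extChartAt (𝓡 4) x).symm y) := by
  have h1 := (contMDiffAt_field_iff hy
    (V := fun z => V ((extChartAt (𝓡 4) x).symm z))).2 h
  have hs := mem_chart_source hy
  have h2 := ContMDiffAt.comp_of_eq (x := (extChartAt (𝓡 4) x).symm y) h1
    (contMDiffAt_chart hs) ((extChartAt (𝓡 4) x).right_inv hy)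
  refine (ContMDiffAt.congr_of_eventuallyEq h2 ?_).mdifferentiableAt (by simp)
  filter_upwards [(chartAt E4 x).open_source.mem_nhds hs] with z hz
  have e : (extChartAt (𝓡 4) x).symm (extChartAt (𝓡 4) x z) = z :=
    (extChartAt (𝓡 4) x).left_inv (by rwa [extChartAt_source])
  change _ = (⟨(extChartAt (𝓡 4) x).symm (extChartAt (𝓡 4) x z),
    V ((extChartAt (𝓡 4) x).symm (extChartAt (𝓡 4) x z))⟩ : TangentBundle (𝓡 4) M)
  rw [e]

theorem mpullback_chart_symm {x : M} {y : E4} (hy : y ∈ (extChartAt (𝓡 4) x).target)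
    (V : ∀ z : M, TangentSpace (𝓡 4) z) :
    VectorField.mpullback 𝓘(ℝ, E4) (𝓡 4) (extChartAt (𝓡 4) x).symm V y
      = chartI x y (V ((extChartAt (𝓡 4) x).symm y)) := by
  change (chartD x y).inverse (V ((extChartAt (𝓡 4) x).symm y)) = _
  have : (chartD x y).inverse = chartI x y :=
    ContinuousLinearMap.inverse_eq (by ext1 v; exact chartD_chartI x hy v)
      (by ext1 v; exact chartI_chartD x hy v)
  rw [this]

/-- The Lie bracket in coordinates. -/
theorem chartI_mlieBracket {x : M} {y : E4} (hy : y ∈ (extChartAt (𝓡 4) x).target)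
    {V W : ∀ z : M, TangentSpace (𝓡 4) z}
    (hV : ContDiffAt ℝ ∞ (fun z => chartI x z (V ((extChartAt (𝓡 4) x).symm z))) y)
    (hW : ContDiffAt ℝ ∞ (fun z => chartI x z (W ((extChartAt (𝓡 4) x).symm z))) y) :
    chartI x y (VectorField.mlieBracket (𝓡 4) V W ((extChartAt (𝓡 4) x).symm y)) =
      VectorField.lieBracket ℝ (fun z => chartI x z (V ((extChartAt (𝓡 4) x).symm z)))
        (fun z => chartI x z (W ((extChartAt (𝓡 4) x).symm z))) y := by
  have : IsManifold (𝓡 4) (minSmoothness ℝ 2) M := by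
    rw [minSmoothness_of_isRCLikeNormedField]; infer_instance
  have : IsManifold 𝓘(ℝ, E4) (minSmoothness ℝ 2) E4 := by
    rw [minSmoothness_of_isRCLikeNormedField]; infer_instance
  rw [← mpullback_chart_symm hy, VectorField.mpullback_mlieBracket (n := ∞)
    (mdifferentiableAt_of_chart hy hV) (mdifferentiableAt_of_chart hy hW)
    (contMDiffAt_chart_symm x hy) (by simp; exact ENat.LEInfty.out),
    ← VectorField.mlieBracketWithin_univ, VectorField.mlieBracketWithin_eq_lieBracketWithin]
  refine (congrFun (VectorField.lieBracketWithin_univ (𝕜 := ℝ) (E := E4)) y).trans ?_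
  apply Filter.EventuallyEq.lieBracket_vectorField_eq
  · filter_upwards [chart_target_mem_nhds hy] with z hz using mpullback_chart_symm hz V
  · filter_upwards [chart_target_mem_nhds hy] with z hz using mpullback_chart_symm hz W

theorem chartI_end {x : M} {y : E4} (hy : y ∈ (extChartAt (𝓡 4) x).target) (A : EndField M)
    (w : E4) : chartI x y (A ((extChartAt (𝓡 4) x).symm y) w) = chartEnd A x y (chartI x y w) := by
  rw [chartEnd_apply, chartD_chartI x hy]; rfl

/-- Integrability is tested on fields with constant coordinate expressions `u, v`: their bracket
vanishes, and brackets with their images under `A` are derivatives of the matrix of `A`. -/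
theorem nijenhuisZeroAt_chartEnd {A : EndField M} (hA : IsIntegrable A) {x : M} {y : E4}
    (hy : y ∈ (extChartAt (𝓡 4) x).target) (hs : ContDiffAt ℝ ∞ (chartEnd A x) y) :
    NijenhuisZeroAt (chartEnd A x) y := by
  intro u v
  let P : E4 → ∀ z : M, TangentSpace (𝓡 4) z := fun u z => chartD x (extChartAt (𝓡 4) x z) u
  have eP : ∀ u, (fun z => chartI x z (P u ((extChartAt (𝓡 4) x).symm z))) =ᶠ[𝓝 y] fun _ => u := by
    intro u
    filter_upwards [chart_target_mem_nhds hy] with z hz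
    simp only [P]
    rw [(extChartAt (𝓡 4) x).right_inv hz, chartI_chartD x hz]
  have eA : ∀ u, (fun z => chartI x z ((A ((extChartAt (𝓡 4) x).symm z))
      (P u ((extChartAt (𝓡 4) x).symm z)))) =ᶠ[𝓝 y] fun z => chartEnd A x z u := by
    intro u
    filter_upwards [chart_target_mem_nhds hy] with z hz
    simp only [P]
    rw [(extChartAt (𝓡 4) x).right_inv hz]; rfl
  have sP : ∀ u, ContDiffAt ℝ ∞ (fun z => chartI x z (P u ((extChartAt (𝓡 4) x).symm z))) y :=
    fun u => contDiffAt_const.congr_of_eventuallyEq (eP u)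
  have sA : ∀ u, ContDiffAt ℝ ∞ (fun z => chartI x z ((A ((extChartAt (𝓡 4) x).symm z))
      (P u ((extChartAt (𝓡 4) x).symm z)))) y :=
    fun u => (hs.clm_apply contDiffAt_const).congr_of_eventuallyEq (eA u)
  have key := hA (P u) (P v) _ (mdifferentiableAt_of_chart hy (sP u))
    (mdifferentiableAt_of_chart hy (sP v))
  have d : ∀ w a, fderiv ℝ (fun z => chartEnd A x z w) y a = fderiv ℝ (chartEnd A x) y a w :=
    fun w a => by
      rw [fderiv_clm_apply (hs.differentiableAt (by simp)) (differentiableAt_const _)]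
      simp
  have b1 := chartI_mlieBracket (V := fun z => A z (P u z)) (W := fun z => A z (P v z)) hy
    (sA u) (sA v)
  have b2 := chartI_mlieBracket (V := fun z => A z (P u z)) (W := P v) hy (sA u) (sP v)
  have b3 := chartI_mlieBracket (V := P u) (W := fun z => A z (P v z)) hy (sP u) (sA v)
  have b4 := chartI_mlieBracket (V := P u) (W := P v) hy (sP u) (sP v)
  rw [((eA u).lieBracket_vectorField_eq (eA v))] at b1
  rw [((eA u).lieBracket_vectorField_eq (eP v))] at b2
  rw [((eP u).lieBracket_vectorField_eq (eA v))] at b3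
  rw [((eP u).lieBracket_vectorField_eq (eP v))] at b4
  -- Stated for arbitrary vectors of the model space, so that tangent vectors at the point can be
  -- substituted by definitional unfolding.
  have m : ∀ a b c d a' b' c' d' : E4, chartI x y a = a' → chartI x y b = b' →
      chartI x y c = c' → chartI x y d = d' → a - b - c - d = 0 → a' - b' - c' - d' = 0 := by
    rintro a b c d _ _ _ _ rfl rfl rfl rfl h
    simp only [← map_sub, h, map_zero]
  have key3 := m _ _ _ _ _ _ _ _ b1 ((chartI_end hy A _).trans (congrArg (chartEnd A x y) b2))
    ((chartI_end hy A _).trans (congrArg (chartEnd A x y) b3)) b4 key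
  simp only [VectorField.lieBracket, d, fderiv_fun_const, Pi.zero_apply,
    _root_.zero_apply, zero_sub, sub_zero, map_neg] at key3
  linear_combination (norm := module) key3

/-- The change of charts. -/
theorem chartD_change {x x' : M} {y : E4} (hy : y ∈ (extChartAt (𝓡 4) x).target)
    (hy' : (extChartAt (𝓡 4) x).symm y ∈ (chartAt E4 x').source) (u : E4) :
    chartD x y u = chartD x' (extChartAt (𝓡 4) x' ((extChartAt (𝓡 4) x).symm y))
      (fderiv ℝ (fun z => extChartAt (𝓡 4) x' ((extChartAt (𝓡 4) x).symm z)) y u) := by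
  have hτ : MDifferentiableAt 𝓘(ℝ, E4) 𝓘(ℝ, E4)
      (fun z => extChartAt (𝓡 4) x' ((extChartAt (𝓡 4) x).symm z)) y :=
    (ContMDiffAt.comp y (contMDiffAt_chart hy') (contMDiffAt_chart_symm x hy)).mdifferentiableAt
      (by simp)
  have ht : extChartAt (𝓡 4) x' ((extChartAt (𝓡 4) x).symm y) ∈ (extChartAt (𝓡 4) x').target :=
    (extChartAt (𝓡 4) x').map_source (by rwa [extChartAt_source])
  have e : (extChartAt (𝓡 4) x).symm =ᶠ[𝓝 y] (extChartAt (𝓡 4) x').symm ∘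
      (fun z => extChartAt (𝓡 4) x' ((extChartAt (𝓡 4) x).symm z)) := by
    have hc : ContinuousAt (extChartAt (𝓡 4) x).symm y := (contMDiffAt_chart_symm x hy).continuousAt
    filter_upwards [hc.preimage_mem_nhds ((chartAt E4 x').open_source.mem_nhds hy')] with z hz
    exact ((extChartAt (𝓡 4) x').left_inv (by rwa [extChartAt_source])).symm
  have := mfderiv_comp y (I := 𝓘(ℝ, E4)) (I' := 𝓘(ℝ, E4)) (I'' := 𝓡 4)
    ((contMDiffAt_chart_symm x' ht).mdifferentiableAt (by simp)) hτ
  rw [← Filter.EventuallyEq.mfderiv_eq e, mfderiv_eq_fderiv] at this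
  exact congrArg (fun T : E4 →L[ℝ] E4 => T u) this

/-- A closed form is closed in every chart. -/
theorem extDerivTwo_chartBilin {Ω : BilinField M} (hΩ : IsSymplecticForm Ω) {x : M} {y : E4}
    (hy : y ∈ (extChartAt (𝓡 4) x).target) (u v w : E4) :
    extDerivTwo (chartBilin Ω x) y u v w = 0 := by
  -- Closedness is assumed only in each preferred chart at its own centre. The chart centred at the
  -- point in question is therefore introduced, and the form is pulled back by the change of charts
  -- `τ`.
  let x' := (extChartAt (𝓡 4) x).symm y
  let τ : E4 → E4 := fun z => extChartAt (𝓡 4) x' ((extChartAt (𝓡 4) x).symm z)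
  have hx' : (extChartAt (𝓡 4) x).symm y ∈ (chartAt E4 x').source := ChartedSpace.mem_chart_source _
  have hτ : ContDiffAt ℝ ∞ τ y :=
    (ContMDiffAt.comp y (contMDiffAt_chart hx') (contMDiffAt_chart_symm x hy)).contDiffAt
  have ht : τ y ∈ (extChartAt (𝓡 4) x').target :=
    (extChartAt (𝓡 4) x').map_source (by rwa [extChartAt_source])
  have hσ' := contDiffAt_chartBilin hΩ.smooth x' ht
  have hc : ContinuousAt (extChartAt (𝓡 4) x).symm y := (contMDiffAt_chart_symm x hy).continuousAt
  have e : ∀ a b, (fun z => chartBilin Ω x z a b) =ᶠ[𝓝 y]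
      fun z => chartBilin Ω x' (τ z) (fderiv ℝ τ z a) (fderiv ℝ τ z b) := by
    intro a b
    filter_upwards [chart_target_mem_nhds hy, hc.preimage_mem_nhds
      ((chartAt E4 x').open_source.mem_nhds hx')] with z hz hz'
    rw [chartBilin_apply, chartBilin_apply, chartD_change hz hz', chartD_change hz hz']
    have e' : (extChartAt (𝓡 4) x').symm (τ z) = (extChartAt (𝓡 4) x).symm z :=
      (extChartAt (𝓡 4) x').left_inv (by rwa [extChartAt_source])
    rw [e']
  have hσ := contDiffAt_chartBilin hΩ.smooth x hy
  have d1 : ContDiffAt ℝ ∞ (fderiv ℝ τ) y := hτ.fderiv_right (m := ∞) (by simp)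
  have sc : ContDiffAt ℝ ∞ (fun z => chartBilin Ω x' (τ z)) y := ContDiffAt.comp y hσ' hτ
  have hd : ∀ c a b, fderiv ℝ (chartBilin Ω x) y c a b =
      fderiv ℝ (chartBilin Ω x') (τ y) (fderiv ℝ τ y c) (fderiv ℝ τ y a) (fderiv ℝ τ y b)
        + chartBilin Ω x' (τ y) (fderiv ℝ (fderiv ℝ τ) y c a) (fderiv ℝ τ y b)
        + chartBilin Ω x' (τ y) (fderiv ℝ τ y a) (fderiv ℝ (fderiv ℝ τ) y c b) := by
    intro c a b
    have h1 : fderiv ℝ (fun z => chartBilin Ω x z a b) y c = fderiv ℝ (chartBilin Ω x) y c a b := by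
      rw [fderiv_clm_apply ((hσ.clm_apply contDiffAt_const).differentiableAt (by simp))
        (differentiableAt_const _), fderiv_clm_apply (hσ.differentiableAt (by simp))
        (differentiableAt_const _)]
      simp
    rw [← h1, (e a b).fderiv_eq]
    have A : ∀ a, fderiv ℝ (fun z => fderiv ℝ τ z a) y c = fderiv ℝ (fderiv ℝ τ) y c a := by
      intro a
      rw [fderiv_clm_apply (d1.differentiableAt (by simp)) (differentiableAt_const _)]
      simp
    have B : fderiv ℝ (fun z => chartBilin Ω x' (τ z)) y c =
        fderiv ℝ (chartBilin Ω x') (τ y) (fderiv ℝ τ y c) := by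
      rw [fderiv_fun_comp y (hσ'.differentiableAt (by simp)) (hτ.differentiableAt (by simp))]
      rfl
    have sa : ∀ a, ContDiffAt ℝ ∞ (fun z => fderiv ℝ τ z a) y := fun a =>
      d1.clm_apply contDiffAt_const
    rw [fderiv_clm_apply ((sc.clm_apply (sa a)).differentiableAt (by simp))
      ((sa b).differentiableAt (by simp)), fderiv_clm_apply (sc.differentiableAt (by simp))
      ((sa a).differentiableAt (by simp))]
    simp only [_root_.add_apply, ContinuousLinearMap.comp_apply, ContinuousLinearMap.flip_apply, A,
      B]
    ring
  have sym : ∀ a b, fderiv ℝ (fderiv ℝ τ) y a b = fderiv ℝ (fderiv ℝ τ) y b a := fun a b =>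
    (hτ.isSymmSndFDerivAt (by simp; exact ENat.LEInfty.out)) a b
  have alt : ∀ a b, chartBilin Ω x' (τ y) a b = - chartBilin Ω x' (τ y) b a := by
    intro a b
    have k := fun v => hΩ.alternating ((extChartAt (𝓡 4) x').symm (τ y)) v
    have k' : ∀ v, chartBilin Ω x' (τ y) v v = 0 := fun v => k _
    have := k' (a + b)
    simp only [map_add, _root_.add_apply, k', zero_add, add_zero] at this
    linarith
  have cl := hΩ.closed x' (fderiv ℝ τ y u) (fderiv ℝ τ y v) (fderiv ℝ τ y w)
  change extDerivTwo (chartBilin Ω x') (τ y) _ _ _ = 0 at cl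
  simp only [extDerivTwo, hd] at cl ⊢
  -- The second derivatives of `τ` cancel in pairs by their symmetry and the skewness of the form:
  -- pullback commutes with the exterior derivative.
  rw [sym v u, sym w u, sym w v, alt (fderiv ℝ τ y v) (fderiv ℝ (fderiv ℝ τ) y u w),
    alt (fderiv ℝ τ y u) (fderiv ℝ (fderiv ℝ τ) y v w)]
  linarith

theorem sympAdjoint_spec {Ω : BilinField M} (hΩ : IsSymplecticForm Ω) (J : EndField M) (x : M)
    (v w : TangentSpace (𝓡 4) x) : Ω x (sympAdjoint Ω J x v) w = Ω x v (J x w) := by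
  let s : E4 →L[ℝ] E4 →L[ℝ] ℝ := Ω x
  let f : E4 →L[ℝ] E4 := J x
  have hi : s.IsInvertible := isInvertible_of_nondegenerate (hΩ.nondegenerate x)
  change s (s.inverse ((s v) ∘L f)) w = s v (f w)
  rw [hi.self_apply_inverse]; rfl

theorem chartEnd_sympAdjoint {Ω : BilinField M} (hΩ : IsSymplecticForm Ω) (J : EndField M) {x : M}
    {y : E4} (hy : y ∈ (extChartAt (𝓡 4) x).target) :
    chartEnd (sympAdjoint Ω J) x y = locAdj (chartBilin Ω x) (chartEnd J x) y := by
  have hi : (chartBilin Ω x y).IsInvertible := by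
    refine isInvertible_of_nondegenerate fun v hv => ?_
    have h1 : ∀ w : E4, bilinAt Ω ((extChartAt (𝓡 4) x).symm y) (chartD x y v) w = 0 := fun w => by
      have := hv (chartI x y w)
      rwa [chartBilin_apply, chartD_chartI x hy] at this
    have h0 : chartD x y v = 0 := hΩ.nondegenerate _ _ h1
    rw [← chartI_chartD x hy v, h0, map_zero]
  ext1 v
  apply hi.injective
  change _ = chartBilin Ω x y ((chartBilin Ω x y).inverse ((chartBilin Ω x y v) ∘L chartEnd J x y))
  rw [hi.self_apply_inverse]
  ext1 w
  change chartBilin Ω x y _ w = chartBilin Ω x y v (chartEnd J x y w)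
  rw [chartBilin_apply, chartBilin_apply, chartEnd_apply, chartEnd_apply, chartD_chartI x hy,
    chartD_chartI x hy]
  exact sympAdjoint_spec hΩ J _ _ _

theorem chartBilin_metric (Ω : BilinField M) (J : EndField M) {x : M} {y : E4}
    (hy : y ∈ (extChartAt (𝓡 4) x).target) :
    chartBilin (metric Ω J) x y = locMetric (chartBilin Ω x) (chartEnd J x) y := by
  ext u v
  rw [locMetric_apply, chartBilin_apply, chartBilin_apply, chartBilin_apply, chartEnd_apply,
    chartEnd_apply, chartD_chartI x hy, chartD_chartI x hy]
  rfl

theorem chartEnd_commutator {Ω : BilinField M} (hΩ : IsSymplecticForm Ω) (J : EndField M) {x : M}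
    {y : E4} (hy : y ∈ (extChartAt (𝓡 4) x).target) :
    chartEnd (commutator Ω J) x y = chartEnd J x y ∘L locAdj (chartBilin Ω x) (chartEnd J x) y
      - locAdj (chartBilin Ω x) (chartEnd J x) y ∘L chartEnd J x y := by
  rw [← chartEnd_sympAdjoint hΩ J hy]
  ext1 v
  have : endAt (commutator Ω J) ((extChartAt (𝓡 4) x).symm y) =
      endAt J ((extChartAt (𝓡 4) x).symm y) ∘L endAt (sympAdjoint Ω J) ((extChartAt (𝓡 4) x).symm y)
      - endAt (sympAdjoint Ω J) ((extChartAt (𝓡 4) x).symm y) ∘L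
        endAt J ((extChartAt (𝓡 4) x).symm y) := rfl
  rw [chartEnd_apply, this]
  simp only [_root_.sub_apply, ContinuousLinearMap.comp_apply, chartEnd_apply, chartD_chartI x hy,
    map_sub]

theorem chartFun_angle {Ω : BilinField M} (hΩ : IsSymplecticForm Ω) (J : EndField M) {x : M}
    {y : E4} (hy : y ∈ (extChartAt (𝓡 4) x).target) :
    chartFun (angle Ω J) x y = locAngle (chartBilin Ω x) (chartEnd J x) y := by
  rw [locAngle, ← chartEnd_sympAdjoint hΩ J hy]
  let T : E4 →L[ℝ] E4 := J ((extChartAt (𝓡 4) x).symm y) ∘L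
    sympAdjoint Ω J ((extChartAt (𝓡 4) x).symm y)
  change -(1 / 4) * LinearMap.trace ℝ E4 (T : E4 →ₗ[ℝ] E4) = _
  congr 1
  have h : ((chartEnd J x y ∘L chartEnd (sympAdjoint Ω J) x y : E4 →L[ℝ] E4) : E4 →ₗ[ℝ] E4)
      = (chartI x y : E4 →ₗ[ℝ] E4) ∘ₗ ((T : E4 →ₗ[ℝ] E4) ∘ₗ (chartD x y : E4 →ₗ[ℝ] E4)) := by
    ext1 v
    change chartEnd J x y (chartEnd (sympAdjoint Ω J) x y v) = _
    rw [chartEnd_apply, chartEnd_apply, chartD_chartI x hy]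
    rfl
  rw [h, LinearMap.trace_comp_comm', LinearMap.comp_assoc]
  have h' : (chartD x y : E4 →ₗ[ℝ] E4) ∘ₗ (chartI x y : E4 →ₗ[ℝ] E4) = LinearMap.id := by
    ext1 v; exact chartD_chartI x hy v
  rw [h', LinearMap.comp_id]

/-- The structure in a chart. -/
theorem isLocalGK_chart [MulAction Torus M] {Ω : BilinField M} (hΩ : IsSymplecticForm Ω)
    {J : EndField M} (hJ : IsDGK Ω J) (x : M) :
    IsLocalGK (extChartAt (𝓡 4) x).target (chartBilin Ω x) (chartEnd J x) := by
  have hsq : ∀ y ∈ (extChartAt (𝓡 4) x).target, ∀ v, chartEnd J x y (chartEnd J x y v) = -v := by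
    intro y hy v
    rw [chartEnd_apply, chartEnd_apply, chartD_chartI x hy]
    refine (congrArg (chartI x y) (hJ.sq _ _)).trans ?_
    exact (map_neg (chartI x y) (chartD x y v)).trans (by rw [chartI_chartD x hy])
  have hta : ∀ y ∈ (extChartAt (𝓡 4) x).target, ∀ v, v ≠ 0 →
      0 < chartBilin Ω x y v (chartEnd J x y v) := by
    intro y hy v hv
    rw [chartBilin_apply, chartEnd_apply, chartD_chartI x hy]
    refine hJ.tamed _ _ fun h0 => hv ?_
    rw [← chartI_chartD x hy v]
    exact (congrArg (chartI x y) h0).trans (map_zero _)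
  have hadj : ∀ y ∈ (extChartAt (𝓡 4) x).target,
      ContDiffAt ℝ ∞ (locAdj (chartBilin Ω x) (chartEnd J x)) y := by
    intro y hy
    refine contDiffAt_clm_of_apply (isOpen_extChartAt_target x) (fun v y hy => ?_) y hy
    have hs := contDiffAt_chartBilin hΩ.smooth x hy
    refine (contDiffAt_inverse hs (isInvertible_of_nondegenerate fun v hv => ?_)).clm_apply ?_
    · by_contra h0
      exact (hta y hy v h0).ne' (hv _)
    · exact (hs.clm_apply contDiffAt_const).clm_comp (contDiffAt_chartEnd hJ.smooth x hy)
  have heq : ∀ y ∈ (extChartAt (𝓡 4) x).target, chartEnd (sympAdjoint Ω J) x =ᶠ[𝓝 y]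
      locAdj (chartBilin Ω x) (chartEnd J x) := fun y hy => by
    filter_upwards [chart_target_mem_nhds hy] with z hz using chartEnd_sympAdjoint hΩ J hz
  exact
  { isOpen := isOpen_extChartAt_target x
    smooth_form := fun y hy => contDiffAt_chartBilin hΩ.smooth x hy
    smooth_str := fun y hy => contDiffAt_chartEnd hJ.smooth x hy
    alternating := fun y hy v => hΩ.alternating _ _
    closed := fun y hy u v w => extDerivTwo_chartBilin hΩ hy u v w
    sq := hsq
    tamed := hta
    nijenhuis := fun y hy =>
      nijenhuisZeroAt_chartEnd hJ.integrable hy (contDiffAt_chartEnd hJ.smooth x hy)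
    nijenhuis_adj := fun y hy u v => by
      have := nijenhuisZeroAt_chartEnd hJ.integrable_adjoint hy
        ((hadj y hy).congr_of_eventuallyEq (heq y hy)) u v
      rwa [(heq y hy).fderiv_eq, (heq y hy).self_of_nhds] at this }

end ChartGK

/-! ### The torus action in a chart -/

section ChartAct

variable {M : Type*} [TopologicalSpace M] [ChartedSpace E4 M] [MulAction Torus M]

theorem torusExp_zero : torusExp 0 = 1 := by
  ext1 i; simp [torusExp]

theorem torusExp_add (a b : LieT) : torusExp (a + b) = torusExp a * torusExp b := by
  ext1 i; simp [torusExp, Circle.exp_add]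

theorem hasFDerivAt_clm_comp_apply {E F G H : Type*} [NormedAddCommGroup E] [NormedSpace ℝ E]
    [NormedAddCommGroup F] [NormedSpace ℝ F] [NormedAddCommGroup G] [NormedSpace ℝ G]
    [NormedAddCommGroup H] [NormedSpace ℝ H] {f : E → F →L[ℝ] G} {f' : E →L[ℝ] F →L[ℝ] G} {c : H → E}
    {c' : H →L[ℝ] E} {a : H} (hf : HasFDerivAt f f' (c a)) (hc : HasFDerivAt c c' a) (w : F) :
    HasFDerivAt (fun s => f (c s) w) ((ContinuousLinearMap.apply ℝ G w) ∘L (f' ∘L c')) a :=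
  (ContinuousLinearMap.apply ℝ G w).hasFDerivAt.comp a (hf.comp a hc)

/-- The torus action in the preferred chart at `x`. -/
def chartAct (x : M) (q : LieT × E4) : E4 :=
  extChartAt (𝓡 4) x (torusExp q.1 • (extChartAt (𝓡 4) x).symm q.2)

/-- The fundamental field of `ζ` in the preferred chart at `x`. -/
def chartFund (x : M) (ζ : LieT) (y : E4) : E4 :=
  chartI x y (fundField ζ ((extChartAt (𝓡 4) x).symm y))

theorem chartAct_zero (x : M) {y : E4} (hy : y ∈ (extChartAt (𝓡 4) x).target) :
    chartAct x (0, y) = y := by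
  simp only [chartAct, torusExp_zero, one_smul]
  exact (extChartAt (𝓡 4) x).right_inv hy

/-- The torus acts smoothly. -/
abbrev IsSmoothAction (M : Type*) [TopologicalSpace M] [ChartedSpace E4 M] [MulAction Torus M] :
    Prop :=
  ContMDiff (𝓘(ℝ, LieT).prod (𝓡 4)) (𝓡 4) ∞ (fun q : LieT × M => torusExp q.1 • q.2)

theorem act_zero_mem (x : M) {y : E4} (hy : y ∈ (extChartAt (𝓡 4) x).target) :
    torusExp ((0 : LieT), y).1 • (extChartAt (𝓡 4) x).symm y ∈ (chartAt E4 x).source := by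
  simp only [torusExp_zero, one_smul]
  exact mem_chart_source hy

theorem mem_target_chartAct (x : M) {q : LieT × E4}
    (hs : torusExp q.1 • (extChartAt (𝓡 4) x).symm q.2 ∈ (chartAt E4 x).source) :
    chartAct x q ∈ (extChartAt (𝓡 4) x).target :=
  (extChartAt (𝓡 4) x).map_source (by rwa [extChartAt_source])

theorem symm_chartAct (x : M) {q : LieT × E4}
    (hs : torusExp q.1 • (extChartAt (𝓡 4) x).symm q.2 ∈ (chartAt E4 x).source) :
    (extChartAt (𝓡 4) x).symm (chartAct x q) = torusExp q.1 • (extChartAt (𝓡 4) x).symm q.2 :=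
  (extChartAt (𝓡 4) x).left_inv (by rwa [extChartAt_source])

variable [IsManifold (𝓡 4) ∞ M]

theorem contMDiffAt_act (h : IsSmoothAction M) (x : M) {q : LieT × E4}
    (hq : q.2 ∈ (extChartAt (𝓡 4) x).target) :
    ContMDiffAt 𝓘(ℝ, LieT × E4) (𝓡 4) ∞
      (fun q : LieT × E4 => torusExp q.1 • (extChartAt (𝓡 4) x).symm q.2) q := by
  have h1 : ContMDiffAt 𝓘(ℝ, LieT × E4) (𝓘(ℝ, LieT).prod (𝓡 4)) ∞
      (fun q : LieT × E4 => (q.1, (extChartAt (𝓡 4) x).symm q.2)) q := by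
    refine ContMDiffAt.prodMk contDiff_fst.contDiffAt.contMDiffAt ?_
    exact ContMDiffAt.comp q (contMDiffAt_chart_symm x hq) contDiff_snd.contDiffAt.contMDiffAt
  exact ContMDiffAt.comp q h.contMDiffAt h1

theorem contDiffAt_chartAct (h : IsSmoothAction M) (x : M) {q : LieT × E4}
    (hq : q.2 ∈ (extChartAt (𝓡 4) x).target)
    (hs : torusExp q.1 • (extChartAt (𝓡 4) x).symm q.2 ∈ (chartAt E4 x).source) :
    ContDiffAt ℝ ∞ (chartAct x) q :=
  (ContMDiffAt.comp q (contMDiffAt_chart hs) (contMDiffAt_act h x hq)).contDiffAt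

theorem contDiffAt_chartAct_zero (h : IsSmoothAction M) (x : M) {y : E4}
    (hy : y ∈ (extChartAt (𝓡 4) x).target) : ContDiffAt ℝ ∞ (chartAct x) (0, y) :=
  contDiffAt_chartAct h x hy (act_zero_mem x hy)

/-- Elements close to `1` keep the points close to `y` in the chart. -/
theorem eventually_mem (h : IsSmoothAction M) (x : M) {y : E4}
    (hy : y ∈ (extChartAt (𝓡 4) x).target) :
    ∀ᶠ q : LieT × E4 in 𝓝 (0, y), q.2 ∈ (extChartAt (𝓡 4) x).target ∧
      torusExp q.1 • (extChartAt (𝓡 4) x).symm q.2 ∈ (chartAt E4 x).source := by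
  have h1 : ∀ᶠ q : LieT × E4 in 𝓝 (0, y), q.2 ∈ (extChartAt (𝓡 4) x).target :=
    continuous_snd.continuousAt.eventually (chart_target_mem_nhds hy)
  have h2 := (contMDiffAt_act h x (q := (0, y)) hy).continuousAt.preimage_mem_nhds
    ((chartAt E4 x).open_source.mem_nhds (act_zero_mem x hy))
  filter_upwards [h1, h2] with q a b using ⟨a, b⟩

/-- The chain rule identifies the fundamental field with a partial derivative of the action at the
identity. Its smoothness in the point and linearity in `ζ` both follow. -/
theorem chartFund_eq (h : IsSmoothAction M) (x : M) (ζ : LieT) {y : E4}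
    (hy : y ∈ (extChartAt (𝓡 4) x).target) :
    chartFund x ζ y = fderiv ℝ (chartAct x) (0, y) (ζ, 0) := by
  have hl : HasFDerivAt (fun s : ℝ => (s • ζ, y))
      ((ContinuousLinearMap.toSpanSingleton ℝ ζ).prod (0 : ℝ →L[ℝ] E4)) 0 :=
    ((ContinuousLinearMap.toSpanSingleton ℝ ζ).hasFDerivAt).prodMk (hasFDerivAt_const y (0 : ℝ))
  have h0 : ((0 : ℝ) • ζ, y) = ((0 : LieT), y) := by simp
  have ha : HasFDerivAt (chartAct x) (fderiv ℝ (chartAct x) (0, y)) ((0 : ℝ) • ζ, y) := by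
    rw [h0]; exact ((contDiffAt_chartAct_zero h x hy).differentiableAt (by simp)).hasFDerivAt
  have h1 := (ha.comp (0 : ℝ) hl).fderiv
  have hcurve : MDifferentiableAt 𝓘(ℝ, ℝ) (𝓡 4)
      (fun s : ℝ => torusExp (s • ζ) • (extChartAt (𝓡 4) x).symm y) 0 := by
    have hls : ContDiff ℝ ∞ (fun s : ℝ => (s • ζ, y)) := by fun_prop
    exact (ContMDiffAt.comp (0 : ℝ) (contMDiffAt_act h x (q := ((0 : ℝ) • ζ, y)) hy)
      hls.contDiffAt.contMDiffAt).mdifferentiableAt (by simp)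
  have e0 : torusExp ((0 : ℝ) • ζ) • (extChartAt (𝓡 4) x).symm y = (extChartAt (𝓡 4) x).symm y := by
    simp [torusExp_zero]
  have hchart : MDifferentiableAt (𝓡 4) 𝓘(ℝ, E4) (extChartAt (𝓡 4) x)
      (torusExp ((0 : ℝ) • ζ) • (extChartAt (𝓡 4) x).symm y) := by
    rw [e0]; exact (contMDiffAt_chart (mem_chart_source hy)).mdifferentiableAt (by simp)
  have h2 := mfderiv_comp (0 : ℝ) hchart hcurve
  rw [mfderiv_eq_fderiv] at h2
  have h3 := congrArg (fun T : ℝ →L[ℝ] E4 => T 1) (h1.symm.trans h2)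
  have h4 : fderiv ℝ (chartAct x) (0, y) (ζ, 0) =
      (mfderiv (𝓡 4) 𝓘(ℝ, E4) (extChartAt (𝓡 4) x)
        (torusExp ((0 : ℝ) • ζ) • (extChartAt (𝓡 4) x).symm y) : E4 →L[ℝ] E4)
        (fundField ζ ((extChartAt (𝓡 4) x).symm y)) := by
    refine Eq.trans ?_ h3
    simp
  rw [h4, e0]; rfl

theorem contDiffAt_chartFund (h : IsSmoothAction M) (x : M) (ζ : LieT) {y : E4}
    (hy : y ∈ (extChartAt (𝓡 4) x).target) : ContDiffAt ℝ ∞ (chartFund x ζ) y := by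
  have e : chartFund x ζ =ᶠ[𝓝 y] fun z => fderiv ℝ (chartAct x) (0, z) (ζ, 0) := by
    filter_upwards [chart_target_mem_nhds hy] with z hz using chartFund_eq h x ζ hz
  refine ContDiffAt.congr_of_eventuallyEq (ContDiffAt.clm_apply ?_ contDiffAt_const) e
  exact ContDiffAt.comp y ((contDiffAt_chartAct_zero h x hy).fderiv_right (m := ∞) (by simp))
    (contDiff_const.prodMk contDiff_id).contDiffAt

theorem chartFund_add (h : IsSmoothAction M) (x : M) (a b : LieT) {y : E4}
    (hy : y ∈ (extChartAt (𝓡 4) x).target) :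
    chartFund x (a + b) y = chartFund x a y + chartFund x b y := by
  rw [chartFund_eq h x _ hy, chartFund_eq h x _ hy, chartFund_eq h x _ hy, ← map_add]
  simp

theorem chartFund_smul (h : IsSmoothAction M) (x : M) (c : ℝ) (a : LieT) {y : E4}
    (hy : y ∈ (extChartAt (𝓡 4) x).target) :
    chartFund x (c • a) y = c • chartFund x a y := by
  rw [chartFund_eq h x _ hy, chartFund_eq h x _ hy, ← map_smul]
  simp

/-- The partial derivative of the action in the second variable. -/
def chartActD (x : M) (η : LieT) (y : E4) : E4 →L[ℝ] E4 :=
  fderiv ℝ (chartAct x) (η, y) ∘L ContinuousLinearMap.inr ℝ LieT E4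

theorem chartActD_zero (h : IsSmoothAction M) (x : M) {y : E4}
    (hy : y ∈ (extChartAt (𝓡 4) x).target) (v : E4) : chartActD x 0 y v = v := by
  have h1 := ((contDiffAt_chartAct_zero h x hy).differentiableAt (by simp)).hasFDerivAt.comp y
    ((hasFDerivAt_const (0 : LieT) y).prodMk (hasFDerivAt_id y))
  have e : (chartAct x) ∘ (fun z : E4 => ((0 : LieT), id z)) =ᶠ[𝓝 y] id := by
    filter_upwards [chart_target_mem_nhds hy] with z hz using chartAct_zero x hz
  have h2 := (h1.congr_of_eventuallyEq e.symm).unique (hasFDerivAt_id y)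
  have := congrArg (fun T : E4 →L[ℝ] E4 => T v) h2
  simpa [chartActD] using this

/-- The infinitesimal variation of the derivative of the action is the derivative of the
fundamental field. -/
theorem hasDerivAt_chartActD (h : IsSmoothAction M) (x : M) (ζ : LieT) {y : E4}
    (hy : y ∈ (extChartAt (𝓡 4) x).target) (v : E4) :
    HasDerivAt (fun s : ℝ => chartActD x (s • ζ) y v) (fderiv ℝ (chartFund x ζ) y v) 0 := by
  have hsm := contDiffAt_chartAct_zero h x hy
  have hd : HasFDerivAt (fderiv ℝ (chartAct x)) (fderiv ℝ (fderiv ℝ (chartAct x)) (0, y))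
      ((0 : LieT), y) :=
    ((hsm.fderiv_right (m := ∞) (by simp)).differentiableAt (by simp)).hasFDerivAt
  have e : chartFund x ζ =ᶠ[𝓝 y] fun z => fderiv ℝ (chartAct x) (0, z) (ζ, 0) := by
    filter_upwards [chart_target_mem_nhds hy] with z hz using chartFund_eq h x ζ hz
  have h1 : fderiv ℝ (chartFund x ζ) y v =
      fderiv ℝ (fderiv ℝ (chartAct x)) (0, y) (0, v) (ζ, 0) := by
    rw [e.fderiv_eq, (hasFDerivAt_clm_comp_apply (c := fun z : E4 => ((0 : LieT), z)) hd
      ((hasFDerivAt_const (0 : LieT) y).prodMk (hasFDerivAt_id y)) (ζ, 0)).fderiv]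
    rfl
  -- Symmetry of the second derivative exchanges differentiation in the group parameter with
  -- differentiation in the point.
  rw [h1, (hsm.isSymmSndFDerivAt (by simp; exact ENat.LEInfty.out)) (0, v) (ζ, 0)]
  have hl : HasFDerivAt (fun s : ℝ => (s • ζ, y))
      ((ContinuousLinearMap.toSpanSingleton ℝ ζ).prod (0 : ℝ →L[ℝ] E4)) 0 :=
    ((ContinuousLinearMap.toSpanSingleton ℝ ζ).hasFDerivAt).prodMk (hasFDerivAt_const y (0 : ℝ))
  have hd' : HasFDerivAt (fderiv ℝ (chartAct x)) (fderiv ℝ (fderiv ℝ (chartAct x)) (0, y))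
      ((0 : ℝ) • ζ, y) := by rwa [zero_smul]
  have := (hasFDerivAt_clm_comp_apply (c := fun s : ℝ => (s • ζ, y)) hd' hl
    (0, v)).hasDerivAt
  have e' : ((ContinuousLinearMap.toSpanSingleton ℝ ζ).prod (0 : ℝ →L[ℝ] E4)) 1 = (ζ, 0) := by
    simp
  rw [ContinuousLinearMap.comp_apply, ContinuousLinearMap.comp_apply, e'] at this
  exact this

theorem hasDerivAt_chartAct (h : IsSmoothAction M) (x : M) (ζ : LieT) {y : E4}
    (hy : y ∈ (extChartAt (𝓡 4) x).target) :
    HasDerivAt (fun s : ℝ => chartAct x (s • ζ, y)) (chartFund x ζ y) 0 := by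
  have hl : HasDerivAt (fun s : ℝ => (s • ζ, y)) (ζ, 0) 0 := by
    simpa using ((hasDerivAt_id (0 : ℝ)).smul_const ζ).prodMk (hasDerivAt_const (0 : ℝ) y)
  have hd : HasFDerivAt (chartAct x) (fderiv ℝ (chartAct x) (0, y)) ((0 : ℝ) • ζ, y) := by
    rw [zero_smul]
    exact ((contDiffAt_chartAct_zero h x hy).differentiableAt (by simp)).hasFDerivAt
  rw [chartFund_eq h x ζ hy]
  exact hd.comp_hasDerivAt (0 : ℝ) hl

theorem tendsto_smul_prod (ζ : LieT) (y : E4) :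
    Filter.Tendsto (fun s : ℝ => (s • ζ, y)) (𝓝 0) (𝓝 ((0 : LieT), y)) := by
  have : Continuous (fun s : ℝ => (s • ζ, y)) := by fun_prop
  simpa using this.tendsto 0

/-- The derivative of the action of a fixed element, in a chart. -/
theorem hasFDerivAt_chartAct_right (h : IsSmoothAction M) (x : M) {q : LieT × E4}
    (hq : q.2 ∈ (extChartAt (𝓡 4) x).target)
    (hs : torusExp q.1 • (extChartAt (𝓡 4) x).symm q.2 ∈ (chartAt E4 x).source) :
    HasFDerivAt (fun z => chartAct x (q.1, z)) (chartActD x q.1 q.2) q.2 := by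
  have := ((contDiffAt_chartAct h x hq hs).differentiableAt (by simp)).hasFDerivAt
  have h2 : HasFDerivAt (fun z => chartAct x (q.1, z)) _ q.2 :=
    this.comp (f := fun z : E4 => (q.1, z)) q.2
      ((hasFDerivAt_const q.1 q.2).prodMk (hasFDerivAt_id q.2))
  exact h2

/-- The fundamental fields are invariant. -/
theorem chartActD_chartFund (h : IsSmoothAction M) (x : M) (ζ : LieT) {q : LieT × E4}
    (hq : q.2 ∈ (extChartAt (𝓡 4) x).target)
    (hs : torusExp q.1 • (extChartAt (𝓡 4) x).symm q.2 ∈ (chartAt E4 x).source) :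
    chartActD x q.1 q.2 (chartFund x ζ q.2) = chartFund x ζ (chartAct x q) := by
  have h1 := hasDerivAt_chartAct h x ζ (mem_target_chartAct x hs)
  have h2 : HasFDerivAt (fun z => chartAct x (q.1, z)) (chartActD x q.1 q.2)
      (chartAct x ((0 : ℝ) • ζ, q.2)) := by
    rw [zero_smul, chartAct_zero x hq]; exact hasFDerivAt_chartAct_right h x hq hs
  have h3 := h2.comp_hasDerivAt (0 : ℝ) (hasDerivAt_chartAct h x ζ hq)
  refine h3.unique (h1.congr_of_eventuallyEq ?_)
  filter_upwards [(tendsto_smul_prod ζ q.2).eventually (eventually_mem h x hq)] with s hs'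
  simp only [Function.comp, chartAct]
  have e1 := symm_chartAct x (q := (s • ζ, q.2)) hs'.2
  have e2 := symm_chartAct x hs
  simp only [chartAct] at e1 e2
  -- Commutativity of the torus: `exp(sζ)` may be applied before or after the given element.
  rw [e1, e2, smul_smul, smul_smul, mul_comm]

/-- The field of `b` is invariant under the flow of `a`. Differentiating this at time zero gives the
derivative of the first field on one side and of the second on the other. -/
theorem chartFund_comm (h : IsSmoothAction M) (x : M) (a b : LieT) {y : E4}
    (hy : y ∈ (extChartAt (𝓡 4) x).target) :
    fderiv ℝ (chartFund x a) y (chartFund x b y) = fderiv ℝ (chartFund x b) y (chartFund x a y) := by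
  have h1 := hasDerivAt_chartActD h x a hy (chartFund x b y)
  have h2 : HasFDerivAt (chartFund x b) (fderiv ℝ (chartFund x b) y)
      (chartAct x ((0 : ℝ) • a, y)) := by
    rw [zero_smul, chartAct_zero x hy]
    exact ((contDiffAt_chartFund h x b hy).differentiableAt (by simp)).hasFDerivAt
  refine h1.unique ((h2.comp_hasDerivAt (0 : ℝ) (hasDerivAt_chartAct h x a hy)).congr_of_eventuallyEq
    ?_)
  filter_upwards [(tendsto_smul_prod a y).eventually (eventually_mem h x hy)] with s hs
  exact chartActD_chartFund h x b (q := (s • a, y)) hs.1 hs.2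

/-- The derivative of an invariant function along the orbits vanishes. -/
theorem fderiv_chartFund_of_invariant (h : IsSmoothAction M) (x : M) (ζ : LieT) {y : E4}
    (hy : y ∈ (extChartAt (𝓡 4) x).target) {f : M → ℝ} (hf : ∀ (t : Torus) z, f (t • z) = f z)
    (hd : DifferentiableAt ℝ (chartFun f x) y) :
    fderiv ℝ (chartFun f x) y (chartFund x ζ y) = 0 := by
  have h2 : HasFDerivAt (chartFun f x) (fderiv ℝ (chartFun f x) y)
      (chartAct x ((0 : ℝ) • ζ, y)) := by
    rw [zero_smul, chartAct_zero x hy]; exact hd.hasFDerivAt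
  refine (h2.comp_hasDerivAt (0 : ℝ) (hasDerivAt_chartAct h x ζ hy)).unique
    ((hasDerivAt_const (0 : ℝ) (chartFun f x y)).congr_of_eventuallyEq ?_)
  filter_upwards [(tendsto_smul_prod ζ y).eventually (eventually_mem h x hy)] with s hs
  simp only [Function.comp, chartFun]
  rw [symm_chartAct x (q := (s • ζ, y)) hs.2, hf]

end ChartAct

/-! ### The toric structure in a chart -/

theorem mdifferentiableAt_smul {M : Type*} [TopologicalSpace M] [ChartedSpace E4 M]
    [MulAction Torus M] (h : IsSmoothAction M) (η : LieT) (z : M) :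
    MDifferentiableAt (𝓡 4) (𝓡 4) (fun z : M => torusExp η • z) z := by
  have h1 : ContMDiffAt (𝓡 4) (𝓘(ℝ, LieT).prod (𝓡 4)) ∞ (fun z : M => (η, z)) z :=
    contMDiffAt_const.prodMk contMDiffAt_id
  exact (ContMDiffAt.comp z h.contMDiffAt h1).mdifferentiableAt (by simp)

section ChartToric

variable {M : Type*} [TopologicalSpace M] [ChartedSpace E4 M] [IsManifold (𝓡 4) ∞ M]

theorem mvfderiv_eq_chart {x : M} {y : E4} (hy : y ∈ (extChartAt (𝓡 4) x).target) {f : M → ℝ}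
    (hf : DifferentiableAt ℝ (chartFun f x) y) (v : E4) :
    mvfderiv (𝓡 4) f ((extChartAt (𝓡 4) x).symm y) v =
      fderiv ℝ (chartFun f x) y (chartI x y v) := by
  have hs := mem_chart_source hy
  have hr : extChartAt (𝓡 4) x ((extChartAt (𝓡 4) x).symm y) = y :=
    (extChartAt (𝓡 4) x).right_inv hy
  have e : f =ᶠ[𝓝 ((extChartAt (𝓡 4) x).symm y)] chartFun f x ∘ (extChartAt (𝓡 4) x) := by
    filter_upwards [(chartAt E4 x).open_source.mem_nhds hs] with z hz
    simp only [Function.comp, chartFun]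
    rw [(extChartAt (𝓡 4) x).left_inv (by rwa [extChartAt_source])]
  have h1 := (contMDiffAt_chart hs).mdifferentiableAt (by simp)
  have h2 : MDifferentiableAt 𝓘(ℝ, E4) 𝓘(ℝ, ℝ) (chartFun f x)
      (extChartAt (𝓡 4) x ((extChartAt (𝓡 4) x).symm y)) := by
    rw [hr]; exact hf.mdifferentiableAt
  have h3 := mfderiv_comp _ h2 h1
  rw [← e.mfderiv_eq, mfderiv_eq_fderiv, hr] at h3
  exact congrArg (fun T : E4 →L[ℝ] ℝ => T v) h3

variable [MulAction Torus M]

/-- The derivative of the action of `exp η`. -/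
def smulD (η : LieT) (z : M) : E4 →L[ℝ] E4 :=
  mfderiv (𝓡 4) (𝓡 4) (fun z : M => torusExp η • z) z

/-- The value of a fundamental field, in the model space. -/
def fundAt (ζ : LieT) (z : M) : E4 := fundField ζ z

theorem chartD_chartFund (x : M) (ζ : LieT) {y : E4} (hy : y ∈ (extChartAt (𝓡 4) x).target) :
    chartD x y (chartFund x ζ y) = fundAt ζ ((extChartAt (𝓡 4) x).symm y) :=
  chartD_chartI x hy _

theorem hasDerivAt_clm_apply {A : ℝ → E4 →L[ℝ] E4} {A' : E4 →L[ℝ] E4} {w : ℝ → E4} {w' : E4} {s : ℝ}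
    (hA : HasDerivAt A A' s) (hw : HasDerivAt w w' s) :
    HasDerivAt (fun r => A r (w r)) (A' (w s) + A s w') s := hA.clm_apply hw

theorem chartActD_eq (h : IsSmoothAction M) (x : M) {q : LieT × E4}
    (hq : q.2 ∈ (extChartAt (𝓡 4) x).target)
    (hs : torusExp q.1 • (extChartAt (𝓡 4) x).symm q.2 ∈ (chartAt E4 x).source) (v : E4) :
    chartActD x q.1 q.2 v = chartI x (chartAct x q)
      (smulD q.1 ((extChartAt (𝓡 4) x).symm q.2) (chartD x q.2 v)) := by
  have h1 := (contMDiffAt_chart_symm x hq).mdifferentiableAt (by simp)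
  have h2 := mdifferentiableAt_smul h q.1 ((extChartAt (𝓡 4) x).symm q.2)
  have h3 := (contMDiffAt_chart hs).mdifferentiableAt (by simp)
  have h23 := mfderiv_comp_apply q.2 h2 h1 v
  have h123 := mfderiv_comp_apply q.2 h3 (h2.comp q.2 h1) v
  have hd := (hasFDerivAt_chartAct_right h x hq hs).fderiv
  rw [← hd, ← mfderiv_eq_fderiv]
  refine Eq.trans h123 ?_
  rw [h23]
  have e := symm_chartAct x hs
  have : ∀ w : E4, chartI x (chartAct x q) w = (mfderiv (𝓡 4) 𝓘(ℝ, E4) (extChartAt (𝓡 4) x)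
      (torusExp q.1 • (extChartAt (𝓡 4) x).symm q.2) : E4 →L[ℝ] E4) w := by
    intro w
    rw [chartI, e]; rfl
  exact (this _).symm

theorem chartActD_chartEnd (h : IsSmoothAction M) {Ω : BilinField M} {J : EndField M}
    (hJ : IsDGK Ω J) (x : M) {q : LieT × E4}
    (hq : q.2 ∈ (extChartAt (𝓡 4) x).target)
    (hs : torusExp q.1 • (extChartAt (𝓡 4) x).symm q.2 ∈ (chartAt E4 x).source) (v : E4) :
    chartActD x q.1 q.2 (chartEnd J x q.2 v) =
      chartEnd J x (chartAct x q) (chartActD x q.1 q.2 v) := by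
  have hi : ∀ w : E4, _ = _ := hJ.invariant (torusExp q.1) ((extChartAt (𝓡 4) x).symm q.2)
  rw [chartActD_eq h x hq hs, chartActD_eq h x hq hs, chartEnd_apply, chartD_chartI x hq,
    chartEnd_apply, chartD_chartI x (mem_target_chartAct x hs), symm_chartAct x hs]
  exact congrArg (chartI x (chartAct x q)) (hi (chartD x q.2 v))

/-- The complex structure is invariant under the fundamental fields. -/
theorem chartFund_chartEnd (h : IsSmoothAction M) {Ω : BilinField M} {J : EndField M}
    (hJ : IsDGK Ω J) (x : M) (ζ : LieT) {y : E4} (hy : y ∈ (extChartAt (𝓡 4) x).target) (v : E4) :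
    fderiv ℝ (chartFund x ζ) y (chartEnd J x y v) =
      fderiv ℝ (chartEnd J x) y (chartFund x ζ y) v
        + chartEnd J x y (fderiv ℝ (chartFund x ζ) y v) := by
  have h1 := hasDerivAt_chartActD h x ζ hy (chartEnd J x y v)
  have hj : HasFDerivAt (chartEnd J x) (fderiv ℝ (chartEnd J x) y)
      (chartAct x ((0 : ℝ) • ζ, y)) := by
    rw [zero_smul, chartAct_zero x hy]
    exact ((contDiffAt_chartEnd hJ.smooth x hy).differentiableAt (by simp)).hasFDerivAt
  have hA : HasDerivAt (fun s : ℝ => chartEnd J x (chartAct x (s • ζ, y)))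
      (fderiv ℝ (chartEnd J x) y (chartFund x ζ y)) 0 :=
    HasFDerivAt.comp_hasDerivAt (l := chartEnd J x) (f := fun s : ℝ => chartAct x (s • ζ, y)) (0 : ℝ)
      hj (hasDerivAt_chartAct h x ζ hy)
  have h2 := hasDerivAt_clm_apply hA (hasDerivAt_chartActD h x ζ hy v)
  -- Both expressions are derivatives at time zero of the identity saying that the flow commutes
  -- with `J`.
  have h3 := h1.unique (h2.congr_of_eventuallyEq ?_)
  · rw [zero_smul, chartAct_zero x hy, chartActD_zero h x hy] at h3
    exact h3
  · filter_upwards [(tendsto_smul_prod ζ y).eventually (eventually_mem h x hy)] with s hs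
    exact chartActD_chartEnd h hJ x (q := (s • ζ, y)) hs.1 hs.2 v

theorem eq_zero_of_torusExp {ζ : LieT} (h : ∀ᶠ s : ℝ in 𝓝 0, torusExp (s • ζ) = 1) : ζ = 0 := by
  ext i
  have h1 : (fun s : ℝ => Complex.exp ((s * ζ i : ℝ) * Complex.I)) =ᶠ[𝓝 0] fun _ => 1 := by
    filter_upwards [h] with s hs
    have := congrArg (fun z : Circle => (z : ℂ)) (congrFun hs i)
    simpa [torusExp, Circle.coe_exp] using this
  have h2 : HasDerivAt (fun s : ℝ => Complex.exp ((s * ζ i : ℝ) * Complex.I))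
      (Complex.exp (((0 : ℝ) * ζ i : ℝ) * Complex.I) * ((ζ i : ℝ) * Complex.I)) 0 := by
    refine HasDerivAt.cexp ?_
    refine HasDerivAt.mul_const ?_ _
    have := ((hasDerivAt_id (0 : ℝ)).mul_const (ζ i)).ofReal_comp
    simpa using this
  have h3 := h2.unique ((hasDerivAt_const (0 : ℝ) (1 : ℂ)).congr_of_eventuallyEq h1)
  simpa using h3

/-- The fundamental fields are independent at free points. -/
theorem eq_zero_of_chartFund (h : IsSmoothAction M) (x : M) (ζ : LieT) {y : E4}
    (hy : y ∈ (extChartAt (𝓡 4) x).target) (hf : (extChartAt (𝓡 4) x).symm y ∈ freeLocus M)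
    (h0 : chartFund x ζ y = 0) : ζ = 0 := by
  have hev := (tendsto_smul_prod ζ y).eventually (eventually_mem h x hy)
  obtain ⟨ε, hε, hb⟩ := Metric.eventually_nhds_iff_ball.1 hev
  -- The field at time `s` along the orbit is the image of the field at `y` under the derivative of
  -- the flow, hence zero. So the orbit is constant and a one-parameter family of elements fixes the
  -- point.
  have hder : ∀ s ∈ Metric.ball (0 : ℝ) ε, HasDerivAt (fun s : ℝ => chartAct x (s • ζ, y)) 0 s := by
    intro s hs
    obtain ⟨-, hs2⟩ := hb s hs
    have ht := mem_target_chartAct x (q := (s • ζ, y)) hs2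
    have h1 := hasDerivAt_chartAct h x ζ ht
    rw [← chartActD_chartFund h x ζ (q := (s • ζ, y)) hy hs2] at h1
    simp only [h0, map_zero] at h1
    have h2 : HasDerivAt (fun r : ℝ => chartAct x ((r - s) • ζ, chartAct x (s • ζ, y))) 0 s := by
      have h1' : HasDerivAt (fun s' : ℝ => chartAct x (s' • ζ, chartAct x (s • ζ, y))) 0 (s - s) := by
        rwa [sub_self]
      simpa [Function.comp_def] using h1'.scomp (h := fun r => r - s) s ((hasDerivAt_id s).sub_const s)
    refine h2.congr_of_eventuallyEq (Filter.Eventually.of_forall fun r => ?_)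
    simp only [chartAct]
    have e1 := symm_chartAct x (q := (s • ζ, y)) hs2
    simp only [chartAct] at e1
    rw [e1, smul_smul, ← torusExp_add, ← add_smul, sub_add_cancel]
  have hconst : ∀ s ∈ Metric.ball (0 : ℝ) ε, chartAct x (s • ζ, y) = y := by
    intro s hs
    have hd : DifferentiableOn ℝ (fun s : ℝ => chartAct x (s • ζ, y)) (Metric.ball (0 : ℝ) ε) :=
      fun s hs => (hder s hs).differentiableAt.differentiableWithinAt
    have := Metric.isOpen_ball.is_const_of_deriv_eq_zero
      (convex_ball (0 : ℝ) ε).isPreconnected hd (fun s hs => (hder s hs).deriv) hs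
      (Metric.mem_ball_self hε)
    simpa [chartAct_zero x hy] using this
  refine eq_zero_of_torusExp ?_
  filter_upwards [Metric.ball_mem_nhds (0 : ℝ) hε] with s hs
  refine hf _ ?_
  have := symm_chartAct x (q := (s • ζ, y)) (hb s hs).2
  rw [hconst s hs] at this
  exact this.symm

theorem basis_expand (ξ : Module.Basis (Fin 2) ℝ LieT) (ζ : LieT) :
    ζ = ξ.repr ζ 0 • ξ 0 + ξ.repr ζ 1 • ξ 1 := by
  have := ξ.sum_repr ζ
  rw [Fin.sum_univ_two] at this
  exact this.symm

/-- The toric structure in a chart. -/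
theorem isLocalToric_chart (hopen : IsOpen (freeLocus M)) {Ω : BilinField M}
    (hΩ : IsSymplecticForm Ω) {μ : M → (LieT →L[ℝ] ℝ)} (hμ : IsHamiltonianAction Ω μ)
    (ξ : Module.Basis (Fin 2) ℝ LieT) {J : EndField M} (hJ : IsDGK Ω J) (x : M) :
    IsLocalToric ((extChartAt (𝓡 4) x).target ∩ (extChartAt (𝓡 4) x).symm ⁻¹' freeLocus M)
      (chartBilin Ω x) (chartEnd J x) (fun i => chartFund x (ξ i))
      (fun i => chartFun (fun z => μ z (ξ i)) x) := by
  have h := hμ.smooth_action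
  have gk := isLocalGK_chart hΩ hJ x
  have hm : ∀ i : Fin 2, ∀ y ∈ (extChartAt (𝓡 4) x).target,
      ContDiffAt ℝ ∞ (chartFun (fun z => μ z (ξ i)) x) y := fun i y hy => by
    refine contDiffAt_chartFun ?_ x hy
    exact (ContinuousLinearMap.apply ℝ ℝ (ξ i)).contMDiff.comp hμ.smooth_moment
  exact
  { isOpen := (continuousOn_extChartAt_symm x).isOpen_inter_preimage
      (isOpen_extChartAt_target x) hopen
    smooth_form := fun y hy => gk.smooth_form y hy.1
    smooth_str := fun y hy => gk.smooth_str y hy.1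
    alternating := fun y hy => gk.alternating y hy.1
    closed := fun y hy => gk.closed y hy.1
    sq := fun y hy => gk.sq y hy.1
    tamed := fun y hy => gk.tamed y hy.1
    nijenhuis := fun y hy => gk.nijenhuis y hy.1
    nijenhuis_adj := fun y hy => gk.nijenhuis_adj y hy.1
    smoothK := fun i y hy => contDiffAt_chartFund h x (ξ i) hy.1
    smoothM := fun i y hy => hm i y hy.1
    hamiltonian := fun i y hy v => by
      have h1 := mvfderiv_eq_chart hy.1 ((hm i y hy.1).differentiableAt (by simp)) (chartD x y v)
      rw [chartI_chartD x hy.1] at h1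
      rw [← h1, chartBilin_apply, chartD_chartFund x _ hy.1]
      exact hμ.hamiltonian (ξ i) _ _
    invariant := fun i l y hy => fderiv_chartFund_of_invariant h x (ξ l) hy.1
      (fun t z => by rw [hμ.invariant]) ((hm i y hy.1).differentiableAt (by simp))
    commKK := fun i l y hy => chartFund_comm h x (ξ l) (ξ i) hy.1
    invJ := fun i y hy v => chartFund_chartEnd h hJ x (ξ i) hy.1 v
    indep := fun y hy a b hab => by
      rw [← chartFund_smul h x a (ξ 0) hy.1, ← chartFund_smul h x b (ξ 1) hy.1,
        ← chartFund_add h x _ _ hy.1] at hab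
      have h0 := eq_zero_of_chartFund h x _ hy.1 hy.2 hab
      have h1 := congrArg ξ.repr h0
      have e : ∀ i, ξ.repr (a • ξ 0 + b • ξ 1) i = 0 := fun i => by rw [h1]; simp
      exact ⟨by simpa using e 0, by simpa using e 1⟩
    -- Only the inclusion of `J𝒦` in `J^*𝒦` is needed, and the orbit distribution is spanned by the
    -- fields of the two basis elements.
    anti := fun i y hy => by
      have ha := hJ.antidiagonal _ hy.2
      have hmem : J ((extChartAt (𝓡 4) x).symm y) (fundField (ξ i) ((extChartAt (𝓡 4) x).symm y)) ∈
          (orbitDist ((extChartAt (𝓡 4) x).symm y)).map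
            (J ((extChartAt (𝓡 4) x).symm y) :
              TangentSpace (𝓡 4) ((extChartAt (𝓡 4) x).symm y) →ₗ[ℝ]
              TangentSpace (𝓡 4) ((extChartAt (𝓡 4) x).symm y)) :=
        Submodule.mem_map_of_mem (Submodule.subset_span ⟨ξ i, rfl⟩)
      rw [← ha] at hmem
      obtain ⟨w', hw, hwe⟩ := hmem
      obtain ⟨w, rfl⟩ : ∃ w : E4, w = w' := ⟨w', rfl⟩
      have hc : ∀ w : E4, w ∈ Submodule.span ℝ (Set.range fun ζ : LieT =>
          fundAt ζ ((extChartAt (𝓡 4) x).symm y)) → ∃ a b : ℝ, chartI x y w =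
            a • chartFund x (ξ 0) y + b • chartFund x (ξ 1) y := by
        intro w hw
        induction hw using Submodule.span_induction with
        | mem w hw =>
          obtain ⟨ζ, rfl⟩ := hw
          refine ⟨ξ.repr ζ 0, ξ.repr ζ 1, ?_⟩
          rw [← chartFund_smul h x _ (ξ 0) hy.1, ← chartFund_smul h x _ (ξ 1) hy.1,
            ← chartFund_add h x _ _ hy.1, ← basis_expand ξ ζ]
          rfl
        | zero => exact ⟨0, 0, by simp⟩
        | add u v _ _ hu hv =>
          obtain ⟨a, b, e⟩ := hu
          obtain ⟨c, d, e'⟩ := hv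
          exact ⟨a + c, b + d, by rw [map_add, e, e']; module⟩
        | smul c u _ hu =>
          obtain ⟨a, b, e⟩ := hu
          exact ⟨c * a, c * b, by rw [map_smul, e]; module⟩
      obtain ⟨a, b, hab⟩ := hc w hw
      refine ⟨a, b, ?_⟩
      rw [← hab, ← chartEnd_sympAdjoint hΩ J hy.1, chartEnd_apply, chartEnd_apply,
        chartD_chartFund x _ hy.1, chartD_chartI x hy.1]
      exact (congrArg (chartI x y) hwe).symm }

end ChartToric

/-! ### Derivatives with respect to the momenta -/

namespace IsLocalToric

variable {U : Set E4} {σ : E4 → E4 →L[ℝ] E4 →L[ℝ] ℝ} {j : E4 → E4 →L[ℝ] E4}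
  {K : Fin 2 → E4 → E4} {m : Fin 2 → E4 → ℝ} {y : E4}

theorem along_K_psiSym (h : IsLocalToric U σ j K m) (k i l : Fin 2) (hy : y ∈ U) :
    along (K k) (psiSym σ j K i l) y = 0 := by
  have e : along (K k) (psiSym σ j K i l) y = _ :=
    along_const_mul (f := fun z => psi σ j K i l z + psi σ j K l i z) (1 / 2)
      ((h.smooth_psi i l hy).add (h.smooth_psi l i hy))
  rw [e, along_add (h.smooth_psi i l hy) (h.smooth_psi l i hy), h.along_K_psi _ _ _ hy,
    h.along_K_psi _ _ _ hy]
  simp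

theorem smooth_psiSym (h : IsLocalToric U σ j K m) (i l : Fin 2) (hy : y ∈ U) :
    ContDiffAt ℝ ∞ (psiSym σ j K i l) y :=
  contDiffAt_const.mul ((h.smooth_psi i l hy).add (h.smooth_psi l i hy))

theorem smooth_symDet (h : IsLocalToric U σ j K m) (hy : y ∈ U) :
    ContDiffAt ℝ ∞ (symDet σ j K) y :=
  ((h.smooth_psi 0 0 hy).mul (h.smooth_psi 1 1 hy)).sub
    ((h.smooth_psiSym 0 1 hy).mul (h.smooth_psiSym 0 1 hy))

theorem along_K_symDet (h : IsLocalToric U σ j K m) (k : Fin 2) (hy : y ∈ U) :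
    along (K k) (symDet σ j K) y = 0 := by
  have e : along (K k) (symDet σ j K) y = _ :=
    along_sub (f := fun z => psi σ j K 0 0 z * psi σ j K 1 1 z)
      (g := fun z => psiSym σ j K 0 1 z * psiSym σ j K 0 1 z)
      ((h.smooth_psi 0 0 hy).mul (h.smooth_psi 1 1 hy))
      ((h.smooth_psiSym 0 1 hy).mul (h.smooth_psiSym 0 1 hy))
  rw [e, along_mul (h.smooth_psi 0 0 hy) (h.smooth_psi 1 1 hy),
    along_mul (h.smooth_psiSym 0 1 hy) (h.smooth_psiSym 0 1 hy), h.along_K_psi _ _ _ hy,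
    h.along_K_psi _ _ _ hy, h.along_K_psiSym _ _ _ hy]
  simp

theorem along_K_locQ (h : IsLocalToric U σ j K m) (k i l : Fin 2) (hy : y ∈ U) :
    along (K k) (locQ σ j K i l) y = 0 := by
  have hn : along (K k) (fun z => locQ σ j K i l z * symDet σ j K z) y = 0 := by
    have e : ∀ z ∈ U, locQ σ j K i l z * symDet σ j K z =
        !![-psi σ j K 1 1 z, psiSym σ j K 0 1 z; psiSym σ j K 0 1 z, -psi σ j K 0 0 z] i l :=
      fun z hz => by rw [h.locQ_eq hz, div_mul_cancel₀ _ (h.symDet_ne_zero hz)]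
    rw [along_congr_on h.isOpen e hy]
    fin_cases i <;> fin_cases l <;>
      simp [along_neg, h.along_K_psi _ _ _ hy, h.along_K_psiSym _ _ _ hy]
  rw [along_mul (h.smooth_locQ hy i l) (h.smooth_symDet hy), h.along_K_symDet _ hy, mul_zero,
    add_zero] at hn
  exact (mul_eq_zero.mp hn).resolve_right (h.symDet_ne_zero hy)

/-- The derivatives with respect to the momenta of an invariant function are invariant. -/
theorem along_K_along_N (h : IsLocalToric U σ j K m) (k l : Fin 2) {f : E4 → ℝ}
    (hf : ∀ z ∈ U, ContDiffAt ℝ ∞ f z) (h0 : ∀ z ∈ U, along (K k) f z = 0) (hy : y ∈ U) :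
    along (K k) (along (nField σ j K l) f) y = 0 := by
  rw [along_along_comm (h.smoothK k y hy) (h.smoothN l hy) (hf y hy) (h.commKN k l hy),
    along_congr_on h.isOpen h0 hy, along_const]

/-- The coefficients of the differential of an invariant function. -/
theorem coeff_iff (h : IsLocalToric U σ j K m) (hy : y ∈ U) {f : E4 → ℝ}
    (h0 : ∀ k, fderiv ℝ f y (K k y) = 0) (c : Fin 2 → ℝ) :
    (∀ v, fderiv ℝ f y v = ∑ k, c k * fderiv ℝ (m k) y v) ↔
      c = fun k => along (nField σ j K k) f y := by
  constructor
  · intro hc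
    ext l
    rw [along, hc]
    simp [h.fderiv_moment_N _ _ hy]
  · rintro rfl v
    obtain ⟨a, b, c, d, rfl⟩ := h.exists_combination hy v
    simp [h0, h.fderiv_moment_N _ _ hy, h.invariant _ _ y hy, along, Fin.sum_univ_two]
    ring

end IsLocalToric

section ChartMomentum

variable {M : Type*} [TopologicalSpace M] [ChartedSpace E4 M] [IsManifold (𝓡 4) ∞ M]
  [MulAction Torus M]

/-- At a free point the coefficients of the differential are unique, since the `N_k` are dual to the
momenta. So `epsilon` selects the derivatives along the `N_k`. -/
theorem chartFun_momentumPartial (hopen : IsOpen (freeLocus M)) {Ω : BilinField M}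
    (hΩ : IsSymplecticForm Ω) {μ : M → (LieT →L[ℝ] ℝ)} (hμ : IsHamiltonianAction Ω μ)
    (ξ : Module.Basis (Fin 2) ℝ LieT) {J : EndField M} (hJ : IsDGK Ω J) {x : M} {y : E4}
    (hy : y ∈ (extChartAt (𝓡 4) x).target ∩ (extChartAt (𝓡 4) x).symm ⁻¹' freeLocus M) {f : M → ℝ}
    (hf : DifferentiableAt ℝ (chartFun f x) y)
    (h0 : ∀ k, along (chartFund x (ξ k)) (chartFun f x) y = 0) (i : Fin 2) :
    chartFun (momentumPartial ξ μ f i) x y = along (nField (chartBilin Ω x) (chartEnd J x)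
      (fun i => chartFund x (ξ i)) i) (chartFun f x) y := by
  have h := isLocalToric_chart hopen hΩ hμ ξ hJ x
  have hc := h.coeff_iff hy h0
  have key : (fun c : Fin 2 → ℝ => ∀ v : TangentSpace (𝓡 4) ((extChartAt (𝓡 4) x).symm y),
      mvfderiv (𝓡 4) f ((extChartAt (𝓡 4) x).symm y) v = ∑ k, c k * mvfderiv (𝓡 4)
        (fun z => μ z (ξ k)) ((extChartAt (𝓡 4) x).symm y) v) =
      fun c => c = fun k => along (nField (chartBilin Ω x) (chartEnd J x)
        (fun i => chartFund x (ξ i)) k) (chartFun f x) y := by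
    ext c
    rw [← hc]
    have e : ∀ v : E4, mvfderiv (𝓡 4) f ((extChartAt (𝓡 4) x).symm y) v =
      fderiv ℝ (chartFun f x) y (chartI x y v) := mvfderiv_eq_chart hy.1 hf
    have e' : ∀ (k : Fin 2) (v : E4),
        mvfderiv (𝓡 4) (fun z => μ z (ξ k)) ((extChartAt (𝓡 4) x).symm y) v =
        fderiv ℝ (chartFun (fun z => μ z (ξ k)) x) y (chartI x y v) := fun k =>
      mvfderiv_eq_chart hy.1 ((h.smoothM k y hy).differentiableAt (by simp))
    constructor
    · intro hv v
      have := hv (chartD x y v)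
      rw [e] at this
      simp only [e'] at this
      simpa only [chartI_chartD x hy.1] using this
    · intro hv v
      refine (e v).trans ((hv _).trans (Finset.sum_congr rfl fun k _ => ?_))
      exact congrArg _ (e' k v).symm
  have gen : ∀ (p : (Fin 2 → ℝ) → Prop) (c : Fin 2 → ℝ), p = (fun c' => c' = c) →
      Classical.epsilon p = c := by
    rintro p c rfl
    exact Classical.epsilon_spec (p := fun c' => c' = c) ⟨c, rfl⟩
  exact congrFun (gen _ _ key) i

theorem chartFun_reQ {Ω : BilinField M} (hΩ : IsSymplecticForm Ω) {J : EndField M}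
    (hJ : IsDGK Ω J) (ξ : Module.Basis (Fin 2) ℝ LieT) (i l : Fin 2) {x : M} {y : E4}
    (hy : y ∈ (extChartAt (𝓡 4) x).target) :
    chartFun (reQ Ω J (ξ i) (ξ l)) x y =
      locQ (chartBilin Ω x) (chartEnd J x) (fun i => chartFund x (ξ i)) i l y := by
  have gk := isLocalGK_chart hΩ hJ x
  let A : E4 →L[ℝ] E4 := endAt J ((extChartAt (𝓡 4) x).symm y)
    - endAt (sympAdjoint Ω J) ((extChartAt (𝓡 4) x).symm y)
  have hA : ∀ v, chartEnd J x y v - locAdj (chartBilin Ω x) (chartEnd J x) y v =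
      chartI x y (A (chartD x y v)) := by
    intro v
    rw [← chartEnd_sympAdjoint hΩ J hy, chartEnd_apply, chartEnd_apply, ← map_sub]
    rfl
  have hinv := gk.isInvertible_sub hy
  have hAi : A.IsInvertible := by
    have hinj : Function.Injective A := by
      refine (injective_iff_map_eq_zero A).2 fun w hw => ?_
      have h1 : (chartEnd J x y - locAdj (chartBilin Ω x) (chartEnd J x) y) (chartI x y w) = 0 := by
        rw [_root_.sub_apply, hA, chartD_chartI x hy, hw, map_zero]
      have h2 := (injective_iff_map_eq_zero _).1 hinv.injective _ h1
      rw [← chartD_chartI x hy w, h2, map_zero]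
    exact ⟨(LinearEquiv.ofInjectiveEndo (A : E4 →ₗ[ℝ] E4) hinj).toContinuousLinearEquiv, by ext1; rfl⟩
  have hI : ∀ w, (chartEnd J x y - locAdj (chartBilin Ω x) (chartEnd J x) y).inverse (chartI x y w)
      = chartI x y (A.inverse w) := by
    intro w
    refine hinv.inverse_apply_eq.2 ?_
    rw [_root_.sub_apply, hA, chartD_chartI x hy, hAi.self_apply_inverse]
  have hD : chartD x y (((-2 : ℝ) • (chartEnd J x y
      - locAdj (chartBilin Ω x) (chartEnd J x) y).inverse) (chartFund x (ξ i) y)) =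
      ((-2 : ℝ) • A.inverse) (fundAt (ξ i) ((extChartAt (𝓡 4) x).symm y)) := by
    rw [_root_.smul_apply, map_smul, _root_.smul_apply]
    congr 1
    have : chartFund x (ξ i) y = chartI x y (fundAt (ξ i) ((extChartAt (𝓡 4) x).symm y)) := rfl
    rw [this, hI, chartD_chartI x hy]
  rw [locQ, chartBilin_apply, hD, chartD_chartFund x _ hy]
  rfl

/-- The generalized Hermitian scalar curvature, in a chart, at a free point. -/
theorem sum_momentumPartial (hopen : IsOpen (freeLocus M)) {Ω : BilinField M}
    (hΩ : IsSymplecticForm Ω) {μ : M → (LieT →L[ℝ] ℝ)} (hμ : IsHamiltonianAction Ω μ)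
    (ξ : Module.Basis (Fin 2) ℝ LieT) {J : EndField M} (hJ : IsDGK Ω J) {x : M} {y : E4}
    (hy : y ∈ (extChartAt (𝓡 4) x).target ∩ (extChartAt (𝓡 4) x).symm ⁻¹' freeLocus M) :
    ∑ i, ∑ l, momentumPartial ξ μ (momentumPartial ξ μ (reQ Ω J (ξ i) (ξ l)) l) i
        ((extChartAt (𝓡 4) x).symm y) =
      ∑ i, ∑ l, along (nField (chartBilin Ω x) (chartEnd J x) (fun i => chartFund x (ξ i)) i)
        (along (nField (chartBilin Ω x) (chartEnd J x) (fun i => chartFund x (ξ i)) l)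
          (locQ (chartBilin Ω x) (chartEnd J x) (fun i => chartFund x (ξ i)) i l)) y := by
  have h := isLocalToric_chart hopen hΩ hμ ξ hJ x
  refine Finset.sum_congr rfl fun i _ => Finset.sum_congr rfl fun l _ => ?_
  have e0 : ∀ z ∈ (extChartAt (𝓡 4) x).target ∩ (extChartAt (𝓡 4) x).symm ⁻¹' freeLocus M,
      chartFun (reQ Ω J (ξ i) (ξ l)) x =ᶠ[𝓝 z]
        locQ (chartBilin Ω x) (chartEnd J x) (fun i => chartFund x (ξ i)) i l := by
    intro z hz
    filter_upwards [h.isOpen.mem_nhds hz] with w hw using chartFun_reQ hΩ hJ ξ i l hw.1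
  have e1 : ∀ z ∈ (extChartAt (𝓡 4) x).target ∩ (extChartAt (𝓡 4) x).symm ⁻¹' freeLocus M,
      chartFun (momentumPartial ξ μ (reQ Ω J (ξ i) (ξ l)) l) x z =
        along (nField (chartBilin Ω x) (chartEnd J x) (fun i => chartFund x (ξ i)) l)
          (locQ (chartBilin Ω x) (chartEnd J x) (fun i => chartFund x (ξ i)) i l) z := by
    intro z hz
    rw [chartFun_momentumPartial hopen hΩ hμ ξ hJ hz, along_congr (e0 z hz)]
    · exact (((h.smooth_locQ hz i l).congr_of_eventuallyEq (e0 z hz)).differentiableAt (by simp))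
    · intro k
      rw [along_congr (e0 z hz)]
      exact h.along_K_locQ k i l hz
  have e1' : chartFun (momentumPartial ξ μ (reQ Ω J (ξ i) (ξ l)) l) x =ᶠ[𝓝 y]
        along (nField (chartBilin Ω x) (chartEnd J x) (fun i => chartFund x (ξ i)) l)
          (locQ (chartBilin Ω x) (chartEnd J x) (fun i => chartFund x (ξ i)) i l) := by
    filter_upwards [h.isOpen.mem_nhds hy] with w hw using e1 w hw
  have e2 := chartFun_momentumPartial (f := momentumPartial ξ μ (reQ Ω J (ξ i) (ξ l)) l)
    hopen hΩ hμ ξ hJ hy ?_ ?_ i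
  · exact e2.trans (along_congr e1')
  · exact ((contDiffAt_along (h.smoothN l hy) (h.smooth_locQ hy i l)).congr_of_eventuallyEq
      e1').differentiableAt (by simp)
  · intro k
    rw [along_congr e1']
    exact h.along_K_along_N k l (fun z hz => h.smooth_locQ hz i l)
      (fun z hz => h.along_K_locQ k i l hz) hy

end ChartMomentum

/-! ### The free locus is open and dense -/

section Circle

/-- The circle has no small subgroups. -/
theorem exists_pow_re_nonpos {z : Circle} (hz : z ≠ 1) : ∃ n : ℕ, ((z ^ n : Circle) : ℂ).re ≤ 0 := by
  by_contra! h
  have hsq : ∀ w : Circle, 1 - ((w ^ 2 : Circle) : ℂ).re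
      = 2 * (1 - (w : ℂ).re) * (1 + (w : ℂ).re) := by
    intro w
    have hn : (w : ℂ).re * (w : ℂ).re + (w : ℂ).im * (w : ℂ).im = 1 := by
      have := Circle.normSq_coe w
      rwa [Complex.normSq_apply] at this
    have : ((w ^ 2 : Circle) : ℂ).re = (w : ℂ).re * (w : ℂ).re - (w : ℂ).im * (w : ℂ).im := by
      rw [sq, Circle.coe_mul, Complex.mul_re]
    rw [this]; linarith
  -- Squaring multiplies `1 - Re w` by `2 (1 + Re w)`, a factor at least 2 while the real part is
  -- positive; iteration would push it past 1.
  have hgrow : ∀ k : ℕ, 2 ^ k * (1 - (z : ℂ).re) ≤ 1 - ((z ^ (2 ^ k) : Circle) : ℂ).re := by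
    intro k
    induction k with
    | zero => simp
    | succ k ih =>
      have e : z ^ (2 ^ (k + 1)) = (z ^ (2 ^ k)) ^ 2 := by rw [← pow_mul, ← pow_succ]
      rw [e, hsq]
      have h1 := h (2 ^ k)
      have h2 : 0 ≤ 1 - ((z ^ (2 ^ k) : Circle) : ℂ).re := by
        have := Complex.re_le_norm ((z ^ (2 ^ k) : Circle) : ℂ)
        rw [Circle.norm_coe] at this
        linarith
      rw [pow_succ]
      nlinarith
  have h0 : 0 < 1 - (z : ℂ).re := by
    have hle : (z : ℂ).re ≤ 1 := by
      have := Complex.re_le_norm (z : ℂ)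
      rwa [Circle.norm_coe] at this
    rcases hle.lt_or_eq with h1 | h1
    · linarith
    · exfalso
      apply hz
      have hn := Circle.normSq_coe z
      rw [Complex.normSq_apply, h1] at hn
      have him : (z : ℂ).im = 0 := by nlinarith
      ext
      exact Complex.ext (by simpa using h1) (by simpa using him)
  obtain ⟨k, hk⟩ := pow_unbounded_of_one_lt (1 / (1 - (z : ℂ).re)) (one_lt_two (α := ℝ))
  have h1 := hgrow k
  have h2 := h (2 ^ k)
  rw [div_lt_iff₀ h0] at hk
  linarith

/-- A nontrivial closed subgroup of the circle contains a nontrivial element of finite order. -/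
theorem exists_torsion_circle (H : Subgroup Circle) (hc : IsClosed (H : Set Circle))
    (hne : ∃ h ∈ H, h ≠ 1) : ∃ h ∈ H, h ≠ 1 ∧ ∃ n : ℕ, 0 < n ∧ h ^ n = 1 := by
  let L : AddSubgroup ℝ :=
    { carrier := {θ | Circle.exp θ ∈ H}
      zero_mem' := by simp [H.one_mem]
      add_mem' := fun {a b} ha hb => by
        simp only [Set.mem_ofPred_eq, Circle.exp_add] at ha hb ⊢
        exact H.mul_mem ha hb
      neg_mem' := fun {a} ha => by
        simp only [Set.mem_ofPred_eq, Circle.exp_neg] at ha ⊢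
        exact H.inv_mem ha }
  have hL : ∀ θ, θ ∈ L ↔ Circle.exp θ ∈ H := fun θ => Iff.rfl
  have hLc : IsClosed (L : Set ℝ) := hc.preimage Circle.exp.continuous
  -- The preimage of `H` in `ℝ` is closed, so it is all of `ℝ` or cyclic. It contains `2π`, so in
  -- the cyclic case every element is commensurable with `2π` and its image has finite order.
  rcases L.dense_or_cyclic with hd | ⟨a, ha⟩
  · have hall : ∀ θ, θ ∈ L := fun θ => by
      have : θ ∈ closure (L : Set ℝ) := hd θ
      rwa [hLc.closure_eq] at this
    refine ⟨Circle.exp Real.pi, (hL _).1 (hall _), ?_, 2, two_pos, ?_⟩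
    · intro h
      have := congrArg (fun z : Circle => (z : ℂ)) h
      simp only [Circle.coe_exp, Complex.exp_pi_mul_I, Circle.coe_one] at this
      norm_num at this
    · rw [sq, ← Circle.exp_add, ← two_mul, Circle.exp_two_pi]
  · have h2 : 2 * Real.pi ∈ L := by rw [hL, Circle.exp_two_pi]; exact H.one_mem
    rw [ha, AddSubgroup.mem_closure_singleton] at h2
    obtain ⟨k, hk⟩ := h2
    have hk0 : k ≠ 0 := by
      rintro rfl
      rw [zero_smul] at hk
      exact (by positivity : (2 * Real.pi) ≠ 0) hk.symm
    obtain ⟨h, hh, h1⟩ := hne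
    obtain ⟨θ, rfl⟩ := Circle.exp_surjective h
    have hθ : θ ∈ L := hh
    rw [ha, AddSubgroup.mem_closure_singleton] at hθ
    obtain ⟨n, rfl⟩ := hθ
    refine ⟨_, hh, h1, k.natAbs, Int.natAbs_pos.2 hk0, ?_⟩
    have hz : (Circle.exp (n • a)) ^ k = 1 := by
      rw [← Circle.exp_zsmul, smul_comm, hk, zsmul_eq_mul, mul_comm, Circle.exp_two_pi_mul_int]
    rcases Int.natAbs_eq k with e | e
    · rw [e, zpow_natCast] at hz; exact hz
    · rw [e, zpow_neg, zpow_natCast, inv_eq_one] at hz; exact hz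

/-- A nontrivial closed subgroup of the torus contains a nontrivial element of finite order. -/
theorem exists_torsion_torus (S : Subgroup Torus) (hc : IsClosed (S : Set Torus))
    (hne : ∃ t ∈ S, t ≠ 1) : ∃ t ∈ S, t ≠ 1 ∧ ∃ n : ℕ, 0 < n ∧ t ^ n = 1 := by
  let ι : Circle →* Torus := MonoidHom.mulSingle (fun _ : Fin 2 => Circle) 1
  have hι : Continuous ι := continuous_mulSingle (A := fun _ : Fin 2 => Circle) 1
  have hιi : Function.Injective ι := Pi.mulSingle_injective (M := fun _ : Fin 2 => Circle) 1
  -- Either `S` meets the factor of index 1 nontrivially, or projection to the factor of index 0 is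
  -- injective on `S`. In the second case the image is closed by compactness, and torsion lifts back
  -- by injectivity.
  by_cases h1 : ∃ z ∈ S.comap ι, z ≠ 1
  · obtain ⟨z, hz, hz1, n, hn, hzn⟩ := exists_torsion_circle (S.comap ι) (hc.preimage hι) h1
    refine ⟨ι z, hz, fun h => hz1 (hιi (h.trans (map_one ι).symm)), n, hn, ?_⟩
    rw [← map_pow, hzn, map_one]
  · push Not at h1
    have key : ∀ t ∈ S, t 0 = 1 → t = 1 := by
      intro t ht h0
      have e : t = ι (t 1) := by
        ext1 i
        fin_cases i
        · simpa [ι] using h0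
        · simp [ι]
      have : t 1 = 1 := h1 (t 1) (by rw [Subgroup.mem_comap, ← e]; exact ht)
      rw [e, this, map_one]
    let P : Subgroup Circle := S.map (Pi.evalMonoidHom (fun _ : Fin 2 => Circle) 0)
    have hP : IsClosed (P : Set Circle) := by
      have hcomp : IsCompact (S : Set Torus) := hc.isCompact
      exact (hcomp.image (continuous_apply 0)).isClosed
    obtain ⟨t, ht, ht1⟩ := hne
    obtain ⟨p, hp, hp1, n, hn, hpn⟩ := exists_torsion_circle P hP
      ⟨t 0, ⟨t, ht, rfl⟩, fun h => ht1 (key t ht h)⟩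
    obtain ⟨s, hs, rfl⟩ := hp
    refine ⟨s, hs, fun h => hp1 (by rw [h]; rfl), n, hn, key _ (S.pow_mem hs n) hpn⟩

theorem countable_torsion : {t : Torus | ∃ n : ℕ, 0 < n ∧ t ^ n = 1}.Countable := by
  have h : {t : Torus | ∃ n : ℕ, 0 < n ∧ t ^ n = 1} ⊆
      ⋃ n : ℕ, {t : Torus | 0 < n ∧ t ^ n = 1} := by
    rintro t ⟨n, hn⟩
    exact Set.mem_iUnion.2 ⟨n, hn⟩
  refine (Set.countable_iUnion fun n => Set.Finite.countable ?_).mono h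
  rcases Nat.eq_zero_or_pos n with rfl | hn
  · simp
  have hf : {z : Circle | z ^ n = 1}.Finite := by
    have h1 : ((Polynomial.nthRootsFinset n (1 : ℂ) : Finset ℂ) : Set ℂ).Finite :=
      Finset.finite_toSet _
    refine (h1.preimage (f := fun z : Circle => (z : ℂ)) Subtype.val_injective.injOn).subset ?_
    intro z hz
    simp only [Set.mem_preimage, Finset.mem_coe]
    rw [Polynomial.mem_nthRootsFinset hn]
    have := congrArg (fun z : Circle => (z : ℂ)) hz
    simpa using this
  refine (Set.Finite.pi' (fun _ : Fin 2 => hf)).subset ?_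
  rintro t ⟨-, ht⟩ i
  exact congrFun ht i

end Circle

section FreeLocus

variable {M : Type*} [TopologicalSpace M] [ChartedSpace E4 M] [MulAction Torus M]

theorem torusExp_surjective : Function.Surjective torusExp := fun t => by
  choose θ hθ using fun i => Circle.exp_surjective (t i)
  exact ⟨θ, funext hθ⟩

theorem isOpenQuotientMap_torusExp : IsOpenQuotientMap torusExp := by
  have h : ∀ _ : Fin 2, IsOpenQuotientMap (Circle.exp : ℝ → Circle) := fun _ =>
    ⟨Circle.exp_surjective, Circle.exp.continuous, isLocalHomeomorph_circleExp.isOpenMap⟩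
  exact IsOpenQuotientMap.piMap h

/-- Smoothness is given on `𝔱 × M`; since `exp` is an open quotient map, continuity descends to `𝕋 ×
M`. -/
theorem continuous_action (h : IsSmoothAction M) :
    Continuous (fun q : Torus × M => q.1 • q.2) := by
  have hq : IsOpenQuotientMap (Prod.map torusExp (id : M → M)) :=
    isOpenQuotientMap_torusExp.prodMap .id
  exact hq.isQuotientMap.continuous_iff.2 h.continuous

theorem continuous_smul_right (h : IsSmoothAction M) (t : Torus) :
    Continuous (fun x : M => t • x) :=
  (continuous_action h).comp (Continuous.prodMk_right t)

/-- The circle has no small subgroups: a nontrivial stabilizer contains an element with some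
component of nonpositive real part. Pairs of such an element and a point it fixes form a closed set,
and projection along the compact torus is closed. -/
theorem isOpen_freeLocus [T2Space M] (h : IsSmoothAction M) : IsOpen (freeLocus M) := by
  have hc' : IsClosed {q : Torus × M | ∃ i, ((q.1 i : Circle) : ℂ).re ≤ 0} := by
    rw [Set.ofPred_exists]
    refine isClosed_iUnion_of_finite fun i => ?_
    refine isClosed_le ?_ continuous_const
    exact Complex.continuous_re.comp (continuous_subtype_val.comp
      ((continuous_apply i).comp continuous_fst))
  have hc : IsClosed {q : Torus × M | (∃ i, ((q.1 i : Circle) : ℂ).re ≤ 0) ∧ q.1 • q.2 = q.2} :=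
    hc'.inter (isClosed_eq (continuous_action h) continuous_snd)
  have himg := isClosedMap_snd_of_compactSpace (X := Torus) (Y := M) _ hc
  have e : freeLocus M = (Prod.snd '' {q : Torus × M |
      (∃ i, ((q.1 i : Circle) : ℂ).re ≤ 0) ∧ q.1 • q.2 = q.2})ᶜ := by
    ext x
    simp only [freeLocus, Set.mem_ofPred_eq, Set.mem_compl_iff, Set.mem_image, Prod.exists,
      exists_eq_right, not_exists]
    constructor
    · rintro hx t ⟨⟨i, hi⟩, ht⟩
      rw [hx t ht] at hi
      norm_num at hi
    · intro hx t ht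
      by_contra h1
      obtain ⟨i, hi⟩ : ∃ i, t i ≠ 1 := by
        by_contra! hh
        exact h1 (funext hh)
      obtain ⟨n, hn⟩ := exists_pow_re_nonpos hi
      refine hx (t ^ n) ⟨⟨i, hn⟩, ?_⟩
      exact (MulAction.stabilizer Torus x).pow_mem (show t ∈ MulAction.stabilizer Torus x from ht) n
  rw [e]
  exact himg.isOpen_compl

theorem contMDiff_smul (h : IsSmoothAction M) (t : Torus) :
    ContMDiff (𝓡 4) (𝓡 4) ∞ (fun z : M => t • z) := by
  obtain ⟨η, rfl⟩ := torusExp_surjective t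
  have h1 : ContMDiff (𝓡 4) (𝓘(ℝ, LieT).prod (𝓡 4)) ∞ (fun z : M => (η, z)) :=
    contMDiff_const.prodMk contMDiff_id
  exact h.comp h1

/-- The action of `t` in the preferred chart at `x`. -/
def chartSmul (x : M) (t : Torus) (y : E4) : E4 :=
  extChartAt (𝓡 4) x (t • (extChartAt (𝓡 4) x).symm y)

theorem chartSmul_mul {x : M} {s t : Torus} {y : E4}
    (hs : t • (extChartAt (𝓡 4) x).symm y ∈ (chartAt E4 x).source) :
    chartSmul x s (chartSmul x t y) = chartSmul x (s * t) y := by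
  simp only [chartSmul]
  rw [(extChartAt (𝓡 4) x).left_inv (by rwa [extChartAt_source]), smul_smul]

variable [IsManifold (𝓡 4) ∞ M]

theorem contDiffAt_chartSmul (h : IsSmoothAction M) {x : M} {t : Torus} {y : E4}
    (hy : y ∈ (extChartAt (𝓡 4) x).target)
    (hs : t • (extChartAt (𝓡 4) x).symm y ∈ (chartAt E4 x).source) :
    ContDiffAt ℝ ∞ (chartSmul x t) y :=
  (ContMDiffAt.comp y (contMDiffAt_chart hs) (ContMDiffAt.comp y (contMDiff_smul h t).contMDiffAt
    (contMDiffAt_chart_symm x hy))).contDiffAt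

theorem eventually_chartSmul_mem (h : IsSmoothAction M) {x : M} {t : Torus} {y : E4}
    (hy : y ∈ (extChartAt (𝓡 4) x).target)
    (hs : t • (extChartAt (𝓡 4) x).symm y ∈ (chartAt E4 x).source) :
    ∀ᶠ z in 𝓝 y, t • (extChartAt (𝓡 4) x).symm z ∈ (chartAt E4 x).source := by
  have hc : ContinuousAt (fun z => t • (extChartAt (𝓡 4) x).symm z) y :=
    (continuous_smul_right h t).continuousAt.comp (contMDiffAt_chart_symm x hy).continuousAt
  exact hc.preimage_mem_nhds ((chartAt E4 x).open_source.mem_nhds hs)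

/-- An element of finite order whose derivative at a fixed point is the identity is the identity
near this point. -/
theorem eventually_fixed (h : IsSmoothAction M) {t : Torus} {n : ℕ} (hn : 0 < n) (ht : t ^ n = 1)
    {x : M} (hx : t • x = x)
    (hd : fderiv ℝ (chartSmul x t) (extChartAt (𝓡 4) x x) = ContinuousLinearMap.id ℝ E4) :
    ∀ᶠ z in 𝓝 x, t • z = z := by
  have hy : extChartAt (𝓡 4) x x ∈ (extChartAt (𝓡 4) x).target := mem_extChartAt_target x
  have hψ : (extChartAt (𝓡 4) x).symm (extChartAt (𝓡 4) x x) = x := extChartAt_to_inv x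
  have hxk : ∀ k : ℕ, t ^ k • x = x := fun k =>
    (MulAction.stabilizer Torus x).pow_mem (show t ∈ MulAction.stabilizer Torus x from hx) k
  have hs : ∀ k : ℕ, t ^ k • (extChartAt (𝓡 4) x).symm (extChartAt (𝓡 4) x x) ∈
      (chartAt E4 x).source := fun k => by
    rw [hψ, hxk]; exact ChartedSpace.mem_chart_source x
  have hsm : ∀ k, ContDiffAt ℝ ∞ (chartSmul x (t ^ k)) (extChartAt (𝓡 4) x x) := fun k =>
    contDiffAt_chartSmul h hy (hs k)
  have hfix : ∀ k : ℕ, chartSmul x (t ^ k) (extChartAt (𝓡 4) x x) = extChartAt (𝓡 4) x x :=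
    fun k => by rw [chartSmul, hψ, hxk]
  have hfd : ∀ k : ℕ, HasFDerivAt (chartSmul x (t ^ k)) (ContinuousLinearMap.id ℝ E4)
      (extChartAt (𝓡 4) x x) := by
    intro k
    induction k with
    | zero =>
      refine (hasFDerivAt_id _).congr_of_eventuallyEq ?_
      filter_upwards [chart_target_mem_nhds hy] with z hz
      simp only [pow_zero, chartSmul, one_smul, id]
      exact (extChartAt (𝓡 4) x).right_inv hz
    | succ k ih =>
      have h1 : HasFDerivAt (chartSmul x t) (ContinuousLinearMap.id ℝ E4)
          (chartSmul x (t ^ k) (extChartAt (𝓡 4) x x)) := by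
        rw [hfix k, ← hd]
        have := hsm 1
        rw [pow_one] at this
        exact (this.differentiableAt (by simp)).hasFDerivAt
      have h2 := h1.comp _ ih
      refine (h2.congr_of_eventuallyEq ?_)
      filter_upwards [eventually_chartSmul_mem h hy (hs k)] with z hz
      rw [Function.comp, chartSmul_mul hz, pow_succ']
  -- The orbit sum satisfies `A ∘ t = A` because `tⁿ = 1`. Its derivative at the fixed point is `n`
  -- times the identity, so it is injective nearby, and `t` must be the identity there.
  let A : E4 → E4 := fun z => ∑ k ∈ Finset.range n, chartSmul x (t ^ k) z
  have hA : ContDiffAt ℝ ∞ A (extChartAt (𝓡 4) x x) := ContDiffAt.sum fun k _ => hsm k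
  have hA' : HasFDerivAt A ((n : ℝ) • ContinuousLinearMap.id ℝ E4) (extChartAt (𝓡 4) x x) := by
    have := HasFDerivAt.fun_sum (u := Finset.range n) fun k _ => hfd k
    simpa [A, ← Nat.cast_smul_eq_nsmul ℝ] using this
  have hn0 : (n : ℝ) ≠ 0 := Nat.cast_ne_zero.2 hn.ne'
  let e : E4 ≃L[ℝ] E4 := ContinuousLinearEquiv.smulLeft (Units.mk0 (n : ℝ) hn0)
  have hstrict : HasStrictFDerivAt A (e : E4 →L[ℝ] E4) (extChartAt (𝓡 4) x x) := by
    refine hA.hasStrictFDerivAt' ?_ (by simp)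
    exact hA'
  have hinj : ∃ W ∈ 𝓝 (extChartAt (𝓡 4) x x), Set.InjOn A W :=
    ⟨_, (hstrict.toOpenPartialHomeomorph A).open_source.mem_nhds
      hstrict.mem_toOpenPartialHomeomorph_source, (hstrict.toOpenPartialHomeomorph A).injOn⟩
  obtain ⟨W, hW, hinj⟩ := hinj
  have hcx : ContinuousAt (extChartAt (𝓡 4) x) x := continuousAt_extChartAt x
  have hcx' : ContinuousAt (fun z => extChartAt (𝓡 4) x (t • z)) x := by
    refine ContinuousAt.comp_of_eq hcx (continuous_smul_right h t).continuousAt hx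
  have m1 := hcx.preimage_mem_nhds hW
  have m2 := hcx'.preimage_mem_nhds (by simpa only [hx] using hW)
  have m3 := (chartAt E4 x).open_source.mem_nhds (ChartedSpace.mem_chart_source x)
  have m4 := (continuous_smul_right h t).continuousAt.preimage_mem_nhds
    ((chartAt E4 x).open_source.mem_nhds (by rw [hx]; exact ChartedSpace.mem_chart_source x))
  filter_upwards [m1, m2, m3, m4] with z h1 h2 h3 h4
  have hl : ∀ w, w ∈ (chartAt E4 x).source →
      (extChartAt (𝓡 4) x).symm (extChartAt (𝓡 4) x w) = w := fun w hw =>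
    (extChartAt (𝓡 4) x).left_inv (by rwa [extChartAt_source])
  have hAeq : A (extChartAt (𝓡 4) x (t • z)) = A (extChartAt (𝓡 4) x z) := by
    simp only [A, chartSmul]
    rw [hl _ h3, hl _ h4]
    have e1 : ∀ k : ℕ, extChartAt (𝓡 4) x (t ^ k • t • z) = extChartAt (𝓡 4) x (t ^ (k + 1) • z) :=
      fun k => by rw [smul_smul, ← pow_succ]
    simp only [e1]
    have e2 := Finset.sum_range_succ (fun k => extChartAt (𝓡 4) x (t ^ k • z)) n
    rw [Finset.sum_range_succ', ht, pow_zero] at e2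
    exact add_right_cancel e2
  have h5 := congrArg (extChartAt (𝓡 4) x).symm (hinj h2 h1 hAeq)
  exact (hl _ h4).symm.trans (h5.trans (hl _ h3))

/-- The fixed points of a nontrivial element of finite order form a set with empty interior. -/
theorem interior_fixed_eq_empty [T2Space M] [ConnectedSpace M] [FaithfulSMul Torus M] (h : IsSmoothAction M)
    {t : Torus} (h1 : t ≠ 1) {n : ℕ} (hn : 0 < n) (ht : t ^ n = 1) :
    interior {x : M | t • x = x} = ∅ := by
  have hclosed : IsClosed {x : M | t • x = x} :=
    isClosed_eq (continuous_smul_right h t) continuous_id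
  -- At a limit point of the interior the derivative of `t` is the identity by continuity, so `t` is
  -- the identity nearby. The interior is thus open and closed: empty by connectedness and
  -- faithfulness.
  have hcl : IsClosed (interior {x : M | t • x = x}) := by
    refine isClosed_of_closure_subset fun x hx => ?_
    have hxf : t • x = x := closure_minimal interior_subset hclosed hx
    refine mem_interior_iff_mem_nhds.2 (eventually_fixed h hn ht hxf ?_)
    have hy : extChartAt (𝓡 4) x x ∈ (extChartAt (𝓡 4) x).target := mem_extChartAt_target x
    have hψ : (extChartAt (𝓡 4) x).symm (extChartAt (𝓡 4) x x) = x := extChartAt_to_inv x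
    have hsm : ContDiffAt ℝ ∞ (chartSmul x t) (extChartAt (𝓡 4) x x) :=
      contDiffAt_chartSmul h hy (by rw [hψ, hxf]; exact ChartedSpace.mem_chart_source x)
    let W := (extChartAt (𝓡 4) x).target ∩ (extChartAt (𝓡 4) x).symm ⁻¹'
      interior {x : M | t • x = x}
    have hWo : IsOpen W := (continuousOn_extChartAt_symm x).isOpen_inter_preimage
      (isOpen_extChartAt_target x) isOpen_interior
    have hWe : ∀ z ∈ W, fderiv ℝ (chartSmul x t) z = ContinuousLinearMap.id ℝ E4 := by
      intro z hz
      have e : chartSmul x t =ᶠ[𝓝 z] id := by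
        filter_upwards [hWo.mem_nhds hz] with w hw
        have : t • (extChartAt (𝓡 4) x).symm w = (extChartAt (𝓡 4) x).symm w :=
          interior_subset (s := {x : M | t • x = x}) hw.2
        rw [chartSmul, this, (extChartAt (𝓡 4) x).right_inv hw.1]; rfl
      rw [e.fderiv_eq, fderiv_id]
    have hWc : extChartAt (𝓡 4) x x ∈ closure W := by
      rw [mem_closure_iff_nhds]
      intro V hV
      have hV' := (continuousAt_extChartAt (I := 𝓡 4) x).preimage_mem_nhds hV
      have m3 := (chartAt E4 x).open_source.mem_nhds (ChartedSpace.mem_chart_source x)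
      obtain ⟨z, ⟨hz1, hz2⟩, hz3⟩ := mem_closure_iff_nhds.1 hx _ (Filter.inter_mem hV' m3)
      have hz2' : z ∈ (extChartAt (𝓡 4) x).source := by rwa [extChartAt_source]
      refine ⟨extChartAt (𝓡 4) x z, hz1, (extChartAt (𝓡 4) x).map_source hz2', ?_⟩
      rw [Set.mem_preimage, (extChartAt (𝓡 4) x).left_inv hz2']
      exact hz3
    have hne : (𝓝[W] (extChartAt (𝓡 4) x x)).NeBot := mem_closure_iff_nhdsWithin_neBot.1 hWc
    have hcont : ContinuousAt (fderiv ℝ (chartSmul x t)) (extChartAt (𝓡 4) x x) :=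
      (hsm.fderiv_right (m := ∞) (by simp)).continuousAt
    refine tendsto_nhds_unique (l := 𝓝[W] (extChartAt (𝓡 4) x x)) (hcont.tendsto.mono_left nhdsWithin_le_nhds) ?_
    exact tendsto_const_nhds.congr' (Filter.eventually_of_mem self_mem_nhdsWithin
      fun z hz => (hWe z hz).symm)
  rcases isClopen_iff.1 ⟨hcl, isOpen_interior⟩ with he | he
  · exact he
  · exfalso
    refine h1 (eq_of_smul_eq_smul (α := M) fun x => ?_)
    have : x ∈ interior {x : M | t • x = x} := by rw [he]; trivial
    rw [one_smul]
    exact interior_subset (s := {x : M | t • x = x}) this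

/-- Stabilizers are closed, so a nonfree point is fixed by a nontrivial torsion element. There are
countably many of these, with closed fixed sets of empty interior, and Baire's theorem applies. -/
theorem dense_freeLocus [T2Space M] [CompactSpace M] [ConnectedSpace M] [FaithfulSMul Torus M]
    (h : IsSmoothAction M) : Dense (freeLocus M) := by
  have hd : Dense (⋂ t ∈ {t : Torus | t ≠ 1 ∧ ∃ n : ℕ, 0 < n ∧ t ^ n = 1},
      {x : M | t • x = x}ᶜ) := by
    refine dense_biInter_of_isOpen (fun t _ => ?_) (countable_torsion.mono fun t ht => ht.2) ?_
    · exact (isClosed_eq (continuous_smul_right h t) continuous_id).isOpen_compl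
    · rintro t ⟨h1, n, hn, ht⟩
      exact interior_eq_empty_iff_dense_compl.1 (interior_fixed_eq_empty h h1 hn ht)
  refine hd.mono fun x hx t htx => ?_
  by_contra h1
  have hS : IsClosed (MulAction.stabilizer Torus x : Set Torus) := by
    have hc : Continuous fun t : Torus => t • x :=
      (continuous_action h).comp (Continuous.prodMk_left x)
    exact isClosed_eq hc continuous_const
  obtain ⟨s, hs, hs1, hs2⟩ := exists_torsion_torus _ hS ⟨t, htx, h1⟩
  have := Set.mem_iInter₂.1 hx s ⟨hs1, hs2⟩
  exact this hs

end FreeLocus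

/-! ### The two formulas -/

/-- The right hand side of the second formula. -/
def riemannianSide (σ : E4 → E4 →L[ℝ] E4 →L[ℝ] ℝ) (j : E4 → E4 →L[ℝ] E4) (y : E4) : ℝ :=
  scalarCurvature (locMetric σ j) y
    + 2 * laplacian (locMetric σ j) (locAngle σ j) y / (1 - locAngle σ j y)
    - 1 / (1 - locAngle σ j y ^ 2) * ((4 + 2 * locAngle σ j y) / (1 - locAngle σ j y) - 1 / 2)
      * normSqOne (locMetric σ j y) (fderiv ℝ (locAngle σ j) y)

theorem laplacian_const (G : E4 → E4 →L[ℝ] E4 →L[ℝ] ℝ) (c : ℝ) (y : E4) :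
    laplacian G (fun _ => c) y = 0 := by
  have e : fderiv ℝ (fun _ : E4 => c) = fun _ => 0 := by
    ext1 z; simp
  simp [laplacian, metricTrace, e]

/-- The second right hand side in the Kähler case. -/
theorem riemannianSide_of_angle {σ : E4 → E4 →L[ℝ] E4 →L[ℝ] ℝ} {j : E4 → E4 →L[ℝ] E4} {y : E4}
    (h : locAngle σ j =ᶠ[𝓝 y] fun _ => -1) :
    riemannianSide σ j y = scalarCurvature (locMetric σ j) y := by
  rw [riemannianSide, laplacian_congr (Filter.EventuallyEq.refl _ _) h, laplacian_const, h.eq_of_nhds]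
  norm_num

section Global

variable {M : Type*} [TopologicalSpace M] [ChartedSpace E4 M] [IsManifold (𝓡 4) ∞ M]

theorem angle_eq_locAngle {Ω : BilinField M} (hΩ : IsSymplecticForm Ω) (J : EndField M) (x : M) :
    angle Ω J x = locAngle (chartBilin Ω x) (chartEnd J x) (extChartAt (𝓡 4) x x) := by
  rw [← chartFun_angle hΩ J (mem_extChartAt_target x), chartFun, extChartAt_to_inv]

theorem metric_eventuallyEq (Ω : BilinField M) (J : EndField M) (x : M) :
    chartBilin (metric Ω J) x =ᶠ[𝓝 (extChartAt (𝓡 4) x x)]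
      locMetric (chartBilin Ω x) (chartEnd J x) := by
  filter_upwards [chart_target_mem_nhds (mem_extChartAt_target x)] with z hz
    using chartBilin_metric Ω J hz

theorem angle_eventuallyEq {Ω : BilinField M} (hΩ : IsSymplecticForm Ω) (J : EndField M) (x : M) :
    chartFun (angle Ω J) x =ᶠ[𝓝 (extChartAt (𝓡 4) x x)]
      locAngle (chartBilin Ω x) (chartEnd J x) := by
  filter_upwards [chart_target_mem_nhds (mem_extChartAt_target x)] with z hz
    using chartFun_angle hΩ J hz

theorem hermitian_side_eq {Ω : BilinField M} (hΩ : IsSymplecticForm Ω) (J : EndField M) (x : M) :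
    uHerm Ω J x - (4 - 2 * angle Ω J x) / (1 - angle Ω J x) * leeNormSq Ω J x
        + 2 * commutatorInnerLee Ω J x / (1 - angle Ω J x) =
      hermitianSide (chartBilin Ω x) (chartEnd J x) (extChartAt (𝓡 4) x x) := by
  have e := metric_eventuallyEq Ω J x
  have r : chartEnd J x =ᶠ[𝓝 (extChartAt (𝓡 4) x x)] chartEnd J x := Filter.EventuallyEq.refl _ _
  rw [hermitianSide, angle_eq_locAngle hΩ, uHerm, leeNormSq, commutatorInnerLee,
    hermitianScalar_congr e r, leeForm_congr e r, e.eq_of_nhds,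
    chartEnd_commutator hΩ J (mem_extChartAt_target x)]
  simp only [extDerivOne]
  rw [(leeForm_eventuallyEq e r).fderiv_eq]

theorem riemannian_side_eq {Ω : BilinField M} (hΩ : IsSymplecticForm Ω) (J : EndField M) (x : M) :
    sRiem Ω J x + 2 * laplacianAngle Ω J x / (1 - angle Ω J x)
        - 1 / (1 - angle Ω J x ^ 2) * ((4 + 2 * angle Ω J x) / (1 - angle Ω J x) - 1 / 2)
          * dAngleNormSq Ω J x =
      riemannianSide (chartBilin Ω x) (chartEnd J x) (extChartAt (𝓡 4) x x) := by
  have e := metric_eventuallyEq Ω J x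
  have e' := angle_eventuallyEq hΩ J x
  rw [riemannianSide, angle_eq_locAngle hΩ, sRiem, laplacianAngle, dAngleNormSq,
    scalarCurvature_congr e, laplacian_congr e e', e'.fderiv_eq, e.eq_of_nhds]

variable [MulAction Torus M] [T2Space M]

/-- Both sides equal the sum of momentum derivatives for any basis of the Lie algebra; neither
involves the basis, so the standard one serves. -/
theorem hermitianSide_eq_riemannianSide {Ω : BilinField M} (hΩ : IsSymplecticForm Ω)
    {μ : M → (LieT →L[ℝ] ℝ)} (hμ : IsHamiltonianAction Ω μ) {J : EndField M} (hJ : IsDGK Ω J) (x : M)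
    {y : E4} (hy : y ∈ (extChartAt (𝓡 4) x).target ∩ (extChartAt (𝓡 4) x).symm ⁻¹' freeLocus M) :
    hermitianSide (chartBilin Ω x) (chartEnd J x) y
      = riemannianSide (chartBilin Ω x) (chartEnd J x) y := by
  have h := isLocalToric_chart (isOpen_freeLocus hμ.smooth_action) hΩ hμ (Pi.basisFun ℝ (Fin 2)) hJ x
  exact (h.hermitian_formula hy).symm.trans (h.riemannian_formula hy)

variable [CompactSpace M] [ConnectedSpace M] [FaithfulSMul Torus M]

theorem mem_closure_free (h : IsSmoothAction M) (x : M) : extChartAt (𝓡 4) x x ∈ closure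
    ((extChartAt (𝓡 4) x).target ∩ (extChartAt (𝓡 4) x).symm ⁻¹' freeLocus M) := by
  rw [mem_closure_iff_nhds]
  intro V hV
  have hV' := (continuousAt_extChartAt (I := 𝓡 4) x).preimage_mem_nhds hV
  have m3 := (chartAt E4 x).open_source.mem_nhds (ChartedSpace.mem_chart_source x)
  obtain ⟨z, ⟨hz1, hz2⟩, hz3⟩ :=
    mem_closure_iff_nhds.1 (dense_freeLocus h x) _ (Filter.inter_mem hV' m3)
  have hz2' : z ∈ (extChartAt (𝓡 4) x).source := by rwa [extChartAt_source]
  refine ⟨extChartAt (𝓡 4) x z, hz1, (extChartAt (𝓡 4) x).map_source hz2', ?_⟩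
  rw [Set.mem_preimage, (extChartAt (𝓡 4) x).left_inv hz2']
  exact hz3

/-- All nearby free points are treated in the one chart at `x`, where the right side is continuous.
Its limit along the dense free locus is the extended value. -/
theorem uGK_eq {Ω : BilinField M} (hΩ : IsSymplecticForm Ω) {μ : M → (LieT →L[ℝ] ℝ)}
    (hμ : IsHamiltonianAction Ω μ) (ξ : Module.Basis (Fin 2) ℝ LieT) {J : EndField M}
    (hJ : IsDGK Ω J) (x : M) :
    uGK ξ μ Ω J x = hermitianSide (chartBilin Ω x) (chartEnd J x) (extChartAt (𝓡 4) x x) := by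
  have hopen := isOpen_freeLocus hμ.smooth_action
  refine extendFrom_eq (dense_freeLocus hμ.smooth_action x) ?_
  have hc : ContinuousAt (fun z => hermitianSide (chartBilin Ω x) (chartEnd J x)
      (extChartAt (𝓡 4) x z)) x :=
    ContinuousAt.comp ((isLocalGK_chart hΩ hJ x).continuousAt_hermitianSide
      (mem_extChartAt_target x)) (continuousAt_extChartAt x)
  refine (hc.tendsto.mono_left nhdsWithin_le_nhds).congr' ?_
  have m3 := (chartAt E4 x).open_source.mem_nhds (ChartedSpace.mem_chart_source x)
  filter_upwards [self_mem_nhdsWithin, mem_nhdsWithin_of_mem_nhds m3] with z hz hz'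
  have hs : z ∈ (extChartAt (𝓡 4) x).source := by rwa [extChartAt_source]
  have hl := (extChartAt (𝓡 4) x).left_inv hs
  have hy : extChartAt (𝓡 4) x z ∈ (extChartAt (𝓡 4) x).target ∩
      (extChartAt (𝓡 4) x).symm ⁻¹' freeLocus M := by
    refine ⟨(extChartAt (𝓡 4) x).map_source hs, ?_⟩
    rw [Set.mem_preimage, hl]; exact hz
  have h1 := sum_momentumPartial hopen hΩ hμ ξ hJ hy
  rw [hl] at h1
  rw [h1]
  exact ((isLocalToric_chart hopen hΩ hμ ξ hJ x).hermitian_formula hy).symm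

theorem uGK_eq_hermitian {Ω : BilinField M} (hΩ : IsSymplecticForm Ω) {μ : M → (LieT →L[ℝ] ℝ)}
    (hμ : IsHamiltonianAction Ω μ) (ξ : Module.Basis (Fin 2) ℝ LieT) {J : EndField M}
    (hJ : IsDGK Ω J) (x : M) :
    uGK ξ μ Ω J x = uHerm Ω J x
      - (4 - 2 * angle Ω J x) / (1 - angle Ω J x) * leeNormSq Ω J x
      + 2 * commutatorInnerLee Ω J x / (1 - angle Ω J x) := by
  rw [hermitian_side_eq hΩ, uGK_eq hΩ hμ ξ hJ]

theorem uGK_eq_riemannian {Ω : BilinField M} (hΩ : IsSymplecticForm Ω) {μ : M → (LieT →L[ℝ] ℝ)}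
    (hμ : IsHamiltonianAction Ω μ) (ξ : Module.Basis (Fin 2) ℝ LieT) {J : EndField M}
    (hJ : IsDGK Ω J) (x : M) (hx : x ∈ freeLocus M ∨ ∀ z : M, angle Ω J z = -1) :
    uGK ξ μ Ω J x = sRiem Ω J x + 2 * laplacianAngle Ω J x / (1 - angle Ω J x)
      - 1 / (1 - angle Ω J x ^ 2) * ((4 + 2 * angle Ω J x) / (1 - angle Ω J x) - 1 / 2)
        * dAngleNormSq Ω J x := by
  rw [riemannian_side_eq hΩ, uGK_eq hΩ hμ ξ hJ]
  rcases hx with hx | hx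
  · refine hermitianSide_eq_riemannianSide hΩ hμ hJ x ⟨mem_extChartAt_target x, ?_⟩
    rw [Set.mem_preimage, extChartAt_to_inv]
    exact hx
  have hy : extChartAt (𝓡 4) x x ∈ (extChartAt (𝓡 4) x).target := mem_extChartAt_target x
  have gk := isLocalGK_chart hΩ hJ x
  have hp : ∀ y ∈ (extChartAt (𝓡 4) x).target,
      locAngle (chartBilin Ω x) (chartEnd J x) =ᶠ[𝓝 y] fun _ => -1 := by
    intro y hy
    filter_upwards [chart_target_mem_nhds hy] with z hz
    rw [← chartFun_angle hΩ J hz]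
    exact hx _
  -- With `p` identically `-1` the second side is the scalar curvature. It and the first side are
  -- continuous and agree on free points, which accumulate at `x`.
  rw [riemannianSide_of_angle (hp _ hy)]
  have hne := mem_closure_iff_nhdsWithin_neBot.1 (mem_closure_free hμ.smooth_action x)
  refine tendsto_nhds_unique (l := 𝓝[(extChartAt (𝓡 4) x).target ∩
    (extChartAt (𝓡 4) x).symm ⁻¹' freeLocus M] (extChartAt (𝓡 4) x x))
    ((gk.continuousAt_hermitianSide hy).tendsto.mono_left nhdsWithin_le_nhds)
    (((gk.isHermitianOn.continuousAt_scalarCurvature hy).tendsto.mono_left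
      nhdsWithin_le_nhds).congr' ?_)
  filter_upwards [self_mem_nhdsWithin] with z hz
  rw [hermitianSide_eq_riemannianSide hΩ hμ hJ x hz, riemannianSide_of_angle (hp z hz.1)]

end Global

end ToricGK

end

theorem corollary6p14 {M : Type*} [TopologicalSpace M] [ChartedSpace ToricGK.E4 M]
    [IsManifold (𝓡 4) ∞ M] [T2Space M] [CompactSpace M] [ConnectedSpace M]
    [MulAction ToricGK.Torus M] [FaithfulSMul ToricGK.Torus M]
    (Ω : ToricGK.BilinField M) (hΩ : ToricGK.IsSymplecticForm Ω)
    (μ : M → (ToricGK.LieT →L[ℝ] ℝ)) (hμ : ToricGK.IsHamiltonianAction Ω μ)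
    (ξ : Module.Basis (Fin 2) ℝ ToricGK.LieT)
    (J : ToricGK.EndField M) (hJ : ToricGK.IsDGK Ω J) :
    (∀ x : M, ToricGK.uGK ξ μ Ω J x =
      ToricGK.uHerm Ω J x
        - (4 - 2 * ToricGK.angle Ω J x) / (1 - ToricGK.angle Ω J x) * ToricGK.leeNormSq Ω J x
        + 2 * ToricGK.commutatorInnerLee Ω J x / (1 - ToricGK.angle Ω J x)) ∧
    (∀ x : M, (x ∈ ToricGK.freeLocus M ∨ ∀ z : M, ToricGK.angle Ω J z = -1) →
      ToricGK.uGK ξ μ Ω J x =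
        ToricGK.sRiem Ω J x
          + 2 * ToricGK.laplacianAngle Ω J x / (1 - ToricGK.angle Ω J x)
          - 1 / (1 - ToricGK.angle Ω J x ^ 2)
            * ((4 + 2 * ToricGK.angle Ω J x) / (1 - ToricGK.angle Ω J x) - 1 / 2)
            * ToricGK.dAngleNormSq Ω J x) := ⟨fun x => ToricGK.uGK_eq_hermitian hΩ hμ ξ hJ x,
    fun x hx => ToricGK.uGK_eq_riemannian hΩ hμ ξ hJ x hx⟩
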